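/- Let $M$ be a smooth $n$-manifold without boundary. An exact Courant algebroid (ECA) is a rank-$2n$ bundle $E\to M$ with neutral inner product $\langle\cdot,\cdot\rangle$ of signature $(n,n)$, Dorfman bracket $[\cdot,\cdot]$ and anchor $\pi$, satisfying the usual axioms; for $c\neq 0$, $c\cdot E$ is $E$ with $\langle\cdot,\cdot\rangle$ replaced by $c\langle\cdot,\cdot\rangle$. For a closed $3$-form $H$, $(TM\oplus T^*M)_H$ is the ECA with $\langle X+\xi,Y+\eta\rangle=\frac12(\xi(Y)+\eta(X))$, $[X+\xi,Y+\eta]_H=[X,Y]+\mathcal L_X\eta-\iota_Yd\xi+\iota_Y\iota_XH$, $\pi(X+\xi)=X$. A generalized metric is an orthogonal $\mathcal G\in\mathrm{End}(E)$ such that $\langle\mathcal G\cdot,\cdot\rangle$ is symmetric and positive definite. It determines an isotropic splitting $\sigma$ of $\pi$, hence an isomorphism $E\simeq_\sigma(TM\oplus T^*M)_H$ with $H(X,Y,Z)=2\langle[\sigma X,\sigma Y],\sigma Z\rangle$, and a Riemannian metric $g$ such that $\mathcal G$ corresponds to $\mathcal G(g,0)$; here $\mathcal G(g,b)=e^b\begin{pmatrix}0&g^{-1}\\g&0\end{pmatrix}e^{-b}$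 for a $2$-form $b$. Put $\mathrm{Ric}^B_{g,H}=\mathrm{Ric}_g-\frac14H^2$ with $H^2(X,Y)=\sum_{i,j}H(X,e_i,e_j)H(Y,e_i,e_j)$ for a $g$-orthonormal frame $(e_i)$, and $\Delta_g=-(dd^*_g+d^*_gd)$. The generalized Ricci curvature $\mathcal Rc(\mathcal G)$ is the endomorphism which in the splitting $\sigma$ is $$\begin{pmatrix}g^{-1}\mathrm{Ric}^B_{g,H}&\frac12g^{-1}(d^*_gH)g^{-1}\\-\frac12d^*_gH&-\mathrm{Ric}^B_{g,H}g^{-1}\end{pmatrix},$$ and the generalized Ricci flow is $\mathcal G^{-1}\partial_t\mathcal G=-2\mathcal Rc(\mathcal G)$. A solution $(E,\mathcal G(t))_{t\in[0,T)}$, $0<T\le\infty$, smooth on $[0,T)\times M$, is a generalized Ricci soliton if there are a smooth function $c(t)>0$ with $c(0)=1$ and a smooth family of isometries $F_t:(c(t)\cdot E,\mathcal G(0))\to(E,\mathcal G(t))$, i.e. isomorphisms of ECAs covering diffeomorphisms of $M$ and satisfying $F_t\circ\mathcal G(0)=\mathcal G(t)\circ F_t$. **Proposition.** (i) Let $(E,\mathcal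 G(t))$ be a generalized Ricci soliton with scalings $c(t)$, and let $g_0$, $H_0$ be the Riemannian metric and the closed $3$-form determined by $\mathcal G(0)$. Then, with $\lambda=-\frac12c'(0)$, there is a smooth vector field $X$ on $M$ such that $$\mathrm{Ric}^B_{g_0,H_0}=\lambda g_0+\tfrac12\mathcal L_Xg_0,\qquad \Delta_{g_0}H_0=-2\lambda H_0-\mathcal L_XH_0.\qquad(*)$$ (ii) Conversely, if a Riemannian metric $g_0$, a closed $3$-form $H_0$, $\lambda\in\mathbb R$ and a complete smooth vector field $X$ satisfy $(*)$, then there is a generalized Ricci soliton $\mathcal G(g(t),b(t))$, $t\in[0,T)$ with $T>0$, on $(TM\oplus T^*M)_{H_0}$, with $\mathcal G(g(0),b(0))=\mathcal G(g_0,0)$ and with scalings satisfying $-\frac12c'(0)=\lambda$. -/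

import Mathlib

open Bundle Set
open scoped Manifold ContDiff Topology

noncomputable section

namespace GenRicci

/-! ## Tensors on a smooth manifold

Throughout, `M` is a manifold modelled on `EuclideanSpace ℝ (Fin n)` (no boundary).
-/

/-- The model space `ℝⁿ`. -/
abbrev Model (n : ℕ) : Type := EuclideanSpace ℝ (Fin n)

section Tensors

variable {n : ℕ} {M : Type*} [TopologicalSpace M] [ChartedSpace (Model n) M] [IsManifold (𝓡 n) ∞ M]

instance instFiniteDimensionalTangentSpace (x : M) :
    FiniteDimensional ℝ (TangentSpace (𝓡 n) x) :=
  inferInstanceAs (FiniteDimensional ℝ (Model n))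

instance instT2SpaceTangentSpace (x : M) : T2Space (TangentSpace (𝓡 n) x) :=
  inferInstanceAs (T2Space (Model n))

variable (n M) in
/-- (Not necessarily smooth) vector fields. -/
abbrev VectorField : Type _ := Π x : M, TangentSpace (𝓡 n) x

variable (n M) in
/-- (Not necessarily smooth) `(0,2)`-tensor fields. -/
abbrev Tensor2 : Type _ :=
  Π x : M, TangentSpace (𝓡 n) x →L[ℝ] TangentSpace (𝓡 n) x →L[ℝ] ℝ

variable (n M) in
/-- (Not necessarily smooth) differential `k`-forms. -/
abbrev DiffForm (k : ℕ) : Type _ := Π x : M, TangentSpace (𝓡 n) x [⋀^Fin k]→L[ℝ] ℝ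

variable (n M) in
/-- Smooth Riemannian metrics. -/
abbrev SmoothMetric : Type _ :=
  ContMDiffRiemannianMetric (𝓡 n) ∞ (Model n) (fun x : M => TangentSpace (𝓡 n) x)

/-- Smooth sections of a vector bundle `V → M` with typical fibre `F`. -/
def IsSmoothSection (F : Type*) [NormedAddCommGroup F] [NormedSpace ℝ F]
    {V : M → Type*} [TopologicalSpace (TotalSpace F V)] [∀ x, TopologicalSpace (V x)]
    [FiberBundle F V] (s : Π x, V x) : Prop :=
  ContMDiff (𝓡 n) ((𝓡 n).prod 𝓘(ℝ, F)) ∞ (fun x => TotalSpace.mk' F x (s x))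

/-- Smooth vector fields. -/
def IsSmoothField (X : VectorField n M) : Prop :=
  IsSmoothSection (n := n) (Model n) (V := fun x : M => TangentSpace (𝓡 n) x) X

/-- Smooth `k`-forms: all evaluations on smooth vector fields are smooth functions. -/
def IsSmoothForm {k : ℕ} (θ : DiffForm n M k) : Prop :=
  ∀ Y : Fin k → VectorField n M, (∀ i, IsSmoothField (Y i)) →
    ContMDiff (𝓡 n) 𝓘(ℝ, ℝ) ∞ (fun x => θ x (fun i => Y i x))

/-- The derivative `X f` of a function along a vector field. -/
def dirDeriv (X : VectorField n M) (f : M → ℝ) (x : M) : ℝ :=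
  mfderiv (𝓡 n) 𝓘(ℝ, ℝ) f x (X x)

/-- The Lie bracket `[X, Y]`. -/
abbrev lieBr (X Y : VectorField n M) : VectorField n M :=
  VectorField.mlieBracket (𝓡 n) X Y

/-- Completeness of a vector field: every point lies on an integral curve defined on all of `ℝ`. -/
def IsCompleteField (X : VectorField n M) : Prop :=
  ∀ x : M, ∃ γ : ℝ → M, γ 0 = x ∧ IsMIntegralCurve (I := 𝓡 n) γ X

/-- A `2`-form as the bundle map `X ↦ ι_X b : TM → T*M`. -/
def twoFormMap (b : DiffForm n M 2) : Tensor2 n M := fun x =>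
  LinearMap.toContinuousLinearMap
    { toFun := fun u => (b x).toContinuousLinearMap ![u, 0] 1
      map_add' := by
        intro u v
        ext w
        have h := fun a : TangentSpace (𝓡 n) x =>
          show Function.update ![a, 0] 1 w = Matrix.vecCons a ![w] by
            ext i; fin_cases i <;> simp
        change b x (Function.update _ 1 w) = b x (Function.update _ 1 w)
          + b x (Function.update _ 1 w)
        rw [h, h, h]
        exact (b x).vecCons_add ![w] u v
      map_smul' := by
        intro c u
        ext w
        have h := fun a : TangentSpace (𝓡 n) x =>
          show Function.update ![a, 0] 1 w = Matrix.vecCons a ![w] by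
            ext i; fin_cases i <;> simp
        change b x (Function.update _ 1 w) = c • b x (Function.update _ 1 w)
        rw [h, h]
        exact (b x).vecCons_smul ![w] c u }

theorem twoFormMap_apply (b : DiffForm n M 2) (x : M) (u v : TangentSpace (𝓡 n) x) :
    twoFormMap b x u v = b x ![u, v] := by
  change b x (Function.update ![u, 0] 1 v) = _
  congr 1
  ext i; fin_cases i <;> simp

/-- A covector field as a differential `1`-form. -/
def oneForm (ξ : Π x : M, TangentSpace (𝓡 n) x →L[ℝ] ℝ) : DiffForm n M 1 := fun x =>
  ContinuousAlternatingMap.ofSubsingleton ℝ (TangentSpace (𝓡 n) x) ℝ (0 : Fin 1) (ξ x)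

/-- The exterior derivative: at `x`, the exterior derivative in `ℝⁿ` of the expression of `θ` in
the preferred chart around `x`. -/
def extD {k : ℕ} (θ : DiffForm n M k) : DiffForm n M (k + 1) := fun x =>
  (extDeriv (E := Model n)
    (fun y : Model n => (θ ((extChartAt (𝓡 n) x).symm y)).compContinuousLinearMap
      (mfderiv 𝓘(ℝ, Model n) (𝓡 n) (extChartAt (𝓡 n) x).symm y))
    (extChartAt (𝓡 n) x x)).compContinuousLinearMap
      (mfderiv (𝓡 n) 𝓘(ℝ, Model n) (extChartAt (𝓡 n) x) x)

/-! ### Tensors determined by their values on smooth vector fields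

The operators below are `C^∞(M)`-multilinear in the vector fields on which they are tested, so that
there is exactly one tensor with the stated values; `Classical.epsilon` picks it. -/

/-- The Lie derivative of a `k`-form. -/
def lieForm {k : ℕ} (X : VectorField n M) (θ : DiffForm n M k) : DiffForm n M k := fun x =>
  Classical.epsilon fun α : TangentSpace (𝓡 n) x [⋀^Fin k]→L[ℝ] ℝ =>
    ∀ Y : Fin k → VectorField n M, (∀ i, IsSmoothField (Y i)) →
      α (fun i => Y i x) = dirDeriv X (fun y => θ y (fun i => Y i y)) x
        - ∑ i, θ x (Function.update (fun j => Y j x) i (lieBr X (Y i) x))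

/-- The Lie derivative of a covector field. -/
def lieCovector (X : VectorField n M) (ξ : Π x : M, TangentSpace (𝓡 n) x →L[ℝ] ℝ) :
    Π x : M, TangentSpace (𝓡 n) x →L[ℝ] ℝ := fun x =>
  Classical.epsilon fun α : TangentSpace (𝓡 n) x →L[ℝ] ℝ =>
    ∀ Y : VectorField n M, IsSmoothField Y →
      α (Y x) = dirDeriv X (fun y => ξ y (Y y)) x - ξ x (lieBr X Y x)

/-- The Lie derivative of a `(0,2)`-tensor. -/
def lieTensor2 (X : VectorField n M) (g : Tensor2 n M) : Tensor2 n M := fun x =>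
  Classical.epsilon fun B : TangentSpace (𝓡 n) x →L[ℝ] TangentSpace (𝓡 n) x →L[ℝ] ℝ =>
    ∀ Y Z : VectorField n M, IsSmoothField Y → IsSmoothField Z →
      B (Y x) (Z x) = dirDeriv X (fun y => g y (Y y) (Z y)) x
        - g x (lieBr X Y x) (Z x) - g x (Y x) (lieBr X Z x)

/-! ### Riemannian geometry -/

/-- The right-hand side of the Koszul formula for `g(∇_X Y, Z)`. -/
def koszul (g : Tensor2 n M) (X Y Z : VectorField n M) (x : M) : ℝ :=
  (1 / 2 : ℝ) * (dirDeriv X (fun y => g y (Y y) (Z y)) x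
    + dirDeriv Y (fun y => g y (X y) (Z y)) x
    - dirDeriv Z (fun y => g y (X y) (Y y)) x
    + g x (lieBr X Y x) (Z x) - g x (lieBr X Z x) (Y x) - g x (lieBr Y Z x) (X x))

/-- The Levi-Civita connection `∇_X Y` of the metric `g` (for smooth `X`, `Y`). -/
def nabla (g : Tensor2 n M) (X Y : VectorField n M) : VectorField n M := fun x =>
  Classical.epsilon fun w : TangentSpace (𝓡 n) x =>
    ∀ Z : VectorField n M, IsSmoothField Z → g x w (Z x) = koszul g X Y Z x

/-- The curvature tensor `R(X,Y)Z = ∇_X ∇_Y Z - ∇_Y ∇_X Z - ∇_{[X,Y]} Z`. -/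
def curvature (g : Tensor2 n M) (x : M) :
    TangentSpace (𝓡 n) x →ₗ[ℝ] TangentSpace (𝓡 n) x →ₗ[ℝ] TangentSpace (𝓡 n) x →ₗ[ℝ]
      TangentSpace (𝓡 n) x :=
  Classical.epsilon fun R : TangentSpace (𝓡 n) x →ₗ[ℝ] TangentSpace (𝓡 n) x →ₗ[ℝ]
      TangentSpace (𝓡 n) x →ₗ[ℝ] TangentSpace (𝓡 n) x =>
    ∀ X Y Z : VectorField n M, IsSmoothField X → IsSmoothField Y → IsSmoothField Z →
      R (X x) (Y x) (Z x) = nabla g X (nabla g Y Z) x - nabla g Y (nabla g X Z) x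
        - nabla g (lieBr X Y) Z x

/-- Orthonormal bases of `(T_x M, g_x)`. -/
def IsOrthonormalAt (g : Tensor2 n M) (x : M) (e : Fin n → TangentSpace (𝓡 n) x) : Prop :=
  ∀ i j, g x (e i) (e j) = if i = j then 1 else 0

/-- The Ricci tensor `Ric(u,v) = ∑ᵢ g(R(eᵢ,u)v, eᵢ)`, for any orthonormal basis `(eᵢ)`. -/
def ricci (g : Tensor2 n M) : Tensor2 n M := fun x =>
  Classical.epsilon fun B : TangentSpace (𝓡 n) x →L[ℝ] TangentSpace (𝓡 n) x →L[ℝ] ℝ =>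
    ∀ e, IsOrthonormalAt g x e → ∀ u v, B u v = ∑ i, g x (curvature g x (e i) u v) (e i)

/-- The tensor `H²(u,v) = g(ι_u H, ι_v H) = ∑ᵢⱼ H(u,eᵢ,eⱼ) H(v,eᵢ,eⱼ)`, for any orthonormal
basis `(eᵢ)`. -/
def formSq (g : Tensor2 n M) (H : DiffForm n M 3) : Tensor2 n M := fun x =>
  Classical.epsilon fun B : TangentSpace (𝓡 n) x →L[ℝ] TangentSpace (𝓡 n) x →L[ℝ] ℝ =>
    ∀ e, IsOrthonormalAt g x e → ∀ u v,
      B u v = ∑ i, ∑ j, H x ![u, e i, e j] * H x ![v, e i, e j]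

/-- The symmetric part `Ric^B_{g,H} = Ric_g - ¼ H²` of the Bismut Ricci tensor. -/
def ricciB (g : Tensor2 n M) (H : DiffForm n M 3) : Tensor2 n M := fun x =>
  ricci g x - (1 / 4 : ℝ) • formSq g H x

/-- The covariant derivative `u ↦ ∇_u θ` of a `k`-form. -/
def nablaForm {k : ℕ} (g : Tensor2 n M) (θ : DiffForm n M k) (x : M) :
    TangentSpace (𝓡 n) x →ₗ[ℝ] TangentSpace (𝓡 n) x [⋀^Fin k]→L[ℝ] ℝ :=
  Classical.epsilon fun D : TangentSpace (𝓡 n) x →ₗ[ℝ] TangentSpace (𝓡 n) x [⋀^Fin k]→L[ℝ] ℝ =>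
    ∀ (X : VectorField n M) (Y : Fin k → VectorField n M), IsSmoothField X →
      (∀ i, IsSmoothField (Y i)) →
      D (X x) (fun i => Y i x) = dirDeriv X (fun y => θ y (fun i => Y i y)) x
        - ∑ i, θ x (Function.update (fun j => Y j x) i (nabla g X (Y i) x))

/-- The codifferential `d*_g θ = -∑ᵢ (∇_{eᵢ} θ)(eᵢ, ·, …, ·)`, for any orthonormal basis `(eᵢ)`. -/
def codiff {k : ℕ} (g : Tensor2 n M) (θ : DiffForm n M (k + 1)) : DiffForm n M k := fun x =>
  Classical.epsilon fun α : TangentSpace (𝓡 n) x [⋀^Fin k]→L[ℝ] ℝ =>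
    ∀ e, IsOrthonormalAt g x e → ∀ v : Fin k → TangentSpace (𝓡 n) x,
      α v = -∑ i, nablaForm g θ x (e i) (Matrix.vecCons (e i) v)

/-- The Hodge Laplacian with the sign of the heat equation, `Δ_g = -(d d* + d* d)`. -/
def hodgeLaplacian {k : ℕ} (g : Tensor2 n M) (θ : DiffForm n M (k + 1)) : DiffForm n M (k + 1) :=
  fun x => -(extD (codiff g θ) x + codiff g (extD θ) x)

/-- `g⁻¹ : T*M → TM`. -/
def sharp (g : Tensor2 n M) (x : M) :
    (TangentSpace (𝓡 n) x →L[ℝ] ℝ) →L[ℝ] TangentSpace (𝓡 n) x :=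
  (g x).inverse

/-- The static soliton equations
`Ric^B_{g,H} = λ g + ½ L_X g` and `Δ_g H = -2 λ H - L_X H`. -/
def IsStaticSoliton (g : Tensor2 n M) (H : DiffForm n M 3) (lam : ℝ) (X : VectorField n M) : Prop :=
  (∀ x, ricciB g H x = lam • g x + (1 / 2 : ℝ) • lieTensor2 X g x) ∧
  (∀ x, hodgeLaplacian g H x = (-2 * lam) • H x - lieForm X H x)

end Tensors

/-! ## Exact Courant algebroids -/

section Courant

variable {n : ℕ} {M : Type*} [TopologicalSpace M] [ChartedSpace (Model n) M] [IsManifold (𝓡 n) ∞ M]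
  {F : Type*} [NormedAddCommGroup F] [NormedSpace ℝ F]
  {V : M → Type*} [TopologicalSpace (TotalSpace F V)]
  [∀ x, AddCommGroup (V x)] [∀ x, Module ℝ (V x)] [∀ x, TopologicalSpace (V x)]
  [∀ x, IsTopologicalAddGroup (V x)] [∀ x, ContinuousSMul ℝ (V x)]
  [FiberBundle F V]

variable (n V) in
/-- The data of a Courant algebroid on the vector bundle `V → M`: neutral inner product, Dorfman
bracket and anchor. Only the values of the bracket on smooth sections are relevant. -/
structure CourantData where
  /-- the neutral inner product -/
  pairing : Π x, V x →L[ℝ] V x →L[ℝ] ℝ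
  /-- the Dorfman bracket -/
  bracket : (Π x, V x) → (Π x, V x) → (Π x, V x)
  /-- the anchor -/
  anchor : Π x, V x →L[ℝ] TangentSpace (𝓡 n) x

namespace CourantData

variable (C : CourantData n V)

/-- `π* : T*M → E* ≃ E`, i.e. `⟨π* α, e⟩ = α (π e)`. -/
def coanchor (x : M) : (TangentSpace (𝓡 n) x →L[ℝ] ℝ) →L[ℝ] V x :=
  (C.pairing x).inverse ∘L ContinuousLinearMap.precomp ℝ (C.anchor x)

/-- The scaled structure `c · E`: the inner product is multiplied by `c`. -/
def scale (c : ℝ) : CourantData n V where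
  pairing x := c • C.pairing x
  bracket := C.bracket
  anchor := C.anchor

variable (F) in
/-- The axioms of an exact Courant algebroid of rank `2n` over the `n`-manifold `M`. -/
structure IsExact : Prop where
  smooth_pairing : ∀ a b : Π x, V x, IsSmoothSection (n := n) F a → IsSmoothSection (n := n) F b →
    ContMDiff (𝓡 n) 𝓘(ℝ, ℝ) ∞ (fun x => C.pairing x (a x) (b x))
  smooth_bracket : ∀ a b : Π x, V x, IsSmoothSection (n := n) F a → IsSmoothSection (n := n) F b →
    IsSmoothSection (n := n) F (C.bracket a b)
  smooth_anchor : ∀ a : Π x, V x, IsSmoothSection (n := n) F a →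
    IsSmoothField (fun x => C.anchor x (a x))
  bracket_add_left : ∀ a b c : Π x, V x, IsSmoothSection (n := n) F a →
    IsSmoothSection (n := n) F b → IsSmoothSection (n := n) F c →
    C.bracket (a + b) c = C.bracket a c + C.bracket b c
  bracket_add_right : ∀ a b c : Π x, V x, IsSmoothSection (n := n) F a →
    IsSmoothSection (n := n) F b → IsSmoothSection (n := n) F c →
    C.bracket a (b + c) = C.bracket a b + C.bracket a c
  bracket_smul_left : ∀ (r : ℝ) (a b : Π x, V x), IsSmoothSection (n := n) F a →
    IsSmoothSection (n := n) F b → C.bracket (r • a) b = r • C.bracket a b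
  bracket_smul_right : ∀ (r : ℝ) (a b : Π x, V x), IsSmoothSection (n := n) F a →
    IsSmoothSection (n := n) F b → C.bracket a (r • b) = r • C.bracket a b
  finrank_fibre : ∀ x, Module.finrank ℝ (V x) = 2 * n
  symm : ∀ x (a b : V x), C.pairing x a b = C.pairing x b a
  nondegenerate : ∀ x (a : V x), (∀ b, C.pairing x a b = 0) → a = 0
  signature : ∀ x, ∃ P N : Submodule ℝ (V x), Module.finrank ℝ P = n ∧ Module.finrank ℝ N = n ∧
    (∀ a ∈ P, a ≠ 0 → 0 < C.pairing x a a) ∧ (∀ a ∈ N, a ≠ 0 → C.pairing x a a < 0)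
  jacobi : ∀ a b c : Π x, V x, IsSmoothSection (n := n) F a → IsSmoothSection (n := n) F b →
    IsSmoothSection (n := n) F c →
    C.bracket a (C.bracket b c) = C.bracket (C.bracket a b) c + C.bracket b (C.bracket a c)
  anchor_bracket : ∀ a b : Π x, V x, IsSmoothSection (n := n) F a →
    IsSmoothSection (n := n) F b → ∀ x, C.anchor x (C.bracket a b x) =
      lieBr (fun y => C.anchor y (a y)) (fun y => C.anchor y (b y)) x
  leibniz : ∀ (a b : Π x, V x) (f : M → ℝ), IsSmoothSection (n := n) F a →
    IsSmoothSection (n := n) F b → ContMDiff (𝓡 n) 𝓘(ℝ, ℝ) ∞ f →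
    ∀ x, C.bracket a (fun y => f y • b y) x =
      f x • C.bracket a b x + dirDeriv (fun y => C.anchor y (a y)) f x • b x
  invariance : ∀ a b c : Π x, V x, IsSmoothSection (n := n) F a → IsSmoothSection (n := n) F b →
    IsSmoothSection (n := n) F c → ∀ x,
    dirDeriv (fun y => C.anchor y (a y)) (fun y => C.pairing y (b y) (c y)) x =
      C.pairing x (C.bracket a b x) (c x) + C.pairing x (b x) (C.bracket a c x)
  symm_part : ∀ a b : Π x, V x, IsSmoothSection (n := n) F a → IsSmoothSection (n := n) F b →
    ∀ x, C.bracket a b x + C.bracket b a x =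
      C.coanchor x (mfderiv (𝓡 n) 𝓘(ℝ, ℝ) (fun y => C.pairing y (a y) (b y)) x)
  coanchor_injective : ∀ x, Function.Injective (C.coanchor x)
  range_coanchor : ∀ x (e : V x), C.anchor x e = 0 ↔ ∃ α, C.coanchor x α = e
  anchor_surjective : ∀ x, Function.Surjective (C.anchor x)

/-! ### Generalized metrics -/

variable (F) in
/-- Generalized metrics: smooth orthogonal endomorphisms `G` such that `⟨G·,·⟩` is symmetric and
positive definite. -/
structure IsGenMetric (G : Π x, V x →L[ℝ] V x) : Prop where
  smooth : ∀ a : Π x, V x, IsSmoothSection (n := n) F a →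
    IsSmoothSection (n := n) F (fun x => G x (a x))
  orthogonal : ∀ x (a b : V x), C.pairing x (G x a) (G x b) = C.pairing x a b
  symm : ∀ x (a b : V x), C.pairing x (G x a) b = C.pairing x (G x b) a
  pos : ∀ x (a : V x), a ≠ 0 → 0 < C.pairing x (G x a) a

/-- `σ₊ : TM → E₊`, the inverse of the restriction of the anchor to the `1`-eigenbundle of `G`. -/
def sigmaPlus (G : Π x, V x →L[ℝ] V x) (x : M) : TangentSpace (𝓡 n) x →L[ℝ] V x :=
  Classical.epsilon fun s : TangentSpace (𝓡 n) x →L[ℝ] V x =>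
    ∀ u, C.anchor x (s u) = u ∧ G x (s u) = s u

/-- The Riemannian metric `g(u,v) = ⟨σ₊ u, σ₊ v⟩` determined by `G`. -/
def metricOf (G : Π x, V x →L[ℝ] V x) : Tensor2 n M := fun x =>
  ContinuousLinearMap.precomp ℝ (C.sigmaPlus G x) ∘L C.pairing x ∘L C.sigmaPlus G x

/-- The preferred isotropic splitting `σ = σ₊ - ½ π* g` determined by `G`. -/
def splitting (G : Π x, V x →L[ℝ] V x) (x : M) : TangentSpace (𝓡 n) x →L[ℝ] V x :=
  C.sigmaPlus G x - (1 / 2 : ℝ) • (C.coanchor x ∘L C.metricOf G x)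

/-- The preferred `3`-form `H(X,Y,Z) = 2 ⟨[σX, σY], σZ⟩` determined by `G`. -/
def torsionOf (G : Π x, V x →L[ℝ] V x) : DiffForm n M 3 := fun x =>
  Classical.epsilon fun H : TangentSpace (𝓡 n) x [⋀^Fin 3]→L[ℝ] ℝ =>
    ∀ X Y Z : VectorField n M, IsSmoothField X → IsSmoothField Y → IsSmoothField Z →
      H ![X x, Y x, Z x] = 2 * C.pairing x
        (C.bracket (fun y => C.splitting G y (X y)) (fun y => C.splitting G y (Y y)) x)
        (C.splitting G x (Z x))

/-- The inverse `X + ξ ↦ σ X + ½ π* ξ` of the isomorphism `E ≃ TM ⊕ T*M` induced by the preferred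
splitting. -/
def ofSplit (G : Π x, V x →L[ℝ] V x) (x : M) (X : TangentSpace (𝓡 n) x)
    (ξ : TangentSpace (𝓡 n) x →L[ℝ] ℝ) : V x :=
  C.splitting G x X + (1 / 2 : ℝ) • C.coanchor x ξ

/-- The `T*M`-component `ξ = 2 ⟨e, σ ·⟩` of `e = σ X + ½ π* ξ`. -/
def cotangentPart (G : Π x, V x →L[ℝ] V x) (x : M) (e : V x) : TangentSpace (𝓡 n) x →L[ℝ] ℝ :=
  (2 : ℝ) • (C.pairing x e ∘L C.splitting G x)

/-- The generalized Ricci curvature `Rc(G)`. In the preferred splitting, with associated metric `g`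
and `3`-form `H`, it is the endomorphism of `TM ⊕ T*M` with matrix
`(g⁻¹ Ric^B,  ½ g⁻¹ (d*H) g⁻¹; -½ d*H,  -Ric^B g⁻¹)`. -/
def genRicci (G : Π x, V x →L[ℝ] V x) (x : M) (e : V x) : V x :=
  let g := C.metricOf G
  let H := C.torsionOf G
  let X := C.anchor x e
  let ξ := C.cotangentPart G x e
  C.ofSplit G x
    (sharp g x (ricciB g H x X) + (1 / 2 : ℝ) • sharp g x (twoFormMap (codiff g H) x (sharp g x ξ)))
    (-((1 / 2 : ℝ) • twoFormMap (codiff g H) x X) - ricciB g H x (sharp g x ξ))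

/-! ### Generalized Ricci flow and solitons -/

end CourantData

/-- The time interval `[0, T)`, `0 < T ≤ ∞`. -/
def timeInterval (T : EReal) : Set ℝ := {t : ℝ | 0 ≤ t ∧ (t : EReal) < T}

namespace CourantData

variable (C : CourantData n V)

variable (F) in
/-- Solutions `(G(t))_{t ∈ [0,T)}` of the generalized Ricci flow `G⁻¹ ∂G/∂t = -2 Rc(G)`: families of
generalized metrics, smooth in `(t,x) ∈ [0,T) × M`, with `∂G/∂t = G (-2 Rc(G))`. -/
structure IsGRF (T : EReal) (G : ℝ → Π x, V x →L[ℝ] V x) : Prop where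
  genMetric : ∀ t ∈ timeInterval T, C.IsGenMetric F (G t)
  smooth : ∀ a : Π x, V x, IsSmoothSection (n := n) F a →
    ContMDiffOn (𝓘(ℝ, ℝ).prod (𝓡 n)) ((𝓡 n).prod 𝓘(ℝ, F)) ∞
      (fun p : ℝ × M => TotalSpace.mk' F p.2 (G p.1 p.2 (a p.2))) (timeInterval T ×ˢ univ)
  flow : ∀ t ∈ timeInterval T, ∀ x (e : V x),
    HasDerivWithinAt (fun s => G s x e) (G t x ((-2 : ℝ) • C.genRicci (G t) x e))
      (timeInterval T) t

end CourantData

variable (n F V) in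
/-- Smooth vector bundle automorphisms of `V → M`, covering a diffeomorphism of `M`. -/
structure BundleAut where
  /-- the diffeomorphism of the base -/
  base : M ≃ₘ^∞⟮𝓡 n, 𝓡 n⟯ M
  /-- the linear isomorphisms between fibres -/
  map : Π x, V x ≃L[ℝ] V (base x)
  smooth : ContMDiff ((𝓡 n).prod 𝓘(ℝ, F)) ((𝓡 n).prod 𝓘(ℝ, F)) ∞
    (fun p : TotalSpace F V => TotalSpace.mk' F (base p.1) (map p.1 p.2))

/-- `Φ` is an isometry `(E₁, G₁) → (E₂, G₂)` of metric Courant algebroids on the same bundle: an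
isomorphism of Courant algebroids with `Φ ∘ G₁ = G₂ ∘ Φ`. Sections `a`, `a'` with
`a' (f x) = Φ (a x)` are those with `a' = Φ a`. -/
structure IsIsometry (C₁ : CourantData n V) (G₁ : Π x, V x →L[ℝ] V x) (C₂ : CourantData n V)
    (G₂ : Π x, V x →L[ℝ] V x) (Φ : BundleAut n F V) : Prop where
  pairing : ∀ x (a b : V x),
    C₂.pairing (Φ.base x) (Φ.map x a) (Φ.map x b) = C₁.pairing x a b
  bracket : ∀ a b a' b' : Π x, V x, IsSmoothSection (n := n) F a → IsSmoothSection (n := n) F b →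
    (∀ x, a' (Φ.base x) = Φ.map x (a x)) → (∀ x, b' (Φ.base x) = Φ.map x (b x)) →
    ∀ x, C₂.bracket a' b' (Φ.base x) = Φ.map x (C₁.bracket a b x)
  metric : ∀ x (a : V x), Φ.map x (G₁ x a) = G₂ (Φ.base x) (Φ.map x a)

/-- The solution `(E, G(t))_{t ∈ [0,T)}` of the generalized Ricci flow is a generalized Ricci soliton
with scalings `c(t)` and isometries `Φ_t : (c(t) · E, G(0)) → (E, G(t))`, smooth in `t`. -/
structure IsSoliton (C : CourantData n V) (T : EReal) (G : ℝ → Π x, V x →L[ℝ] V x)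
    (c : ℝ → ℝ) (Φ : ℝ → BundleAut n F V) : Prop where
  pos_time : 0 < T
  grf : C.IsGRF F T G
  c_smooth : ContDiffOn ℝ ∞ c (timeInterval T)
  c_pos : ∀ t ∈ timeInterval T, 0 < c t
  c_zero : c 0 = 1
  family_smooth : ContMDiffOn (𝓘(ℝ, ℝ).prod ((𝓡 n).prod 𝓘(ℝ, F))) ((𝓡 n).prod 𝓘(ℝ, F)) ∞
    (fun p : ℝ × TotalSpace F V =>
      TotalSpace.mk' F ((Φ p.1).base p.2.1) ((Φ p.1).map p.2.1 p.2.2)) (timeInterval T ×ˢ univ)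
  isometry : ∀ t ∈ timeInterval T, IsIsometry (C.scale (c t)) (G 0) C (G t) (Φ t)

end Courant

/-! ## The generalized tangent bundle -/

section GenTangent

variable {n : ℕ} {M : Type*} [TopologicalSpace M] [ChartedSpace (Model n) M] [IsManifold (𝓡 n) ∞ M]

variable (n M) in
/-- The generalized tangent bundle `TM ⊕ T*M`. -/
abbrev GenTangent : M → Type :=
  (fun x : M => TangentSpace (𝓡 n) x) ×ᵇ (fun x : M => TangentSpace (𝓡 n) x →L[ℝ] ℝ)

/-- The typical fibre of the generalized tangent bundle. -/
abbrev GenModel (n : ℕ) : Type := Model n × (Model n →L[ℝ] ℝ)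

/-- The Courant structure `(TM ⊕ T*M)_H`:
`⟨X+ξ, Y+η⟩ = ½ (ξ(Y) + η(X))`, `[X+ξ, Y+η]_H = [X,Y] + L_X η - ι_Y dξ + ι_Y ι_X H`,
`π(X+ξ) = X`. -/
def twisted (H : DiffForm n M 3) : CourantData n (GenTangent n M) where
  pairing x := (1 / 2 : ℝ) • LinearMap.toContinuousBilinearMap
    (LinearMap.mk₂ ℝ (fun a b : TangentSpace (𝓡 n) x × (TangentSpace (𝓡 n) x →L[ℝ] ℝ) =>
        a.2 b.1 + b.2 a.1)
      (by intro a a' b; simp; ring) (by intro r a b; simp; ring)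
      (by intro a b b'; simp; ring) (by intro r a b; simp; ring))
  bracket a b := fun x =>
    (lieBr (fun y => (a y).1) (fun y => (b y).1) x,
      lieCovector (fun y => (a y).1) (fun y => (b y).2) x
        - twoFormMap (extD (oneForm fun y => (a y).2)) x (b x).1
        + (H x).toContinuousLinearMap ![(a x).1, (b x).1, 0] 2)
  anchor x := ContinuousLinearMap.fst ℝ _ _

/-- The generalized metric `G(g,b) = e^b (0, g⁻¹; g, 0) e^{-b}` on `TM ⊕ T*M`, i.e.
`X + ξ ↦ g⁻¹ξ' + (g X + b (g⁻¹ ξ'))` with `ξ' = ξ - b X`. -/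
def genMetric (g : Tensor2 n M) (b : DiffForm n M 2) : Π x, GenTangent n M x →L[ℝ] GenTangent n M x :=
  fun x =>
    let ξ' : GenTangent n M x →L[ℝ] (TangentSpace (𝓡 n) x →L[ℝ] ℝ) :=
      ContinuousLinearMap.snd ℝ _ _ - twoFormMap b x ∘L ContinuousLinearMap.fst ℝ _ _
    (sharp g x ∘L ξ').prod
      (g x ∘L ContinuousLinearMap.fst ℝ _ _ + twoFormMap b x ∘L sharp g x ∘L ξ')

end GenTangent

end GenRicci

end

open GenRicci

noncomputable section

namespace GenRicci

set_option linter.unusedSectionVars false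

/-! ### Smoothness of families of linear maps -/

section Frames

variable {n : ℕ} {M : Type*} [TopologicalSpace M] [T2Space M] [ChartedSpace (Model n) M]
  [IsManifold (𝓡 n) ∞ M]
  {F : Type*} [NormedAddCommGroup F] [NormedSpace ℝ F] [FiniteDimensional ℝ F]
  {V : M → Type*} [TopologicalSpace (TotalSpace F V)]
  [∀ x, AddCommGroup (V x)] [∀ x, Module ℝ (V x)] [∀ x, TopologicalSpace (V x)]
  [FiberBundle F V] [VectorBundle ℝ F V] [ContMDiffVectorBundle ∞ F V (𝓡 n)]
  {F₂ : Type*} [NormedAddCommGroup F₂] [NormedSpace ℝ F₂] [FiniteDimensional ℝ F₂]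
  {V₂ : M → Type*} [TopologicalSpace (TotalSpace F₂ V₂)]
  [∀ x, AddCommGroup (V₂ x)] [∀ x, Module ℝ (V₂ x)] [∀ x, TopologicalSpace (V₂ x)]
  [FiberBundle F₂ V₂] [VectorBundle ℝ F₂ V₂] [ContMDiffVectorBundle ∞ F₂ V₂ (𝓡 n)]
  {EN : Type*} [NormedAddCommGroup EN] [NormedSpace ℝ EN] {HN : Type*} [TopologicalSpace HN]
  {J : ModelWithCorners ℝ EN HN} {N : Type*} [TopologicalSpace N] [ChartedSpace HN N]
  {W : Type*} [NormedAddCommGroup W] [NormedSpace ℝ W]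

/-! Both directions compare the two ways in which the pair (g, H) determined by a generalized metric
can move: by the generalized Ricci flow, and by scaling together with diffeomorphisms.

From solitons to the static equations. An isomorphism of Courant algebroids `(c · E, G(0)) → (E,
G(t))` covering `f_t` respects anchors, eigenbundles and preferred splittings, so `f_t^* g_t = c(t)
g₀` and `f_t^* H_t = c(t) H₀` (`IsIsometry.metricOf`, `IsIsometry.torsionOf`). After replacing `f_t`
by `f_t ∘ f₀⁻¹` the family starts at the identity and has a velocity field X. On the other side, the
flow equation gives `∂g/∂t = -2 Ric^B` and `∂H/∂t = Δ_g H` at t = 0 (`IsGRF.variation`).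
Differentiating the two pullback identities at t = 0 yields `-2 Ric^B + L_X g₀ = c'(0) g₀` and `Δ H₀
+ L_X H₀ = c'(0) H₀`, which is the claim with `λ = -c'(0)/2`.

The variation formulas come from the single function `q_t(u,v) = ⟨σ₊^t u, σ₊^0 v⟩`. The metric is
its symmetrization up to the constant g₀, and its antisymmetrization `b_t` satisfies `H_t = H₀ + d
b_t` (`IsGenMetric.exists_shift`). Since `G(t)` fixes `σ₊^t u` and `G(0)` negates `σ₋^0 v`, one has
`q_t(u,v) = g₀(u,v) + ½ ⟨σ₊^t u, (G(t) - G(0)) σ₋^0 v⟩`. The second factor vanishes at t = 0, so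
`q'` is read off from the flow equation: it is `-Ric^B - ½ d*H`. The 3-form is closed by the Jacobi
identity, hence `-d d*H = Δ H`.

From the static equations to solitons. Let θ be the flow of X and put `ĝ(s) = e^{-2λs} θ_{-s}^* g₀`,
`Ĥ(s) = e^{-2λs} θ_{-s}^* H₀`. The tensors `Ric^B` and `d*H` are natural under diffeomorphisms and
unchanged when g and H are multiplied by the same constant. Hence the static equations give `∂ĝ/∂s =
-2 e^{-2λs} Ric^B(ĝ, Ĥ)`, and `B(s) = -∫₀^s e^{-2λr} θ_{-r}^*(d*H₀) dr` satisfies both `∂B/∂s =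
-e^{-2λs} d*Ĥ` and `H₀ + dB = Ĥ`. The time change `τ' = e^{2λτ}` removes the factor, so `G(ĝ(τ(t)),
B(τ(t)))` solves the flow. With `f = θ_{τ(t)}`, `c = e^{-2λτ(t)}` and `B = B(τ(t))`, the map `X + ξ
↦ f_* X + c f_* ξ + B(f_* X)` is the required isometry, because `f^*(H₀ + dB) = c H₀`.

Three analytic foundations support this. Tensors chosen by `Classical.epsilon` have their intended
values once the defining expressions are shown to be function-linear (`IsTensorialAt`,
`IsMultiTensorial`). Derivatives in time and in space commute up to the endpoint t = 0, because that
endpoint lies in the closure of the interior of the time interval. The flow of a complete field is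
jointly smooth, which follows from the inverse function theorem on a Banach space of curves. -/

variable (n F V) in
theorem exists_bump (x₀ : M) : ∃ f : SmoothBumpFunction (𝓡 n) x₀,
    tsupport f ⊆ (trivializationAt F V x₀).baseSet := by
  have h : (trivializationAt F V x₀).baseSet ∈ 𝓝 x₀ :=
    (trivializationAt F V x₀).open_baseSet.mem_nhds (mem_baseSet_trivializationAt F V x₀)
  obtain ⟨f, -, hf⟩ := (SmoothBumpFunction.nhds_basis_tsupport (I := 𝓡 n) x₀).mem_iff.1 h
  exact ⟨f, hf⟩

variable (n F V) in
/-- A bump function around `x₀` supported in the domain of the trivialization at `x₀`. -/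
def frameBump (x₀ : M) : M → ℝ := (exists_bump n F V x₀).choose

variable (n F) in
/-- The constant section `w` in the trivialization around `x₀`, cut off away from `x₀`. -/
def frame (x₀ : M) (w : F) : Π x, V x := fun y =>
  frameBump n F V x₀ y • (trivializationAt F V x₀).symmL ℝ y w

variable (F) in
/-- The coordinates of a vector in the trivialization around `x₀`. -/
def crd (x₀ : M) {y : M} (v : V y) : F := (trivializationAt F V x₀).continuousLinearMapAt ℝ y v

variable (n F) in
/-- A smooth section with prescribed value at `x₀`, constant in coordinates near `x₀`. -/
def ext (x₀ : M) (v : V x₀) : Π x, V x := frame n F x₀ (crd F x₀ v)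

theorem frameBump_smooth (x₀ : M) : ContMDiff (𝓡 n) 𝓘(ℝ, ℝ) ∞ (frameBump n F V x₀) :=
  (exists_bump n F V x₀).choose.contMDiff

theorem frameBump_eventually (x₀ : M) : ∀ᶠ y in 𝓝 x₀, frameBump n F V x₀ y = 1 :=
  (exists_bump n F V x₀).choose.eventuallyEq_one

theorem frame_smooth (x₀ : M) (w : F) :
    IsSmoothSection (n := n) F (V := V) (frame n F x₀ w) := by
  have h := ContMDiffOn.smul_section_of_tsupport (I := 𝓡 n) (F := F) (V := V) (n := ∞)
    (u := (trivializationAt F V x₀).baseSet) (ψ := frameBump n F V x₀)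
    (s := fun y => (trivializationAt F V x₀).symmL ℝ y w)
    (frameBump_smooth x₀).contMDiffOn (trivializationAt F V x₀).open_baseSet
    (exists_bump n F V x₀).choose_spec ?_
  · exact h
  · rw [(trivializationAt F V x₀).contMDiffOn_section_baseSet_iff]
    refine (contMDiffOn_const (c := w)).congr fun y hy => ?_
    have := (trivializationAt F V x₀).continuousLinearMapAt_symmL (R := ℝ) hy w
    rwa [Trivialization.continuousLinearMapAt_apply_of_mem (R := ℝ) (hb := hy)] at this

theorem frame_eventually (x₀ : M) : ∀ᶠ y in 𝓝 x₀, ∀ w, frame n F (V := V) x₀ w y =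
    (trivializationAt F V x₀).symmL ℝ y w := by
  filter_upwards [frameBump_eventually (n := n) (F := F) (V := V) x₀] with y hy w
  simp [frame, hy]

theorem baseSet_eventually (x₀ : M) : ∀ᶠ y in 𝓝 x₀, y ∈ (trivializationAt F V x₀).baseSet :=
  (trivializationAt F V x₀).open_baseSet.mem_nhds (mem_baseSet_trivializationAt F V x₀)

theorem crd_frame (x₀ : M) : ∀ᶠ y in 𝓝 x₀, ∀ w, crd F x₀ (frame n F (V := V) x₀ w y) = w := by
  filter_upwards [frame_eventually (n := n) (F := F) (V := V) x₀,
    baseSet_eventually (F := F) (V := V) x₀] with y hy hb w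
  rw [hy, crd, Trivialization.continuousLinearMapAt_symmL _ hb]

theorem frame_crd (x₀ : M) : ∀ᶠ y in 𝓝 x₀, ∀ v : V y, frame n F x₀ (crd F x₀ v) y = v := by
  filter_upwards [frame_eventually (n := n) (F := F) (V := V) x₀,
    baseSet_eventually (F := F) (V := V) x₀] with y hy hb v
  rw [hy, crd, Trivialization.symmL_continuousLinearMapAt _ hb]

theorem ext_smooth (x₀ : M) (v : V x₀) : IsSmoothSection (n := n) F (ext n F x₀ v) :=
  frame_smooth x₀ _

@[simp] theorem ext_self (x₀ : M) (v : V x₀) : ext n F x₀ v x₀ = v :=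
  (frame_crd (n := n) (F := F) (V := V) x₀).self_of_nhds v

theorem crd_add (x₀ : M) {y : M} (v w : V y) : crd F x₀ (v + w) = crd F x₀ v + crd F x₀ w := by
  simp [crd]

theorem crd_smul (x₀ : M) {y : M} (r : ℝ) (v : V y) : crd F x₀ (r • v) = r • crd F x₀ v := by
  simp [crd]

theorem frame_add (x₀ : M) (v w : F) :
    frame n F (V := V) x₀ (v + w) = frame n F x₀ v + frame n F x₀ w := by
  ext y; simp [frame]

theorem frame_smul (x₀ : M) (r : ℝ) (v : F) :
    frame n F (V := V) x₀ (r • v) = r • frame n F x₀ v := by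
  ext y; simp [frame, smul_comm r]

theorem ext_add (x₀ : M) (v w : V x₀) : ext n F x₀ (v + w) = ext n F x₀ v + ext n F x₀ w := by
  rw [ext, crd_add, frame_add]; rfl

theorem ext_smul (x₀ : M) (r : ℝ) (v : V x₀) : ext n F x₀ (r • v) = r • ext n F x₀ v := by
  rw [ext, crd_smul, frame_smul]; rfl

/-- Vectors along a map f from a parameter manifold N occur below with N = M, ℝ × M or ℝ times a
total space. Near p₀ the point f p stays in the base set of the single trivialization at f p₀, so
smoothness can be tested in fixed coordinates. -/
theorem contMDiffWithinAt_totalSpace_iff_crd {f : N → M} {v : Π p, V (f p)} {S : Set N} {p₀ : N}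
    (hp : p₀ ∈ S) :
    ContMDiffWithinAt J ((𝓡 n).prod 𝓘(ℝ, F)) ∞ (fun p => TotalSpace.mk' F (f p) (v p)) S p₀ ↔
      ContMDiffWithinAt J (𝓡 n) ∞ f S p₀ ∧
      ContMDiffWithinAt J 𝓘(ℝ, F) ∞ (fun p => crd F (f p₀) (v p)) S p₀ := by
  rw [contMDiffWithinAt_totalSpace]
  refine and_congr_right fun hf => ?_
  have : ∀ᶠ p in 𝓝[S] p₀, f p ∈ (trivializationAt F V (f p₀)).baseSet :=
    hf.continuousWithinAt.eventually (baseSet_eventually (F := F) (V := V) (f p₀))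
  have heq : (fun p => crd F (f p₀) (v p)) =ᶠ[𝓝[S] p₀]
      fun p => (trivializationAt F V (f p₀) (TotalSpace.mk' F (f p) (v p))).2 := ?_
  · exact ⟨fun h => h.congr_of_eventuallyEq_of_mem heq hp,
      fun h => h.congr_of_eventuallyEq_of_mem heq.symm hp⟩
  filter_upwards [this] with p hp'
  rw [crd, Trivialization.continuousLinearMapAt_apply_of_mem (R := ℝ) (hb := hp')]

theorem contMDiffWithinAt_clm_of_apply {L : N → F →L[ℝ] W} {S : Set N} {p₀ : N}
    (h : ∀ w, ContMDiffWithinAt J 𝓘(ℝ, W) ∞ (fun p => L p w) S p₀) :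
    ContMDiffWithinAt J 𝓘(ℝ, F →L[ℝ] W) ∞ L S p₀ := by
  let b := Module.finBasis ℝ F
  have : L = fun p => ∑ i, ContinuousLinearMap.smulRightL ℝ F W
      (LinearMap.toContinuousLinearMap (b.coord i)) (L p (b i)) := by
    ext p w
    conv_lhs => rw [← b.sum_repr w]
    simp only [map_sum, map_smul]
    rw [_root_.sum_apply]
    simp
  rw [this]
  refine contMDiffWithinAt_finsetSum fun i _ => ?_
  exact ((ContinuousLinearMap.contMDiff (ContinuousLinearMap.smulRightL ℝ F W
    (LinearMap.toContinuousLinearMap (b.coord i)))) _).comp_contMDiffWithinAt _ (h (b i))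

/-- Expand v in the cut-off frame around f p₀: the coefficients are smooth, and the frame sections
are global, so A is only ever evaluated on global smooth sections. No smoothness of A as a section
of a Hom bundle has to be formulated. -/
theorem contMDiffWithinAt_apply_section {f : N → M} {A : Π p, V (f p) →ₗ[ℝ] W} {v : Π p, V (f p)}
    {S : Set N} {p₀ : N} (hp : p₀ ∈ S)
    (hA : ∀ s : Π x, V x, IsSmoothSection (n := n) F s →
      ContMDiffWithinAt J 𝓘(ℝ, W) ∞ (fun p => A p (s (f p))) S p₀)
    (hv : ContMDiffWithinAt J ((𝓡 n).prod 𝓘(ℝ, F)) ∞ (fun p => TotalSpace.mk' F (f p) (v p)) S p₀) :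
    ContMDiffWithinAt J 𝓘(ℝ, W) ∞ (fun p => A p (v p)) S p₀ := by
  rw [contMDiffWithinAt_totalSpace_iff_crd hp] at hv
  let b := Module.finBasis ℝ F
  have h : ContMDiffWithinAt J 𝓘(ℝ, W) ∞ (fun p => ∑ i, b.coord i (crd F (f p₀) (v p)) •
      A p (frame n F (f p₀) (b i) (f p))) S p₀ := by
    refine contMDiffWithinAt_finsetSum fun i _ =>
      ContMDiffWithinAt.smul (I := 𝓘(ℝ, ℝ)) (G := ℝ) (M := W) ?_ (hA _ (frame_smooth _ _))
    exact ((ContinuousLinearMap.contMDiff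
      (LinearMap.toContinuousLinearMap (b.coord i))) _).comp_contMDiffWithinAt _ hv.2
  refine h.congr_of_eventuallyEq_of_mem ?_ hp
  filter_upwards [hv.1.continuousWithinAt.eventually
    (frame_crd (n := n) (F := F) (V := V) (f p₀))] with p hp'
  conv_lhs => rw [← hp' (v p), ← b.sum_repr (crd F (f p₀) (v p))]
  have : ∀ w, A p (frame n F (f p₀) w (f p)) = (A p ∘ₗ
      { toFun := fun w => frame n F (V := V) (f p₀) w (f p)
        map_add' := fun v w => by rw [frame_add]; rfl
        map_smul' := fun r w => by rw [frame_smul]; rfl }) w := fun w => rfl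
  rw [this, _root_.map_sum]
  simp only [map_smul]
  rfl

theorem contMDiffWithinAt_base {f : N → M} {v : Π p, V (f p)} {S : Set N} {p₀ : N}
    (hv : ContMDiffWithinAt J ((𝓡 n).prod 𝓘(ℝ, F)) ∞ (fun p => TotalSpace.mk' F (f p) (v p)) S p₀) :
    ContMDiffWithinAt J (𝓡 n) ∞ f S p₀ :=
  (contMDiffWithinAt_totalSpace.1 hv).1

theorem isSmoothSection_zero : IsSmoothSection (n := n) F (0 : Π x, V x) :=
  contMDiff_zeroSection ℝ V

/-- A fibrewise linear family of maps which is smooth on sections is smooth. -/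
theorem contMDiffWithinAt_map_section {f h : N → M} {A : Π p, V (f p) →ₗ[ℝ] V₂ (h p)}
    {v : Π p, V (f p)} {S : Set N} {p₀ : N} (hp : p₀ ∈ S)
    (hA : ∀ s : Π x, V x, IsSmoothSection (n := n) F s →
      ContMDiffWithinAt J ((𝓡 n).prod 𝓘(ℝ, F₂)) ∞
        (fun p => TotalSpace.mk' F₂ (h p) (A p (s (f p)))) S p₀)
    (hv : ContMDiffWithinAt J ((𝓡 n).prod 𝓘(ℝ, F)) ∞ (fun p => TotalSpace.mk' F (f p) (v p)) S p₀) :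
    ContMDiffWithinAt J ((𝓡 n).prod 𝓘(ℝ, F₂)) ∞
        (fun p => TotalSpace.mk' F₂ (h p) (A p (v p))) S p₀ := by
  rw [contMDiffWithinAt_totalSpace_iff_crd hp]
  refine ⟨contMDiffWithinAt_base (hA 0 isSmoothSection_zero), ?_⟩
  refine contMDiffWithinAt_apply_section (n := n) (F := F) (V := V) (f := f) (v := v)
    (A := fun p => ((trivializationAt F₂ V₂ (h p₀)).continuousLinearMapAt ℝ (h p)).toLinearMap ∘ₗ A p)
    hp (fun s hs => ?_) hv
  exact ((contMDiffWithinAt_totalSpace_iff_crd hp).1 (hA s hs)).2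

/-- If a smooth fibrewise linear family of maps is invertible at `p₀`, then preimages of smooth
families of vectors are smooth near `p₀`. -/
theorem contMDiffWithinAt_of_map_section {f h : N → M} {A : Π p, V (f p) →ₗ[ℝ] V₂ (h p)}
    {v : Π p, V (f p)} {S : Set N} {p₀ : N} (hp : p₀ ∈ S)
    (hf : ContMDiffWithinAt J (𝓡 n) ∞ f S p₀)
    (hA : ∀ s : Π x, V x, IsSmoothSection (n := n) F s →
      ContMDiffWithinAt J ((𝓡 n).prod 𝓘(ℝ, F₂)) ∞
        (fun p => TotalSpace.mk' F₂ (h p) (A p (s (f p)))) S p₀)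
    (hbij : Function.Bijective (A p₀))
    (hv : ContMDiffWithinAt J ((𝓡 n).prod 𝓘(ℝ, F₂)) ∞
        (fun p => TotalSpace.mk' F₂ (h p) (A p (v p))) S p₀) :
    ContMDiffWithinAt J ((𝓡 n).prod 𝓘(ℝ, F)) ∞ (fun p => TotalSpace.mk' F (f p) (v p)) S p₀ := by
  have hvc := (contMDiffWithinAt_totalSpace_iff_crd hp).1 hv
  rw [contMDiffWithinAt_totalSpace_iff_crd hp]
  refine ⟨hf, ?_⟩
  let e₁ := trivializationAt F V (f p₀)
  let e₂ := trivializationAt F₂ V₂ (h p₀)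
  -- The family A read in the two trivializations. It is a smooth family of maps between fixed
  -- finite-dimensional spaces, so inversion is smooth where it is defined.
  let Ll : N → F →ₗ[ℝ] F₂ := fun p => (e₂.continuousLinearMapAt ℝ (h p)).toLinearMap ∘ₗ A p ∘ₗ
      (e₁.symmL ℝ (f p)).toLinearMap
  let L : N → F →L[ℝ] F₂ := fun p => LinearMap.toContinuousLinearMap (Ll p)
  have hb₁ : f p₀ ∈ e₁.baseSet := mem_baseSet_trivializationAt F V (f p₀)
  have hb₂ : h p₀ ∈ e₂.baseSet := mem_baseSet_trivializationAt F₂ V₂ (h p₀)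
  have hL : ContMDiffWithinAt J 𝓘(ℝ, F →L[ℝ] F₂) ∞ L S p₀ := by
    refine contMDiffWithinAt_clm_of_apply fun w => ?_
    have := ((contMDiffWithinAt_totalSpace_iff_crd hp).1
      (hA _ (frame_smooth (n := n) (V := V) (f p₀) w))).2
    refine this.congr_of_eventuallyEq_of_mem ?_ hp
    filter_upwards [hf.continuousWithinAt.eventually
      (frame_eventually (n := n) (F := F) (V := V) (f p₀))] with p hp'
    rw [hp' w]; rfl
  have hLbij : Function.Bijective (Ll p₀) := by
    have h1 : Function.Bijective (e₁.symmL ℝ (f p₀)) := by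
      rw [← e₁.symm_continuousLinearEquivAt_eq hb₁]
      exact (e₁.continuousLinearEquivAt ℝ (f p₀) hb₁).symm.bijective
    have h2 : Function.Bijective (e₂.continuousLinearMapAt ℝ (h p₀)) := by
      rw [← e₂.coe_continuousLinearEquivAt_eq hb₂]
      exact (e₂.continuousLinearEquivAt ℝ (h p₀) hb₂).bijective
    exact h2.comp (hbij.comp h1)
  let Le : F ≃L[ℝ] F₂ := (LinearEquiv.ofBijective (Ll p₀) hLbij).toContinuousLinearEquiv
  have hLe : (Le : F →L[ℝ] F₂) = L p₀ := by ext w; rfl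
  have hinv : ContMDiffWithinAt J 𝓘(ℝ, F₂ →L[ℝ] F) ∞ (fun p => (L p).inverse) S p₀ := by
    have := (contDiffAt_map_inverse (n := ∞) Le).contMDiffAt
    rw [hLe] at this
    exact this.comp_contMDiffWithinAt _ hL
  refine (hinv.clm_apply hvc.2).congr_of_eventuallyEq_of_mem ?_ hp
  -- Invertibility is an open condition. It is assumed only at p₀ but holds for p near p₀, and there
  -- the coordinates of v are the inverse of `L p` applied to those of A v.
  have hnear : ∀ᶠ p in 𝓝[S] p₀, L p ∈ range ((↑) : (F ≃L[ℝ] F₂) → F →L[ℝ] F₂) := by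
    refine hL.continuousWithinAt.eventually ?_
    rw [← hLe]; exact Le.nhds
  filter_upwards [hnear, hf.continuousWithinAt.eventually
    (baseSet_eventually (F := F) (V := V) (f p₀))] with p hp1 hp2
  obtain ⟨e, he⟩ := hp1
  have : crd F₂ (h p₀) (A p (v p)) = L p (crd F (f p₀) (v p)) := by
    change _ = crd F₂ (h p₀) (A p (e₁.symmL ℝ (f p) (e₁.continuousLinearMapAt ℝ (f p) (v p))))
    rw [Trivialization.symmL_continuousLinearMapAt _ hp2]
  rw [this, ← he]
  simp

theorem isSmoothSection_add {a b : Π x, V x} (ha : IsSmoothSection (n := n) F a)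
    (hb : IsSmoothSection (n := n) F b) : IsSmoothSection (n := n) F (a + b) :=
  ContMDiff.add_section ha hb

theorem isSmoothSection_smul {a : Π x, V x} {f : M → ℝ} (hf : ContMDiff (𝓡 n) 𝓘(ℝ, ℝ) ∞ f)
    (ha : IsSmoothSection (n := n) F a) : IsSmoothSection (n := n) F (f • a) :=
  ContMDiff.smul_section hf ha

theorem isSmoothSection_const_smul {a : Π x, V x} (r : ℝ)
    (ha : IsSmoothSection (n := n) F a) : IsSmoothSection (n := n) F (r • a) :=
  ContMDiff.const_smul_section ha

theorem isSmoothSection_sum {ι : Type*} {t : Finset ι} {a : ι → Π x, V x}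
    (ha : ∀ i ∈ t, IsSmoothSection (n := n) F (a i)) :
    IsSmoothSection (n := n) F (∑ i ∈ t, a i) := by
  have := ContMDiff.sum_section (I := 𝓡 n) (n := ∞) (F := F) (V := V) (s := t) (t := a) ha
  unfold IsSmoothSection
  convert this using 3
  simp

/-! ### Tensoriality -/

variable (F) in
/-- `C^∞(M)`-linear operations on smooth sections, at `x`. -/
structure IsTensorialAt {A : Type*} [AddCommGroup A] [Module ℝ A] (Λ : (Π x, V x) → A) (x : M) :
    Prop where
  add : ∀ a b, IsSmoothSection (n := n) F a → IsSmoothSection (n := n) F b → Λ (a + b) = Λ a + Λ b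
  smul : ∀ (f : M → ℝ) a, ContMDiff (𝓡 n) 𝓘(ℝ, ℝ) ∞ f → IsSmoothSection (n := n) F a →
    Λ (f • a) = f x • Λ a

namespace IsTensorialAt

variable {A : Type*} [AddCommGroup A] [Module ℝ A] {Λ : (Π x, V x) → A} {x : M}

theorem map_zero (h : IsTensorialAt (n := n) F Λ x) : Λ 0 = 0 := by
  have := h.smul 0 0 contMDiff_const isSmoothSection_zero
  simpa using this

theorem map_sum (h : IsTensorialAt (n := n) F Λ x) {ι : Type*} (t : Finset ι) {a : ι → Π x, V x}
    (ha : ∀ i ∈ t, IsSmoothSection (n := n) F (a i)) : Λ (∑ i ∈ t, a i) = ∑ i ∈ t, Λ (a i) := by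
  classical
  induction t using Finset.induction_on with
  | empty => simpa using h.map_zero
  | insert i t hi ih =>
    rw [Finset.sum_insert hi, Finset.sum_insert hi, h.add, ih]
    · exact fun j hj => ha j (Finset.mem_insert_of_mem hj)
    · exact ha i (Finset.mem_insert_self _ _)
    · exact isSmoothSection_sum fun j hj => ha j (Finset.mem_insert_of_mem hj)

/-- Near x, a equals the combination a' of frame sections with global coefficients vanishing at x,
so Λ a' = 0 by linearity. The difference a - a' vanishes near x, hence equals (1 - η)(a - a') for a
cutoff η with η(x) = 1, and Λ kills it as well. -/
theorem eq_zero (h : IsTensorialAt (n := n) F Λ x) {a : Π x, V x}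
    (ha : IsSmoothSection (n := n) F a) (hx : a x = 0) : Λ a = 0 := by
  let b := Module.finBasis ℝ F
  let ψ := frameBump n F V x
  -- The bump function turns the local coordinate functions of a into smooth functions on all of M
  -- without changing them near x.
  let c : Fin (Module.finrank ℝ F) → M → ℝ := fun i y => ψ y * b.coord i (crd F x (a y))
  have hc : ∀ i, ContMDiff (𝓡 n) 𝓘(ℝ, ℝ) ∞ (c i) := by
    intro i
    refine contMDiff_of_tsupport fun y hy => ?_
    have hy' : y ∈ (trivializationAt F V x).baseSet := by
      refine (exists_bump n F V x).choose_spec (closure_mono ?_ hy)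
      intro z hz
      exact left_ne_zero_of_mul hz
    refine ContMDiffAt.mul (frameBump_smooth x y) ?_
    have h1 : ContMDiffAt (𝓡 n) 𝓘(ℝ, F) ∞ (fun y => (trivializationAt F V x ⟨y, a y⟩).2) y :=
      ((trivializationAt F V x).contMDiffAt_section_iff hy').1 (ha y)
    have h2 : ContMDiffAt (𝓡 n) 𝓘(ℝ, F) ∞ (fun y => crd F x (a y)) y := by
      refine h1.congr_of_eventuallyEq ?_
      filter_upwards [(trivializationAt F V x).open_baseSet.mem_nhds hy'] with z hz
      rw [crd, Trivialization.continuousLinearMapAt_apply_of_mem (R := ℝ) (hb := hz)]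
    exact (ContinuousLinearMap.contMDiff
      (LinearMap.toContinuousLinearMap (b.coord i))).contMDiffAt.comp _ h2
  let a' : Π x, V x := ∑ i, c i • frame n F x (b i)
  have hs : ∀ i ∈ Finset.univ, IsSmoothSection (n := n) F (V := V) (c i • frame n F x (b i)) :=
    fun i _ => isSmoothSection_smul (hc i) (frame_smooth x (b i))
  have ha' : IsSmoothSection (n := n) F a' := isSmoothSection_sum hs
  have hc0 : ∀ i, c i x = 0 := fun i => by simp [c, hx, crd]
  have h0 : Λ a' = 0 := by
    rw [h.map_sum _ hs]
    refine Finset.sum_eq_zero fun i _ => ?_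
    rw [h.smul _ _ (hc i) (frame_smooth x _), hc0, zero_smul]
  have hev : ∀ᶠ y in 𝓝 x, a y = a' y := by
    filter_upwards [frame_crd (n := n) (F := F) (V := V) x,
      frameBump_eventually (n := n) (F := F) (V := V) x] with y hy hy1
    conv_lhs => rw [← hy (a y), ← b.sum_repr (crd F x (a y))]
    have : ∀ w, frame n F x w y = ({ toFun := fun w => frame n F (V := V) x w y
                                     map_add' := fun v w => by rw [frame_add]; rfl
                                     map_smul' := fun r w => by rw [frame_smul]; rfl } :
                                       F →ₗ[ℝ] V y) w := fun w => rfl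
    rw [this, _root_.map_sum]
    simp only [map_smul, a', c, ψ, Finset.sum_apply, Pi.smul_apply', hy1, one_mul]
    rfl
  obtain ⟨η, -, hη⟩ := (SmoothBumpFunction.nhds_basis_tsupport (I := 𝓡 n) x).mem_iff.1 hev
  have hη' : ContMDiff (𝓡 n) 𝓘(ℝ, ℝ) ∞ (fun y => 1 - η y) := contMDiff_const.sub η.contMDiff
  have key : a + (-1 : ℝ) • a' = (fun y => 1 - η y) • (a + (-1 : ℝ) • a') := by
    ext y
    by_cases hy : y ∈ tsupport η
    · have : a y = a' y := hη hy
      simp [this]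
    · simp [image_eq_zero_of_notMem_tsupport hy]
  have h1 := h.smul _ _ hη' (isSmoothSection_add ha (isSmoothSection_const_smul (-1) ha'))
  rw [← key] at h1
  have h2 := h.add _ _ ha (isSmoothSection_const_smul (-1) ha')
  have h3 := h.smul (fun _ => -1) a' contMDiff_const ha'
  have h4 : ((fun _ => -1 : M → ℝ) • a') = (-1 : ℝ) • a' := rfl
  rw [h4, h0, smul_zero] at h3
  rw [h3, add_zero] at h2
  rw [← h2, h1]
  simp

theorem congr (h : IsTensorialAt (n := n) F Λ x) {a b : Π x, V x}
    (ha : IsSmoothSection (n := n) F a) (hb : IsSmoothSection (n := n) F b) (hx : a x = b x) :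
    Λ a = Λ b := by
  have h2 := h.add _ _ ha (isSmoothSection_const_smul (-1) hb)
  rw [h.eq_zero (isSmoothSection_add ha (isSmoothSection_const_smul (-1) hb)) (by simp [hx])] at h2
  have h3 := h.smul (fun _ => -1) b contMDiff_const hb
  have h4 : ((fun _ => -1 : M → ℝ) • b) = (-1 : ℝ) • b := rfl
  rw [h4] at h3
  rw [h3] at h2
  have : (0 : A) = Λ a - Λ b := by rw [h2]; simp [sub_eq_add_neg]
  exact sub_eq_zero.1 this.symm

/-- The linear map determined by a tensorial operation. -/
def toLinear (h : IsTensorialAt (n := n) F Λ x) : V x →ₗ[ℝ] A where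
  toFun v := Λ (ext n F x v)
  map_add' v w := by rw [ext_add, h.add _ _ (ext_smooth _ _) (ext_smooth _ _)]
  map_smul' r v := by
    rw [ext_smul]
    exact h.smul (fun _ => r) _ contMDiff_const (ext_smooth _ _)

theorem toLinear_apply (h : IsTensorialAt (n := n) F Λ x) {a : Π x, V x}
    (ha : IsSmoothSection (n := n) F a) : h.toLinear (a x) = Λ a :=
  h.congr (ext_smooth _ _) ha (ext_self _ _)

end IsTensorialAt

/-! ### Smoothness of sections of bundles of linear maps -/

theorem contMDiffWithinAt_hom {f : N → M} {A : Π p, V (f p) →L[ℝ] V₂ (f p)}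
    [∀ x, IsTopologicalAddGroup (V₂ x)] [∀ x, ContinuousSMul ℝ (V₂ x)]
    {S : Set N} {p₀ : N} (hp : p₀ ∈ S) (hf : ContMDiffWithinAt J (𝓡 n) ∞ f S p₀)
    (hA : ∀ s : Π x, V x, IsSmoothSection (n := n) F s →
      ContMDiffWithinAt J ((𝓡 n).prod 𝓘(ℝ, F₂)) ∞
        (fun p => TotalSpace.mk' F₂ (f p) (A p (s (f p)))) S p₀) :
    ContMDiffWithinAt J ((𝓡 n).prod 𝓘(ℝ, F →L[ℝ] F₂)) ∞
      (fun p => TotalSpace.mk' (F →L[ℝ] F₂) (E := fun x => V x →L[ℝ] V₂ x) (f p) (A p)) S p₀ := by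
  rw [contMDiffWithinAt_hom_bundle]
  refine ⟨hf, contMDiffWithinAt_clm_of_apply fun w => ?_⟩
  have := ((contMDiffWithinAt_totalSpace_iff_crd hp).1
      (hA _ (frame_smooth (n := n) (V := V) (f p₀) w))).2
  refine this.congr_of_eventuallyEq_of_mem ?_ hp
  filter_upwards [hf.continuousWithinAt.eventually
      (frame_eventually (n := n) (F := F) (V := V) (f p₀))] with p hp'
  rw [hp' w]; rfl

end Frames

/-! ### Functions depending on time -/

section Time

variable {n : ℕ} {M : Type*} [TopologicalSpace M] [T2Space M] [ChartedSpace (Model n) M]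
  [IsManifold (𝓡 n) ∞ M]
  {W : Type*} [NormedAddCommGroup W] [NormedSpace ℝ W]

theorem crd_tangent {x₀ y : M} (hy : y ∈ (extChartAt (𝓡 n) x₀).source)
    (v : TangentSpace (𝓡 n) y) :
    crd (Model n) x₀ v = mfderiv (𝓡 n) 𝓘(ℝ, Model n) (extChartAt (𝓡 n) x₀) y v := by
  rw [extChartAt_source] at hy
  rw [crd, TangentBundle.continuousLinearMapAt_trivializationAt hy]
  rfl

/-- Identifies the product of the two model structures with the model structure of the product
space, so that calculus on ℝ × E applies to functions on ℝ × M read in a chart of M. -/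
theorem contMDiffWithinAt_prod_iff {E : Type*} [NormedAddCommGroup E] [NormedSpace ℝ E]
    {f : ℝ × E → W} {S : Set (ℝ × E)} {p : ℝ × E} :
    ContMDiffWithinAt (𝓘(ℝ, ℝ).prod 𝓘(ℝ, E)) 𝓘(ℝ, W) ∞ f S p ↔ ContDiffWithinAt ℝ ∞ f S p := by
  rw [← contMDiffWithinAt_iff_contDiffWithinAt, modelWithCornersSelf_prod, ← chartedSpaceSelf_prod]

theorem mfderiv_eq_fderiv_chart {x₀ y : M} (hy : y ∈ (extChartAt (𝓡 n) x₀).source) {h : M → W}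
    (hh : MDifferentiableAt (𝓡 n) 𝓘(ℝ, W) h y) (v : TangentSpace (𝓡 n) y) :
    mfderiv (𝓡 n) 𝓘(ℝ, W) h y v =
      fderiv ℝ (h ∘ (extChartAt (𝓡 n) x₀).symm) (extChartAt (𝓡 n) x₀ y) (crd (Model n) x₀ v) := by
  set φ := extChartAt (𝓡 n) x₀
  have h1 : MDifferentiableAt (𝓡 n) 𝓘(ℝ, Model n) φ y :=
    mdifferentiableAt_extChartAt (by rwa [extChartAt_source] at hy)
  have hl : φ.symm (φ y) = y := φ.left_inv hy
  have h2 : MDifferentiableAt 𝓘(ℝ, Model n) (𝓡 n) φ.symm (φ y) := by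
    have := (contMDiffOn_extChartAt_symm (I := 𝓡 n) (n := ∞) x₀).contMDiffAt
      ((isOpen_extChartAt_target x₀).mem_nhds (φ.map_source hy))
    exact this.mdifferentiableAt (by simp)
  have h3 : MDifferentiableAt 𝓘(ℝ, Model n) 𝓘(ℝ, W) (h ∘ φ.symm) (φ y) := by
    refine MDifferentiableAt.comp _ ?_ h2
    rwa [hl]
  have h4 : h =ᶠ[𝓝 y] (h ∘ φ.symm) ∘ φ := by
    have : φ.source ∈ 𝓝 y := (isOpen_extChartAt_source x₀).mem_nhds hy
    filter_upwards [this] with z hz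
    simp [φ.left_inv hz]
  rw [h4.mfderiv_eq, mfderiv_comp _ h3 h1, mfderiv_eq_fderiv, crd_tangent hy]
  rfl

variable {S : Set ℝ} {t₀ : ℝ} {x₀ : M} {u : ℝ × M → W}

/-- Only the space variable is read in a chart; time is kept as it is. This reduces questions on S ×
M to `fderivWithin` on S × ℝⁿ. -/
theorem contDiffWithinAt_chart
    (hu : ContMDiffWithinAt (𝓘(ℝ, ℝ).prod (𝓡 n)) 𝓘(ℝ, W) ∞ u (S ×ˢ univ) (t₀, x₀)) :
    ContDiffWithinAt ℝ ∞ (fun q : ℝ × Model n => u (q.1, (extChartAt (𝓡 n) x₀).symm q.2))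
      (S ×ˢ univ) (t₀, extChartAt (𝓡 n) x₀ x₀) := by
  rw [← contMDiffWithinAt_prod_iff]
  have h2 : ContMDiffAt 𝓘(ℝ, Model n) (𝓡 n) ∞ (extChartAt (𝓡 n) x₀).symm
      (extChartAt (𝓡 n) x₀ x₀) :=
    (contMDiffOn_extChartAt_symm (I := 𝓡 n) (n := ∞) x₀).contMDiffAt
      ((isOpen_extChartAt_target x₀).mem_nhds (mem_extChartAt_target x₀))
  have h3 : ContMDiffWithinAt (𝓘(ℝ, ℝ).prod 𝓘(ℝ, Model n)) (𝓘(ℝ, ℝ).prod (𝓡 n)) ∞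
      (fun q : ℝ × Model n => (q.1, (extChartAt (𝓡 n) x₀).symm q.2)) (S ×ˢ univ)
      (t₀, extChartAt (𝓡 n) x₀ x₀) :=
    (contMDiffAt_fst.prodMk (h2.comp (t₀, extChartAt (𝓡 n) x₀ x₀)
      contMDiffAt_snd)).contMDiffWithinAt
  refine ContMDiffWithinAt.comp (t := S ×ˢ univ) (t₀, extChartAt (𝓡 n) x₀ x₀) (g := u) ?_ h3
    (fun q hq => mk_mem_prod hq.1 (mem_univ _))
  rw [extChartAt_to_inv]
  exact hu

theorem eventually_mdifferentiableAt (ht : t₀ ∈ S)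
    (hu : ContMDiffWithinAt (𝓘(ℝ, ℝ).prod (𝓡 n)) 𝓘(ℝ, W) ∞ u (S ×ˢ univ) (t₀, x₀)) :
    ∀ᶠ p in 𝓝[S ×ˢ univ] (t₀, x₀), MDifferentiableAt (𝓡 n) 𝓘(ℝ, W) (fun y => u (p.1, y)) p.2 := by
  have h1 := (contMDiffWithinAt_iff_contMDiffWithinAt_nhdsWithin (n := 1) (by simp)).1
    (hu.of_le (by simp))
  rw [insert_eq_of_mem (show (t₀, x₀) ∈ S ×ˢ univ from ⟨ht, trivial⟩)] at h1
  filter_upwards [h1, self_mem_nhdsWithin] with p hp hpS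
  have h2 : ContMDiffAt (𝓡 n) (𝓘(ℝ, ℝ).prod (𝓡 n)) 1 (fun y : M => (p.1, y)) p.2 :=
    contMDiffAt_const.prodMk contMDiffAt_id
  have h3 : ContMDiffWithinAt (𝓡 n) 𝓘(ℝ, W) 1 (u ∘ fun y => (p.1, y)) univ p.2 :=
    ContMDiffWithinAt.comp (t := S ×ˢ univ) p.2 hp h2.contMDiffWithinAt
      (fun y _ => mk_mem_prod hpS.1 (mem_univ _))
  exact (contMDiffWithinAt_univ.1 h3).mdifferentiableAt (by simp)

/-- Space slices of S × ℝⁿ are open in ℝⁿ, so the one-sidedness of S in time does not affect the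
spatial derivative. The formula holds at all points near (t₀, x₀), always in the chart at x₀, so it
can be differentiated further. -/
theorem eventually_mfderiv_eq (ht : t₀ ∈ S)
    (hu : ContMDiffWithinAt (𝓘(ℝ, ℝ).prod (𝓡 n)) 𝓘(ℝ, W) ∞ u (S ×ˢ univ) (t₀, x₀)) :
    ∀ᶠ p in 𝓝[S ×ˢ univ] (t₀, x₀), ∀ v : TangentSpace (𝓡 n) p.2,
      mfderiv (𝓡 n) 𝓘(ℝ, W) (fun y => u (p.1, y)) p.2 v =
      fderivWithin ℝ (fun q : ℝ × Model n => u (q.1, (extChartAt (𝓡 n) x₀).symm q.2))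
        (S ×ˢ univ) (p.1, extChartAt (𝓡 n) x₀ p.2) (0, crd (Model n) x₀ v) := by
  have hc := contDiffWithinAt_chart hu
  -- Being smooth at a point propagates to nearby points only for finite order; order 1 is all that
  -- is needed.
  have h1 := (hc.of_le (m := 1) (by simp)).eventually (by simp)
  rw [insert_eq_of_mem (show (t₀, _) ∈ S ×ˢ univ from ⟨ht, trivial⟩)] at h1
  have hcont : Filter.Tendsto (fun p : ℝ × M => (p.1, extChartAt (𝓡 n) x₀ p.2))
      (𝓝[S ×ˢ univ] (t₀, x₀)) (𝓝[S ×ˢ univ] (t₀, extChartAt (𝓡 n) x₀ x₀)) := by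
    refine tendsto_nhdsWithin_iff.2 ⟨?_, ?_⟩
    · refine Filter.Tendsto.mono_left ?_ nhdsWithin_le_nhds
      exact (continuousAt_fst.prodMk
        (ContinuousAt.comp (continuousAt_extChartAt (I := 𝓡 n) x₀) continuousAt_snd))
    · filter_upwards [self_mem_nhdsWithin] with p hp using ⟨hp.1, trivial⟩
  have hsrc : ∀ᶠ p : ℝ × M in 𝓝[S ×ˢ univ] (t₀, x₀), p.2 ∈ (extChartAt (𝓡 n) x₀).source := by
    refine nhdsWithin_le_nhds (continuousAt_snd.eventually ?_)
    exact extChartAt_source_mem_nhds x₀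
  filter_upwards [hcont.eventually h1, hsrc, eventually_mdifferentiableAt ht hu,
    self_mem_nhdsWithin] with p hp hps hpm hpS v
  rw [mfderiv_eq_fderiv_chart hps hpm]
  have hd := (hp.differentiableWithinAt (by simp)).hasFDerivWithinAt
  have hi : HasFDerivAt (fun z : Model n => (p.1, z)) (ContinuousLinearMap.inr ℝ ℝ (Model n))
      (extChartAt (𝓡 n) x₀ p.2) := hasFDerivAt_prodMk_right _ _
  have := HasFDerivWithinAt.comp (t := S ×ˢ univ) _ hd
    (hi.hasFDerivWithinAt (s := univ)) (fun y _ => mk_mem_prod hpS.1 (mem_univ _))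
  rw [hasFDerivWithinAt_univ] at this
  have h5 := this.fderiv
  have : fderiv ℝ ((fun y => u (p.1, y)) ∘ (extChartAt (𝓡 n) x₀).symm) (extChartAt (𝓡 n) x₀ p.2)
      = _ := h5
  rw [this]; rfl

theorem uniqueDiffOn_prod_univ {E : Type*} [NormedAddCommGroup E] [NormedSpace ℝ E]
    (hS : UniqueDiffOn ℝ S) : UniqueDiffOn ℝ (S ×ˢ (univ : Set E)) :=
  hS.prod uniqueDiffOn_univ

/-- The spatial derivative of a jointly smooth function is jointly smooth. -/
theorem contMDiffWithinAt_mfderiv (ht : t₀ ∈ S) (hS : UniqueDiffOn ℝ S)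
    (hu : ContMDiffWithinAt (𝓘(ℝ, ℝ).prod (𝓡 n)) 𝓘(ℝ, W) ∞ u (S ×ˢ univ) (t₀, x₀))
    {Y : Π p : ℝ × M, TangentSpace (𝓡 n) p.2}
    (hY : ContMDiffWithinAt (𝓘(ℝ, ℝ).prod (𝓡 n)) ((𝓡 n).prod 𝓘(ℝ, Model n)) ∞
      (fun p => TotalSpace.mk' (Model n) (E := fun x : M => TangentSpace (𝓡 n) x) p.2 (Y p))
      (S ×ˢ univ) (t₀, x₀)) :
    ContMDiffWithinAt (𝓘(ℝ, ℝ).prod (𝓡 n)) 𝓘(ℝ, W) ∞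
      (fun p => (mfderiv (𝓡 n) 𝓘(ℝ, W) (fun y => u (p.1, y)) p.2 (Y p) : W))
      (S ×ˢ univ) (t₀, x₀) := by
  have hmem : (t₀, x₀) ∈ S ×ˢ (univ : Set M) := ⟨ht, trivial⟩
  have hc := (contDiffWithinAt_chart hu).fderivWithin_right (m := ∞) (uniqueDiffOn_prod_univ hS)
    (by simp) ⟨ht, trivial⟩
  rw [← contMDiffWithinAt_prod_iff] at hc
  have h3 : ContMDiffWithinAt (𝓘(ℝ, ℝ).prod (𝓡 n)) (𝓘(ℝ, ℝ).prod 𝓘(ℝ, Model n)) ∞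
      (fun q : ℝ × M => (q.1, extChartAt (𝓡 n) x₀ q.2)) (S ×ˢ univ) (t₀, x₀) :=
    (contMDiffAt_fst.prodMk ((contMDiffAt_extChartAt (I := 𝓡 n) (n := ∞)).comp (t₀, x₀)
      contMDiffAt_snd)).contMDiffWithinAt
  have h4 := ContMDiffWithinAt.comp (t := S ×ˢ univ) (t₀, x₀)
    (f := fun q : ℝ × M => (q.1, extChartAt (𝓡 n) x₀ q.2)) hc h3
    (fun q hq => mk_mem_prod hq.1 (mem_univ _))
  have hY2 := ((contMDiffWithinAt_totalSpace_iff_crd (n := n) hmem).1 hY).2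
  have h5 := ((ContinuousLinearMap.contMDiff (n := ∞) (ContinuousLinearMap.inr ℝ ℝ (Model n)))
    _).comp_contMDiffWithinAt _ hY2
  refine (h4.clm_apply h5).congr_of_eventuallyEq_of_mem ?_ hmem
  filter_upwards [eventually_mfderiv_eq ht hu] with p hp
  rw [hp]; rfl

theorem derivWithin_eq_fderivWithin_chart (ht : t₀ ∈ S)
    (hu : ContMDiffWithinAt (𝓘(ℝ, ℝ).prod (𝓡 n)) 𝓘(ℝ, W) ∞ u (S ×ˢ univ) (t₀, x₀)) :
    ∀ᶠ z in 𝓝 (extChartAt (𝓡 n) x₀ x₀), HasDerivWithinAt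
      (fun t => u (t, (extChartAt (𝓡 n) x₀).symm z))
      (fderivWithin ℝ (fun q : ℝ × Model n => u (q.1, (extChartAt (𝓡 n) x₀).symm q.2))
        (S ×ˢ univ) (t₀, z) (1, 0)) S t₀ := by
  have hc := contDiffWithinAt_chart hu
  have h1 := (hc.of_le (m := 1) (by simp)).eventually (by simp)
  rw [insert_eq_of_mem (show (t₀, _) ∈ S ×ˢ univ from ⟨ht, trivial⟩)] at h1
  have hcont : Filter.Tendsto (fun z : Model n => (t₀, z))
      (𝓝 (extChartAt (𝓡 n) x₀ x₀)) (𝓝[S ×ˢ univ] (t₀, extChartAt (𝓡 n) x₀ x₀)) := by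
    refine tendsto_nhdsWithin_iff.2 ⟨?_, Filter.Eventually.of_forall fun z => ⟨ht, trivial⟩⟩
    exact (continuous_const.prodMk continuous_id).tendsto _
  filter_upwards [hcont.eventually h1] with z hz
  have hd := (hz.differentiableWithinAt (by simp)).hasFDerivWithinAt
  have hi : HasDerivWithinAt (fun t : ℝ => (t, z)) (1, 0) S t₀ :=
    ((hasDerivAt_id t₀).prodMk (hasDerivAt_const t₀ z)).hasDerivWithinAt
  exact hd.comp_hasDerivWithinAt t₀ hi (fun t ht' => mk_mem_prod ht' (mem_univ _))

/-- A jointly smooth function is differentiable in time. -/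
theorem differentiableWithinAt_time (ht : t₀ ∈ S)
    (hu : ContMDiffWithinAt (𝓘(ℝ, ℝ).prod (𝓡 n)) 𝓘(ℝ, W) ∞ u (S ×ˢ univ) (t₀, x₀)) :
    DifferentiableWithinAt ℝ (fun t => u (t, x₀)) S t₀ := by
  have := (derivWithin_eq_fderivWithin_chart ht hu).self_of_nhds
  rw [extChartAt_to_inv] at this
  exact this.differentiableWithinAt

theorem contDiffWithinAt_derivWithin_chart (ht : t₀ ∈ S) (hS : UniqueDiffOn ℝ S)
    (hu : ContMDiffWithinAt (𝓘(ℝ, ℝ).prod (𝓡 n)) 𝓘(ℝ, W) ∞ u (S ×ˢ univ) (t₀, x₀)) :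
    ContDiffAt ℝ ∞ (fun z => derivWithin (fun t => u (t, (extChartAt (𝓡 n) x₀).symm z)) S t₀)
      (extChartAt (𝓡 n) x₀ x₀) := by
  have hc := (contDiffWithinAt_chart hu).fderivWithin_right (m := ∞) (uniqueDiffOn_prod_univ hS)
    (by simp) ⟨ht, trivial⟩
  have h3 : ContDiffWithinAt ℝ ∞ (fun z : Model n => (t₀, z)) univ (extChartAt (𝓡 n) x₀ x₀) :=
    (contDiff_const.prodMk contDiff_id).contDiffWithinAt
  have h4 := ContDiffWithinAt.comp (t := S ×ˢ univ) _ hc h3 (fun q _ => mk_mem_prod ht (mem_univ _))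
  rw [contDiffWithinAt_univ] at h4
  refine (h4.clm_apply (contDiffAt_const (c := ((1 : ℝ), (0 : Model n))))).congr_of_eventuallyEq ?_
  filter_upwards [derivWithin_eq_fderivWithin_chart ht hu] with z hz
  rw [hz.derivWithin (hS t₀ ht)]; rfl

/-- The time derivative of a jointly smooth function is smooth. -/
theorem contMDiffAt_derivWithin (ht : t₀ ∈ S) (hS : UniqueDiffOn ℝ S)
    (hu : ContMDiffWithinAt (𝓘(ℝ, ℝ).prod (𝓡 n)) 𝓘(ℝ, W) ∞ u (S ×ˢ univ) (t₀, x₀)) :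
    ContMDiffAt (𝓡 n) 𝓘(ℝ, W) ∞ (fun y => derivWithin (fun t => u (t, y)) S t₀) x₀ := by
  have h := (contDiffWithinAt_derivWithin_chart ht hS hu).contMDiffAt.comp x₀
    (contMDiffAt_extChartAt (I := 𝓡 n) (n := ∞))
  refine h.congr_of_eventuallyEq ?_
  filter_upwards [extChartAt_source_mem_nhds (I := 𝓡 n) x₀] with y hy
  simp only [Function.comp, (extChartAt (𝓡 n) x₀).left_inv hy]

set_option maxHeartbeats 1000000 in
/-- Time and space derivatives commute. -/
theorem hasDerivWithinAt_mfderiv (ht : t₀ ∈ S) (hS : UniqueDiffOn ℝ S)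
    (hcl : t₀ ∈ closure (interior S))
    (hu : ContMDiffWithinAt (𝓘(ℝ, ℝ).prod (𝓡 n)) 𝓘(ℝ, W) ∞ u (S ×ˢ univ) (t₀, x₀))
    (v : TangentSpace (𝓡 n) x₀) :
    HasDerivWithinAt (fun t => (mfderiv (𝓡 n) 𝓘(ℝ, W) (fun y => u (t, y)) x₀ v : W))
      (mfderiv (𝓡 n) 𝓘(ℝ, W) (fun y => derivWithin (fun t => u (t, y)) S t₀) x₀ v) S t₀ := by
  set z₀ := extChartAt (𝓡 n) x₀ x₀
  set ũ : ℝ × Model n → W := fun q => u (q.1, (extChartAt (𝓡 n) x₀).symm q.2)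
  have hmem : (t₀, z₀) ∈ S ×ˢ (univ : Set (Model n)) := ⟨ht, trivial⟩
  have hU := uniqueDiffOn_prod_univ (E := Model n) hS
  have hc : ContDiffWithinAt ℝ ∞ ũ (S ×ˢ univ) (t₀, z₀) := contDiffWithinAt_chart hu
  have hc' := hc.fderivWithin_right (m := ∞) hU (by simp) hmem
  have hd := (hc'.differentiableWithinAt (by simp)).hasFDerivWithinAt
  set D2 := fderivWithin ℝ (fderivWithin ℝ ũ (S ×ˢ univ)) (S ×ˢ univ) (t₀, z₀)
  set w := crd (Model n) x₀ v
  -- Symmetry of the second derivative within S × ℝⁿ needs the base point in the closure of the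
  -- interior. This is what `hcl` provides, so t₀ may be an endpoint of S.
  have hsym : D2 (1, 0) (0, w) = D2 (0, w) (1, 0) := by
    have : IsSymmSndFDerivWithinAt ℝ ũ (S ×ˢ univ) (t₀, z₀) := by
      refine hc.isSymmSndFDerivWithinAt (by simpa using WithTop.coe_le_coe.2 (le_top : (2 : ℕ∞) ≤ ⊤)) hU ?_ hmem
      rw [interior_prod_eq, closure_prod_eq]
      exact ⟨hcl, by simp⟩
    exact this _ _
  have hsrc : x₀ ∈ (extChartAt (𝓡 n) x₀).source := mem_extChartAt_source x₀
  have hR : mfderiv (𝓡 n) 𝓘(ℝ, W) (fun y => derivWithin (fun t => u (t, y)) S t₀) x₀ v =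
      D2 (0, w) (1, 0) := by
    rw [mfderiv_eq_fderiv_chart hsrc ((contMDiffAt_derivWithin ht hS hu).mdifferentiableAt (by simp))]
    have hi : HasFDerivAt (fun z : Model n => (t₀, z)) (ContinuousLinearMap.inr ℝ ℝ (Model n))
      z₀ := hasFDerivAt_prodMk_right _ _
    have h6 := HasFDerivWithinAt.comp (t := S ×ˢ univ) _ hd
      (hi.hasFDerivWithinAt (s := univ)) (fun y _ => mk_mem_prod ht (mem_univ _))
    rw [hasFDerivWithinAt_univ] at h6
    have h7 := h6.clm_apply (hasFDerivAt_const ((1 : ℝ), (0 : Model n)) z₀)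
    have h8 : (fun y => derivWithin (fun t => u (t, y)) S t₀) ∘ (extChartAt (𝓡 n) x₀).symm =ᶠ[𝓝 z₀]
        fun z => (fderivWithin ℝ ũ (S ×ˢ univ) ∘ fun z => (t₀, z)) z (1, 0) := by
      filter_upwards [derivWithin_eq_fderivWithin_chart ht hu] with z hz
      exact hz.derivWithin (hS t₀ ht)
    rw [h8.fderiv_eq, h7.fderiv]
    simp [w]; rfl
  rw [hR, ← hsym]
  have hi : HasDerivWithinAt (fun t : ℝ => (t, z₀)) (1, 0) S t₀ :=
    ((hasDerivAt_id t₀).prodMk (hasDerivAt_const t₀ z₀)).hasDerivWithinAt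
  have h9 := (hd.comp_hasDerivWithinAt t₀ hi (fun t ht' => mk_mem_prod ht' (mem_univ _))).clm_apply
    (hasDerivWithinAt_const t₀ S ((0 : ℝ), w))
  simp only [map_zero, add_zero] at h9
  refine h9.congr_of_eventuallyEq_of_mem ?_ ht
  have hcont : Filter.Tendsto (fun t : ℝ => (t, x₀)) (𝓝[S] t₀) (𝓝[S ×ˢ univ] (t₀, x₀)) := by
    refine tendsto_nhdsWithin_iff.2 ⟨?_, ?_⟩
    · exact ((continuous_id.prodMk continuous_const).tendsto t₀).mono_left nhdsWithin_le_nhds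
    · filter_upwards [self_mem_nhdsWithin] with t ht' using ⟨ht', trivial⟩
  filter_upwards [hcont.eventually (eventually_mfderiv_eq ht hu)] with t ht'
  exact ht' v

end Time

/-! ### Directional derivatives and Lie brackets -/

section Calculus

variable {n : ℕ} {M : Type*} [TopologicalSpace M] [T2Space M] [ChartedSpace (Model n) M]
  [IsManifold (𝓡 n) ∞ M]

variable (n M) in
/-- Smooth functions. -/
abbrev IsSmoothFn (f : M → ℝ) : Prop := ContMDiff (𝓡 n) 𝓘(ℝ, ℝ) ∞ f

/-- A smooth vector field with prescribed value at `x`, constant in the chart around `x`. -/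
def tExt (x : M) (v : TangentSpace (𝓡 n) x) : VectorField n M :=
  ext n (Model n) (V := fun x : M => TangentSpace (𝓡 n) x) x v

theorem tExt_smooth (x : M) (v : TangentSpace (𝓡 n) x) : IsSmoothField (tExt x v) :=
  ext_smooth (n := n) (F := Model n) (V := fun x : M => TangentSpace (𝓡 n) x) x v

@[simp] theorem tExt_self (x : M) (v : TangentSpace (𝓡 n) x) : tExt x v x = v :=
  ext_self (n := n) (F := Model n) (V := fun x : M => TangentSpace (𝓡 n) x) x v

theorem tExt_add (x : M) (v w : TangentSpace (𝓡 n) x) : tExt x (v + w) = tExt x v + tExt x w :=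
  ext_add (n := n) (F := Model n) (V := fun x : M => TangentSpace (𝓡 n) x) x v w

theorem tExt_smul (x : M) (r : ℝ) (v : TangentSpace (𝓡 n) x) : tExt x (r • v) = r • tExt x v :=
  ext_smul (n := n) (F := Model n) (V := fun x : M => TangentSpace (𝓡 n) x) x r v

theorem crd_tExt (x : M) (v : TangentSpace (𝓡 n) x) :
    ∀ᶠ y in 𝓝 x, crd (Model n) x (tExt x v y) = crd (Model n) x v := by
  filter_upwards [crd_frame (n := n) (F := Model n) (V := fun x : M => TangentSpace (𝓡 n) x) x]
    with y hy
  exact hy _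

variable {X Y Z X' Y' : VectorField n M} {f h : M → ℝ} {x : M}

namespace IsSmoothField

theorem mdiff (hX : IsSmoothField X) (x : M) :
    MDifferentiableAt (𝓡 n) (𝓡 n).tangent (fun y => (X y : TangentBundle (𝓡 n) M)) x :=
  (hX x).mdifferentiableAt (by simp)

theorem add (hX : IsSmoothField X) (hY : IsSmoothField Y) : IsSmoothField (X + Y) :=
  isSmoothSection_add (n := n) (V := fun x : M => TangentSpace (𝓡 n) x) hX hY

theorem smul (hf : IsSmoothFn n M f) (hX : IsSmoothField X) : IsSmoothField (f • X) :=
  isSmoothSection_smul (n := n) (V := fun x : M => TangentSpace (𝓡 n) x) hf hX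

theorem const_smul (r : ℝ) (hX : IsSmoothField X) : IsSmoothField (r • X) :=
  isSmoothSection_const_smul (n := n) (V := fun x : M => TangentSpace (𝓡 n) x) r hX

theorem lieBr (hX : IsSmoothField X) (hY : IsSmoothField Y) :
    IsSmoothField (GenRicci.lieBr X Y) := by
  have : IsManifold (𝓡 n) ((⊤ : ℕ∞) + 1) M := by
    simpa using (inferInstance : IsManifold (𝓡 n) ∞ M)
  have : IsManifold (𝓡 n) (minSmoothness ℝ 2) M :=
    IsManifold.of_le (n := ∞) (by simpa using WithTop.coe_le_coe.2 (le_top : (2 : ℕ∞) ≤ ⊤))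
  exact ContDiff.mlieBracket_vectorField (m := ⊤) (n := ⊤) hX hY (by simp)

end IsSmoothField

theorem IsSmoothFn.mdiff (hf : IsSmoothFn n M f) (x : M) :
    MDifferentiableAt (𝓡 n) 𝓘(ℝ, ℝ) f x := (hf x).mdifferentiableAt (by simp)

theorem dirDeriv_apply (X : VectorField n M) (f : M → ℝ) (x : M) :
    dirDeriv X f x = mvfderiv (𝓡 n) f x (X x) := rfl

theorem IsSmoothFn.dirDeriv (hX : IsSmoothField X) (hf : IsSmoothFn n M f) :
    IsSmoothFn n M (dirDeriv X f) := by
  intro x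
  have h1 := contMDiffWithinAt_mfderiv (n := n) (M := M) (W := ℝ) (S := univ) (t₀ := 0) (x₀ := x)
    (u := fun p => f p.2) (mem_univ _) uniqueDiffOn_univ
    ((hf x).comp (0, x) contMDiffAt_snd).contMDiffWithinAt (Y := fun p => X p.2)
    ((hX x).comp (0, x) contMDiffAt_snd).contMDiffWithinAt
  have h1 := h1.contMDiffAt (by simp)
  have h2 : ContMDiffAt (𝓡 n) (𝓘(ℝ, ℝ).prod (𝓡 n)) ∞ (fun y : M => ((0 : ℝ), y)) x :=
    contMDiffAt_const.prodMk contMDiffAt_id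
  exact ContMDiffAt.comp x h1 h2

theorem dirDeriv_add (hf : IsSmoothFn n M f) (hh : IsSmoothFn n M h) :
    dirDeriv X (fun y => f y + h y) x = dirDeriv X f x + dirDeriv X h x := by
  have := mvfderiv_add (hf.mdiff x) (hh.mdiff x)
  exact congrArg (fun L => L (X x)) this

theorem dirDeriv_neg : dirDeriv X (fun y => - f y) x = - dirDeriv X f x := by
  have := mvfderiv_neg (I := 𝓡 n) (g := f) (x := x)
  exact congrArg (fun L => L (X x)) this

theorem dirDeriv_mul (hf : IsSmoothFn n M f) (hh : IsSmoothFn n M h) :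
    dirDeriv X (fun y => f y * h y) x = dirDeriv X f x * h x + f x * dirDeriv X h x := by
  have := mvfderiv_mul (hf.mdiff x) (hh.mdiff x)
  have h2 := congrArg (fun L => L (X x)) this
  refine h2.trans ?_
  simp [dirDeriv_apply]
  ring

@[simp] theorem dirDeriv_const (c : ℝ) : dirDeriv X (fun _ => c) x = 0 := by
  have := mvfderiv_const (I := 𝓡 n) c (x := x)
  exact congrArg (fun L => L (X x)) this

theorem dirDeriv_const_mul (c : ℝ) (hf : IsSmoothFn n M f) :
    dirDeriv X (fun y => c * f y) x = c * dirDeriv X f x := by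
  rw [dirDeriv_mul contMDiff_const hf, dirDeriv_const]; ring

theorem dirDeriv_add_field : dirDeriv (X + Y) f x = dirDeriv X f x + dirDeriv Y f x := by
  simp [dirDeriv_apply]

theorem dirDeriv_smul_field : dirDeriv (h • X) f x = h x * dirDeriv X f x := by
  simp [dirDeriv_apply]

theorem dirDeriv_congr (hfh : f =ᶠ[𝓝 x] h) : dirDeriv X f x = dirDeriv X h x := by
  rw [dirDeriv, dirDeriv, hfh.mfderiv_eq]; rfl

theorem lieBr_swap : lieBr X Y x = - lieBr Y X x := VectorField.mlieBracket_swap_apply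

theorem lieBr_add_left (hX : IsSmoothField X) (hX' : IsSmoothField X') :
    lieBr (X + X') Y x = lieBr X Y x + lieBr X' Y x :=
  VectorField.mlieBracket_add_left (hX.mdiff x) (hX'.mdiff x)

theorem lieBr_add_right (hY : IsSmoothField Y) (hY' : IsSmoothField Y') :
    lieBr X (Y + Y') x = lieBr X Y x + lieBr X Y' x :=
  VectorField.mlieBracket_add_right (hY.mdiff x) (hY'.mdiff x)

theorem lieBr_smul_left (hf : IsSmoothFn n M f) (hX : IsSmoothField X) :
    lieBr (f • X) Y x = f x • lieBr X Y x - dirDeriv Y f x • X x := by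
  have := VectorField.mlieBracket_smul_left (W := Y) (hf.mdiff x) (hX.mdiff x)
  refine this.trans ?_
  rw [neg_smul, dirDeriv_apply]; abel

theorem lieBr_smul_right (hf : IsSmoothFn n M f) (hY : IsSmoothField Y) :
    lieBr X (f • Y) x = f x • lieBr X Y x + dirDeriv X f x • Y x := by
  have := VectorField.mlieBracket_smul_right (V := X) (hf.mdiff x) (hY.mdiff x)
  refine this.trans ?_
  rw [dirDeriv_apply]; abel

theorem lieBr_jacobi (hX : IsSmoothField X) (hY : IsSmoothField Y) (hZ : IsSmoothField Z) :
    lieBr X (lieBr Y Z) x = lieBr (lieBr X Y) Z x + lieBr Y (lieBr X Z) x := by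
  have : IsManifold (𝓡 n) (minSmoothness ℝ 3) M :=
    IsManifold.of_le (n := ∞) (by simpa using WithTop.coe_le_coe.2 (le_top : (3 : ℕ∞) ≤ ⊤))
  have h2 : minSmoothness ℝ 2 ≤ ∞ := by
    simpa using WithTop.coe_le_coe.2 (le_top : (2 : ℕ∞) ≤ ⊤)
  exact VectorField.leibniz_identity_mlieBracket_apply ((hX x).of_le h2) ((hY x).of_le h2)
    ((hZ x).of_le h2)

/-- The Lie bracket is the commutator of derivations. -/
theorem dirDeriv_lieBr (hX : IsSmoothField X) (hY : IsSmoothField Y) (hf : IsSmoothFn n M f) :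
    dirDeriv (lieBr X Y) f x = dirDeriv X (dirDeriv Y f) x - dirDeriv Y (dirDeriv X f) x := by
  -- In dimension zero both sides vanish. Otherwise the identity is the coefficient of Z(x) ≠ 0 in
  -- the Jacobi identity for X, Y and f Z.
  rcases subsingleton_or_nontrivial (TangentSpace (𝓡 n) x) with hs | hs
  · have : ∀ (W : VectorField n M) (h : M → ℝ), dirDeriv W h x = 0 := fun W h => by
      rw [dirDeriv_apply, Subsingleton.elim (W x) 0, map_zero]
    simp only [this, sub_zero]
  obtain ⟨v, hv⟩ := exists_ne (0 : TangentSpace (𝓡 n) x)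
  set Z := tExt x v
  have hZ : IsSmoothField Z := tExt_smooth x v
  have hZx : Z x = v := tExt_self x v
  have e1 : ∀ {W : VectorField n M}, lieBr W (f • Z) = f • lieBr W Z + dirDeriv W f • Z :=
    funext fun y => lieBr_smul_right hf hZ
  have key := lieBr_jacobi (x := x) hX hY (hZ.smul hf)
  rw [e1, e1, e1, lieBr_add_right ((hY.lieBr hZ).smul hf) (hZ.smul (hf.dirDeriv hY)),
    lieBr_add_right ((hX.lieBr hZ).smul hf) (hZ.smul (hf.dirDeriv hX)),
    lieBr_smul_right hf (hY.lieBr hZ), lieBr_smul_right hf (hX.lieBr hZ),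
    lieBr_smul_right (hf.dirDeriv hY) hZ, lieBr_smul_right (hf.dirDeriv hX) hZ,
    lieBr_jacobi hX hY hZ] at key
  simp only [Pi.add_apply, Pi.smul_apply', hZx, smul_add] at key
  have h0 : (dirDeriv (lieBr X Y) f x - (dirDeriv X (dirDeriv Y f) x
      - dirDeriv Y (dirDeriv X f) x)) • v = 0 := by
    rw [← sub_eq_zero] at key
    rw [← neg_eq_zero, ← key]
    module
  exact sub_eq_zero.1 ((smul_eq_zero.1 h0).resolve_right hv)

/-- A global function agreeing near x with a linear function of the coordinates. Its derivative
along any field reads off the corresponding component of that field, at every point near x. -/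
theorem exists_chart_fn (x : M) (ℓ : Model n →L[ℝ] ℝ) : ∃ f : M → ℝ, IsSmoothFn n M f ∧
    (∀ᶠ y in 𝓝 x, ∀ X : VectorField n M, dirDeriv X f y = ℓ (crd (Model n) x (X y))) ∧
    ∀ᶠ y in 𝓝 x, f y = ℓ (extChartAt (𝓡 n) x y) := by
  obtain ⟨ψ⟩ : Nonempty (SmoothBumpFunction (𝓡 n) x) := inferInstance
  refine ⟨fun y => ψ y • ℓ (extChartAt (𝓡 n) x y), ψ.contMDiff_smul ?_, ?_, ?_⟩
  · exact ℓ.contMDiff.comp_contMDiffOn contMDiffOn_extChartAt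
  swap
  · filter_upwards [ψ.eventuallyEq_one] with y hy
    simp [hy]
  filter_upwards [ψ.eventuallyEq_one.eventuallyEq_nhds, extChartAt_source_mem_nhds (I := 𝓡 n) x]
    with y hy hs X
  rw [dirDeriv_congr (h := ℓ ∘ extChartAt (𝓡 n) x), crd_tangent hs]
  · have h1 : MDifferentiableAt 𝓘(ℝ, Model n) 𝓘(ℝ, ℝ) ℓ (extChartAt (𝓡 n) x y) :=
      ℓ.mdifferentiableAt
    have := mfderiv_comp y h1 (mdifferentiableAt_extChartAt (by rwa [extChartAt_source] at hs))
    rw [ContinuousLinearMap.mfderiv_eq] at this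
    exact congrArg (fun L => (L (X y) : ℝ)) this
  · filter_upwards [hy] with z hz
    simp [hz]

/-- In coordinates, the bracket with a constant field is minus the derivative. -/
theorem crd_lieBr_tExt (hX : IsSmoothField X) (v : TangentSpace (𝓡 n) x) :
    crd (Model n) x (lieBr X (tExt x v) x) =
      - (mfderiv (𝓡 n) 𝓘(ℝ, Model n) (fun y => crd (Model n) x (X y)) x v : Model n) := by
  have hcX : ContMDiffAt (𝓡 n) 𝓘(ℝ, Model n) ∞ (fun y => crd (Model n) x (X y)) x := by
    have := ((contMDiffWithinAt_totalSpace_iff_crd (n := n) (F := Model n)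
      (V := fun x : M => TangentSpace (𝓡 n) x) (f := id) (v := X) (mem_univ x)).1
        ((hX x).contMDiffWithinAt (s := univ))).2
    exact this.contMDiffAt (by simp)
  -- Test against linear functionals: for the coordinate function f of ℓ, the derivative of f along
  -- the constant field is locally constant, so only -v(X f) survives in [X, v] f.
  have key : ∀ ℓ : Model n →L[ℝ] ℝ, ℓ (crd (Model n) x (lieBr X (tExt x v) x)) =
      - ℓ (mfderiv (𝓡 n) 𝓘(ℝ, Model n) (fun y => crd (Model n) x (X y)) x v : Model n) := by
    intro ℓ
    obtain ⟨f, hf, hfd, -⟩ := exists_chart_fn x ℓ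
    rw [← hfd.self_of_nhds, dirDeriv_lieBr hX (tExt_smooth x v) hf,
      dirDeriv_congr (h := fun _ => ℓ (crd (Model n) x v)), dirDeriv_const, zero_sub,
      dirDeriv_congr (h := fun y => ℓ (crd (Model n) x (X y)))]
    · have h1 : MDifferentiableAt 𝓘(ℝ, Model n) 𝓘(ℝ, ℝ) ℓ (crd (Model n) x (X x)) :=
        ℓ.mdifferentiableAt
      have := mfderiv_comp x h1 (hcX.mdifferentiableAt (by simp))
      rw [ContinuousLinearMap.mfderiv_eq] at this
      have h2 := congrArg (fun L => (L v : ℝ)) this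
      rw [dirDeriv, tExt_self]
      exact congrArg Neg.neg h2
    · filter_upwards [hfd] with y hy using hy X
    · filter_upwards [hfd, crd_tExt x v] with y hy hy2
      rw [hy, hy2]
  ext i
  have := key (EuclideanSpace.proj i)
  exact this

/-- Fields constant in one chart commute. Evaluating tensorial identities on such fields at x
therefore removes all bracket terms. -/
theorem lieBr_tExt_tExt (x : M) (u v : TangentSpace (𝓡 n) x) :
    lieBr (tExt x u) (tExt x v) x = 0 := by
  have h := crd_lieBr_tExt (tExt_smooth x u) v
  have hc : (fun y => crd (Model n) x (tExt x u y)) =ᶠ[𝓝 x] fun _ => crd (Model n) x u :=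
    crd_tExt x u
  rw [hc.mfderiv_eq, mfderiv_const] at h
  have h2 := (frame_crd (n := n) (F := Model n) (V := fun x : M => TangentSpace (𝓡 n) x) x).self_of_nhds
    (lieBr (tExt x u) (tExt x v) x)
  rw [h] at h2
  rw [← h2]
  have h0 : frame n (Model n) (V := fun x : M => TangentSpace (𝓡 n) x) x 0 x = 0 := by simp [frame]
  rw [← h0]
  congr 1
  exact neg_zero

end Calculus

/-! ### Multilinear maps on finite-dimensional spaces -/

section Multilinear

variable {k : ℕ} {ι : Type*} [Fintype ι] [DecidableEq ι] {E : Type*} [AddCommGroup E] [Module ℝ E]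

theorem multilinear_expand (b : Module.Basis ι ℝ E) (f : MultilinearMap ℝ (fun _ : Fin k => E) ℝ)
    (v : Fin k → E) :
    f v = ∑ r : Fin k → ι, (∏ i, b.repr (v i) (r i)) * f (fun i => b (r i)) := by
  conv_lhs => rw [show v = fun i => ∑ j, b.repr (v i) j • b j from
    funext fun i => (b.sum_repr (v i)).symm]
  rw [f.map_sum]
  simp only [f.map_smul_univ, smul_eq_mul]

theorem continuous_multilinear [TopologicalSpace E] [IsTopologicalAddGroup E] [ContinuousSMul ℝ E]
    [T2Space E] [FiniteDimensional ℝ E] (f : MultilinearMap ℝ (fun _ : Fin k => E) ℝ) :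
    Continuous f := by
  let b := Module.finBasis ℝ E
  have : (f : (Fin k → E) → ℝ) = fun v => _ := funext (multilinear_expand b f)
  rw [this]
  refine continuous_finsetSum _ fun r _ => (continuous_finsetProd _ fun i _ => ?_).mul
    continuous_const
  exact ((b.coord (r i)).continuous_of_finiteDimensional).comp (continuous_apply i)

/-- An alternating multilinear map on a finite-dimensional space, as a continuous one. -/
def mkForm [TopologicalSpace E] [IsTopologicalAddGroup E] [ContinuousSMul ℝ E]
    [T2Space E] [FiniteDimensional ℝ E] (f : MultilinearMap ℝ (fun _ : Fin k => E) ℝ)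
    (hf : ∀ (v : Fin k → E) (i j : Fin k), v i = v j → i ≠ j → f v = 0) : E [⋀^Fin k]→L[ℝ] ℝ where
  toMultilinearMap := f
  cont := continuous_multilinear f
  map_eq_zero_of_eq' := hf

/-- The product rule after expansion in a basis. Derivatives of the arguments are taken in
coordinates, so E needs no norm. -/
theorem hasDerivWithinAt_multilinear (b : Module.Basis ι ℝ E)
    {f : ℝ → MultilinearMap ℝ (fun _ : Fin k => E) ℝ} {f' : MultilinearMap ℝ (fun _ : Fin k => E) ℝ}
    {v : ℝ → Fin k → E} {v' : Fin k → E} {S : Set ℝ} {t : ℝ}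
    (hf : ∀ w, HasDerivWithinAt (fun s => f s w) (f' w) S t)
    (hv : ∀ i j, HasDerivWithinAt (fun s => b.repr (v s i) j) (b.repr (v' i) j) S t) :
    HasDerivWithinAt (fun s => f s (v s))
      (f' (v t) + ∑ i, f t (Function.update (v t) i (v' i))) S t := by
  have h1 : ∀ r : Fin k → ι, HasDerivWithinAt
      (fun s => (∏ i, b.repr (v s i) (r i)) * f s (fun i => b (r i)))
      ((∑ i, (∏ j ∈ Finset.univ.erase i, b.repr (v t j) (r j)) * b.repr (v' i) (r i)) *
        f t (fun i => b (r i)) + (∏ i, b.repr (v t i) (r i)) * f' (fun i => b (r i))) S t := by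
    intro r
    refine HasDerivWithinAt.mul ?_ (hf _)
    have := HasDerivWithinAt.fun_finsetProd (u := Finset.univ)
      (f := fun i s => b.repr (v s i) (r i)) (fun i _ => hv i (r i))
    simpa [smul_eq_mul] using this
  have h2 := HasDerivWithinAt.fun_sum (u := Finset.univ) fun r _ => h1 r
  have h3 : (fun s => f s (v s)) = fun s => ∑ r : Fin k → ι, (∏ i, b.repr (v s i) (r i)) *
      f s (fun i => b (r i)) := funext fun s => multilinear_expand b (f s) (v s)
  rw [h3]
  refine h2.congr_deriv ?_
  symm
  rw [Finset.sum_add_distrib, add_comm, multilinear_expand b f']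
  congr 1
  simp only [Finset.sum_mul]
  rw [Finset.sum_comm]
  refine Finset.sum_congr rfl fun i _ => ?_
  rw [multilinear_expand b (f t)]
  refine Finset.sum_congr rfl fun r _ => ?_
  congr 1
  rw [← Finset.mul_prod_erase _ _ (Finset.mem_univ i), Function.update_self, mul_comm]
  congr 1
  refine Finset.prod_congr rfl fun j hj => ?_
  rw [Function.update_of_ne (Finset.ne_of_mem_erase hj)]

/-- Evaluation on tuples of basis vectors is an injective linear map into a finite-dimensional
space. A linear left inverse is continuous there and carries differentiability of the values back to
the form. -/
theorem differentiableAt_alternating_of_apply {E' G : Type*} [NormedAddCommGroup E']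
    [NormedSpace ℝ E'] [FiniteDimensional ℝ E'] [NormedAddCommGroup G] [NormedSpace ℝ G]
    {θ : G → E' [⋀^Fin k]→L[ℝ] ℝ} {x : G}
    (h : ∀ v, DifferentiableAt ℝ (fun y => θ y v) x) : DifferentiableAt ℝ θ x := by
  let b := Module.finBasis ℝ E'
  let ev : (E' [⋀^Fin k]→L[ℝ] ℝ) →ₗ[ℝ] ((Fin k → Fin (Module.finrank ℝ E')) → ℝ) :=
    { toFun := fun α r => α fun i => b (r i)
      map_add' := fun _ _ => rfl
      map_smul' := fun _ _ => rfl }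
  have hev : Function.Injective ev := by
    intro α β hα
    ext v
    have h1 := multilinear_expand b α.toMultilinearMap v
    have h2 := multilinear_expand b β.toMultilinearMap v
    refine h1.trans (Eq.trans ?_ h2.symm)
    refine Finset.sum_congr rfl fun r _ => ?_
    congr 1
    exact congrFun hα r
  obtain ⟨g, hg⟩ := ev.exists_leftInverse_of_injective (LinearMap.ker_eq_bot.2 hev)
  have hθ : θ = fun y => LinearMap.toContinuousLinearMap g (ev (θ y)) := by
    funext y
    exact (LinearMap.congr_fun hg (θ y)).symm
  rw [hθ]
  refine (LinearMap.toContinuousLinearMap g).differentiableAt.comp x ?_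
  exact differentiableAt_pi.2 fun r => h _

end Multilinear

/-! ### Tensorial operations in several vector fields -/

section MultiTensorial

variable {n : ℕ} {M : Type*} [TopologicalSpace M] [T2Space M] [ChartedSpace (Model n) M]
  [IsManifold (𝓡 n) ∞ M] {k : ℕ}

/-- Operations on smooth vector fields which are `C^∞(M)`-linear at `x`. -/
abbrev IsTensorial {A : Type*} [AddCommGroup A] [Module ℝ A] (Λ : VectorField n M → A) (x : M) :
    Prop :=
  IsTensorialAt (n := n) (Model n) (V := fun x : M => TangentSpace (𝓡 n) x) Λ x

/-- Operations on smooth vector fields which are `C^∞(M)`-multilinear at `x`. -/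
def IsMultiTensorial (Λ : (Fin k → VectorField n M) → ℝ) (x : M) : Prop :=
  ∀ Y : Fin k → VectorField n M, (∀ i, IsSmoothField (Y i)) → ∀ i,
    IsTensorial (fun a => Λ (Function.update Y i a)) x

theorem smooth_update {Y : Fin k → VectorField n M} (hY : ∀ i, IsSmoothField (Y i)) (i : Fin k)
    {a : VectorField n M} (ha : IsSmoothField a) (j : Fin k) :
    IsSmoothField (Function.update Y i a j) := by
  rcases eq_or_ne j i with rfl | h
  · rwa [Function.update_self]
  · rw [Function.update_of_ne h]; exact hY j

namespace IsMultiTensorial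

variable {Λ : (Fin k → VectorField n M) → ℝ} {x : M}

/-- The arguments are exchanged one at a time, by induction on the set of slots already changed. -/
theorem congr (h : IsMultiTensorial Λ x) {Y Z : Fin k → VectorField n M}
    (hY : ∀ i, IsSmoothField (Y i)) (hZ : ∀ i, IsSmoothField (Z i)) (hYZ : ∀ i, Y i x = Z i x) :
    Λ Y = Λ Z := by
  have key : ∀ s : Finset (Fin k), Λ (fun i => if i ∈ s then Z i else Y i) = Λ Y := by
    intro s
    induction s using Finset.induction_on with
    | empty => simp
    | insert j s hj ih =>
      rw [← ih]
      have hs : ∀ i, IsSmoothField ((fun i => if i ∈ s then Z i else Y i) i) := fun i => by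
        dsimp only; split_ifs
        exacts [hZ i, hY i]
      have h1 := (h _ hs j).congr (hZ j) (hY j) (hYZ j).symm
      have e1 : Function.update (fun i => if i ∈ s then Z i else Y i) j (Z j) =
          fun i => if i ∈ insert j s then Z i else Y i := by
        ext1 i
        rcases eq_or_ne i j with rfl | hi
        · simp
        · simp [hi]
      have e2 : Function.update (fun i => if i ∈ s then Z i else Y i) j (Y j) =
          fun i => if i ∈ s then Z i else Y i := by
        ext1 i
        rcases eq_or_ne i j with rfl | hi
        · simp [hj]
        · simp [hi]
      rwa [e1, e2] at h1
  have := key Finset.univ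
  simpa using this.symm

/-- The multilinear map determined by a tensorial operation. -/
def toMultilinear (h : IsMultiTensorial Λ x) :
    MultilinearMap ℝ (fun _ : Fin k => TangentSpace (𝓡 n) x) ℝ where
  toFun v := Λ fun i => tExt x (v i)
  map_update_add' v i a b := by
    have e : ∀ c : TangentSpace (𝓡 n) x, (fun j => tExt x (Function.update v i c j)) =
        Function.update (fun j => tExt x (v j)) i (tExt x c) := fun c => by
      ext1 j
      rcases eq_or_ne j i with rfl | hj
      · rw [Function.update_self, Function.update_self]
      · rw [Function.update_of_ne hj, Function.update_of_ne hj]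
    -- The fields of `MultilinearMap` quantify over an arbitrary decidability instance, while
    -- `IsMultiTensorial` uses the standard one.
    have hd : ‹DecidableEq (Fin k)› = instDecidableEqFin k := Subsingleton.elim _ _
    subst hd
    rw [e, e, e, tExt_add]
    exact (h _ (fun j => tExt_smooth x (v j)) i).add _ _ (tExt_smooth x a) (tExt_smooth x b)
  map_update_smul' v i r a := by
    have e : ∀ c : TangentSpace (𝓡 n) x, (fun j => tExt x (Function.update v i c j)) =
        Function.update (fun j => tExt x (v j)) i (tExt x c) := fun c => by
      ext1 j
      rcases eq_or_ne j i with rfl | hj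
      · rw [Function.update_self, Function.update_self]
      · rw [Function.update_of_ne hj, Function.update_of_ne hj]
    have hd : ‹DecidableEq (Fin k)› = instDecidableEqFin k := Subsingleton.elim _ _
    subst hd
    rw [e, e, tExt_smul]
    exact (h _ (fun j => tExt_smooth x (v j)) i).smul (fun _ => r) _ contMDiff_const
      (tExt_smooth x a)

theorem toMultilinear_apply (h : IsMultiTensorial Λ x) {Y : Fin k → VectorField n M}
    (hY : ∀ i, IsSmoothField (Y i)) : h.toMultilinear (fun i => Y i x) = Λ Y :=
  h.congr (fun _ => tExt_smooth x _) hY (fun _ => tExt_self x _)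

/-- The form determined by an alternating tensorial operation. -/
def toForm (h : IsMultiTensorial Λ x)
    (halt : ∀ Y : Fin k → VectorField n M, (∀ i, IsSmoothField (Y i)) →
      ∀ i j, Y i = Y j → i ≠ j → Λ Y = 0) : TangentSpace (𝓡 n) x [⋀^Fin k]→L[ℝ] ℝ :=
  mkForm h.toMultilinear fun _ i j hij hne => halt _ (fun _ => tExt_smooth x _) i j
    (congrArg (tExt x) hij) hne

theorem toForm_apply (h : IsMultiTensorial Λ x)
    (halt : ∀ Y : Fin k → VectorField n M, (∀ i, IsSmoothField (Y i)) →
      ∀ i j, Y i = Y j → i ≠ j → Λ Y = 0) {Y : Fin k → VectorField n M}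
    (hY : ∀ i, IsSmoothField (Y i)) : h.toForm halt (fun i => Y i x) = Λ Y :=
  h.toMultilinear_apply hY

end IsMultiTensorial

/-- A form is determined by its values on smooth vector fields. -/
theorem form_ext {x : M} {α β : TangentSpace (𝓡 n) x [⋀^Fin k]→L[ℝ] ℝ}
    (h : ∀ Y : Fin k → VectorField n M, (∀ i, IsSmoothField (Y i)) →
      α (fun i => Y i x) = β (fun i => Y i x)) : α = β := by
  ext v
  have := h (fun i => tExt x (v i)) fun i => tExt_smooth x _
  simpa using this

/-! ### The exterior derivative on vector fields -/

/-- In the chart at x the extension `tExt x v` is a constant vector near the centre. Pulling a form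
back by the inverse chart and inserting constant vectors is thus the same as inserting these
extensions. -/
theorem symm_chart_tExt {x : M} (v : TangentSpace (𝓡 n) x) :
    ∀ᶠ y in 𝓝 (extChartAt (𝓡 n) x x),
      mfderiv 𝓘(ℝ, Model n) (𝓡 n) (extChartAt (𝓡 n) x).symm y (crd (Model n) x v) =
        tExt x v ((extChartAt (𝓡 n) x).symm y) := by
  have hc : Filter.Tendsto (extChartAt (𝓡 n) x).symm (𝓝 (extChartAt (𝓡 n) x x)) (𝓝 x) := by
    have := continuousAt_extChartAt_symm (I := 𝓡 n) x
    rwa [ContinuousAt, extChartAt_to_inv] at this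
  filter_upwards [hc.eventually (frame_eventually (n := n) (F := Model n)
    (V := fun x : M => TangentSpace (𝓡 n) x) x), extChartAt_target_mem_nhds (I := 𝓡 n) x] with y hy ht
  change _ = frame n (Model n) x _ _
  have hs := (extChartAt (𝓡 n) x).map_target ht
  rw [extChartAt_source] at hs
  rw [hy, TangentBundle.symmL_trivializationAt hs, (extChartAt (𝓡 n) x).right_inv ht]
  simp
  rfl

theorem contMDiffAt_extChartAt_symm_self (x : M) :
    ContMDiffAt 𝓘(ℝ, Model n) (𝓡 n) ∞ (extChartAt (𝓡 n) x).symm (extChartAt (𝓡 n) x x) :=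
  (contMDiffOn_extChartAt_symm (I := 𝓡 n) (n := ∞) x).contMDiffAt
    ((isOpen_extChartAt_target x).mem_nhds (mem_extChartAt_target x))

theorem differentiableAt_comp_chart_symm {h : M → ℝ} (hh : IsSmoothFn n M h) (x : M) :
    DifferentiableAt ℝ (h ∘ (extChartAt (𝓡 n) x).symm) (extChartAt (𝓡 n) x x) := by
  have := (hh _).comp _ (contMDiffAt_extChartAt_symm_self x)
  exact mdifferentiableAt_iff_differentiableAt.1 (this.mdifferentiableAt (by simp))

/-- The exterior derivative on vector fields which are constant in a chart. -/
theorem extD_tExt {θ : DiffForm n M k} (hθ : IsSmoothForm θ) (x : M)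
    (v : Fin (k + 1) → TangentSpace (𝓡 n) x) :
    extD θ x v = ∑ i : Fin (k + 1), (-1 : ℝ) ^ (i : ℕ) *
      dirDeriv (tExt x (v i)) (fun y => θ y (fun j => tExt x (v (i.succAbove j)) y)) x := by
  set φ := extChartAt (𝓡 n) x
  set θ' : Model n → Model n [⋀^Fin k]→L[ℝ] ℝ := fun y =>
    (θ (φ.symm y)).compContinuousLinearMap (mfderiv 𝓘(ℝ, Model n) (𝓡 n) φ.symm y)
  have hev : ∀ u : Fin k → TangentSpace (𝓡 n) x,
      (fun y => θ' y (fun j => crd (Model n) x (u j))) =ᶠ[𝓝 (φ x)]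
        (fun y => θ y (fun j => tExt x (u j) y)) ∘ φ.symm := by
    intro u
    have : ∀ j, ∀ᶠ y in 𝓝 (φ x), mfderiv 𝓘(ℝ, Model n) (𝓡 n) φ.symm y (crd (Model n) x (u j)) =
        tExt x (u j) (φ.symm y) := fun j => symm_chart_tExt (u j)
    filter_upwards [Filter.eventually_all.2 this] with y hy
    exact congrArg (θ (φ.symm y)) (funext hy)
  have hsm : ∀ u : Fin k → TangentSpace (𝓡 n) x,
      IsSmoothFn n M (fun y => θ y (fun j => tExt x (u j) y)) :=
    fun u => hθ _ fun j => tExt_smooth x _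
  -- Smoothness of θ is given only through its values on fields. Every constant tuple in ℝⁿ consists
  -- of coordinates of tangent vectors at x, and on these the values are known to be smooth.
  have hd : DifferentiableAt ℝ θ' (φ x) := by
    refine differentiableAt_alternating_of_apply fun m => ?_
    obtain ⟨u, hu⟩ : ∃ u : Fin k → TangentSpace (𝓡 n) x, m = fun j => crd (Model n) x (u j) :=
      ⟨fun j => frame n (Model n) (V := fun x : M => TangentSpace (𝓡 n) x) x (m j) x,
        funext fun j => ((crd_frame (n := n) (F := Model n)
          (V := fun x : M => TangentSpace (𝓡 n) x) x).self_of_nhds (m j)).symm⟩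
    rw [hu]
    exact (differentiableAt_comp_chart_symm (hsm u) x).congr_of_eventuallyEq (hev u)
  have hx : x ∈ φ.source := mem_extChartAt_source x
  have e1 : extD θ x v = extDeriv θ' (φ x) (fun i => crd (Model n) x (v i)) := by
    have : (fun i => crd (Model n) x (v i)) =
        fun i => (mfderiv (𝓡 n) 𝓘(ℝ, Model n) φ x (v i) : Model n) :=
      funext fun i => crd_tangent hx (v i)
    rw [this]
    rfl
  rw [e1, extDeriv_apply hd]
  refine Finset.sum_congr rfl fun i _ => ?_
  refine (zsmul_eq_mul _ _).trans ?_
  push_cast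
  congr 1
  rw [dirDeriv, tExt_self, mfderiv_eq_fderiv_chart hx ((hsm _).mdiff x)]
  rw [← (hev _).fderiv_eq]
  rfl

end MultiTensorial

/-! ### Tensors specified by their values on smooth vector fields -/

section TensorSpecs

variable {n : ℕ} {M : Type*} [TopologicalSpace M] [T2Space M] [ChartedSpace (Model n) M]
  [IsManifold (𝓡 n) ∞ M] {k : ℕ}

variable (n M) in
/-- Covector fields. -/
abbrev CovectorField : Type _ := Π x : M, TangentSpace (𝓡 n) x →L[ℝ] ℝ

/-- Smooth covector fields: evaluations on smooth fields are smooth. -/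
def IsSmoothCovector (ξ : CovectorField n M) : Prop :=
  ∀ Y : VectorField n M, IsSmoothField Y → IsSmoothFn n M (fun x => ξ x (Y x))

/-- Smooth `(0,2)`-tensors: evaluations on smooth fields are smooth. -/
def IsSmoothTensor2 (g : Tensor2 n M) : Prop :=
  ∀ Y Z : VectorField n M, IsSmoothField Y → IsSmoothField Z →
    IsSmoothFn n M (fun x => g x (Y x) (Z x))

variable {X Y Z : VectorField n M} {x : M}

/-! ### Existence of tensors -/

theorem exists_linear {A : Type*} [AddCommGroup A] [Module ℝ A] {Λ : VectorField n M → A}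
    (h : IsTensorial Λ x) : ∃ L : TangentSpace (𝓡 n) x →ₗ[ℝ] A,
      ∀ Y, IsSmoothField Y → L (Y x) = Λ Y :=
  ⟨h.toLinear, fun _ hY => h.toLinear_apply hY⟩

theorem exists_covector {Λ : VectorField n M → ℝ}
    (h : IsTensorial Λ x) : ∃ L : TangentSpace (𝓡 n) x →L[ℝ] ℝ,
      ∀ Y, IsSmoothField Y → L (Y x) = Λ Y :=
  ⟨LinearMap.toContinuousLinearMap h.toLinear, fun _ hY => h.toLinear_apply hY⟩

theorem exists_bilin_linear {A : Type*} [AddCommGroup A] [Module ℝ A]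
    {Λ : VectorField n M → VectorField n M → A}
    (h₁ : ∀ Z, IsSmoothField Z → IsTensorial (fun Y => Λ Y Z) x)
    (h₂ : ∀ Y, IsSmoothField Y → IsTensorial (fun Z => Λ Y Z) x) :
    ∃ B : TangentSpace (𝓡 n) x →ₗ[ℝ] TangentSpace (𝓡 n) x →ₗ[ℝ] A,
      ∀ Y Z, IsSmoothField Y → IsSmoothField Z → B (Y x) (Z x) = Λ Y Z := by
  refine ⟨LinearMap.mk₂ ℝ (fun u v => Λ (tExt x u) (tExt x v)) ?_ ?_ ?_ ?_, ?_⟩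
  · intro u v w
    rw [tExt_add]
    exact (h₁ _ (tExt_smooth x w)).add _ _ (tExt_smooth x u) (tExt_smooth x v)
  · intro r u v
    rw [tExt_smul]
    exact (h₁ _ (tExt_smooth x v)).smul (fun _ => r) _ contMDiff_const (tExt_smooth x u)
  · intro u v w
    rw [tExt_add]
    exact (h₂ _ (tExt_smooth x u)).add _ _ (tExt_smooth x v) (tExt_smooth x w)
  · intro r u v
    rw [tExt_smul]
    exact (h₂ _ (tExt_smooth x u)).smul (fun _ => r) _ contMDiff_const (tExt_smooth x v)
  · intro Y Z hY hZ
    rw [LinearMap.mk₂_apply]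
    exact ((h₁ _ (tExt_smooth x _)).congr (tExt_smooth x _) hY (tExt_self x _)).trans
      ((h₂ _ hY).congr (tExt_smooth x _) hZ (tExt_self x _))

theorem exists_bilin {Λ : VectorField n M → VectorField n M → ℝ}
    (h₁ : ∀ Z, IsSmoothField Z → IsTensorial (fun Y => Λ Y Z) x)
    (h₂ : ∀ Y, IsSmoothField Y → IsTensorial (fun Z => Λ Y Z) x) :
    ∃ B : TangentSpace (𝓡 n) x →L[ℝ] TangentSpace (𝓡 n) x →L[ℝ] ℝ,
      ∀ Y Z, IsSmoothField Y → IsSmoothField Z → B (Y x) (Z x) = Λ Y Z := by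
  obtain ⟨B, hB⟩ := exists_bilin_linear h₁ h₂
  exact ⟨LinearMap.toContinuousBilinearMap B, hB⟩

/-- Tensoriality in the last slot spreads to the others by skew-symmetry, so the value depends only
on the three vectors at x. This reduces identities between 3-forms to commuting fields. -/
theorem congr_of_skew₃ {Λ : VectorField n M → VectorField n M → VectorField n M → ℝ}
    (h : ∀ X Y, IsSmoothField X → IsSmoothField Y → IsTensorial (fun Z => Λ X Y Z) x)
    (h₁₂ : ∀ X Y Z, IsSmoothField X → IsSmoothField Y → IsSmoothField Z → Λ X Y Z = - Λ Y X Z)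
    (h₂₃ : ∀ X Y Z, IsSmoothField X → IsSmoothField Y → IsSmoothField Z → Λ X Y Z = - Λ X Z Y)
    {X Y Z X' Y' Z' : VectorField n M} (hX : IsSmoothField X) (hY : IsSmoothField Y)
    (hZ : IsSmoothField Z) (hX' : IsSmoothField X') (hY' : IsSmoothField Y')
    (hZ' : IsSmoothField Z') (eX : X x = X' x) (eY : Y x = Y' x) (eZ : Z x = Z' x) :
    Λ X Y Z = Λ X' Y' Z' := by
  have e1 := (h X Y hX hY).congr hZ hZ' eZ
  have e2 := (h X Z' hX hZ').congr hY hY' eY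
  have e3 := (h Y' Z' hY' hZ').congr hX hX' eX
  rw [e1, h₂₃ _ _ _ hX hY hZ', e2, ← h₂₃ _ _ _ hX hY' hZ', h₁₂ _ _ _ hX hY' hZ',
    h₂₃ _ _ _ hY' hX hZ', e3, ← h₂₃ _ _ _ hY' hX' hZ', ← h₁₂ _ _ _ hX' hY' hZ']

/-- Only one slot has to be checked for tensoriality: two transpositions generate the permutations
of the arguments. They also force Λ to vanish on repeated arguments. -/
theorem exists_form₃ {Λ : VectorField n M → VectorField n M → VectorField n M → ℝ}
    (h : ∀ X Y, IsSmoothField X → IsSmoothField Y → IsTensorial (fun Z => Λ X Y Z) x)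
    (h₁₂ : ∀ X Y Z, IsSmoothField X → IsSmoothField Y → IsSmoothField Z → Λ X Y Z = - Λ Y X Z)
    (h₂₃ : ∀ X Y Z, IsSmoothField X → IsSmoothField Y → IsSmoothField Z → Λ X Y Z = - Λ X Z Y) :
    ∃ H : TangentSpace (𝓡 n) x [⋀^Fin 3]→L[ℝ] ℝ, ∀ X Y Z, IsSmoothField X → IsSmoothField Y →
      IsSmoothField Z → H ![X x, Y x, Z x] = Λ X Y Z := by
  have hY₂ : ∀ X Z, IsSmoothField X → IsSmoothField Z → IsTensorial (fun Y => Λ X Y Z) x :=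
    fun X Z hX hZ =>
    ⟨fun a b ha hb => by
      rw [h₂₃ _ _ _ hX (IsSmoothField.add ha hb) hZ, (h X Z hX hZ).add a b ha hb, h₂₃ _ _ _ hX ha hZ,
        h₂₃ _ _ _ hX hb hZ]; ring,
     fun f a hf ha => by
      rw [h₂₃ _ _ _ hX (IsSmoothField.smul hf ha) hZ, (h X Z hX hZ).smul f a hf ha, h₂₃ _ _ _ hX ha hZ,
        smul_neg]⟩
  have hX₁ : ∀ Y Z, IsSmoothField Y → IsSmoothField Z → IsTensorial (fun X => Λ X Y Z) x :=
    fun Y Z hY hZ =>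
    ⟨fun a b ha hb => by
      rw [h₁₂ _ _ _ (IsSmoothField.add ha hb) hY hZ, (hY₂ Y Z hY hZ).add a b ha hb, h₁₂ _ _ _ ha hY hZ,
        h₁₂ _ _ _ hb hY hZ]; ring,
     fun f a hf ha => by
      rw [h₁₂ _ _ _ (IsSmoothField.smul hf ha) hY hZ, (hY₂ Y Z hY hZ).smul f a hf ha, h₁₂ _ _ _ ha hY hZ,
        smul_neg]⟩
  have hm : IsMultiTensorial (fun Y : Fin 3 → VectorField n M => Λ (Y 0) (Y 1) (Y 2)) x := by
    intro Y hY i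
    fin_cases i
    · exact hX₁ _ _ (hY 1) (hY 2)
    · exact hY₂ _ _ (hY 0) (hY 2)
    · exact h _ _ (hY 0) (hY 1)
  have z₁₂ : ∀ X Z, IsSmoothField X → IsSmoothField Z → Λ X X Z = 0 := fun X Z hX hZ => by
    linarith [h₁₂ X X Z hX hX hZ]
  have z₂₃ : ∀ X Z, IsSmoothField X → IsSmoothField Z → Λ X Z Z = 0 := fun X Z hX hZ => by
    linarith [h₂₃ X Z Z hX hZ hZ]
  have z₁₃ : ∀ X Z, IsSmoothField X → IsSmoothField Z → Λ X Z X = 0 := fun X Z hX hZ => by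
    rw [h₂₃ X Z X hX hZ hX, z₁₂ X Z hX hZ, neg_zero]
  have halt : ∀ Y : Fin 3 → VectorField n M, (∀ i, IsSmoothField (Y i)) →
      ∀ i j, Y i = Y j → i ≠ j → Λ (Y 0) (Y 1) (Y 2) = 0 := by
    intro Y hY i j hij hne
    fin_cases i <;> fin_cases j <;> simp at hij hne ⊢ <;>
      first
      | rw [hij]; first | exact z₁₂ _ _ (hY _) (hY _) | exact z₂₃ _ _ (hY _) (hY _) |
          exact z₁₃ _ _ (hY _) (hY _)
  refine ⟨hm.toForm halt, fun X Y Z hX hY hZ => ?_⟩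
  · have hs : ∀ i, IsSmoothField (![X, Y, Z] i) := by
      intro i; fin_cases i <;> assumption
    have := hm.toForm_apply halt hs
    · refine Eq.trans ?_ this
      congr 1
      ext1 i; fin_cases i <;> rfl

/-- The expression is function-linear in Y and Z, since the terms with X f coming from the product
rule and from [X, f Y] cancel. Hence a tensor with these values exists and `Classical.epsilon`
returns one. -/
theorem lieTensor2_spec {g : Tensor2 n M} (hg : IsSmoothTensor2 g)
    (hY : IsSmoothField Y) (hZ : IsSmoothField Z) :
    lieTensor2 X g x (Y x) (Z x) = dirDeriv X (fun y => g y (Y y) (Z y)) x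
        - g x (lieBr X Y x) (Z x) - g x (Y x) (lieBr X Z x) := by
  have hex : ∃ B : TangentSpace (𝓡 n) x →L[ℝ] TangentSpace (𝓡 n) x →L[ℝ] ℝ,
      ∀ Y Z : VectorField n M, IsSmoothField Y → IsSmoothField Z →
      B (Y x) (Z x) = dirDeriv X (fun y => g y (Y y) (Z y)) x
        - g x (lieBr X Y x) (Z x) - g x (Y x) (lieBr X Z x) := by
    refine exists_bilin (fun Z hZ => ⟨fun a b ha hb => ?_, fun f a hf ha => ?_⟩)
      (fun Y hY => ⟨fun a b ha hb => ?_, fun f a hf ha => ?_⟩)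
    · simp only [Pi.add_apply, map_add, _root_.add_apply]
      rw [dirDeriv_add (hg _ _ ha hZ) (hg _ _ hb hZ), lieBr_add_right ha hb]
      simp only [map_add, _root_.add_apply]; ring
    · simp only [Pi.smul_apply', map_smul, _root_.smul_apply, smul_eq_mul]
      rw [dirDeriv_mul hf (hg _ _ ha hZ), lieBr_smul_right hf ha]
      simp only [map_add, map_smul, _root_.add_apply, _root_.smul_apply,
        smul_eq_mul]; ring
    · simp only [Pi.add_apply, map_add]
      rw [dirDeriv_add (hg _ _ hY ha) (hg _ _ hY hb), lieBr_add_right ha hb]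
      simp only [map_add]; ring
    · simp only [Pi.smul_apply', map_smul, smul_eq_mul]
      rw [dirDeriv_mul hf (hg _ _ hY ha), lieBr_smul_right hf ha]
      simp only [map_add, map_smul, smul_eq_mul]; ring
  exact Classical.epsilon_spec hex Y Z hY hZ

theorem lieCovector_spec {ξ : CovectorField n M} (hξ : IsSmoothCovector ξ)
    (hY : IsSmoothField Y) :
    lieCovector X ξ x (Y x) = dirDeriv X (fun y => ξ y (Y y)) x - ξ x (lieBr X Y x) := by
  have hex : ∃ B : TangentSpace (𝓡 n) x →L[ℝ] ℝ,
      ∀ Y : VectorField n M, IsSmoothField Y →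
      B (Y x) = dirDeriv X (fun y => ξ y (Y y)) x - ξ x (lieBr X Y x) := by
    refine exists_covector ⟨fun a b ha hb => ?_, fun f a hf ha => ?_⟩
    · simp only [Pi.add_apply, map_add]
      rw [dirDeriv_add (hξ _ ha) (hξ _ hb), lieBr_add_right ha hb]
      simp only [map_add]; ring
    · simp only [Pi.smul_apply', map_smul, smul_eq_mul]
      rw [dirDeriv_mul hf (hξ _ ha), lieBr_smul_right hf ha]
      simp only [map_add, map_smul, smul_eq_mul]; ring
  exact Classical.epsilon_spec hex Y hY

/-! ### Derivations -/

section Derivation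

variable {θ : Π x : M, MultilinearMap ℝ (fun _ : Fin k => TangentSpace (𝓡 n) x) ℝ}
  {D : VectorField n M → VectorField n M}

theorem apply_update_eval (Y : Fin k → VectorField n M) (i : Fin k) (a : VectorField n M) (y : M) :
    (fun j => Function.update Y i a j y) = Function.update (fun j => Y j y) i (a y) := by
  ext1 j
  rcases eq_or_ne j i with rfl | hj
  · rw [Function.update_self, Function.update_self]
  · rw [Function.update_of_ne hj, Function.update_of_ne hj]

/-- For any derivation D over X the terms (X f) θ(…, a, …) cancel between the two parts. The Lie
derivative (D = [X, ·]) and the covariant derivative (D = ∇_X) are both instances. -/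
theorem isMultiTensorial_derivation
    (hθ : ∀ Y : Fin k → VectorField n M, (∀ i, IsSmoothField (Y i)) →
      IsSmoothFn n M (fun y => θ y (fun i => Y i y)))
    (hadd : ∀ a b, IsSmoothField a → IsSmoothField b → D (a + b) x = D a x + D b x)
    (hsmul : ∀ f a, IsSmoothFn n M f → IsSmoothField a →
      D (f • a) x = f x • D a x + dirDeriv X f x • a x) :
    IsMultiTensorial (fun Y => dirDeriv X (fun y => θ y (fun i => Y i y)) x
        - ∑ i, θ x (Function.update (fun j => Y j x) i (D (Y i) x))) x := by
  intro Y hY i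
  -- The i-th summand contains D a; in all others a enters only through its value at x. The two
  -- kinds are separated before linearity in a is checked.
  have hterm : ∀ a : VectorField n M,
      ∑ j, θ x (Function.update (fun l => Function.update Y i a l x) j
        (D (Function.update Y i a j) x)) =
      θ x (Function.update (fun j => Y j x) i (D a x)) + ∑ j ∈ Finset.univ.erase i,
        θ x (Function.update (Function.update (fun l => Y l x) j (D (Y j) x)) i (a x)) := by
    intro a
    rw [← Finset.add_sum_erase _ _ (Finset.mem_univ i)]
    congr 1
    · rw [apply_update_eval, Function.update_self, Function.update_idem]
    · refine Finset.sum_congr rfl fun j hj => ?_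
      have hj := Finset.ne_of_mem_erase hj
      rw [apply_update_eval, Function.update_of_ne hj, Function.update_comm hj]
  have hev : ∀ a, IsSmoothField a →
      IsSmoothFn n M (fun y => θ y (Function.update (fun j => Y j y) i (a y))) := by
    intro a ha
    have := hθ _ (smooth_update hY i ha)
    simpa only [apply_update_eval] using this
  constructor
  · intro a b ha hb
    simp only [hterm]
    simp only [apply_update_eval, Pi.add_apply, MultilinearMap.map_update_add]
    rw [dirDeriv_add (hev a ha) (hev b hb), hadd a b ha hb, MultilinearMap.map_update_add,
      Finset.sum_add_distrib]
    ring
  · intro f a hf ha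
    simp only [hterm]
    simp only [apply_update_eval, Pi.smul_apply', MultilinearMap.map_update_smul, smul_eq_mul]
    rw [dirDeriv_mul hf (hev a ha), hsmul f a hf ha, MultilinearMap.map_update_add,
      MultilinearMap.map_update_smul, MultilinearMap.map_update_smul, ← Finset.mul_sum]
    simp only [smul_eq_mul]
    ring

end Derivation

theorem exists_form_derivation {θ : DiffForm n M k} {D : VectorField n M → VectorField n M}
    (hθ : IsSmoothForm θ)
    (hadd : ∀ a b, IsSmoothField a → IsSmoothField b → D (a + b) x = D a x + D b x)
    (hsmul : ∀ f a, IsSmoothFn n M f → IsSmoothField a →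
      D (f • a) x = f x • D a x + dirDeriv X f x • a x) :
    ∃ α : TangentSpace (𝓡 n) x [⋀^Fin k]→L[ℝ] ℝ,
      ∀ Y : Fin k → VectorField n M, (∀ i, IsSmoothField (Y i)) →
      α (fun i => Y i x) = dirDeriv X (fun y => θ y (fun i => Y i y)) x
        - ∑ i, θ x (Function.update (fun j => Y j x) i (D (Y i) x)) := by
  have hm := isMultiTensorial_derivation (X := X) (θ := fun x => (θ x).toMultilinearMap) hθ
    hadd hsmul
  refine ⟨hm.toForm fun Y hY i j hij hne => ?_, fun Y hY => hm.toForm_apply _ hY⟩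
  have h0 : ∀ y, (θ y).toMultilinearMap (fun l => Y l y) = 0 := fun y =>
    (θ y).map_eq_zero_of_eq _ (congrFun hij y) hne
  simp only [h0, dirDeriv_const, zero_sub, neg_eq_zero]
  rw [Fintype.sum_eq_add i j hne]
  · have hsw : Function.update (fun l => Y l x) j (D (Y j) x) =
        (Function.update (fun l => Y l x) i (D (Y i) x)) ∘ Equiv.swap i j := by
      ext1 l
      rcases eq_or_ne l j with rfl | hlj
      · simp [hij]
      rcases eq_or_ne l i with rfl | hli
      · simp [hne, hne.symm, hij]
      · simp [Equiv.swap_apply_of_ne_of_ne hli hlj, hli, hlj]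
    have := (θ x).toAlternatingMap.map_swap (Function.update (fun l => Y l x) i (D (Y i) x)) hne
    rw [hsw]
    exact add_eq_zero_iff_neg_eq.2 this.symm
  · rintro l ⟨hli, hlj⟩
    refine (θ x).map_eq_zero_of_eq _ ?_ hne
    rw [Function.update_of_ne hli.symm, Function.update_of_ne hlj.symm, hij]

theorem lieForm_spec {θ : DiffForm n M k} (hθ : IsSmoothForm θ)
    {Y : Fin k → VectorField n M} (hY : ∀ i, IsSmoothField (Y i)) :
    lieForm X θ x (fun i => Y i x) = dirDeriv X (fun y => θ y (fun i => Y i y)) x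
        - ∑ i, θ x (Function.update (fun j => Y j x) i (lieBr X (Y i) x)) :=
  Classical.epsilon_spec (exists_form_derivation (x := x) (X := X) (D := lieBr X) hθ
    (fun _ _ ha hb => lieBr_add_right ha hb) (fun _ _ hf ha => lieBr_smul_right hf ha)) Y hY

/-! ### Invariant formulas for the exterior derivative -/

theorem oneForm_apply (ξ : CovectorField n M) (v : Fin 1 → TangentSpace (𝓡 n) x) :
    oneForm ξ x v = ξ x (v 0) := rfl

theorem isSmoothForm_oneForm {ξ : CovectorField n M} (hξ : IsSmoothCovector ξ) :
    IsSmoothForm (oneForm ξ) := fun _ hY => hξ _ (hY 0)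

theorem twoFormMap_skew (b : DiffForm n M 2) (u v : TangentSpace (𝓡 n) x) :
    twoFormMap b x u v = - twoFormMap b x v u := by
  have h := (b x).toAlternatingMap.map_swap ![v, u] (show (0 : Fin 2) ≠ 1 by decide)
  rw [twoFormMap_apply, twoFormMap_apply]
  refine Eq.trans ?_ h
  change b x _ = b x _
  congr 1
  ext1 i; fin_cases i <;> rfl

theorem IsSmoothForm.twoFormMap {b : DiffForm n M 2} (hb : IsSmoothForm b) :
    IsSmoothTensor2 (twoFormMap b) := fun Y Z hY hZ => by
  have := hb ![Y, Z] (by intro i; fin_cases i <;> assumption)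
  refine this.congr fun y => ?_
  rw [twoFormMap_apply]
  congr 1
  ext1 i; fin_cases i <;> rfl

/-- The right side is tensorial in X and Y, so both fields may be replaced by chart-constant
extensions. Their bracket vanishes at x and the chart definition of the exterior derivative applies.
-/
theorem extD_oneForm {ξ : CovectorField n M} (hξ : IsSmoothCovector ξ) (hX : IsSmoothField X)
    (hY : IsSmoothField Y) :
    extD (oneForm ξ) x ![X x, Y x] = dirDeriv X (fun y => ξ y (Y y)) x
      - dirDeriv Y (fun y => ξ y (X y)) x - ξ x (lieBr X Y x) := by
  set Λ : VectorField n M → VectorField n M → ℝ := fun X Y =>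
    dirDeriv X (fun y => ξ y (Y y)) x - dirDeriv Y (fun y => ξ y (X y)) x - ξ x (lieBr X Y x)
  have h2 : ∀ X, IsSmoothField X → IsTensorial (Λ X) x := fun X hX =>
    ⟨fun a b ha hb => by
      simp only [Λ, Pi.add_apply, map_add]
      rw [dirDeriv_add (hξ _ ha) (hξ _ hb), lieBr_add_right ha hb, dirDeriv_add_field]
      simp only [map_add]; ring,
     fun f a hf ha => by
      simp only [Λ, Pi.smul_apply', map_smul, smul_eq_mul]
      rw [dirDeriv_mul hf (hξ _ ha), lieBr_smul_right hf ha, dirDeriv_smul_field]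
      simp only [map_add, map_smul, smul_eq_mul]; ring⟩
  have hs : ∀ X Y, Λ X Y = - Λ Y X := fun X Y => by
    simp only [Λ]
    rw [lieBr_swap (X := X), map_neg]; ring
  have e1 := (h2 X hX).congr hY (tExt_smooth x (Y x)) (tExt_self x _).symm
  have e2 := (h2 (tExt x (Y x)) (tExt_smooth x _)).congr hX (tExt_smooth x (X x))
    (tExt_self x _).symm
  change _ = Λ X Y
  rw [e1, hs, e2, ← hs, extD_tExt (isSmoothForm_oneForm hξ)]
  simp only [Λ, lieBr_tExt_tExt, map_zero, sub_zero]
  rw [Fin.sum_univ_two]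
  simp [oneForm_apply]
  ring

/-- The same reduction to chart-constant fields as in degree one. Tensoriality is checked in Z only
and transferred by the skew-symmetry of the expression. -/
theorem extD_twoForm {b : DiffForm n M 2} (hb : IsSmoothForm b) (hX : IsSmoothField X)
    (hY : IsSmoothField Y) (hZ : IsSmoothField Z) :
    extD b x ![X x, Y x, Z x] = dirDeriv X (fun y => twoFormMap b y (Y y) (Z y)) x
      - dirDeriv Y (fun y => twoFormMap b y (X y) (Z y)) x
      + dirDeriv Z (fun y => twoFormMap b y (X y) (Y y)) x
      - twoFormMap b x (lieBr X Y x) (Z x) + twoFormMap b x (lieBr X Z x) (Y x)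
      - twoFormMap b x (lieBr Y Z x) (X x) := by
  have hs := hb.twoFormMap
  set Λ : VectorField n M → VectorField n M → VectorField n M → ℝ := fun X Y Z =>
    dirDeriv X (fun y => twoFormMap b y (Y y) (Z y)) x
      - dirDeriv Y (fun y => twoFormMap b y (X y) (Z y)) x
      + dirDeriv Z (fun y => twoFormMap b y (X y) (Y y)) x
      - twoFormMap b x (lieBr X Y x) (Z x) + twoFormMap b x (lieBr X Z x) (Y x)
      - twoFormMap b x (lieBr Y Z x) (X x)
  have hsk : ∀ (W : VectorField n M) (Y Z : VectorField n M),
      dirDeriv W (fun y => twoFormMap b y (Y y) (Z y)) x =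
      - dirDeriv W (fun y => twoFormMap b y (Z y) (Y y)) x := fun W Y Z => by
    rw [← dirDeriv_neg]
    congr 1; funext y; exact twoFormMap_skew b _ _
  have e := congr_of_skew₃ (Λ := Λ) (x := x) (fun X Y hX hY =>
    ⟨fun a c ha hc => by
      simp only [Λ, Pi.add_apply, map_add]
      rw [dirDeriv_add (hs _ _ hY ha) (hs _ _ hY hc), dirDeriv_add (hs _ _ hX ha) (hs _ _ hX hc),
        lieBr_add_right ha hc, lieBr_add_right ha hc, dirDeriv_add_field]
      simp only [map_add, _root_.add_apply]; ring,
     fun f a hf ha => by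
      simp only [Λ, Pi.smul_apply', map_smul, smul_eq_mul]
      rw [dirDeriv_mul hf (hs _ _ hY ha), dirDeriv_mul hf (hs _ _ hX ha),
        lieBr_smul_right hf ha, lieBr_smul_right hf ha, dirDeriv_smul_field]
      simp only [map_add, map_smul, _root_.add_apply, _root_.smul_apply,
        smul_eq_mul]
      rw [twoFormMap_skew b (a x) (Y x), twoFormMap_skew b (a x) (X x)]; ring⟩)
    (fun X Y Z hX hY hZ => by
      simp only [Λ]
      rw [hsk Z X Y, lieBr_swap (X := X) (Y := Y), map_neg, _root_.neg_apply]; ring)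
    (fun X Y Z hX hY hZ => by
      simp only [Λ]
      rw [hsk X Y Z, lieBr_swap (X := Y) (Y := Z), map_neg, _root_.neg_apply]; ring)
    hX hY hZ (tExt_smooth x (X x)) (tExt_smooth x (Y x)) (tExt_smooth x (Z x))
    (tExt_self x _).symm (tExt_self x _).symm (tExt_self x _).symm
  change _ = Λ X Y Z
  rw [e, extD_tExt hb]
  simp only [Λ, lieBr_tExt_tExt, map_zero, sub_zero, _root_.zero_apply, add_zero]
  rw [Fin.sum_univ_three]
  have key : ∀ (W : VectorField n M) (i : Fin 3) (p q : TangentSpace (𝓡 n) x),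
      ![X x, Y x, Z x] (i.succAbove 0) = p → ![X x, Y x, Z x] (i.succAbove 1) = q →
      dirDeriv W (fun y => b y fun j => tExt x (![X x, Y x, Z x] (i.succAbove j)) y) x =
      dirDeriv W (fun y => twoFormMap b y (tExt x p y) (tExt x q y)) x := by
    intro W i p q hp hq
    congr 1; funext y
    rw [twoFormMap_apply, ← hp, ← hq]
    congr 1
    ext1 j; fin_cases j <;> rfl
  rw [key _ 0 (Y x) (Z x) rfl rfl, key _ 1 (X x) (Z x) rfl rfl, key _ 2 (X x) (Y x) rfl rfl]
  simp
  ring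

end TensorSpecs

/-! ### Velocities of families of maps and derivatives of pullbacks -/

section LieDerivative

variable {n : ℕ} {M : Type*} [TopologicalSpace M] [T2Space M] [ChartedSpace (Model n) M]
  [IsManifold (𝓡 n) ∞ M] {k : ℕ} {S : Set ℝ} {t₀ : ℝ} {φ : ℝ → M → M} {X : VectorField n M} {x : M}

/-- `X` is the velocity at time `t₀` of the family of maps `φ`, with `φ t₀ = id`. -/
structure IsVelocity (S : Set ℝ) (t₀ : ℝ) (φ : ℝ → M → M) (X : VectorField n M) : Prop where
  mem : t₀ ∈ S
  unique : UniqueDiffOn ℝ S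
  closure : t₀ ∈ closure (interior S)
  smooth : ∀ x, ContMDiffWithinAt (𝓘(ℝ, ℝ).prod (𝓡 n)) (𝓡 n) ∞ (fun p : ℝ × M => φ p.1 p.2)
    (S ×ˢ univ) (t₀, x)
  id : ∀ x, φ t₀ x = x
  deriv : ∀ f : M → ℝ, IsSmoothFn n M f → ∀ x,
    HasDerivWithinAt (fun t => f (φ t x)) (dirDeriv X f x) S t₀

theorem HasDerivWithinAt.of_proj {m : ℕ} {f : ℝ → Model m} {f' : Model m}
    (h : ∀ i, HasDerivWithinAt (fun t => f t i) (f' i) S t₀) : HasDerivWithinAt f f' S t₀ := by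
  have h1 : HasDerivWithinAt (fun t => WithLp.ofLp (f t)) (WithLp.ofLp f') S t₀ :=
    hasDerivWithinAt_pi.2 h
  exact (PiLp.continuousLinearEquiv 2 ℝ (fun _ : Fin m => ℝ)).symm.toContinuousLinearMap.hasFDerivAt.comp_hasDerivWithinAt
    t₀ h1

namespace IsVelocity

theorem continuousWithinAt (h : IsVelocity S t₀ φ X) (x : M) :
    Filter.Tendsto (fun t => φ t x) (𝓝[S] t₀) (𝓝 x) := by
  have h1 := (h.smooth x).continuousWithinAt
  have h2 : ContinuousWithinAt (fun t : ℝ => (t, x)) S t₀ := by fun_prop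
  have := ContinuousWithinAt.comp (f := fun t : ℝ => (t, x)) (x := t₀) h1 h2
    (fun t ht => mk_mem_prod ht (mem_univ _))
  have h3 : Filter.Tendsto (fun t => φ t x) (𝓝[S] t₀) (𝓝 (φ t₀ x)) := this
  rwa [h.id x] at h3

theorem smooth_chart (h : IsVelocity S t₀ φ X) (x : M) :
    ContMDiffWithinAt (𝓘(ℝ, ℝ).prod (𝓡 n)) 𝓘(ℝ, Model n) ∞
      (fun p : ℝ × M => extChartAt (𝓡 n) x (φ p.1 p.2)) (S ×ˢ univ) (t₀, x) := by
  have h1 : ContMDiffAt (𝓡 n) 𝓘(ℝ, Model n) ∞ (extChartAt (𝓡 n) x) (φ t₀ x) := by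
    rw [h.id x]; exact contMDiffAt_extChartAt
  exact ContMDiffAt.comp_contMDiffWithinAt (t₀, x) h1 (h.smooth x)

/-- `IsVelocity` speaks of scalar test functions; testing on coordinate functions recovers the
vector. The statement covers all y near x because it is later differentiated in y. -/
theorem hasDerivWithinAt_chart (h : IsVelocity S t₀ φ X) (x : M) :
    ∀ᶠ y in 𝓝 x, HasDerivWithinAt (fun t => extChartAt (𝓡 n) x (φ t y))
      (crd (Model n) x (X y)) S t₀ := by
  have key : ∀ i : Fin n, ∀ᶠ y in 𝓝 x, HasDerivWithinAt
      (fun t => extChartAt (𝓡 n) x (φ t y) i) (crd (Model n) x (X y) i) S t₀ := by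
    intro i
    obtain ⟨f, hf, hfd, hfe⟩ := exists_chart_fn x (EuclideanSpace.proj (𝕜 := ℝ) i)
    filter_upwards [hfd, hfe.eventually_nhds] with y hy hye
    have h1 := h.deriv f hf y
    rw [hy X] at h1
    refine h1.congr_of_eventuallyEq_of_mem ?_ h.mem
    filter_upwards [(h.continuousWithinAt y).eventually hye] with t ht
    exact ht.symm
  filter_upwards [Filter.eventually_all.2 key] with y hy
  exact HasDerivWithinAt.of_proj hy

/-- The chain rule at (t₀, x): the curve (t, φ_t x) has velocity (1, X) = (1, 0) + (0, X), which
separates the explicit time dependence from the motion of the point. -/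
theorem hasDerivWithinAt_comp (h : IsVelocity S t₀ φ X) {a : ℝ × M → ℝ}
    (ha : ContMDiffWithinAt (𝓘(ℝ, ℝ).prod (𝓡 n)) 𝓘(ℝ, ℝ) ∞ a (S ×ˢ univ) (t₀, x)) {a' : ℝ}
    (ha' : HasDerivWithinAt (fun t => a (t, x)) a' S t₀) :
    HasDerivWithinAt (fun t => a (t, φ t x)) (a' + dirDeriv X (fun y => a (t₀, y)) x) S t₀ := by
  have hc := ((contDiffWithinAt_chart ha).differentiableWithinAt (by simp)).hasFDerivWithinAt
  have hφ := (h.hasDerivWithinAt_chart x).self_of_nhds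
  have h1 : HasDerivWithinAt (fun t => (t, extChartAt (𝓡 n) x (φ t x)))
      ((1 : ℝ), crd (Model n) x (X x)) S t₀ := (hasDerivWithinAt_id t₀ S).prodMk hφ
  have e0 : (t₀, extChartAt (𝓡 n) x x) = (t₀, extChartAt (𝓡 n) x (φ t₀ x)) := by rw [h.id]
  rw [e0] at hc
  have h2 := hc.comp_hasDerivWithinAt t₀ h1 (fun t ht => mk_mem_prod ht (mem_univ _))
  rw [← e0] at h2
  have e1 := (derivWithin_eq_fderivWithin_chart h.mem ha).self_of_nhds
  rw [extChartAt_to_inv] at e1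
  have e2 := (eventually_mfderiv_eq h.mem ha).self_of_nhdsWithin
    (mk_mem_prod h.mem (mem_univ _)) (X x)
  have e3 : ((1 : ℝ), crd (Model n) x (X x)) = (1, 0) + (0, crd (Model n) x (X x)) := by simp
  rw [e3, map_add, ← e2, (h.unique t₀ h.mem).eq_deriv _ e1 ha'] at h2
  refine h2.congr_of_eventuallyEq_of_mem ?_ h.mem
  filter_upwards [(h.continuousWithinAt x).eventually (extChartAt_source_mem_nhds (I := 𝓡 n) x)]
    with t ht
  simp only [Function.comp, (extChartAt (𝓡 n) x).left_inv ht]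

/-- Derivative of the coordinates of `dφ_t v`. -/
theorem hasDerivWithinAt_crd_mfderiv (h : IsVelocity S t₀ φ X) (hX : IsSmoothField X)
    (v : TangentSpace (𝓡 n) x) :
    HasDerivWithinAt (fun t => crd (Model n) x (mfderiv (𝓡 n) (𝓡 n) (φ t) x v))
      (- crd (Model n) x (lieBr X (tExt x v) x)) S t₀ := by
  -- Exchanging the two derivatives, ∂_t (dφ_t v) is, in coordinates, the derivative along v of the
  -- components of X. By `crd_lieBr_tExt` this is minus the bracket of X with the constant extension
  -- of v.
  have h1 := hasDerivWithinAt_mfderiv h.mem h.unique h.closure (h.smooth_chart x) v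
  refine HasDerivWithinAt.congr_deriv (f' := (mfderiv (𝓡 n) 𝓘(ℝ, Model n)
    (fun y => crd (Model n) x (X y)) x v : Model n)) ?_
    (by rw [crd_lieBr_tExt hX]; exact (neg_neg _).symm)
  have h2 : (fun y => derivWithin (fun t => extChartAt (𝓡 n) x (φ t y)) S t₀) =ᶠ[𝓝 x]
      fun y => crd (Model n) x (X y) := by
    filter_upwards [h.hasDerivWithinAt_chart x] with y hy
    exact hy.derivWithin (h.unique t₀ h.mem)
  have h3 := h2.mfderiv_eq (I := 𝓡 n) (I' := 𝓘(ℝ, Model n))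
  have h4 := congrArg (fun L => (L v : Model n)) h3
  have h5 : HasDerivWithinAt (fun t => (mfderiv (𝓡 n) 𝓘(ℝ, Model n)
      (fun y => extChartAt (𝓡 n) x (φ t y)) x v : Model n))
      (mfderiv (𝓡 n) 𝓘(ℝ, Model n) (fun y => crd (Model n) x (X y)) x v : Model n) S t₀ :=
    HasDerivWithinAt.congr_deriv h1 h4
  refine h5.congr_of_eventuallyEq_of_mem ?_ h.mem
  have hcont : Filter.Tendsto (fun t : ℝ => (t, x)) (𝓝[S] t₀) (𝓝[S ×ˢ univ] (t₀, x)) := by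
    refine tendsto_nhdsWithin_iff.2 ⟨?_, ?_⟩
    · exact ((continuous_id.prodMk continuous_const).tendsto t₀).mono_left nhdsWithin_le_nhds
    · filter_upwards [self_mem_nhdsWithin] with t ht' using mk_mem_prod ht' (mem_univ _)
  have hsm := (contMDiffWithinAt_iff_contMDiffWithinAt_nhdsWithin (n := 1) (by simp)).1
    ((h.smooth x).of_le (by simp))
  rw [insert_eq_of_mem (show (t₀, x) ∈ S ×ˢ univ from mk_mem_prod h.mem (mem_univ _))] at hsm
  filter_upwards [(h.continuousWithinAt x).eventually (extChartAt_source_mem_nhds (I := 𝓡 n) x),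
    hcont.eventually hsm, self_mem_nhdsWithin] with t ht hs htS
  rw [crd_tangent ht]
  have hm : MDifferentiableAt (𝓡 n) (𝓡 n) (φ t) x := by
    have h2 : ContMDiffAt (𝓡 n) (𝓘(ℝ, ℝ).prod (𝓡 n)) 1 (fun y : M => (t, y)) x :=
      contMDiffAt_const.prodMk contMDiffAt_id
    have h3 : ContMDiffWithinAt (𝓡 n) (𝓡 n) 1 ((fun p : ℝ × M => φ p.1 p.2) ∘ fun y => (t, y))
        univ x :=
      ContMDiffWithinAt.comp (t := S ×ˢ univ) x hs h2.contMDiffWithinAt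
        (fun y _ => mk_mem_prod htS (mem_univ _))
    exact (contMDiffWithinAt_univ.1 h3).mdifferentiableAt (by simp)
  have h6 : MDifferentiableAt (𝓡 n) 𝓘(ℝ, Model n) (extChartAt (𝓡 n) x) (φ t x) :=
    mdifferentiableAt_extChartAt (by rwa [extChartAt_source] at ht)
  have := mfderiv_comp x h6 hm
  exact (congrArg (fun L => (L v : Model n)) this).symm

/-- The derivative of the pullbacks of a family of multilinear forms. -/
theorem hasDerivWithinAt_pullback_tExt (h : IsVelocity S t₀ φ X) (hX : IsSmoothField X)
    {θ : ℝ → Π x : M, MultilinearMap ℝ (fun _ : Fin k => TangentSpace (𝓡 n) x) ℝ}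
    (hθ : ∀ Y : Fin k → VectorField n M, (∀ i, IsSmoothField (Y i)) →
      ContMDiffWithinAt (𝓘(ℝ, ℝ).prod (𝓡 n)) 𝓘(ℝ, ℝ) ∞
        (fun p : ℝ × M => θ p.1 p.2 (fun i => Y i p.2)) (S ×ˢ univ) (t₀, x))
    {θ' : (Fin k → TangentSpace (𝓡 n) x) → ℝ}
    (hθ' : ∀ v, HasDerivWithinAt (fun t => θ t x v) (θ' v) S t₀)
    (v : Fin k → TangentSpace (𝓡 n) x) :
    HasDerivWithinAt (fun t => θ t (φ t x) (fun i => mfderiv (𝓡 n) (𝓡 n) (φ t) x (v i)))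
      (θ' v + (dirDeriv X (fun y => θ t₀ y (fun i => tExt x (v i) y)) x
        - ∑ i, θ t₀ x (Function.update v i (lieBr X (tExt x (v i)) x)))) S t₀ := by
  let fr : (y : M) → Model n →ₗ[ℝ] TangentSpace (𝓡 n) y := fun y =>
    { toFun := fun w => frame n (Model n) (V := fun x : M => TangentSpace (𝓡 n) x) x w y
      map_add' := fun v w => by rw [frame_add]; rfl
      map_smul' := fun r w => by rw [frame_smul]; rfl }
  -- The form moves between different fibres. In the frame around x it becomes a family of
  -- multilinear forms on the fixed space ℝⁿ, applied to the coordinates of dφ_t v, and the product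
  -- rule is available.
  let ψ : ℝ → MultilinearMap ℝ (fun _ : Fin k => Model n) ℝ := fun t =>
    (θ t (φ t x)).compLinearMap fun _ => fr (φ t x)
  let F : (Fin k → Model n) → ℝ := fun w => θ' (fun i => fr x (w i)) +
    dirDeriv X (fun y => θ t₀ y (fun i => fr y (w i))) x
  have hF : ∀ w, HasDerivWithinAt (fun t => ψ t w) (F w) S t₀ := fun w =>
    h.hasDerivWithinAt_comp (a := fun p => θ p.1 p.2 (fun i => fr p.2 (w i)))
      (hθ _ fun i => frame_smooth (n := n) (V := fun x : M => TangentSpace (𝓡 n) x) x (w i))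
      (hθ' fun i => fr x (w i))
  have hu := h.unique t₀ h.mem
  -- The derivative θ' is given as a bare function. Multilinearity of F follows from uniqueness of
  -- derivatives.
  let F' : MultilinearMap ℝ (fun _ : Fin k => Model n) ℝ :=
    { toFun := F
      map_update_add' := fun w i a b => hu.eq_deriv _ (hF _) (by
        simp only [MultilinearMap.map_update_add]; exact (hF _).add (hF _))
      map_update_smul' := fun w i r a => hu.eq_deriv _ (hF _) (by
        simp only [MultilinearMap.map_update_smul]; exact (hF _).const_smul r) }
  let b := (EuclideanSpace.basisFun (Fin n) ℝ).toBasis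
  let c : TangentSpace (𝓡 n) x → Model n := fun u => crd (Model n) x u
  have hfc : ∀ u : TangentSpace (𝓡 n) x, fr x (c u) = u :=
    (frame_crd (n := n) (F := Model n) (V := fun x : M => TangentSpace (𝓡 n) x) x).self_of_nhds
  have key := hasDerivWithinAt_multilinear b (f := ψ) (f' := F') (S := S) (t := t₀)
    (v := fun t i => crd (Model n) x (mfderiv (𝓡 n) (𝓡 n) (φ t) x (v i)))
    (v' := fun i => - c (lieBr X (tExt x (v i)) x)) hF (fun i j => by
      have h1 := h.hasDerivWithinAt_crd_mfderiv hX (v i)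
      have h2 := (EuclideanSpace.proj j : Model n →L[ℝ] ℝ).hasFDerivAt.comp_hasDerivWithinAt t₀ h1
      exact h2)
  have hv0 : (fun i => crd (Model n) x (mfderiv (𝓡 n) (𝓡 n) (φ t₀) x (v i))) =
      fun i => c (v i) := by
    have : ∀ f : M → M, f = _root_.id → ∀ i, crd (Model n) x (mfderiv (𝓡 n) (𝓡 n) f x (v i)) =
        crd (Model n) x (v i) := by
      rintro _ rfl i
      rw [mfderiv_id]; rfl
    exact funext fun i => this _ (funext h.id) i
  have hψ0 : ∀ w, ψ t₀ w = θ t₀ x (fun i => fr x (w i)) := fun w => by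
    have : ∀ y, y = x → θ t₀ y (fun i => fr y (w i)) = θ t₀ x (fun i => fr x (w i)) := by
      rintro _ rfl; rfl
    exact this _ (h.id x)
  have key2 : HasDerivWithinAt (fun t => ψ t fun i => crd (Model n) x
      (mfderiv (𝓡 n) (𝓡 n) (φ t) x (v i))) (θ' v +
      (dirDeriv X (fun y => θ t₀ y (fun i => tExt x (v i) y)) x
        - ∑ i, θ t₀ x (Function.update v i (lieBr X (tExt x (v i)) x)))) S t₀ := by
    refine key.congr_deriv ?_
    rw [hv0, sub_eq_add_neg, ← add_assoc, ← Finset.sum_neg_distrib]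
    congr 1
    · change θ' (fun i => fr x (c (v i))) + _ = _
      simp only [hfc]
      rfl
    · refine Finset.sum_congr rfl fun i _ => ?_
      rw [hψ0, ← MultilinearMap.map_update_neg]
      congr 1
      ext1 j
      rcases eq_or_ne j i with rfl | hj
      · rw [Function.update_self, Function.update_self, map_neg, hfc]
      · rw [Function.update_of_ne hj, Function.update_of_ne hj, hfc]
  refine key2.congr_of_eventuallyEq_of_mem ?_ h.mem
  filter_upwards [(h.continuousWithinAt x).eventually (frame_crd (n := n) (F := Model n)
    (V := fun x : M => TangentSpace (𝓡 n) x) x)] with t ht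
  change _ = θ t (φ t x) fun i => fr (φ t x) (crd (Model n) x (mfderiv (𝓡 n) (𝓡 n) (φ t) x (v i)))
  congr 1
  exact funext fun i => (ht _).symm

/-- The derivative of the pullbacks of a family of forms. -/
theorem hasDerivWithinAt_pullback_form (h : IsVelocity S t₀ φ X) (hX : IsSmoothField X)
    {θ : ℝ → DiffForm n M k} (hθ₀ : IsSmoothForm (θ t₀))
    (hθ : ∀ Y : Fin k → VectorField n M, (∀ i, IsSmoothField (Y i)) →
      ContMDiffWithinAt (𝓘(ℝ, ℝ).prod (𝓡 n)) 𝓘(ℝ, ℝ) ∞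
        (fun p : ℝ × M => θ p.1 p.2 (fun i => Y i p.2)) (S ×ˢ univ) (t₀, x))
    {θ' : (Fin k → TangentSpace (𝓡 n) x) → ℝ}
    (hθ' : ∀ v, HasDerivWithinAt (fun t => θ t x v) (θ' v) S t₀)
    (v : Fin k → TangentSpace (𝓡 n) x) :
    HasDerivWithinAt (fun t => θ t (φ t x) (fun i => mfderiv (𝓡 n) (𝓡 n) (φ t) x (v i)))
      (θ' v + lieForm X (θ t₀) x v) S t₀ := by
  have h1 := h.hasDerivWithinAt_pullback_tExt hX (θ := fun t x => (θ t x).toMultilinearMap)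
    hθ hθ' v
  have h2 := lieForm_spec (X := X) (x := x) hθ₀ (Y := fun i => tExt x (v i))
    (fun i => tExt_smooth x _)
  simp only [tExt_self] at h2
  rw [h2]
  exact h1

/-- The derivative of the pullbacks of a family of `(0,2)`-tensors. -/
theorem hasDerivWithinAt_pullback_tensor2 (h : IsVelocity S t₀ φ X) (hX : IsSmoothField X)
    {θ : ℝ → Tensor2 n M} (hθ₀ : IsSmoothTensor2 (θ t₀))
    (hθ : ∀ Y Z : VectorField n M, IsSmoothField Y → IsSmoothField Z →
      ContMDiffWithinAt (𝓘(ℝ, ℝ).prod (𝓡 n)) 𝓘(ℝ, ℝ) ∞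
        (fun p : ℝ × M => θ p.1 p.2 (Y p.2) (Z p.2)) (S ×ˢ univ) (t₀, x))
    {θ' : TangentSpace (𝓡 n) x → TangentSpace (𝓡 n) x → ℝ}
    (hθ' : ∀ u v, HasDerivWithinAt (fun t => θ t x u v) (θ' u v) S t₀)
    (u v : TangentSpace (𝓡 n) x) :
    HasDerivWithinAt (fun t => θ t (φ t x) (mfderiv (𝓡 n) (𝓡 n) (φ t) x u)
      (mfderiv (𝓡 n) (𝓡 n) (φ t) x v)) (θ' u v + lieTensor2 X (θ t₀) x u v) S t₀ := by
  let Θ : ℝ → Π x : M, MultilinearMap ℝ (fun _ : Fin 2 => TangentSpace (𝓡 n) x) ℝ := fun t x =>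
    { toFun := fun w => θ t x (w 0) (w 1)
      map_update_add' := fun w i a b => by fin_cases i <;> simp
      map_update_smul' := fun w i r a => by fin_cases i <;> simp }
  have h1 := h.hasDerivWithinAt_pullback_tExt hX (θ := Θ) (fun Y hY => hθ _ _ (hY 0) (hY 1))
    (θ' := fun w => θ' (w 0) (w 1)) (fun w => hθ' _ _) ![u, v]
  refine h1.congr_deriv ?_
  have h2 := lieTensor2_spec (X := X) (x := x) hθ₀ (tExt_smooth x u) (tExt_smooth x v)
  rw [tExt_self, tExt_self] at h2
  rw [h2, Fin.sum_univ_two]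
  simp [Θ]
  ring

end IsVelocity

/-- The velocity field of a smooth family of maps. -/
theorem exists_velocity (mem : t₀ ∈ S) (unique : UniqueDiffOn ℝ S)
    (hcl : t₀ ∈ closure (interior S))
    (smooth : ∀ x, ContMDiffWithinAt (𝓘(ℝ, ℝ).prod (𝓡 n)) (𝓡 n) ∞ (fun p : ℝ × M => φ p.1 p.2)
      (S ×ˢ univ) (t₀, x)) (id : ∀ x, φ t₀ x = x) :
    ∃ X : VectorField n M, IsSmoothField X ∧ IsVelocity S t₀ φ X := by
  -- The derivative lives in the tangent space at φ_{t₀} y, which equals y only by hypothesis. All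
  -- tangent spaces are ℝⁿ by definition, so the vector can be read at y.
  let X : VectorField n M := fun y =>
    (show Model n from mfderivWithin 𝓘(ℝ, ℝ) (𝓡 n) (fun t => φ t y) S t₀ (1 : ℝ))
  have hX : IsVelocity S t₀ φ X := by
    refine ⟨mem, unique, hcl, smooth, id, fun f hf x => ?_⟩
    have h1 : MDifferentiableWithinAt 𝓘(ℝ, ℝ) (𝓡 n) (fun t => φ t x) S t₀ := by
      have h2 : ContMDiffWithinAt 𝓘(ℝ, ℝ) (𝓘(ℝ, ℝ).prod (𝓡 n)) ∞ (fun t : ℝ => (t, x)) S t₀ :=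
        (contMDiffAt_id.prodMk contMDiffAt_const).contMDiffWithinAt
      have h3 := ContMDiffWithinAt.comp (t := S ×ˢ univ) t₀ (smooth x) h2
        (fun t ht => mk_mem_prod ht (mem_univ _))
      exact h3.mdifferentiableWithinAt (by simp)
    have h2 := (hf.mdiff (φ t₀ x)).hasMFDerivAt.comp_hasMFDerivWithinAt t₀ h1.hasMFDerivWithinAt
    let L : ℝ →L[ℝ] ℝ := (mfderiv (𝓡 n) 𝓘(ℝ, ℝ) f (φ t₀ x)).comp
      (mfderivWithin 𝓘(ℝ, ℝ) (𝓡 n) (fun t => φ t x) S t₀)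
    have h3 : HasFDerivWithinAt (fun t => f (φ t x)) L S t₀ := h2.hasFDerivWithinAt
    refine h3.hasDerivWithinAt.congr_deriv ?_
    have : ∀ (z : M) (_ : z = x) (w : Model n), (mfderiv (𝓡 n) 𝓘(ℝ, ℝ) f z w : ℝ) =
        mfderiv (𝓡 n) 𝓘(ℝ, ℝ) f x w := by
      rintro _ rfl w; rfl
    exact this _ (id x) _
  refine ⟨X, fun x => ?_, hX⟩
  rw [← contMDiffWithinAt_univ]
  refine (contMDiffWithinAt_totalSpace_iff_crd (n := n) (F := Model n) (f := _root_.id)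
      (V := fun x : M => TangentSpace (𝓡 n) x) (v := X) (mem_univ x)).2
    ⟨contMDiffAt_id.contMDiffWithinAt, ContMDiffAt.contMDiffWithinAt ?_⟩
  have h1 := contMDiffAt_derivWithin mem unique (hX.smooth_chart x)
  refine h1.congr_of_eventuallyEq ?_
  filter_upwards [hX.hasDerivWithinAt_chart x] with y hy
  exact (hy.derivWithin (unique t₀ mem)).symm

end LieDerivative

/-! ### Composition operators on spaces of continuous functions -/

section Superposition

universe u

variable {K : Type*} [TopologicalSpace K] [CompactSpace K]
  {E G : Type u} [NormedAddCommGroup E] [NormedSpace ℝ E] [NormedAddCommGroup G] [NormedSpace ℝ G]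

instance instNormedAddCommGroupContinuousMapCLM :
    NormedAddCommGroup C(K, E →L[ℝ] G) := ContinuousMap.instNormedAddCommGroup

variable (K E G) in
/-- Pointwise application of continuous families of linear maps. -/
def pointwiseApply : C(K, E →L[ℝ] G) →L[ℝ] C(K, E) →L[ℝ] C(K, G) :=
  LinearMap.mkContinuous₂
    (LinearMap.mk₂ ℝ (fun (A : C(K, E →L[ℝ] G)) (γ : C(K, E)) =>
        (⟨fun s => A s (γ s), by fun_prop⟩ : C(K, G)))
      (fun _ _ _ => by ext; simp) (fun _ _ _ => by ext; simp)
      (fun _ _ _ => by ext; simp) (fun _ _ _ => by ext; simp)) 1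
    (fun A γ => by
      rw [ContinuousMap.norm_le _ (by positivity), one_mul]
      intro s
      exact ((A s).le_opNorm _).trans (mul_le_mul (A.norm_coe_le_norm s) (γ.norm_coe_le_norm s)
        (norm_nonneg _) (norm_nonneg _)))

/-- The derivative of a smooth map, as a continuous map. -/
def fderivC (f : C(E, G)) (hf : ContDiff ℝ ∞ f) : C(E, E →L[ℝ] G) :=
  ⟨fderiv ℝ f, hf.continuous_fderiv (by simp)⟩

variable [FiniteDimensional ℝ E]

/-- The range of γ is compact, and so is its closed 1-neighbourhood in the finite-dimensional E.
There the second derivative of f is bounded by some C, so the Taylor remainder is at most |C| ‖h‖²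
uniformly in the point of K. -/
theorem hasFDerivAt_comp_continuousMap (f : C(E, G)) (hf : ContDiff ℝ ∞ f) (γ : C(K, E)) :
    HasFDerivAt (fun γ : C(K, E) => f.comp γ) (pointwiseApply K E G ((fderivC f hf).comp γ)) γ := by
  have hf1 : ContDiff ℝ ∞ (fderiv ℝ f) := hf.fderiv_right (by simp)
  have hcpt : IsCompact (Metric.cthickening 1 (range γ)) :=
    (isCompact_range γ.continuous).cthickening
  obtain ⟨C, hC⟩ := hcpt.exists_bound_of_continuousOn
    (hf1.continuous_fderiv (by simp)).continuousOn
  have hpt : ∀ (s : K) (h : E), ‖h‖ ≤ 1 →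
      ‖f (γ s + h) - f (γ s) - fderiv ℝ f (γ s) h‖ ≤ |C| * ‖h‖ * ‖h‖ := by
    intro s h hh
    have hsub : Metric.closedBall (γ s) ‖h‖ ⊆ Metric.cthickening 1 (range γ) :=
      (Metric.closedBall_subset_closedBall hh).trans
        (Metric.closedBall_subset_cthickening (mem_range_self s) 1)
    have hD : ∀ z ∈ Metric.closedBall (γ s) ‖h‖, ‖fderiv ℝ f z - fderiv ℝ f (γ s)‖ ≤ |C| * ‖h‖ := by
      intro z hz
      have := (convex_closedBall (γ s) ‖h‖).norm_image_sub_le_of_norm_fderiv_le (𝕜 := ℝ)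
        (f := fderiv ℝ f) (C := |C|)
        (fun w _ => (hf1.differentiable (by simp)).differentiableAt)
        (fun w hw => (hC w (hsub hw)).trans (le_abs_self C))
        (Metric.mem_closedBall_self (norm_nonneg _)) hz
      refine this.trans (mul_le_mul_of_nonneg_left ?_ (abs_nonneg C))
      rwa [← mem_closedBall_iff_norm]
    have := (convex_closedBall (γ s) ‖h‖).norm_image_sub_le_of_norm_hasFDerivWithin_le' (𝕜 := ℝ)
      (f := f) (y := γ s + h)
      (fun w _ => ((hf.differentiable (by simp)).differentiableAt (x := w)).hasFDerivAt.hasFDerivWithinAt) hD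
      (Metric.mem_closedBall_self (norm_nonneg _)) (by simp)
    simpa using this
  rw [hasFDerivAt_iff_isLittleO_nhds_zero]
  refine Asymptotics.IsBigO.trans_isLittleO (g := fun η : C(K, E) => ‖η‖ ^ 2) ?_
    (Asymptotics.isLittleO_norm_pow_id one_lt_two)
  refine Asymptotics.IsBigO.of_bound |C| ?_
  filter_upwards [Metric.closedBall_mem_nhds (0 : C(K, E)) one_pos] with η hη
  rw [mem_closedBall_zero_iff] at hη
  rw [Real.norm_of_nonneg (by positivity), ContinuousMap.norm_le _ (by positivity)]
  intro s
  have h1 := η.norm_coe_le_norm s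
  refine (hpt s (η s) (h1.trans hη)).trans ?_
  rw [mul_assoc, ← sq]
  gcongr

/-- The derivative of composition with f is pointwise application of composition with `fderiv ℝ f`,
whose target is the space of linear maps from E to G. The induction therefore has to run over all
targets at once. -/
theorem contDiff_comp_continuousMap_nat (k : ℕ) : ∀ {G : Type u} [NormedAddCommGroup G]
    [NormedSpace ℝ G] (f : C(E, G)), ContDiff ℝ ∞ f →
    ContDiff ℝ k (fun γ : C(K, E) => f.comp γ) := by
  induction k with
  | zero =>
    intro G _ _ f hf
    exact contDiff_zero.2 f.continuous_postcomp
  | succ k ih =>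
    intro G _ _ f hf
    have hd : fderiv ℝ (fun γ : C(K, E) => f.comp γ) =
        fun γ => pointwiseApply K E G ((fderivC f hf).comp γ) :=
      funext fun γ => (hasFDerivAt_comp_continuousMap f hf γ).fderiv
    push_cast
    refine contDiff_succ_iff_fderiv.2 ⟨fun γ =>
      (hasFDerivAt_comp_continuousMap f hf γ).differentiableAt, fun h => by simp at h, ?_⟩
    rw [hd]
    exact (pointwiseApply K E G).contDiff.comp (ih (fderivC f hf) (hf.fderiv_right (by simp)))

theorem contDiff_comp_continuousMap (f : C(E, G)) (hf : ContDiff ℝ ∞ f) :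
    ContDiff ℝ ∞ (fun γ : C(K, E) => f.comp γ) :=
  contDiff_infty.2 fun k => contDiff_comp_continuousMap_nat k f hf

end Superposition

/-! ### Local flows -/

section LocalFlow

variable {E : Type} [NormedAddCommGroup E] [NormedSpace ℝ E]

/-- The interval on which curves are considered. -/
abbrev TimeBox : Type := Icc (-2 : ℝ) 2

theorem zero_mem_timeBox : (0 : ℝ) ∈ Icc (-2 : ℝ) 2 := by constructor <;> norm_num

/-- Extension of a function on the interval by constants. -/
def extendBox (γ : C(TimeBox, E)) (s : ℝ) : E := γ (projIcc (-2) 2 (by norm_num) s)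

theorem continuous_extendBox (γ : C(TimeBox, E)) : Continuous (extendBox γ) :=
  γ.continuous.comp continuous_projIcc

theorem extendBox_of_mem (γ : C(TimeBox, E)) {s : ℝ} (hs : s ∈ Icc (-2 : ℝ) 2) :
    extendBox γ s = γ ⟨s, hs⟩ := by rw [extendBox, projIcc_of_mem]

variable (E) in
/-- The primitive vanishing at `0`. -/
def primitiveBox : C(TimeBox, E) →L[ℝ] C(TimeBox, E) :=
  LinearMap.mkContinuous
    { toFun := fun γ => ⟨fun s => ∫ r in (0 : ℝ)..s, extendBox γ r,
        (intervalIntegral.continuous_primitive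
          (fun a b => (continuous_extendBox γ).intervalIntegrable a b) 0).comp
          continuous_subtype_val⟩
      map_add' := fun γ η => by
        ext s
        exact intervalIntegral.integral_add ((continuous_extendBox γ).intervalIntegrable _ _)
          ((continuous_extendBox η).intervalIntegrable _ _)
      map_smul' := fun r γ => by
        ext s
        exact intervalIntegral.integral_smul r _ } 2 (fun γ => by
      rw [ContinuousMap.norm_le _ (by positivity)]
      intro s
      have h := intervalIntegral.norm_integral_le_of_norm_le_const (a := 0) (b := s) (C := ‖γ‖)
        (f := extendBox γ) (fun r _ => γ.norm_coe_le_norm _)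
      refine h.trans ?_
      rw [sub_zero, mul_comm]
      exact mul_le_mul_of_nonneg_right (abs_le.2 s.2) (norm_nonneg _))

theorem primitiveBox_apply (γ : C(TimeBox, E)) (s : TimeBox) :
    primitiveBox E γ s = ∫ r in (0 : ℝ)..s, extendBox γ r := rfl

variable [FiniteDimensional ℝ E]

/-- Integral curves of t f from z solve γ = z + t ∫ f ∘ γ. The inverse function theorem is applied
at (0, z₀, const z₀) to (t, z, γ) ↦ (t, z, γ - z - t ∫ f ∘ γ), which is smooth on a Banach space.
The last component of the inverse at (t, z, 0) is the curve sought, and it depends smoothly on (t,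
z). -/
theorem exists_local_flow_continuousMap (f : C(E, E)) (hf : ContDiff ℝ ∞ f) (z₀ : E) :
    ∃ Γ : ℝ × E → C(TimeBox, E), ContDiffAt ℝ ∞ Γ (0, z₀) ∧
      Γ (0, z₀) = ContinuousMap.const _ z₀ ∧ ∀ᶠ p in 𝓝 ((0 : ℝ), z₀),
        Γ p = ContinuousMap.const _ p.2 + p.1 • primitiveBox E (f.comp (Γ p)) := by
  let cst : E →L[ℝ] C(TimeBox, E) := ContinuousLinearMap.const ℝ TimeBox
  let Φ : ℝ × E × C(TimeBox, E) → ℝ × E × C(TimeBox, E) := fun q =>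
    (q.1, q.2.1, q.2.2 - cst q.2.1 - q.1 • primitiveBox E (f.comp q.2.2))
  have hΦ : ContDiff ℝ ∞ Φ := by
    refine contDiff_fst.prodMk ((contDiff_fst.comp contDiff_snd).prodMk ?_)
    refine ((contDiff_snd.comp contDiff_snd).sub
      (cst.contDiff.comp (contDiff_fst.comp contDiff_snd))).sub (contDiff_fst.smul ?_)
    exact (primitiveBox E).contDiff.comp ((contDiff_comp_continuousMap f hf).comp
      (contDiff_snd.comp contDiff_snd))
  let γ₀ : C(TimeBox, E) := cst z₀
  let w : C(TimeBox, E) := primitiveBox E (f.comp γ₀)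
  let a : ℝ × E × C(TimeBox, E) := (0, z₀, γ₀)
  let p₁ : ℝ × E × C(TimeBox, E) →L[ℝ] ℝ := ContinuousLinearMap.fst ℝ _ _
  let p₂ : ℝ × E × C(TimeBox, E) →L[ℝ] E :=
    (ContinuousLinearMap.fst ℝ _ _).comp (ContinuousLinearMap.snd ℝ _ _)
  let p₃ : ℝ × E × C(TimeBox, E) →L[ℝ] C(TimeBox, E) :=
    (ContinuousLinearMap.snd ℝ _ _).comp (ContinuousLinearMap.snd ℝ _ _)
  -- At t = 0 the derivative in γ of the integral term disappears, so the derivative of Φ is a shear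
  -- and is inverted by changing signs.
  let e : (ℝ × E × C(TimeBox, E)) ≃L[ℝ] ℝ × E × C(TimeBox, E) :=
    ContinuousLinearEquiv.equivOfInverse
      (p₁.prod (p₂.prod (p₃ - cst.comp p₂ - p₁.smulRight w)))
      (p₁.prod (p₂.prod (p₃ + cst.comp p₂ + p₁.smulRight w)))
      (fun q => by
        refine Prod.ext rfl (Prod.ext rfl ?_)
        simp [p₁, p₂, p₃]
        abel)
      (fun q => by
        refine Prod.ext rfl (Prod.ext rfl ?_)
        simp [p₁, p₂, p₃]
        abel)
  have hd : HasFDerivAt Φ (e : ℝ × E × C(TimeBox, E) →L[ℝ] ℝ × E × C(TimeBox, E)) a := by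
    have h2 : HasFDerivAt (fun q : ℝ × E × C(TimeBox, E) => primitiveBox E (f.comp q.2.2))
        ((primitiveBox E).comp ((pointwiseApply TimeBox E E ((fderivC f hf).comp γ₀)).comp p₃)) a :=
      (primitiveBox E).hasFDerivAt.comp a (HasFDerivAt.comp (g := fun γ : C(TimeBox, E) => f.comp γ)
        a (hasFDerivAt_comp_continuousMap f hf γ₀) p₃.hasFDerivAt)
    have h3 := (p₁.hasFDerivAt (x := a)).smul h2
    have h4 := (p₁.hasFDerivAt (x := a)).prodMk ((p₂.hasFDerivAt (x := a)).prodMk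
      (((p₃ - cst.comp p₂).hasFDerivAt (x := a)).sub h3))
    refine h4.congr_fderiv ?_
    ext q <;> simp [e, a, p₁, p₂, p₃, w]
  have hc : ContDiffAt ℝ ∞ Φ a := hΦ.contDiffAt
  have hn : (∞ : WithTop ℕ∞) ≠ 0 := by simp
  have hΦa : Φ a = (0, z₀, 0) := by simp [Φ, a, γ₀]
  let Ψ := hc.localInverse hd hn
  have hΨ : ContDiffAt ℝ ∞ Ψ (Φ a) := hc.to_localInverse hd hn
  have hΨa : Ψ (Φ a) = a := hc.localInverse_apply_image hd hn
  have hr : ∀ᶠ y in 𝓝 (Φ a), Φ (Ψ y) = y :=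
    (hc.hasStrictFDerivAt' hd hn).eventually_right_inverse
  rw [hΦa] at hΨ hΨa hr
  have hι : ContDiff ℝ ∞ (fun p : ℝ × E => (p.1, p.2, (0 : C(TimeBox, E)))) :=
    contDiff_fst.prodMk (contDiff_snd.prodMk contDiff_const)
  refine ⟨fun p => (Ψ (p.1, p.2, 0)).2.2, ?_, ?_, ?_⟩
  · have h5 : ContDiffAt ℝ ∞ (fun p : ℝ × E => Ψ (p.1, p.2, 0)) (0, z₀) :=
      ContDiffAt.comp (0, z₀) hΨ hι.contDiffAt
    exact contDiff_snd.contDiffAt.comp _ (contDiff_snd.contDiffAt.comp _ h5)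
  · simp only [hΨa]; rfl
  · have ht : Filter.Tendsto (fun p : ℝ × E => (p.1, p.2, (0 : C(TimeBox, E)))) (𝓝 (0, z₀))
        (𝓝 (0, z₀, 0)) := hι.continuous.tendsto _
    filter_upwards [ht.eventually hr] with p hp
    have e1 : (Ψ (p.1, p.2, 0)).1 = p.1 := congrArg Prod.fst hp
    have e2 : (Ψ (p.1, p.2, 0)).2.1 = p.2 := congrArg (fun q => q.2.1) hp
    have e3 := congrArg (fun q => q.2.2) hp
    simp only [Φ, e1, e2] at e3
    rw [sub_sub, sub_eq_zero] at e3
    exact e3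

/-- Local flows of smooth vector fields on `E`: for `p = (t, z)` close to `(0, z₀)` the curve
`s ↦ Γ p s` is the integral curve of `t f` starting at `z`. -/
theorem exists_local_flow (f : E → E) (hf : ContDiff ℝ ∞ f) (z₀ : E) :
    ∃ Γ : ℝ × E → ℝ → E, ContDiffAt ℝ ∞ (fun p => Γ p 1) (0, z₀) ∧
      (∀ r > 0, ∀ᶠ p in 𝓝 ((0 : ℝ), z₀), ∀ s, Γ p s ∈ Metric.ball z₀ r) ∧
      ∀ᶠ p in 𝓝 ((0 : ℝ), z₀), Γ p 0 = p.2 ∧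
        ∀ s ∈ Ioo (-2 : ℝ) 2, HasDerivAt (Γ p) (p.1 • f (Γ p s)) s := by
  obtain ⟨Γ, h1, h2, h3⟩ := exists_local_flow_continuousMap ⟨f, hf.continuous⟩ hf z₀
  refine ⟨fun p => extendBox (Γ p), ?_, fun r hr => ?_, ?_⟩
  · exact (ContinuousMap.evalCLM ℝ _).contDiff.contDiffAt.comp (0, z₀) h1
  · have := h1.continuousAt.eventually (Metric.ball_mem_nhds _ hr)
    filter_upwards [this] with p hp s
    rw [h2] at hp
    exact ((ContinuousMap.dist_apply_le_dist _).trans_lt hp :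
      dist (Γ p (projIcc (-2) 2 (by norm_num) s)) z₀ < r)
  · filter_upwards [h3] with p hp
    have hval : ∀ s ∈ Icc (-2 : ℝ) 2, extendBox (Γ p) s =
        p.2 + p.1 • ∫ r in (0 : ℝ)..s, f (extendBox (Γ p) r) := by
      intro s hs
      rw [extendBox_of_mem _ hs]
      exact congrArg (fun η : C(TimeBox, E) => η ⟨s, hs⟩) hp
    refine ⟨by rw [hval 0 zero_mem_timeBox]; simp, fun s hs => ?_⟩
    have hcont : Continuous fun r => f (extendBox (Γ p) r) :=
      hf.continuous.comp (continuous_extendBox _)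
    have := (intervalIntegral.integral_hasDerivAt_right (hcont.intervalIntegrable 0 s)
      (hcont.stronglyMeasurableAtFilter _ _) hcont.continuousAt).const_smul p.1
    have h5 := this.const_add p.2
    refine h5.congr_of_eventuallyEq ?_
    filter_upwards [Ioo_mem_nhds hs.1 hs.2] with r hr
    exact hval r (Ioo_subset_Icc_self hr)

end LocalFlow

/-! ### The flow of a complete vector field -/

section Flow

theorem exists_contDiff_eventuallyEq {E W : Type*} [NormedAddCommGroup E] [NormedSpace ℝ E]
    [FiniteDimensional ℝ E] [NormedAddCommGroup W] [NormedSpace ℝ W] {f : E → W} {U : Set E}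
    {z₀ : E} (hU : IsOpen U) (hz : z₀ ∈ U) (hf : ContDiffOn ℝ ∞ f U) :
    ∃ f' : E → W, ContDiff ℝ ∞ f' ∧ f' =ᶠ[𝓝 z₀] f := by
  obtain ⟨ε, hε, hs⟩ := Metric.nhds_basis_closedBall.mem_iff.1 (hU.mem_nhds hz)
  let χ : ContDiffBump z₀ := ⟨ε / 2, ε, by positivity, by linarith⟩
  refine ⟨fun z => χ z • f z, ?_, ?_⟩
  · rw [contDiff_iff_contDiffAt]
    intro z
    by_cases hz : z ∈ tsupport (fun z => χ z • f z)
    swap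
    · refine (contDiffAt_const (c := (0 : W))).congr_of_eventuallyEq ?_
      exact notMem_tsupport_iff_eventuallyEq.1 hz
    have h1 : z ∈ tsupport χ := tsupport_smul_subset_left (fun z => χ z) f hz
    rw [χ.tsupport_eq] at h1
    exact χ.contDiffAt.smul (hf.contDiffAt (hU.mem_nhds (hs h1)))
  · filter_upwards [χ.eventuallyEq_one] with z hz
    rw [hz]; simp

variable {n : ℕ} {M : Type*} [TopologicalSpace M] [T2Space M] [ChartedSpace (Model n) M]
  [IsManifold (𝓡 n) ∞ M] {X : VectorField n M}

theorem mfderiv_symm_crd {x₀ : M} {z : Model n} (hz : z ∈ (extChartAt (𝓡 n) x₀).target)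
    (v : TangentSpace (𝓡 n) ((extChartAt (𝓡 n) x₀).symm z)) :
    mfderiv 𝓘(ℝ, Model n) (𝓡 n) (extChartAt (𝓡 n) x₀).symm z (crd (Model n) x₀ v) = v := by
  have hs := (extChartAt (𝓡 n) x₀).map_target hz
  rw [extChartAt_source] at hs
  have h1 := (trivializationAt (Model n) (fun x : M => TangentSpace (𝓡 n) x) x₀).symmL_continuousLinearMapAt
    (R := ℝ) (b := (extChartAt (𝓡 n) x₀).symm z) hs v
  rw [TangentBundle.symmL_trivializationAt hs, (extChartAt (𝓡 n) x₀).right_inv hz] at h1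
  simp only [modelWithCornersSelf_coe, range_id, mfderivWithin_univ] at h1
  exact h1

theorem contDiffOn_crd_chart (hX : IsSmoothField X) (x₀ : M) :
    ContDiffOn ℝ ∞ (fun z => crd (Model n) x₀ (X ((extChartAt (𝓡 n) x₀).symm z)))
      (extChartAt (𝓡 n) x₀).target := by
  have h1 := (trivializationAt (Model n) (fun x : M => TangentSpace (𝓡 n) x)
    x₀).contMDiffOn_section_baseSet_iff.1 (contMDiffOn_univ.2 hX |>.mono (subset_univ _))
  rw [← contMDiffOn_iff_contDiffOn]
  have h2 := h1.comp (contMDiffOn_extChartAt_symm (I := 𝓡 n) (n := ∞) x₀) (fun z hz => by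
    have hs := (extChartAt (𝓡 n) x₀).map_target hz
    rw [extChartAt_source] at hs
    exact hs)
  refine h2.congr fun z hz => ?_
  have hs := (extChartAt (𝓡 n) x₀).map_target hz
  rw [extChartAt_source] at hs
  rw [crd, Bundle.Trivialization.continuousLinearMapAt_apply,
    Bundle.Trivialization.linearMapAt_apply, if_pos (by simpa using hs)]
  rfl

theorem IsSmoothField.of_le_one (hX : IsSmoothField X) : ContMDiff (𝓡 n) (𝓡 n).tangent 1
    (fun x => (⟨x, X x⟩ : TangentBundle (𝓡 n) M)) := ContMDiff.of_le hX (by simp)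

variable (X) in
/-- `θ` is the flow of `X`. -/
structure IsFlow (θ : ℝ → M → M) : Prop where
  zero : ∀ x, θ 0 x = x
  add : ∀ s t x, θ (s + t) x = θ s (θ t x)
  curve : ∀ x, IsMIntegralCurve (I := 𝓡 n) (fun t => θ t x) X

/-- A global integral curve is chosen through each point. The group law is the uniqueness of
integral curves on the Hausdorff manifold M. -/
theorem exists_isFlow (hX : IsSmoothField X) (hc : IsCompleteField X) : ∃ θ, IsFlow X θ := by
  choose γ h0 h1 using hc
  refine ⟨fun t x => γ x t, h0, fun s t x => ?_, h1⟩
  have h2 : γ x ∘ (· + t) = γ (γ x t) :=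
    isMIntegralCurve_Ioo_eq_of_contMDiff_boundaryless (t₀ := 0) hX.of_le_one ((h1 x).comp_add t)
      (h1 _) (by simp [h0])
  exact congrFun h2 s

namespace IsFlow

variable {θ : ℝ → M → M}

theorem neg_comp (h : IsFlow X θ) (t : ℝ) (x : M) : θ (-t) (θ t x) = x := by
  rw [← h.add, neg_add_cancel, h.zero]

theorem comp_neg (h : IsFlow X θ) (t : ℝ) (x : M) : θ t (θ (-t) x) = x := by
  rw [← h.add, add_neg_cancel, h.zero]

theorem continuous_curve (h : IsFlow X θ) (x : M) : Continuous fun t => θ t x :=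
  continuous_iff_continuousAt.2 fun t => (h.curve x t).continuousAt

/-- In a chart the flow near time 0 is the local flow Γ evaluated at parameter 1. Both s ↦ θ(s t)
and s ↦ Γ(t, z)(s) are integral curves of t X on (-2, 2), an interval having both 0 and 1 in its
interior, so they agree at s = 1. -/
theorem contMDiffAt_zero (h : IsFlow X θ) (hX : IsSmoothField X) (y : M) :
    ContMDiffAt (𝓘(ℝ, ℝ).prod (𝓡 n)) (𝓡 n) ∞ (fun p : ℝ × M => θ p.1 p.2) (0, y) := by
  set φ := extChartAt (𝓡 n) y
  have hop : IsOpen φ.target := isOpen_extChartAt_target y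
  obtain ⟨f, hf, hfe⟩ := exists_contDiff_eventuallyEq hop (mem_extChartAt_target y)
    (contDiffOn_crd_chart hX y)
  obtain ⟨r, hr, hball⟩ := Metric.mem_nhds_iff.1
    (Filter.inter_mem hfe (hop.mem_nhds (mem_extChartAt_target y)))
  obtain ⟨Γ, hΓ, hΓb, hΓd⟩ := exists_local_flow f hf (φ y)
  have key : ∀ᶠ p in 𝓝 ((0 : ℝ), φ y), θ p.1 (φ.symm p.2) = φ.symm (Γ p 1) := by
    filter_upwards [hΓb r hr, hΓd] with p hp hpd
    have h1 : IsMIntegralCurveOn (I := 𝓡 n) (fun s => φ.symm (Γ p s)) (p.1 • X) (Ioo (-2) 2) := by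
      intro s hs
      have hz := hball (hp s)
      have hd : HasMFDerivAt 𝓘(ℝ, Model n) (𝓡 n) φ.symm (Γ p s)
          (mfderiv 𝓘(ℝ, Model n) (𝓡 n) φ.symm (Γ p s)) :=
        (((contMDiffOn_extChartAt_symm (I := 𝓡 n) (n := ∞) y).contMDiffAt
          (hop.mem_nhds hz.2)).mdifferentiableAt (by simp)).hasMFDerivAt
      have hd2 : HasMFDerivAt 𝓘(ℝ, ℝ) 𝓘(ℝ, Model n) (Γ p) s _ := (hpd.2 s hs).hasFDerivAt.hasMFDerivAt
      refine ((hd.comp s hd2).hasMFDerivWithinAt).congr_mfderiv ?_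
      have e1 : f (Γ p s) = crd (Model n) y (X (φ.symm (Γ p s))) := hz.1
      ext
      change (mfderiv 𝓘(ℝ, Model n) (𝓡 n) φ.symm (Γ p s) ((1 : ℝ) • p.1 • f (Γ p s)) : Model n) =
        (1 : ℝ) • p.1 • X (φ.symm (Γ p s))
      rw [one_smul, one_smul, e1]
      have := congrArg (fun v => (p.1 • v : Model n)) (mfderiv_symm_crd hz.2 (X (φ.symm (Γ p s))))
      exact (map_smul (mfderiv 𝓘(ℝ, Model n) (𝓡 n) φ.symm (Γ p s)) p.1
        (crd (Model n) y (X (φ.symm (Γ p s))))).trans this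
    have h2 : IsMIntegralCurve (I := 𝓡 n) ((fun t => θ t (φ.symm p.2)) ∘ (· * p.1)) (p.1 • X) :=
      (h.curve _).comp_mul p.1
    have hsm : IsSmoothField (p.1 • X) := IsSmoothField.const_smul p.1 hX
    have h3 := isMIntegralCurveOn_Ioo_eqOn_of_contMDiff_boundaryless (t₀ := 0)
      (by norm_num) hsm.of_le_one (h2.isMIntegralCurveOn (Ioo (-2) 2)) h1
      (by simp [h.zero, hpd.1])
    simpa using h3 (show (1 : ℝ) ∈ Ioo (-2) 2 by norm_num)
  have hΓ0 : Γ (0, φ y) 1 ∈ φ.target := by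
    exact (hball ((hΓb r hr).self_of_nhds 1)).2
  have hcomp : ContMDiffAt (𝓘(ℝ, ℝ).prod (𝓡 n)) (𝓡 n) ∞
      (fun p : ℝ × M => φ.symm (Γ (p.1, φ p.2) 1)) (0, y) := by
    have a1 : ContMDiffAt 𝓘(ℝ, ℝ × Model n) 𝓘(ℝ, Model n) ∞ (fun p => Γ p 1) (0, φ y) :=
      hΓ.contMDiffAt
    rw [modelWithCornersSelf_prod, ← chartedSpaceSelf_prod] at a1
    have a2 : ContMDiffAt (𝓘(ℝ, ℝ).prod (𝓡 n)) (𝓘(ℝ, ℝ).prod 𝓘(ℝ, Model n)) ∞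
        (fun p : ℝ × M => (p.1, φ p.2)) (0, y) :=
      contMDiffAt_fst.prodMk ((contMDiffAt_extChartAt (I := 𝓡 n) (x := y)).comp ((0 : ℝ), y)
        contMDiffAt_snd)
    have a3 : ContMDiffAt 𝓘(ℝ, Model n) (𝓡 n) ∞ φ.symm (Γ (0, φ y) 1) :=
      (contMDiffOn_extChartAt_symm (I := 𝓡 n) (n := ∞) y).contMDiffAt (hop.mem_nhds hΓ0)
    exact a3.comp ((0 : ℝ), y) (a1.comp ((0 : ℝ), y) a2)
  refine hcomp.congr_of_eventuallyEq ?_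
  have hc : ContinuousAt (fun p : ℝ × M => (p.1, φ p.2)) (0, y) :=
    continuousAt_fst.prodMk ((continuousAt_extChartAt (I := 𝓡 n) y).comp continuousAt_snd)
  filter_upwards [hc.eventually key, continuousAt_snd.eventually
    (extChartAt_source_mem_nhds (I := 𝓡 n) y)] with p hp hps
  simp only [φ.left_inv hps] at hp
  exact hp

/-- For fixed x the set A of times at which the flow is C^k at (t, x) is open and closed in ℝ and
contains 0. The order k is kept finite so that being C^k at a point extends to a neighbourhood. -/
theorem smooth (h : IsFlow X θ) (hX : IsSmoothField X) :
    ContMDiff (𝓘(ℝ, ℝ).prod (𝓡 n)) (𝓡 n) ∞ (fun p : ℝ × M => θ p.1 p.2) := by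
  refine contMDiff_infty.2 fun k => ?_
  rintro ⟨t, x⟩
  set A : Set ℝ := {t | ContMDiffAt (𝓘(ℝ, ℝ).prod (𝓡 n)) (𝓡 n) k
    (fun p : ℝ × M => θ p.1 p.2) (t, x)}
  -- Around any t, by θ_{s'} = θ_{s'-s} ∘ θ_s and regularity at small times, one regular time s in N
  -- makes every s' in N regular. Symmetry in s and s' gives openness of both A and its complement.
  have hloc : ∀ t, ∃ N ∈ 𝓝 t, ∀ s ∈ N, ∀ s' ∈ N, s ∈ A → s' ∈ A := by
    intro t
    have : IsManifold (𝓡 n) k M := IsManifold.of_le (n := ∞) (by exact_mod_cast le_top)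
    have h1 := (contMDiffAt_iff_contMDiffAt_nhds (n := k) (by simp)).1
      (ContMDiffAt.of_le (h.contMDiffAt_zero hX (θ t x)) (by exact_mod_cast le_top))
    have h2 : Filter.Tendsto (fun q : ℝ × ℝ => (q.2 - q.1, θ q.1 x)) (𝓝 (t, t))
        (𝓝 (0, θ t x)) := by
      have hcc : Continuous (fun q : ℝ × ℝ => (q.2 - q.1, θ q.1 x)) :=
        (continuous_snd.sub continuous_fst).prodMk ((h.continuous_curve x).comp continuous_fst)
      have := hcc.tendsto (t, t)
      simpa using this
    have h3 := h2.eventually h1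
    rw [nhds_prod_eq] at h3
    obtain ⟨N, hN, hNN⟩ := Filter.mem_prod_same_iff.1 h3
    refine ⟨N, hN, fun s hs s' hs' hA => ?_⟩
    have h4 : ContMDiffAt (𝓘(ℝ, ℝ).prod (𝓡 n)) (𝓡 n) k (fun p : ℝ × M => θ p.1 p.2)
        (s' - s, θ s x) := hNN (mk_mem_prod hs hs')
    have h5 : ContMDiffAt (𝓘(ℝ, ℝ).prod (𝓡 n)) (𝓘(ℝ, ℝ).prod (𝓡 n)) k
        (fun p : ℝ × M => (p.1 - s, θ s p.2)) (s', x) := by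
      refine ContMDiffAt.prodMk ?_ ?_
      · have e1 : ContMDiff 𝓘(ℝ, ℝ) 𝓘(ℝ, ℝ) k (fun r : ℝ => r - s) :=
          (contDiff_id.sub contDiff_const).contMDiff
        exact e1.contMDiffAt.comp (s', x) contMDiffAt_fst
      · have e2 : ContMDiffAt (𝓡 n) (𝓡 n) k (fun z => θ s z) x :=
          ContMDiffAt.comp (g := fun p : ℝ × M => θ p.1 p.2) x hA
            (contMDiffAt_const.prodMk contMDiffAt_id)
        exact e2.comp (s', x) contMDiffAt_snd
    have h6 := ContMDiffAt.comp (s', x) h4 h5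
    refine h6.congr_of_eventuallyEq (Filter.Eventually.of_forall fun p => ?_)
    change θ p.1 p.2 = θ (p.1 - s) (θ s p.2)
    rw [← h.add, sub_add_cancel]
  have hclopen : IsClopen A := by
    refine ⟨⟨isOpen_iff_mem_nhds.2 fun t ht => ?_⟩, isOpen_iff_mem_nhds.2 fun t ht => ?_⟩ <;>
    obtain ⟨N, hN, hN2⟩ := hloc t
    · exact Filter.mem_of_superset hN fun s hs hsA => ht (hN2 s hs t (mem_of_mem_nhds hN) hsA)
    · exact Filter.mem_of_superset hN fun s hs => hN2 t (mem_of_mem_nhds hN) s hs ht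
  have h0 : (0 : ℝ) ∈ A := (h.contMDiffAt_zero hX x).of_le (by exact_mod_cast le_top)
  have : t ∈ A := by rw [hclopen.eq_univ ⟨0, h0⟩]; trivial
  exact this

theorem smooth_apply (h : IsFlow X θ) (hX : IsSmoothField X) (t : ℝ) :
    ContMDiff (𝓡 n) (𝓡 n) ∞ (θ t) :=
  (h.smooth hX).comp (contMDiff_const.prodMk contMDiff_id)

theorem hasDerivAt_comp (h : IsFlow X θ) {f : M → ℝ} (hf : IsSmoothFn n M f) (t : ℝ) (x : M) :
    HasDerivAt (fun s => f (θ s x)) (dirDeriv X f (θ t x)) t := by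
  have h1 := ((hf.mdiff (θ t x)).hasMFDerivAt).comp t (h.curve x t)
  obtain ⟨L, hL, hL1⟩ : ∃ L : ℝ →L[ℝ] ℝ, HasFDerivAt (fun s => f (θ s x)) L t ∧
      L 1 = dirDeriv X f (θ t x) := by
    refine ⟨_, h1.hasFDerivAt, ?_⟩
    change mfderiv (𝓡 n) 𝓘(ℝ, ℝ) f (θ t x) ((1 : ℝ) • X (θ t x)) = _
    rw [one_smul]; rfl
  exact hL.hasDerivAt.congr_deriv hL1

/-- The flow as a family of diffeomorphisms. -/
def diffeo (h : IsFlow X θ) (hX : IsSmoothField X) (t : ℝ) : M ≃ₘ^∞⟮𝓡 n, 𝓡 n⟯ M where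
  toFun := θ t
  invFun := θ (-t)
  left_inv := h.neg_comp t
  right_inv := h.comp_neg t
  contMDiff_toFun := h.smooth_apply hX t
  contMDiff_invFun := h.smooth_apply hX (-t)

/-- Reparametrized flows have the velocity of the parameter. -/
theorem isVelocity (h : IsFlow X θ) (hX : IsSmoothField X) (t : ℝ) (r : ℝ) :
    IsVelocity univ t (fun s => θ (r * (s - t))) (r • X) where
  mem := mem_univ _
  unique := uniqueDiffOn_univ
  closure := by simp
  smooth x := by
    have e1 : ContMDiff 𝓘(ℝ, ℝ) 𝓘(ℝ, ℝ) ∞ (fun s : ℝ => r * (s - t)) :=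
      (contDiff_const.mul (contDiff_id.sub contDiff_const)).contMDiff
    exact ((h.smooth hX).comp ((e1.comp contMDiff_fst).prodMk contMDiff_snd) _).contMDiffWithinAt
  id x := by simp [h.zero]
  deriv f hf x := by
    have h1 : HasDerivAt (fun s : ℝ => r * (s - t)) r t := by
      simpa using ((hasDerivAt_id t).sub_const t).const_mul r
    have h2 : HasDerivAt (fun s => f (θ s x)) (dirDeriv X f x) (r * (t - t)) := by
      have := h.hasDerivAt_comp hf 0 x
      rw [h.zero] at this
      simpa using this
    refine ((h2.comp t h1).congr_deriv ?_).hasDerivWithinAt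
    change _ = mfderiv (𝓡 n) 𝓘(ℝ, ℝ) f x (r • X x)
    rw [mul_comm]
    exact (map_smul (mfderiv (𝓡 n) 𝓘(ℝ, ℝ) f x) r (X x)).symm

end IsFlow

end Flow

/-! ### Exact Courant algebroids -/

theorem clm_bijective {E G : Type*} [AddCommGroup E] [Module ℝ E] [AddCommGroup G] [Module ℝ G]
    [FiniteDimensional ℝ E] [FiniteDimensional ℝ G] (A : E →ₗ[ℝ] G)
    (hinj : ∀ x, A x = 0 → x = 0) (hd : Module.finrank ℝ E = Module.finrank ℝ G) :
    Function.Bijective A := by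
  have hi : Function.Injective A := (injective_iff_map_eq_zero A).2 hinj
  exact ⟨hi, (LinearMap.injective_iff_surjective_of_finrank_eq_finrank hd).1 hi⟩

section Inverse

variable {E G : Type*} [AddCommGroup E] [Module ℝ E] [TopologicalSpace E]
  [IsTopologicalAddGroup E] [ContinuousSMul ℝ E] [T2Space E] [FiniteDimensional ℝ E]
  [AddCommGroup G] [Module ℝ G] [TopologicalSpace G]
  [IsTopologicalAddGroup G] [ContinuousSMul ℝ G] [T2Space G] [FiniteDimensional ℝ G]

theorem inverse_spec (A : E →L[ℝ] G) (h : Function.Bijective A) :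
    (∀ y, A (A.inverse y) = y) ∧ ∀ x, A.inverse (A x) = x := by
  let e : E ≃L[ℝ] G := (LinearEquiv.ofBijective (A : E →ₗ[ℝ] G) h).toContinuousLinearEquiv
  have he : (e : E →L[ℝ] G) = A := by ext; rfl
  rw [← he, ContinuousLinearMap.inverse_equiv]
  exact ⟨e.apply_symm_apply, e.symm_apply_apply⟩

theorem finrank_clm_dual : Module.finrank ℝ (E →L[ℝ] ℝ) = Module.finrank ℝ E := by
  rw [← (LinearMap.toContinuousLinearMap (𝕜 := ℝ) (E := E) (F' := ℝ)).finrank_eq]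
  exact Subspace.dual_finrank_eq

theorem finiteDimensional_clm_dual : FiniteDimensional ℝ (E →L[ℝ] ℝ) :=
  Module.Finite.equiv (LinearMap.toContinuousLinearMap (𝕜 := ℝ) (E := E) (F' := ℝ))

theorem bijective_of_nondegenerate (B : E →L[ℝ] E →L[ℝ] ℝ) (h : ∀ a, (∀ b, B a b = 0) → a = 0) :
    Function.Bijective B := by
  have := finiteDimensional_clm_dual (E := E)
  refine clm_bijective (B : E →ₗ[ℝ] E →L[ℝ] ℝ) (fun a ha => h a fun b => ?_) finrank_clm_dual.symm
  have := congrArg (fun L : E →L[ℝ] ℝ => L b) ha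
  exact this

end Inverse

section Courant

variable {n : ℕ} {M : Type*} [TopologicalSpace M] [T2Space M] [ChartedSpace (Model n) M]
  [IsManifold (𝓡 n) ∞ M]
  {F : Type*} [NormedAddCommGroup F] [NormedSpace ℝ F] [FiniteDimensional ℝ F]
  {V : M → Type*} [TopologicalSpace (TotalSpace F V)]
  [∀ x, AddCommGroup (V x)] [∀ x, Module ℝ (V x)] [∀ x, TopologicalSpace (V x)]
  [∀ x, IsTopologicalAddGroup (V x)] [∀ x, ContinuousSMul ℝ (V x)]
  [FiberBundle F V] [VectorBundle ℝ F V] [ContMDiffVectorBundle ∞ F V (𝓡 n)]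
  {EN : Type*} [NormedAddCommGroup EN] [NormedSpace ℝ EN] {HN : Type*} [TopologicalSpace HN]
  {J : ModelWithCorners ℝ EN HN} {N : Type*} [TopologicalSpace N] [ChartedSpace HN N]

theorem contMDiffWithinAt_covector {f : N → M} {A : Π p, V (f p) →L[ℝ] ℝ} {S : Set N} {p₀ : N}
    (hp : p₀ ∈ S) (hf : ContMDiffWithinAt J (𝓡 n) ∞ f S p₀)
    (hA : ∀ s : Π x, V x, IsSmoothSection (n := n) F s →
      ContMDiffWithinAt J 𝓘(ℝ, ℝ) ∞ (fun p => A p (s (f p))) S p₀) :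
    ContMDiffWithinAt J ((𝓡 n).prod 𝓘(ℝ, F →L[ℝ] ℝ)) ∞
      (fun p => TotalSpace.mk' (F →L[ℝ] ℝ) (E := fun x : M => V x →L[ℝ] ℝ) (f p) (A p)) S p₀ := by
  refine contMDiffWithinAt_hom (V₂ := Bundle.Trivial M ℝ) hp hf fun s hs => ?_
  rw [contMDiffWithinAt_totalSpace]
  exact ⟨hf, hA s hs⟩

theorem contMDiffWithinAt_covector_apply {f : N → M} {A : Π p, V (f p) →L[ℝ] ℝ}
    {v : Π p, V (f p)} {S : Set N} {p₀ : N}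
    (hA : ContMDiffWithinAt J ((𝓡 n).prod 𝓘(ℝ, F →L[ℝ] ℝ)) ∞
      (fun p => TotalSpace.mk' (F →L[ℝ] ℝ) (E := fun x : M => V x →L[ℝ] ℝ) (f p) (A p)) S p₀)
    (hv : ContMDiffWithinAt J ((𝓡 n).prod 𝓘(ℝ, F)) ∞ (fun p => TotalSpace.mk' F (f p) (v p)) S p₀) :
    ContMDiffWithinAt J 𝓘(ℝ, ℝ) ∞ (fun p => A p (v p)) S p₀ := by
  have h := ContMDiffWithinAt.clm_bundle_apply (E₂ := Bundle.Trivial M ℝ) (F₂ := ℝ) hA hv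
  rw [contMDiffWithinAt_totalSpace] at h
  exact h.2

theorem isSmoothField_covector_apply {ξ : CovectorField n M}
    (hξ : IsSmoothSection (n := n) (Model n →L[ℝ] ℝ)
      (V := fun x : M => TangentSpace (𝓡 n) x →L[ℝ] ℝ) ξ) : IsSmoothCovector ξ := fun _ hY x =>
  contMDiffWithinAt_univ.1 (contMDiffWithinAt_covector_apply (hξ x).contMDiffWithinAt
    (ContMDiffAt.contMDiffWithinAt (hY x)))

theorem contMDiffWithinAt_section_add {f : N → M} {v w : Π p, V (f p)} {S : Set N} {p₀ : N}
    (hp : p₀ ∈ S)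
    (hv : ContMDiffWithinAt J ((𝓡 n).prod 𝓘(ℝ, F)) ∞ (fun p => TotalSpace.mk' F (f p) (v p)) S p₀)
    (hw : ContMDiffWithinAt J ((𝓡 n).prod 𝓘(ℝ, F)) ∞ (fun p => TotalSpace.mk' F (f p) (w p)) S p₀) :
    ContMDiffWithinAt J ((𝓡 n).prod 𝓘(ℝ, F)) ∞
      (fun p => TotalSpace.mk' F (f p) (v p + w p)) S p₀ := by
  rw [contMDiffWithinAt_totalSpace_iff_crd hp] at hv hw ⊢
  refine ⟨hv.1, ?_⟩
  simp only [crd_add]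
  exact hv.2.add hw.2

theorem finiteDimensional_fibre (F : Type*) [NormedAddCommGroup F] [NormedSpace ℝ F]
    [FiniteDimensional ℝ F] (V : M → Type*) [TopologicalSpace (TotalSpace F V)]
    [∀ x, AddCommGroup (V x)] [∀ x, Module ℝ (V x)] [∀ x, TopologicalSpace (V x)]
    [FiberBundle F V] [VectorBundle ℝ F V] (x : M) : FiniteDimensional ℝ (V x) :=
  Module.Finite.equiv ((trivializationAt F V x).continuousLinearEquivAt ℝ x
    (mem_baseSet_trivializationAt F V x)).symm.toLinearEquiv

theorem t2Space_fibre (F : Type*) [NormedAddCommGroup F] [NormedSpace ℝ F]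
    (V : M → Type*) [TopologicalSpace (TotalSpace F V)]
    [∀ x, AddCommGroup (V x)] [∀ x, Module ℝ (V x)] [∀ x, TopologicalSpace (V x)]
    [FiberBundle F V] [VectorBundle ℝ F V] (x : M) : T2Space (V x) :=
  ((trivializationAt F V x).continuousLinearEquivAt ℝ x
    (mem_baseSet_trivializationAt F V x)).toHomeomorph.symm.t2Space

namespace CourantData

variable {C : CourantData n V} {x : M} {G : Π x, V x →L[ℝ] V x}

namespace IsExact

theorem ext (hC : C.IsExact F) {a b : V x} (h : ∀ e, C.pairing x a e = C.pairing x b e) :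
    a = b := by
  refine sub_eq_zero.1 (hC.nondegenerate x _ fun e => ?_)
  rw [map_sub, _root_.sub_apply, h, sub_self]

theorem pairing_bijective (hC : C.IsExact F) (x : M) : Function.Bijective (C.pairing x) := by
  have := finiteDimensional_fibre F V x
  have := t2Space_fibre F V x
  exact bijective_of_nondegenerate _ (hC.nondegenerate x)

theorem pairing_coanchor (hC : C.IsExact F) (α : TangentSpace (𝓡 n) x →L[ℝ] ℝ) (e : V x) :
    C.pairing x (C.coanchor x α) e = α (C.anchor x e) := by
  have := finiteDimensional_fibre F V x
  have := t2Space_fibre F V x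
  have := finiteDimensional_clm_dual (E := V x)
  have h := (inverse_spec (C.pairing x) (hC.pairing_bijective x)).1
    (ContinuousLinearMap.precomp ℝ (C.anchor x) α)
  exact congrArg (fun L : V x →L[ℝ] ℝ => L e) h

theorem pairing_coanchor_right (hC : C.IsExact F) (α : TangentSpace (𝓡 n) x →L[ℝ] ℝ) (e : V x) :
    C.pairing x e (C.coanchor x α) = α (C.anchor x e) := by
  rw [hC.symm, hC.pairing_coanchor]

theorem anchor_coanchor (hC : C.IsExact F) (α : TangentSpace (𝓡 n) x →L[ℝ] ℝ) :
    C.anchor x (C.coanchor x α) = 0 := (hC.range_coanchor x _).2 ⟨α, rfl⟩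

theorem smooth_pairing_comp (hC : C.IsExact F) {f : N → M} {v w : Π p, V (f p)} {S : Set N} {p₀ : N}
    (hp : p₀ ∈ S)
    (hv : ContMDiffWithinAt J ((𝓡 n).prod 𝓘(ℝ, F)) ∞ (fun p => TotalSpace.mk' F (f p) (v p)) S p₀)
    (hw : ContMDiffWithinAt J ((𝓡 n).prod 𝓘(ℝ, F)) ∞ (fun p => TotalSpace.mk' F (f p) (w p)) S p₀) :
    ContMDiffWithinAt J 𝓘(ℝ, ℝ) ∞ (fun p => C.pairing (f p) (v p) (w p)) S p₀ := by
  have hf := contMDiffWithinAt_base hv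
  refine contMDiffWithinAt_apply_section (n := n) (F := F) (V := V)
    (A := fun p => (C.pairing (f p) (v p)).toLinearMap) hp (fun s hs => ?_) hw
  have h1 := contMDiffWithinAt_apply_section (n := n) (F := F) (V := V) (W := ℝ)
    (A := fun p => (C.pairing (f p) (s (f p))).toLinearMap) hp (fun s' hs' =>
      ContMDiffAt.comp_contMDiffWithinAt p₀ (hC.smooth_pairing s s' hs hs' (f p₀)) hf) hv
  refine h1.congr_of_eventuallyEq_of_mem (Filter.Eventually.of_forall fun p => ?_) hp
  exact hC.symm _ _ _

theorem smooth_anchor_comp (hC : C.IsExact F) {f : N → M} {v : Π p, V (f p)} {S : Set N} {p₀ : N}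
    (hp : p₀ ∈ S)
    (hv : ContMDiffWithinAt J ((𝓡 n).prod 𝓘(ℝ, F)) ∞ (fun p => TotalSpace.mk' F (f p) (v p)) S p₀) :
    ContMDiffWithinAt J ((𝓡 n).prod 𝓘(ℝ, Model n)) ∞ (fun p => TotalSpace.mk' (Model n)
      (E := fun x : M => TangentSpace (𝓡 n) x) (f p) (C.anchor (f p) (v p))) S p₀ :=
  contMDiffWithinAt_map_section (n := n) (F := F) (V := V) (F₂ := Model n)
    (V₂ := fun x : M => TangentSpace (𝓡 n) x)
    (A := fun p => (C.anchor (f p)).toLinearMap) hp (fun s hs =>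
      ContMDiffAt.comp_contMDiffWithinAt p₀ (hC.smooth_anchor s hs (f p₀))
        (contMDiffWithinAt_base hv)) hv

/-- The map π* is defined through the inverse of the pairing, so its values are recovered as the
solutions of an invertible smooth linear equation. -/
theorem smooth_coanchor_comp (hC : C.IsExact F) {f : N → M}
    {α : Π p, TangentSpace (𝓡 n) (f p) →L[ℝ] ℝ} {S : Set N} {p₀ : N} (hp : p₀ ∈ S)
    (hf : ContMDiffWithinAt J (𝓡 n) ∞ f S p₀)
    (hα : ∀ Y, IsSmoothField Y → ContMDiffWithinAt J 𝓘(ℝ, ℝ) ∞ (fun p => α p (Y (f p))) S p₀) :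
    ContMDiffWithinAt J ((𝓡 n).prod 𝓘(ℝ, F)) ∞
      (fun p => TotalSpace.mk' F (f p) (C.coanchor (f p) (α p))) S p₀ := by
  refine contMDiffWithinAt_of_map_section (n := n) (F := F) (V := V) (F₂ := F →L[ℝ] ℝ)
    (V₂ := fun x : M => V x →L[ℝ] ℝ) (f := f) (h := f)
    (A := fun p => (C.pairing (f p)).toLinearMap) hp hf (fun s hs => ?_)
    (hC.pairing_bijective _) ?_
  · exact contMDiffWithinAt_covector hp hf fun s' hs' =>
      ContMDiffAt.comp_contMDiffWithinAt p₀ (hC.smooth_pairing s s' hs hs' (f p₀)) hf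
  · refine contMDiffWithinAt_covector (A := fun p => C.pairing (f p) (C.coanchor (f p) (α p)))
      hp hf fun s hs => ?_
    simp only [hC.pairing_coanchor]
    exact hα _ (hC.smooth_anchor s hs)

theorem smooth_coanchor (hC : C.IsExact F) {ξ : CovectorField n M} (hξ : IsSmoothCovector ξ) :
    IsSmoothSection (n := n) F (fun x => C.coanchor x (ξ x)) := fun x =>
  contMDiffWithinAt_univ.1 (hC.smooth_coanchor_comp (f := id) (mem_univ x)
    contMDiff_id.contMDiffAt.contMDiffWithinAt fun Y hY => (hξ Y hY x).contMDiffWithinAt)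

end IsExact

namespace IsGenMetric

theorem apply_apply (hG : C.IsGenMetric F G) (hC : C.IsExact F) (a : V x) : G x (G x a) = a :=
  hC.ext fun b => by rw [hG.symm, hG.orthogonal, hC.symm]

/-- The kernel of π is the isotropic image of π*, whereas the pairing is positive on the
1-eigenspace of G. -/
theorem eq_zero_of_anchor (hG : C.IsGenMetric F G) (hC : C.IsExact F) {a : V x}
    (h : C.anchor x a = 0) (ha : G x a = a) : a = 0 := by
  by_contra hne
  obtain ⟨α, rfl⟩ := (hC.range_coanchor x a).1 h
  have h1 := hG.pos x _ hne
  rw [ha, hC.pairing_coanchor, hC.anchor_coanchor, map_zero] at h1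
  exact lt_irrefl _ h1

/-- `π G π* : T*M → TM` is invertible. -/
theorem bijective_anchor_coanchor (hG : C.IsGenMetric F G) (hC : C.IsExact F) (x : M) :
    Function.Bijective (C.anchor x ∘L G x ∘L C.coanchor x) := by
  have := finiteDimensional_clm_dual (E := TangentSpace (𝓡 n) x)
  refine clm_bijective (C.anchor x ∘L G x ∘L C.coanchor x).toLinearMap (fun α hα => ?_)
    finrank_clm_dual
  by_contra hne
  have h1 := hG.pos x (C.coanchor x α) (fun h => hne (hC.coanchor_injective x (by rw [h, map_zero])))
  have h2 : C.anchor x (G x (C.coanchor x α)) = 0 := hα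
  rw [hC.pairing_coanchor_right, h2, map_zero] at h1
  exact lt_irrefl _ h1

/-- The map π* + G π* takes values in the 1-eigenspace because G² = 1. Its composite with π is the
invertible map π G π*, so precomposing with the inverse of the latter gives σ₊. -/
theorem exists_sigmaPlus (hG : C.IsGenMetric F G) (hC : C.IsExact F) (x : M) :
    ∃ s : TangentSpace (𝓡 n) x →L[ℝ] V x, ∀ u, C.anchor x (s u) = u ∧ G x (s u) = s u := by
  have := finiteDimensional_clm_dual (E := TangentSpace (𝓡 n) x)
  set γ := C.anchor x ∘L G x ∘L C.coanchor x
  have hγ := (inverse_spec γ (hG.bijective_anchor_coanchor hC x)).1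
  refine ⟨(C.coanchor x + G x ∘L C.coanchor x) ∘L γ.inverse, fun u => ⟨?_, ?_⟩⟩
  · change C.anchor x (C.coanchor x (γ.inverse u) + G x (C.coanchor x (γ.inverse u))) = u
    rw [map_add, hC.anchor_coanchor, zero_add]
    exact hγ u
  · change G x (C.coanchor x (γ.inverse u) + G x (C.coanchor x (γ.inverse u))) =
      C.coanchor x (γ.inverse u) + G x (C.coanchor x (γ.inverse u))
    rw [map_add, hG.apply_apply hC, add_comm]

theorem sigmaPlus_spec (hG : C.IsGenMetric F G) (hC : C.IsExact F) (u : TangentSpace (𝓡 n) x) :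
    C.anchor x (C.sigmaPlus G x u) = u ∧ G x (C.sigmaPlus G x u) = C.sigmaPlus G x u :=
  Classical.epsilon_spec (hG.exists_sigmaPlus hC x) u

theorem anchor_sigmaPlus (hG : C.IsGenMetric F G) (hC : C.IsExact F) (u : TangentSpace (𝓡 n) x) :
    C.anchor x (C.sigmaPlus G x u) = u := (hG.sigmaPlus_spec hC u).1

theorem apply_sigmaPlus (hG : C.IsGenMetric F G) (hC : C.IsExact F) (u : TangentSpace (𝓡 n) x) :
    G x (C.sigmaPlus G x u) = C.sigmaPlus G x u := (hG.sigmaPlus_spec hC u).2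

theorem eq_sigmaPlus (hG : C.IsGenMetric F G) (hC : C.IsExact F) {a : V x} (ha : G x a = a) :
    a = C.sigmaPlus G x (C.anchor x a) := by
  refine sub_eq_zero.1 (hG.eq_zero_of_anchor hC ?_ ?_)
  · rw [map_sub, hG.anchor_sigmaPlus hC, sub_self]
  · rw [map_sub, hG.apply_sigmaPlus hC, ha]

theorem metricOf_apply (u v : TangentSpace (𝓡 n) x) :
    C.metricOf G x u v = C.pairing x (C.sigmaPlus G x u) (C.sigmaPlus G x v) := rfl

theorem metricOf_symm (hC : C.IsExact F) (u v : TangentSpace (𝓡 n) x) :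
    C.metricOf G x u v = C.metricOf G x v u := by
  rw [metricOf_apply, metricOf_apply, hC.symm]

theorem metricOf_pos (hG : C.IsGenMetric F G) (hC : C.IsExact F) {u : TangentSpace (𝓡 n) x}
    (hu : u ≠ 0) : 0 < C.metricOf G x u u := by
  have h0 : C.sigmaPlus G x u ≠ 0 := fun h => hu (by
    rw [← hG.anchor_sigmaPlus hC u, h, map_zero])
  have := hG.pos x _ h0
  rwa [hG.apply_sigmaPlus hC] at this

variable (C G) in
/-- The section `σ₋ u` of the `-1`-eigenbundle of `G`. -/
def sigmaMinus (x : M) (u : TangentSpace (𝓡 n) x) : V x :=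
  C.sigmaPlus G x u - C.coanchor x (C.metricOf G x u)

/-- The vector s = σ₋ u is orthogonal to the 1-eigenspace. Since G s + s lies in that eigenspace and
pairs to zero with itself, positivity forces it to vanish. -/
theorem apply_sigmaMinus (hG : C.IsGenMetric F G) (hC : C.IsExact F) (u : TangentSpace (𝓡 n) x) :
    G x (sigmaMinus C G x u) = - sigmaMinus C G x u := by
  have horth : ∀ a : V x, G x a = a → C.pairing x (sigmaMinus C G x u) a = 0 := by
    intro a ha
    rw [hG.eq_sigmaPlus hC ha, sigmaMinus, map_sub, _root_.sub_apply, hC.pairing_coanchor,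
      hG.anchor_sigmaPlus hC, metricOf_apply, sub_self]
  set s := sigmaMinus C G x u
  have h1 : G x (G x s + s) = G x s + s := by rw [map_add, hG.apply_apply hC, add_comm]
  have h2 : C.pairing x (G x s + s) (G x s + s) = 0 := by
    rw [map_add (C.pairing x), _root_.add_apply, horth _ h1, add_zero, hG.symm, h1, hC.symm,
      horth _ h1]
  rw [eq_neg_iff_add_eq_zero]
  by_contra hne
  have h3 := hG.pos x _ hne
  rw [h1, h2] at h3
  exact lt_irrefl _ h3

theorem apply_coanchor_metricOf (hG : C.IsGenMetric F G) (hC : C.IsExact F)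
    (u : TangentSpace (𝓡 n) x) : G x (C.coanchor x (C.metricOf G x u)) =
      C.sigmaPlus G x u + C.sigmaPlus G x u - C.coanchor x (C.metricOf G x u) := by
  have h := hG.apply_sigmaMinus hC u
  rw [sigmaMinus, map_sub, hG.apply_sigmaPlus hC] at h
  have h2 : G x (C.coanchor x (C.metricOf G x u)) = C.sigmaPlus G x u -
    (C.sigmaPlus G x u - G x (C.coanchor x (C.metricOf G x u))) := by abel
  rw [h2, h]
  abel

/-- With α = ½ g(w, ·) one has σ₊ w = π*α + G π*α, and α solves π G π* α = w. Smoothness of α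
follows by inverting this equation, for a family G that may depend on the parameter. -/
theorem smooth_sigmaPlus_comp (hC : C.IsExact F) {f : N → M} {G : N → Π x, V x →L[ℝ] V x}
    {S : Set N} {p₀ : N} (hp : p₀ ∈ S) (hG : ∀ p ∈ S, C.IsGenMetric F (G p))
    (hs : ∀ a, IsSmoothSection (n := n) F a → ContMDiffWithinAt J ((𝓡 n).prod 𝓘(ℝ, F)) ∞
      (fun p => TotalSpace.mk' F (f p) (G p (f p) (a (f p)))) S p₀)
    {w : Π p, TangentSpace (𝓡 n) (f p)}
    (hw : ContMDiffWithinAt J ((𝓡 n).prod 𝓘(ℝ, Model n)) ∞ (fun p => TotalSpace.mk' (Model n)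
      (E := fun x : M => TangentSpace (𝓡 n) x) (f p) (w p)) S p₀) :
    ContMDiffWithinAt J ((𝓡 n).prod 𝓘(ℝ, F)) ∞
      (fun p => TotalSpace.mk' F (f p) (C.sigmaPlus (G p) (f p) (w p))) S p₀ := by
  have hf := contMDiffWithinAt_base hw
  let α : Π p, TangentSpace (𝓡 n) (f p) →L[ℝ] ℝ := fun p =>
    (1 / 2 : ℝ) • C.metricOf (G p) (f p) (w p)
  have hGc : ∀ p ∈ S, G p (f p) (C.coanchor (f p) (α p)) =
      C.sigmaPlus (G p) (f p) (w p) - C.coanchor (f p) (α p) := by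
    intro p hpS
    rw [map_smul, map_smul, (hG p hpS).apply_coanchor_metricOf hC, smul_sub, smul_add, ← add_smul]
    norm_num
  have hGs : ∀ {v : Π p, V (f p)}, ContMDiffWithinAt J ((𝓡 n).prod 𝓘(ℝ, F)) ∞
      (fun p => TotalSpace.mk' F (f p) (v p)) S p₀ → ContMDiffWithinAt J ((𝓡 n).prod 𝓘(ℝ, F)) ∞
      (fun p => TotalSpace.mk' F (f p) (G p (f p) (v p))) S p₀ := fun hv =>
    contMDiffWithinAt_map_section (n := n) (F := F) (V := V) (F₂ := F) (V₂ := V)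
      (A := fun p => (G p (f p)).toLinearMap) hp hs hv
  have hα : ContMDiffWithinAt J ((𝓡 n).prod 𝓘(ℝ, Model n →L[ℝ] ℝ)) ∞
      (fun p => TotalSpace.mk' (Model n →L[ℝ] ℝ)
        (E := fun x : M => TangentSpace (𝓡 n) x →L[ℝ] ℝ) (f p) (α p)) S p₀ := by
    refine contMDiffWithinAt_of_map_section (n := n) (F := Model n →L[ℝ] ℝ)
      (V := fun x : M => TangentSpace (𝓡 n) x →L[ℝ] ℝ) (F₂ := Model n)
      (V₂ := fun x : M => TangentSpace (𝓡 n) x) (f := f) (h := f)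
      (A := fun p => (C.anchor (f p) ∘L G p (f p) ∘L C.coanchor (f p)).toLinearMap) hp hf
      (fun s hs' => ?_) ((hG p₀ hp).bijective_anchor_coanchor hC _) ?_
    · refine hC.smooth_anchor_comp hp (hGs (hC.smooth_coanchor_comp hp hf fun Y hY => ?_))
      exact ContMDiffAt.comp_contMDiffWithinAt p₀ (isSmoothField_covector_apply hs' Y hY _) hf
    · refine hw.congr_of_eventuallyEq_of_mem ?_ hp
      filter_upwards [self_mem_nhdsWithin] with p hpS
      congr 1
      change C.anchor (f p) (G p (f p) (C.coanchor (f p) (α p))) = w p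
      rw [hGc p hpS, map_sub, hC.anchor_coanchor, sub_zero, (hG p hpS).anchor_sigmaPlus hC]
  have hc : ContMDiffWithinAt J ((𝓡 n).prod 𝓘(ℝ, F)) ∞
      (fun p => TotalSpace.mk' F (f p) (C.coanchor (f p) (α p))) S p₀ :=
    hC.smooth_coanchor_comp hp hf fun Y hY => contMDiffWithinAt_covector_apply
      (V := fun x : M => TangentSpace (𝓡 n) x) (F := Model n) hα
      (ContMDiffAt.comp_contMDiffWithinAt p₀ (hY (f p₀)) hf)
  refine (contMDiffWithinAt_section_add hp hc (hGs hc)).congr_of_eventuallyEq_of_mem ?_ hp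
  filter_upwards [self_mem_nhdsWithin] with p hpS
  rw [hGc p hpS, add_sub_cancel]

end IsGenMetric

end CourantData

end Courant

section Courant

variable {n : ℕ} {M : Type*} [TopologicalSpace M] [T2Space M] [ChartedSpace (Model n) M]
  [IsManifold (𝓡 n) ∞ M]
  {F : Type*} [NormedAddCommGroup F] [NormedSpace ℝ F] [FiniteDimensional ℝ F]
  {V : M → Type*} [TopologicalSpace (TotalSpace F V)]
  [∀ x, AddCommGroup (V x)] [∀ x, Module ℝ (V x)] [∀ x, TopologicalSpace (V x)]
  [∀ x, IsTopologicalAddGroup (V x)] [∀ x, ContinuousSMul ℝ (V x)]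
  [FiberBundle F V] [VectorBundle ℝ F V] [ContMDiffVectorBundle ∞ F V (𝓡 n)]

namespace CourantData

variable {C : CourantData n V} {x : M} {G : Π x, V x →L[ℝ] V x}

/-! ### Brackets with covectors -/

namespace IsExact

variable {a b e : Π x, V x} {α β ε : CovectorField n M}

/-- The axiom on the symmetric part of the bracket, tested against a section e. -/
theorem symm_part_apply (hC : C.IsExact F) (ha : IsSmoothSection (n := n) F a)
    (hb : IsSmoothSection (n := n) F b) (e : Π x, V x) :
    C.pairing x (C.bracket a b x) (e x) + C.pairing x (C.bracket b a x) (e x) =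
      dirDeriv (fun y => C.anchor y (e y)) (fun y => C.pairing y (a y) (b y)) x := by
  rw [← _root_.add_apply, ← map_add]
  have h := congrArg (fun u => C.pairing x u (e x)) (hC.symm_part a b ha hb x)
  exact h.trans (hC.pairing_coanchor _ _)

theorem pairing_bracket_coanchor (hC : C.IsExact F) (ha : IsSmoothSection (n := n) F a)
    (hβ : IsSmoothCovector β) (he : IsSmoothSection (n := n) F e) :
    C.pairing x (C.bracket a (fun y => C.coanchor y (β y)) x) (e x) =
      dirDeriv (fun y => C.anchor y (a y)) (fun y => β y (C.anchor y (e y))) x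
        - β x (lieBr (fun y => C.anchor y (a y)) (fun y => C.anchor y (e y)) x) := by
  have h := hC.invariance a _ e ha (hC.smooth_coanchor hβ) he x
  simp only [hC.pairing_coanchor] at h
  rw [h, hC.anchor_bracket a e ha he, add_sub_cancel_right]

theorem pairing_coanchor_bracket (hC : C.IsExact F) (hα : IsSmoothCovector α)
    (hb : IsSmoothSection (n := n) F b) (he : IsSmoothSection (n := n) F e) :
    C.pairing x (C.bracket (fun y => C.coanchor y (α y)) b x) (e x) =
      dirDeriv (fun y => C.anchor y (e y)) (fun y => α y (C.anchor y (b y))) x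
        - (dirDeriv (fun y => C.anchor y (b y)) (fun y => α y (C.anchor y (e y))) x
        - α x (lieBr (fun y => C.anchor y (b y)) (fun y => C.anchor y (e y)) x)) := by
  have h := hC.symm_part_apply (x := x) (hC.smooth_coanchor hα) hb e
  simp only [hC.pairing_coanchor] at h
  rw [← hC.pairing_bracket_coanchor hb hα he, eq_sub_iff_add_eq, h]

/-- The anchor kills π*α, and all remaining terms in the formula for the bracket with a covector
involve that anchor. -/
theorem pairing_coanchor_bracket_coanchor (hC : C.IsExact F) (hα : IsSmoothCovector α)
    (hβ : IsSmoothCovector β) (he : IsSmoothSection (n := n) F e) :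
    C.pairing x (C.bracket (fun y => C.coanchor y (α y)) (fun y => C.coanchor y (β y)) x) (e x)
      = 0 := by
  rw [hC.pairing_bracket_coanchor (hC.smooth_coanchor hα) hβ he]
  have h0 : (fun y => C.anchor y (C.coanchor y (α y))) = (0 : VectorField n M) :=
    funext fun y => hC.anchor_coanchor (α y)
  rw [h0, lieBr_swap]
  have h1 : lieBr (fun y => C.anchor y (e y)) (0 : VectorField n M) x = 0 := by
    rw [lieBr_swap]; simp [lieBr]
  rw [h1, neg_zero, map_zero, sub_zero]
  exact map_zero (mfderiv (𝓡 n) 𝓘(ℝ, ℝ) _ x)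

/-- The effect on the bracket of shifting sections by covectors. -/
theorem pairing_bracket_shift (hC : C.IsExact F) (ha : IsSmoothSection (n := n) F a)
    (hb : IsSmoothSection (n := n) F b) (he : IsSmoothSection (n := n) F e)
    (hα : IsSmoothCovector α) (hβ : IsSmoothCovector β) {a' b' e' : Π x, V x}
    (ha' : ∀ y, a' y = a y + C.coanchor y (α y)) (hb' : ∀ y, b' y = b y + C.coanchor y (β y))
    (he' : ∀ y, e' y = e y + C.coanchor y (ε y)) :
    C.pairing x (C.bracket a' b' x) (e' x) = C.pairing x (C.bracket a b x) (e x)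
      + (dirDeriv (fun y => C.anchor y (a y)) (fun y => β y (C.anchor y (e y))) x
        - β x (lieBr (fun y => C.anchor y (a y)) (fun y => C.anchor y (e y)) x))
      + (dirDeriv (fun y => C.anchor y (e y)) (fun y => α y (C.anchor y (b y))) x
        - (dirDeriv (fun y => C.anchor y (b y)) (fun y => α y (C.anchor y (e y))) x
        - α x (lieBr (fun y => C.anchor y (b y)) (fun y => C.anchor y (e y)) x)))
      + ε x (lieBr (fun y => C.anchor y (a y)) (fun y => C.anchor y (b y)) x) := by
  have ea : a' = a + fun y => C.coanchor y (α y) := funext ha'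
  have eb : b' = b + fun y => C.coanchor y (β y) := funext hb'
  have hα' := hC.smooth_coanchor hα
  have hβ' := hC.smooth_coanchor hβ
  rw [← hC.pairing_bracket_coanchor ha hβ he, ← hC.pairing_coanchor_bracket hα hb he,
    he', map_add, hC.pairing_coanchor_right, ← hC.anchor_bracket a b ha hb]
  have h1 : C.anchor x (C.bracket a' b' x) = C.anchor x (C.bracket a b x) := by
    rw [hC.anchor_bracket a b ha hb, hC.anchor_bracket a' b' (by rw [ea]; exact isSmoothSection_add ha hα')
      (by rw [eb]; exact isSmoothSection_add hb hβ')]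
    simp only [ha', hb', map_add, hC.anchor_coanchor, add_zero]
  rw [h1]
  congr 1
  rw [ea, eb, hC.bracket_add_left _ _ _ ha hα' (isSmoothSection_add hb hβ'),
    hC.bracket_add_right _ _ _ ha hb hβ', hC.bracket_add_right _ _ _ hα' hb hβ']
  simp only [Pi.add_apply, map_add, _root_.add_apply, hC.pairing_coanchor_bracket_coanchor hα hβ he]
  ring

end IsExact

/-! ### The splitting and the torsion of a generalized metric -/

namespace IsGenMetric

theorem smooth_sigmaPlus (hG : C.IsGenMetric F G) (hC : C.IsExact F) {X : VectorField n M}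
    (hX : IsSmoothField X) : IsSmoothSection (n := n) F (fun x => C.sigmaPlus G x (X x)) := fun x =>
  contMDiffWithinAt_univ.1 (smooth_sigmaPlus_comp hC (f := id) (G := fun _ => G) (mem_univ x)
    (fun _ _ => hG) (fun a ha => (hG.smooth a ha x).contMDiffWithinAt)
    (ContMDiffAt.contMDiffWithinAt (hX x)))

theorem smooth_metricOf (hG : C.IsGenMetric F G) (hC : C.IsExact F) :
    IsSmoothTensor2 (C.metricOf G) := fun _ _ hY hZ =>
  hC.smooth_pairing _ _ (hG.smooth_sigmaPlus hC hY) (hG.smooth_sigmaPlus hC hZ)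

theorem splitting_apply (u : TangentSpace (𝓡 n) x) : C.splitting G x u =
    C.sigmaPlus G x u + C.coanchor x ((-(1 / 2) : ℝ) • C.metricOf G x u) := by
  change C.sigmaPlus G x u - (1 / 2 : ℝ) • C.coanchor x (C.metricOf G x u) = _
  rw [map_smul, neg_smul, sub_eq_add_neg]

theorem anchor_splitting (hG : C.IsGenMetric F G) (hC : C.IsExact F) (u : TangentSpace (𝓡 n) x) :
    C.anchor x (C.splitting G x u) = u := by
  rw [splitting_apply, map_add, hC.anchor_coanchor, add_zero, hG.anchor_sigmaPlus hC]

theorem pairing_splitting (hG : C.IsGenMetric F G) (hC : C.IsExact F)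
    (u v : TangentSpace (𝓡 n) x) : C.pairing x (C.splitting G x u) (C.splitting G x v) = 0 := by
  conv_lhs => rw [splitting_apply u]
  rw [map_add, _root_.add_apply, hC.pairing_coanchor, hG.anchor_splitting hC, splitting_apply v,
    map_add, hC.pairing_coanchor_right, hG.anchor_sigmaPlus hC]
  simp only [_root_.smul_apply, smul_eq_mul]
  rw [metricOf_symm hC v u, ← metricOf_apply]
  ring

theorem smooth_splitting (hG : C.IsGenMetric F G) (hC : C.IsExact F) {X : VectorField n M}
    (hX : IsSmoothField X) : IsSmoothSection (n := n) F (fun x => C.splitting G x (X x)) := by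
  have h : IsSmoothCovector (fun x => (-(1 / 2) : ℝ) • C.metricOf G x (X x)) := fun Y hY =>
    contMDiff_const.mul (hG.smooth_metricOf hC X Y hX hY)
  have h2 := isSmoothSection_add (hG.smooth_sigmaPlus hC hX) (hC.smooth_coanchor h)
  have h3 : (fun x => C.splitting G x (X x)) = (fun x => C.sigmaPlus G x (X x)) +
      fun x => C.coanchor x ((-(1 / 2) : ℝ) • C.metricOf G x (X x)) :=
    funext fun x => splitting_apply (X x)
  rwa [h3]

/-- The symmetric part of the bracket is the differential of the pairing, and the pairing vanishes
on the isotropic image of the splitting. -/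
theorem bracket_splitting_swap (hG : C.IsGenMetric F G) (hC : C.IsExact F) {X Y : VectorField n M}
    (hX : IsSmoothField X) (hY : IsSmoothField Y) :
    C.bracket (fun y => C.splitting G y (X y)) (fun y => C.splitting G y (Y y)) x =
      - C.bracket (fun y => C.splitting G y (Y y)) (fun y => C.splitting G y (X y)) x := by
  rw [eq_neg_iff_add_eq_zero]
  refine hC.nondegenerate x _ fun e => ?_
  rw [← ext_self (n := n) (F := F) x e]
  have h := hC.symm_part_apply (x := x) (hG.smooth_splitting hC hX) (hG.smooth_splitting hC hY)
    (ext n F x e)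
  simp only [hG.pairing_splitting hC] at h
  rw [map_add, _root_.add_apply]
  exact h.trans (by rw [dirDeriv, mfderiv_const]; rfl)

/-- Linearity in Z over functions is evident. Skewness in X, Y is `bracket_splitting_swap`, and
skewness in Y, Z is invariance of the pairing together with isotropy, so `exists_form₃` applies. -/
theorem torsionOf_spec (hG : C.IsGenMetric F G) (hC : C.IsExact F) {X Y Z : VectorField n M}
    (hX : IsSmoothField X) (hY : IsSmoothField Y) (hZ : IsSmoothField Z) :
    C.torsionOf G x ![X x, Y x, Z x] = 2 * C.pairing x
        (C.bracket (fun y => C.splitting G y (X y)) (fun y => C.splitting G y (Y y)) x)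
        (C.splitting G x (Z x)) := by
  refine Classical.epsilon_spec (exists_form₃ (x := x) (Λ := fun X Y Z => 2 * C.pairing x
        (C.bracket (fun y => C.splitting G y (X y)) (fun y => C.splitting G y (Y y)) x)
        (C.splitting G x (Z x))) (fun X Y hX hY => ⟨fun a b _ _ => ?_, fun f a _ _ => ?_⟩)
        (fun X Y Z hX hY hZ => ?_) (fun X Y Z hX hY hZ => ?_)) X Y Z hX hY hZ
  · rw [Pi.add_apply, map_add, map_add, mul_add]
  · rw [Pi.smul_apply', map_smul, map_smul]
    simp only [smul_eq_mul]; ring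
  · rw [hG.bracket_splitting_swap hC hX hY, map_neg, _root_.neg_apply]; ring
  · have h := hC.invariance _ _ _ (hG.smooth_splitting hC hX) (hG.smooth_splitting hC hY)
      (hG.smooth_splitting hC hZ) x
    simp only [hG.pairing_splitting hC] at h
    rw [show dirDeriv (fun y => C.anchor y (C.splitting G y (X y))) (fun _ : M => (0 : ℝ)) x = 0 by
      rw [dirDeriv, mfderiv_const]; rfl, hC.symm x (C.splitting G x (Y x))] at h
    linarith

theorem smooth_torsionOf (hG : C.IsGenMetric F G) (hC : C.IsExact F) :
    IsSmoothForm (C.torsionOf G) := by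
  intro Y hY
  have h : (fun x => C.torsionOf G x fun i => Y i x) = fun x => 2 * C.pairing x
        (C.bracket (fun y => C.splitting G y (Y 0 y)) (fun y => C.splitting G y (Y 1 y)) x)
        (C.splitting G x (Y 2 x)) := by
    funext x
    rw [← hG.torsionOf_spec hC (hY 0) (hY 1) (hY 2)]
    congr 1
    funext i; fin_cases i <;> rfl
  rw [h]
  exact contMDiff_const.mul (hC.smooth_pairing _ _ (hC.smooth_bracket _ _
    (hG.smooth_splitting hC (hY 0)) (hG.smooth_splitting hC (hY 1))) (hG.smooth_splitting hC (hY 2)))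

/-- The torsion form is closed. -/
theorem extD_torsionOf (hG : C.IsGenMetric F G) (hC : C.IsExact F) (x : M) :
    extD (C.torsionOf G) x = 0 := by
  ext v
  let s : Fin 4 → Π x, V x := fun i y => C.splitting G y (tExt x (v i) y)
  have hs : ∀ i, IsSmoothSection (n := n) F (s i) := fun i =>
    hG.smooth_splitting hC (tExt_smooth x (v i))
  have hbr : ∀ i j, IsSmoothSection (n := n) F (C.bracket (s i) (s j)) := fun i j =>
    hC.smooth_bracket _ _ (hs i) (hs j)
  have hanc : ∀ i, (fun y => C.anchor y (s i y)) = tExt x (v i) := fun i =>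
    funext fun y => hG.anchor_splitting hC _
  have hT : ∀ i j k, IsSmoothFn n M (fun y => C.pairing y (C.bracket (s i) (s j) y) (s k y)) :=
    fun i j k => hC.smooth_pairing _ _ (hbr i j) (hs k)
  -- The chart-constant fields commute at x, so the brackets of their lifts lie in the kernel of π
  -- there. That kernel is isotropic.
  have h0 : ∀ i j k l, C.pairing x (C.bracket (s i) (s j) x) (C.bracket (s k) (s l) x) = 0 := by
    intro i j k l
    have hz : ∀ i j, C.anchor x (C.bracket (s i) (s j) x) = 0 := fun i j => by
      rw [hC.anchor_bracket _ _ (hs i) (hs j), hanc, hanc, lieBr_tExt_tExt]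
    obtain ⟨α, hα⟩ := (hC.range_coanchor x _).1 (hz i j)
    rw [← hα, hC.pairing_coanchor, hz, map_zero]
  -- Invariance turns the derivative of a component of H into a double bracket, because the other
  -- term is killed by `h0`.
  have hA : ∀ l i j k, dirDeriv (tExt x (v l))
      (fun y => C.pairing y (C.bracket (s i) (s j) y) (s k y)) x =
      C.pairing x (C.bracket (s l) (C.bracket (s i) (s j)) x) (s k x) := by
    intro l i j k
    have := hC.invariance _ _ _ (hs l) (hbr i j) (hs k) x
    rw [h0, add_zero, hanc] at this
    exact this
  have hsw : C.pairing x (C.bracket (C.bracket (s 0) (s 1)) (s 2) x) (s 3 x) =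
      C.pairing x (C.bracket (s 3) (C.bracket (s 0) (s 1)) x) (s 2 x) -
      C.pairing x (C.bracket (s 2) (C.bracket (s 0) (s 1)) x) (s 3 x) := by
    rw [eq_sub_iff_add_eq, hC.symm_part_apply (hbr 0 1) (hs 2), ← hA 3 0 1 2, hanc 3]
  -- Paired with the fourth lift, the Jacobi identity is exactly dH = 0; `hsw` rewrites the bracket
  -- with the nested bracket on the left.
  have hjac := congrFun (hC.jacobi _ _ _ (hs 0) (hs 1) (hs 2)) x
  have hj2 := congrArg (fun e => C.pairing x e (s 3 x)) hjac
  simp only [Pi.add_apply, map_add, _root_.add_apply] at hj2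
  have hev : ∀ i j k : Fin 4, (fun y => C.torsionOf G y ![tExt x (v i) y, tExt x (v j) y,
      tExt x (v k) y]) = fun y => 2 * C.pairing y (C.bracket (s i) (s j) y) (s k y) := fun i j k =>
    funext fun y => hG.torsionOf_spec hC (tExt_smooth x (v i)) (tExt_smooth x (v j))
      (tExt_smooth x (v k))
  have hterm : ∀ (l i j k : Fin 4) (w : M → Fin 3 → Fin 4), (w = fun _ => ![i, j, k]) →
      dirDeriv (tExt x (v l)) (fun y => C.torsionOf G y fun m => tExt x (v (w x m)) y) x =
      2 * C.pairing x (C.bracket (s l) (C.bracket (s i) (s j)) x) (s k x) := by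
    rintro l i j k w rfl
    have e : (fun y => C.torsionOf G y fun m => tExt x (v (![i, j, k] m)) y) =
        fun y => C.torsionOf G y ![tExt x (v i) y, tExt x (v j) y, tExt x (v k) y] := by
      funext y
      congr 1
      funext m; fin_cases m <;> rfl
    rw [e, hev, dirDeriv_const_mul _ (hT i j k), hA]
  rw [extD_tExt (hG.smooth_torsionOf hC), Fin.sum_univ_four]
  have t0 := hterm 0 1 2 3 (fun _ => (0 : Fin 4).succAbove) (by funext _ m; fin_cases m <;> rfl)
  have t1 := hterm 1 0 2 3 (fun _ => (1 : Fin 4).succAbove) (by funext _ m; fin_cases m <;> rfl)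
  have t2 := hterm 2 0 1 3 (fun _ => (2 : Fin 4).succAbove) (by funext _ m; fin_cases m <;> rfl)
  have t3 := hterm 3 0 1 2 (fun _ => (3 : Fin 4).succAbove) (by funext _ m; fin_cases m <;> rfl)
  rw [t0, t1, t2, t3, hj2, hsw]
  simp
  ring

/-- The splitting determined by `G₁` in terms of the one determined by `G`. -/
theorem exists_shift (hG : C.IsGenMetric F G) {G₁ : Π x, V x →L[ℝ] V x}
    (hG₁ : C.IsGenMetric F G₁) (hC : C.IsExact F) :
    (∀ (x : M) (u v : TangentSpace (𝓡 n) x), C.metricOf G₁ x u v =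
      C.pairing x (C.sigmaPlus G₁ x u) (C.sigmaPlus G x v) +
      C.pairing x (C.sigmaPlus G₁ x v) (C.sigmaPlus G x u) - C.metricOf G x u v) ∧
    ∀ (b : DiffForm n M 2), IsSmoothForm b → (∀ (x : M) (u v : TangentSpace (𝓡 n) x),
      twoFormMap b x u v = C.pairing x (C.sigmaPlus G₁ x u) (C.sigmaPlus G x v) -
      C.pairing x (C.sigmaPlus G₁ x v) (C.sigmaPlus G x u)) →
      ∀ x, C.torsionOf G₁ x = C.torsionOf G x + extD b x := by
  -- Two lifts of u differ by an element of ker π = im π*, and the covector is measured by pairing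
  -- with σ₊ of the old metric.
  have hβ : ∀ (x : M) (u : TangentSpace (𝓡 n) x), ∃ β : TangentSpace (𝓡 n) x →L[ℝ] ℝ,
      C.sigmaPlus G₁ x u = C.sigmaPlus G x u + C.coanchor x β ∧ ∀ v,
      C.pairing x (C.sigmaPlus G₁ x u) (C.sigmaPlus G x v) = C.metricOf G x u v + β v := by
    intro x u
    obtain ⟨β, hβ⟩ := (hC.range_coanchor x (C.sigmaPlus G₁ x u - C.sigmaPlus G x u)).1
      (by rw [map_sub, hG.anchor_sigmaPlus hC, hG₁.anchor_sigmaPlus hC, sub_self])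
    have e : C.sigmaPlus G₁ x u = C.sigmaPlus G x u + C.coanchor x β := by
      rw [hβ, add_sub_cancel]
    refine ⟨β, e, fun v => ?_⟩
    rw [e, map_add, _root_.add_apply, hC.pairing_coanchor, hG.anchor_sigmaPlus hC]; rfl
  have hg : ∀ (x : M) (u v : TangentSpace (𝓡 n) x), C.metricOf G₁ x u v =
      C.pairing x (C.sigmaPlus G₁ x u) (C.sigmaPlus G x v) +
      C.pairing x (C.sigmaPlus G₁ x v) (C.sigmaPlus G x u) - C.metricOf G x u v := by
    intro x u v
    obtain ⟨β, hu, hu2⟩ := hβ x u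
    obtain ⟨γ, hv, hv2⟩ := hβ x v
    rw [hu2, hv2, metricOf_apply, hu, map_add, _root_.add_apply, hC.pairing_coanchor,
      hG₁.anchor_sigmaPlus hC, hv, map_add, hC.pairing_coanchor_right, hG.anchor_sigmaPlus hC,
      metricOf_symm hC v u, metricOf_apply]
    ring
  refine ⟨hg, fun b hb hbq x => ?_⟩
  -- Subtracting half of each metric leaves only the skew part of the shift. The factor ½ is
  -- compensated by the factor 2 in the definition of the torsion.
  have hsplit : ∀ (x : M) (u : TangentSpace (𝓡 n) x), C.splitting G₁ x u = C.splitting G x u +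
      C.coanchor x ((1 / 2 : ℝ) • twoFormMap b x u) := by
    intro x u
    obtain ⟨β, hu, hu2⟩ := hβ x u
    rw [splitting_apply, splitting_apply, hu, add_assoc, add_assoc, ← map_add, ← map_add]
    congr 2
    ext v
    obtain ⟨γ, hv, hv2⟩ := hβ x v
    simp only [_root_.add_apply, _root_.smul_apply, smul_eq_mul]
    rw [hg, hbq, hu2, hv2, metricOf_symm hC v u]
    ring
  refine form_ext fun Y hY => ?_
  have e3 : ∀ α : TangentSpace (𝓡 n) x [⋀^Fin 3]→L[ℝ] ℝ, (α fun i => Y i x) =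
      α ![Y 0 x, Y 1 x, Y 2 x] := fun α => by
    congr 1
    funext i; fin_cases i <;> rfl
  have hcov : ∀ i, IsSmoothCovector (fun y => (1 / 2 : ℝ) • twoFormMap b y (Y i y)) :=
    fun i Z hZ => contMDiff_const.mul (hb.twoFormMap (Y i) Z (hY i) hZ)
  have hfn : ∀ i j, IsSmoothFn n M (fun y => twoFormMap b y (Y i y) (Y j y)) := fun i j =>
    hb.twoFormMap _ _ (hY i) (hY j)
  have key := hC.pairing_bracket_shift (x := x) (hG.smooth_splitting hC (hY 0))
    (hG.smooth_splitting hC (hY 1)) (hG.smooth_splitting hC (hY 2)) (hcov 0) (hcov 1)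
    (ε := fun y => (1 / 2 : ℝ) • twoFormMap b y (Y 2 y))
    (fun y => hsplit y (Y 0 y)) (fun y => hsplit y (Y 1 y)) (fun y => hsplit y (Y 2 y))
  simp only [hG.anchor_splitting hC, _root_.smul_apply, smul_eq_mul] at key
  rw [dirDeriv_const_mul _ (hfn 1 2), dirDeriv_const_mul _ (hfn 0 1),
    dirDeriv_const_mul _ (hfn 0 2)] at key
  rw [e3, e3, ContinuousAlternatingMap.add_apply, hG₁.torsionOf_spec hC (hY 0) (hY 1) (hY 2), key,
    hG.torsionOf_spec hC (hY 0) (hY 1) (hY 2), extD_twoForm hb (hY 0) (hY 1) (hY 2)]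
  rw [twoFormMap_skew b (lieBr (Y 0) (Y 1) x), twoFormMap_skew b (lieBr (Y 0) (Y 2) x),
    twoFormMap_skew b (lieBr (Y 1) (Y 2) x)]
  ring

end IsGenMetric

end CourantData

end Courant

/-! ### Isometries of metric Courant algebroids -/

section Isometry

variable {n : ℕ} {M : Type*} [TopologicalSpace M] [T2Space M] [ChartedSpace (Model n) M]
  [IsManifold (𝓡 n) ∞ M]
  {F : Type*} [NormedAddCommGroup F] [NormedSpace ℝ F] [FiniteDimensional ℝ F]
  {V : M → Type*} [TopologicalSpace (TotalSpace F V)]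
  [∀ x, AddCommGroup (V x)] [∀ x, Module ℝ (V x)] [∀ x, TopologicalSpace (V x)]
  [∀ x, IsTopologicalAddGroup (V x)] [∀ x, ContinuousSMul ℝ (V x)]
  [FiberBundle F V] [VectorBundle ℝ F V] [ContMDiffVectorBundle ∞ F V (𝓡 n)]

theorem crd_injective (x : M) {v w : TangentSpace (𝓡 n) x}
    (h : crd (Model n) x v = crd (Model n) x w) : v = w := by
  have h1 := (frame_crd (n := n) (F := Model n) (V := fun x : M => TangentSpace (𝓡 n) x) x).self_of_nhds
  rw [← h1 v, ← h1 w, h]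

/-- Tangent vectors are determined by the derivatives of smooth functions. -/
theorem tangent_ext {x : M} {v w : TangentSpace (𝓡 n) x}
    (h : ∀ f : M → ℝ, IsSmoothFn n M f → (mfderiv (𝓡 n) 𝓘(ℝ, ℝ) f x v : ℝ) =
      mfderiv (𝓡 n) 𝓘(ℝ, ℝ) f x w) : v = w := by
  refine crd_injective x ?_
  ext i
  obtain ⟨f, hf, hfd, -⟩ := exists_chart_fn x (EuclideanSpace.proj (𝕜 := ℝ) i)
  have hv := hfd.self_of_nhds (tExt x v)
  have hw := hfd.self_of_nhds (tExt x w)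
  rw [dirDeriv, tExt_self] at hv hw
  exact hv.symm.trans ((h f hf).trans hw)

theorem mk'_cast {y y' : M} (h : y = y') (v : V y) :
    TotalSpace.mk' F y' (h ▸ v) = TotalSpace.mk' F y v := by cases h; rfl

theorem cast_apply {f : M → M} (hf : Function.Injective f) (a : Π x, V (f x)) {z x : M}
    (h : f z = f x) : (h ▸ a z : V (f x)) = a x := by
  obtain rfl := hf h; rfl

theorem BundleAut.exists_push (Φ : BundleAut n F V) {a : Π x, V x}
    (ha : IsSmoothSection (n := n) F a) : ∃ a' : Π x, V x, IsSmoothSection (n := n) F a' ∧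
      ∀ x, a' (Φ.base x) = Φ.map x (a x) := by
  refine ⟨fun y => Φ.base.apply_symm_apply y ▸ Φ.map (Φ.base.symm y) (a (Φ.base.symm y)), ?_,
    fun x => cast_apply Φ.base.injective (fun x => Φ.map x (a x)) _⟩
  have h1 : ContMDiff (𝓡 n) ((𝓡 n).prod 𝓘(ℝ, F)) ∞ (fun y => TotalSpace.mk' F
      (Φ.base (Φ.base.symm y)) (Φ.map (Φ.base.symm y) (a (Φ.base.symm y)))) :=
    Φ.smooth.comp (ContMDiff.comp ha Φ.base.symm.contMDiff)
  refine h1.congr fun y => mk'_cast _ _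

namespace IsIsometry

variable {C : CourantData n V} {G G₁ : Π x, V x →L[ℝ] V x} {Φ : BundleAut n F V} {c : ℝ}

/-- Isomorphisms of Courant algebroids are compatible with the anchor. -/
theorem anchor (h : IsIsometry (C.scale c) G C G₁ Φ) (hC : C.IsExact F) {x : M} (u : V x) :
    C.anchor (Φ.base x) (Φ.map x u) = mfderiv (𝓡 n) (𝓡 n) Φ.base x (C.anchor x u) := by
  -- The argument below needs a nonzero vector in the fibre, which exists because the rank is 2n. In
  -- dimension zero there is nothing to prove.
  rcases Nat.eq_zero_or_pos n with rfl | hn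
  · have : Subsingleton (TangentSpace (𝓡 0) (Φ.base x)) :=
      inferInstanceAs (Subsingleton (EuclideanSpace ℝ (Fin 0)))
    exact Subsingleton.elim _ _
  refine tangent_ext fun f hf => ?_
  have hnt : Nontrivial (V x) := Module.nontrivial_of_finrank_pos (R := ℝ)
    (by rw [hC.finrank_fibre]; omega)
  obtain ⟨b₀, hb₀⟩ := exists_ne (0 : V x)
  let a := ext n F x u
  let b := ext n F x b₀
  have ha : IsSmoothSection (n := n) F a := ext_smooth x u
  have hb : IsSmoothSection (n := n) F b := ext_smooth x b₀
  obtain ⟨a', ha', ea⟩ := Φ.exists_push ha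
  obtain ⟨b', hb', eb⟩ := Φ.exists_push hb
  have hf' : IsSmoothFn n M (fun y => f (Φ.base y)) := hf.comp Φ.base.contMDiff
  -- The bracket is preserved for b and for (f ∘ φ) b, where φ is the base map. Comparing the two
  -- Leibniz rules isolates the derivatives of f along the anchors.
  have h1 := h.bracket a (fun y => f (Φ.base y) • b y) a' (fun y => f y • b' y) ha
    (isSmoothSection_smul hf' hb) ea (fun y => by simp only [eb, map_smul]) x
  have h2 := h.bracket a b a' b' ha hb ea eb x
  change C.bracket _ _ _ = Φ.map x (C.bracket _ _ _) at h1 h2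
  rw [hC.leibniz _ _ _ ha' hb' hf, hC.leibniz _ _ _ ha hb hf', h2, map_add, map_smul, map_smul,
    add_right_inj, eb] at h1
  have hne : Φ.map x (b x) ≠ 0 := by
    rw [Ne, EmbeddingLike.map_eq_zero_iff]
    simpa [b] using hb₀
  have h3 := smul_left_injective ℝ hne h1
  simp only [dirDeriv, ea] at h3
  have h4 : mfderiv (𝓡 n) 𝓘(ℝ, ℝ) (fun y => f (Φ.base y)) x =
      (mfderiv (𝓡 n) 𝓘(ℝ, ℝ) f (Φ.base x)).comp (mfderiv (𝓡 n) (𝓡 n) Φ.base x) :=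
    mfderiv_comp x (hf.mdiff _) (Φ.base.contMDiff.mdifferentiableAt (by simp))
  have hax : a x = u := ext_self x u
  rw [hax] at h3
  exact h3.trans (congrArg (fun L => (L (C.anchor x u) : ℝ)) h4)

theorem pairing' (h : IsIsometry (C.scale c) G C G₁ Φ) (x : M) (a b : V x) :
    C.pairing (Φ.base x) (Φ.map x a) (Φ.map x b) = c * C.pairing x a b := h.pairing x a b

/-- Φ maps the 1-eigenbundle of G into that of G₁ and respects anchors, and a vector of the
1-eigenbundle is determined by its anchor. -/
theorem sigmaPlus (h : IsIsometry (C.scale c) G C G₁ Φ) (hC : C.IsExact F)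
    (hG : C.IsGenMetric F G) (hG₁ : C.IsGenMetric F G₁) {x : M} (u : TangentSpace (𝓡 n) x) :
    C.sigmaPlus G₁ (Φ.base x) (mfderiv (𝓡 n) (𝓡 n) Φ.base x u) =
      Φ.map x (C.sigmaPlus G x u) := by
  have h1 : G₁ (Φ.base x) (Φ.map x (C.sigmaPlus G x u)) = Φ.map x (C.sigmaPlus G x u) := by
    rw [← h.metric, hG.apply_sigmaPlus hC]
  rw [hG₁.eq_sigmaPlus hC h1, h.anchor hC, hG.anchor_sigmaPlus hC]

theorem metricOf (h : IsIsometry (C.scale c) G C G₁ Φ) (hC : C.IsExact F)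
    (hG : C.IsGenMetric F G) (hG₁ : C.IsGenMetric F G₁) {x : M} (u v : TangentSpace (𝓡 n) x) :
    C.metricOf G₁ (Φ.base x) (mfderiv (𝓡 n) (𝓡 n) Φ.base x u) (mfderiv (𝓡 n) (𝓡 n) Φ.base x v) =
      c * C.metricOf G x u v := by
  rw [CourantData.IsGenMetric.metricOf_apply, h.sigmaPlus hC hG hG₁, h.sigmaPlus hC hG hG₁,
    h.pairing', CourantData.IsGenMetric.metricOf_apply]

/-- The scaling of the pairing and the scaling of the metric contribute the same factor c to the two
sides, so the preferred splittings correspond exactly although the metrics differ by c. -/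
theorem splitting (h : IsIsometry (C.scale c) G C G₁ Φ) (hC : C.IsExact F)
    (hG : C.IsGenMetric F G) (hG₁ : C.IsGenMetric F G₁) {x : M} (u : TangentSpace (𝓡 n) x) :
    C.splitting G₁ (Φ.base x) (mfderiv (𝓡 n) (𝓡 n) Φ.base x u) = Φ.map x (C.splitting G x u) := by
  rw [CourantData.IsGenMetric.splitting_apply, CourantData.IsGenMetric.splitting_apply, map_add,
    h.sigmaPlus hC hG hG₁, add_right_inj]
  refine hC.ext fun e => ?_
  obtain ⟨e, rfl⟩ := (Φ.map x).surjective e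
  rw [h.pairing', hC.pairing_coanchor, hC.pairing_coanchor, h.anchor hC]
  simp only [_root_.smul_apply, smul_eq_mul]
  rw [h.metricOf hC hG hG₁]
  ring

theorem torsionOf (h : IsIsometry (C.scale c) G C G₁ Φ) (hC : C.IsExact F)
    (hG : C.IsGenMetric F G) (hG₁ : C.IsGenMetric F G₁) {x : M}
    (v : Fin 3 → TangentSpace (𝓡 n) x) :
    C.torsionOf G₁ (Φ.base x) (fun i => mfderiv (𝓡 n) (𝓡 n) Φ.base x (v i)) =
      c * C.torsionOf G x v := by
  have hs : ∀ i, IsSmoothSection (n := n) F (fun y => C.splitting G y (tExt x (v i) y)) :=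
    fun i => hG.smooth_splitting hC (tExt_smooth x (v i))
  choose s' hs' es using fun i => Φ.exists_push (hs i)
  have hanc : ∀ i y, C.anchor (Φ.base y) (s' i (Φ.base y)) =
      mfderiv (𝓡 n) (𝓡 n) Φ.base y (tExt x (v i) y) := fun i y => by
    rw [es, h.anchor hC, hG.anchor_splitting hC]
  -- The pushed-forward sections are again preferred lifts, now for G₁ and for the pushed-forward
  -- vector fields.
  have hspl : ∀ i, (fun y => C.splitting G₁ y (C.anchor y (s' i y))) = s' i := by
    intro i
    funext y
    obtain ⟨y, rfl⟩ : ∃ z, Φ.base z = y := Φ.base.surjective y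
    rw [hanc, h.splitting hC hG hG₁, es]
  have e1 := hG₁.torsionOf_spec hC (x := Φ.base x) (hC.smooth_anchor _ (hs' 0))
    (hC.smooth_anchor _ (hs' 1)) (hC.smooth_anchor _ (hs' 2))
  have e2 := hG.torsionOf_spec hC (x := x) (tExt_smooth x (v 0)) (tExt_smooth x (v 1))
    (tExt_smooth x (v 2))
  have hb : C.bracket (s' 0) (s' 1) (Φ.base x) = Φ.map x (C.bracket _ _ x) :=
    h.bracket _ _ _ _ (hs 0) (hs 1) (es 0) (es 1) x
  simp only [hspl, hanc, tExt_self] at e1 e2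
  rw [h.splitting hC hG hG₁, hb, h.pairing'] at e1
  have ev : v = ![v 0, v 1, v 2] := by funext i; fin_cases i <;> rfl
  have ev' : (fun i => mfderiv (𝓡 n) (𝓡 n) Φ.base x (v i)) =
      ![mfderiv (𝓡 n) (𝓡 n) Φ.base x (v 0), mfderiv (𝓡 n) (𝓡 n) Φ.base x (v 1),
        mfderiv (𝓡 n) (𝓡 n) Φ.base x (v 2)] := by funext i; fin_cases i <;> rfl
  rw [ev', e1]
  conv_rhs => rw [ev, e2]
  ring

end IsIsometry

end Isometry

/-- The fibres of V carry a vector space topology but no chosen norm. The derivative in the flow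
equation is therefore the one for topological vector spaces, and it is used only after applying
continuous functionals. -/
theorem hasDerivWithinAt_clm {E : Type*} [AddCommGroup E] [Module ℝ E] [TopologicalSpace E]
    [IsTopologicalAddGroup E] [ContinuousSMul ℝ E] {f : ℝ → E} {f' : E} {S : Set ℝ} {t : ℝ}
    (ℓ : E →L[ℝ] ℝ) (h : HasDerivWithinAt f f' S t) :
    HasDerivWithinAt (fun s => ℓ (f s)) (ℓ f') S t := by
  have h1 := HasFDerivAtFilter.isLittleOTVS h
  have h2 := (ℓ.isBigOTVS_comp (f := (fun p : ℝ × ℝ => f p.1 - f p.2 -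
    (ContinuousLinearMap.toSpanSingleton ℝ f') (p.1 - p.2)))
      (l := 𝓝[S] t ×ˢ pure t)).trans_isLittleOTVS h1
  refine HasFDerivAtFilter.of_isLittleOTVS (h2.congr_left fun p => ?_)
  simp [Function.comp]

/-! ### Orthonormal bases -/

section Orthonormal

variable {n : ℕ} {M : Type*} [TopologicalSpace M] [T2Space M] [ChartedSpace (Model n) M]
  [IsManifold (𝓡 n) ∞ M] {g : Tensor2 n M} {x : M} {e e' : Fin n → TangentSpace (𝓡 n) x}

/-- Inner products on a tangent space. -/
structure IsMetricAt (g : Tensor2 n M) (x : M) : Prop where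
  symm : ∀ u v, g x u v = g x v u
  pos : ∀ u, u ≠ 0 → 0 < g x u u

theorem finrank_tangent (x : M) : Module.finrank ℝ (TangentSpace (𝓡 n) x) = n := by
  change Module.finrank ℝ (EuclideanSpace ℝ (Fin n)) = n
  simp

namespace IsMetricAt

theorem exists_orthonormal (hg : IsMetricAt g x) :
    ∃ e : Fin n → TangentSpace (𝓡 n) x, IsOrthonormalAt g x e := by
  let B : LinearMap.BilinForm ℝ (TangentSpace (𝓡 n) x) :=
    LinearMap.mk₂ ℝ (fun u v => g x u v) (by intros; simp) (by intros; simp) (by intros; simp)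
      (by intros; simp)
  have : Invertible (2 : ℝ) := invertibleOfNonzero two_ne_zero
  obtain ⟨v, hv⟩ := LinearMap.BilinForm.exists_orthogonal_basis (B := B) ⟨fun u v => hg.symm u v⟩
  let w := v.reindex (finCongr (finrank_tangent (n := n) x))
  have hpos : ∀ i, 0 < g x (w i) (w i) := fun i => hg.pos _ (w.ne_zero i)
  refine ⟨fun i => (Real.sqrt (g x (w i) (w i)))⁻¹ • w i, fun i j => ?_⟩
  simp only [map_smul, _root_.smul_apply, smul_eq_mul]
  split_ifs with hij
  · subst hij
    have h1 := Real.mul_self_sqrt (hpos i).le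
    have h2 := (Real.sqrt_pos.2 (hpos i)).ne'
    field_simp
    nlinarith
  · have h0 : g x (w i) (w j) = 0 := by
      have : Function.Injective (finCongr (finrank_tangent (n := n) x)).symm :=
        (finCongr (finrank_tangent (n := n) x)).symm.injective
      simp only [w, Module.Basis.reindex_apply]
      exact hv (fun h => hij (this h))
    rw [h0]; simp

theorem bijective (hg : IsMetricAt g x) : Function.Bijective (g x) :=
  bijective_of_nondegenerate _ fun a ha => by
    by_contra hne
    exact (hg.pos a hne).ne' (ha a)

theorem sharp_apply (hg : IsMetricAt g x) (u : TangentSpace (𝓡 n) x) : sharp g x (g x u) = u :=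
  haveI := finiteDimensional_clm_dual (E := TangentSpace (𝓡 n) x)
  (inverse_spec (g x) hg.bijective).2 u

theorem apply_sharp (hg : IsMetricAt g x) (α : TangentSpace (𝓡 n) x →L[ℝ] ℝ) :
    g x (sharp g x α) = α :=
  haveI := finiteDimensional_clm_dual (E := TangentSpace (𝓡 n) x)
  (inverse_spec (g x) hg.bijective).1 α

end IsMetricAt

namespace IsOrthonormalAt

theorem expand (he : IsOrthonormalAt g x e) (u : TangentSpace (𝓡 n) x) :
    u = ∑ i, g x u (e i) • e i := by
  let R : (Fin n → ℝ) →ₗ[ℝ] TangentSpace (𝓡 n) x := Fintype.linearCombination ℝ e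
  have hR : ∀ c j, g x (R c) (e j) = c j := by
    intro c j
    simp [R, Fintype.linearCombination_apply, he _ j]
  have hinj : Function.Injective R := fun c d h => funext fun j => by rw [← hR c j, h, hR]
  obtain ⟨c, rfl⟩ := (LinearMap.injective_iff_surjective_of_finrank_eq_finrank
    (by rw [finrank_tangent]; simp)).1 hinj u
  simp only [hR]
  rfl

/-- The matrix expressing e' in terms of e is orthogonal, so traces do not depend on the basis. This
legitimizes every definition by orthonormal bases. -/
theorem sum_eq (he : IsOrthonormalAt g x e) (he' : IsOrthonormalAt g x e')
    (hg : ∀ u v, g x u v = g x v u) {A : Type*} [AddCommGroup A] [Module ℝ A]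
    (β : TangentSpace (𝓡 n) x →ₗ[ℝ] TangentSpace (𝓡 n) x →ₗ[ℝ] A) :
    ∑ i, β (e' i) (e' i) = ∑ i, β (e i) (e i) := by
  have h1 : ∀ i, β (e' i) (e' i) =
      ∑ j, ∑ k, (g x (e' i) (e j) * g x (e' i) (e k)) • β (e j) (e k) := by
    intro i
    conv_lhs => rw [he.expand (e' i)]
    simp only [map_sum, map_smul, LinearMap.sum_apply, LinearMap.smul_apply, Finset.smul_sum,
      smul_smul]
    rw [Finset.sum_comm]
    refine Finset.sum_congr rfl fun j _ => Finset.sum_congr rfl fun k _ => ?_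
    rw [mul_comm]
  have h2 : ∀ j k, ∑ i, g x (e' i) (e j) * g x (e' i) (e k) = if j = k then 1 else 0 := by
    intro j k
    rw [← he j k]
    conv_rhs => rw [he'.expand (e j)]
    simp only [map_sum, map_smul, _root_.sum_apply, _root_.smul_apply, smul_eq_mul]
    exact Finset.sum_congr rfl fun i _ => by rw [hg (e j) (e' i)]
  simp_rw [h1]
  rw [Finset.sum_comm]
  refine Finset.sum_congr rfl fun j _ => ?_
  rw [Finset.sum_comm]
  simp_rw [← Finset.sum_smul, h2]
  simp

end IsOrthonormalAt

/-- For the zero form the defining condition is met by D = 0 whatever the connection is. This gives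
d*dH = 0 for closed H from nondegeneracy at one point alone. -/
theorem nablaForm_zero {k : ℕ} : nablaForm (k := k) g 0 x = 0 := by
  have h := Classical.epsilon_spec (p := fun D : TangentSpace (𝓡 n) x →ₗ[ℝ]
      TangentSpace (𝓡 n) x [⋀^Fin k]→L[ℝ] ℝ =>
    ∀ (X : VectorField n M) (Y : Fin k → VectorField n M), IsSmoothField X →
      (∀ i, IsSmoothField (Y i)) →
      D (X x) (fun i => Y i x) = dirDeriv X (fun y => (0 : DiffForm n M k) y (fun i => Y i y)) x
        - ∑ i, (0 : DiffForm n M k) x (Function.update (fun j => Y j x) i (nabla g X (Y i) x)))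
    ⟨0, fun X Y _ _ => by
      have : dirDeriv X (fun y => (0 : DiffForm n M k) y (fun i => Y i y)) x = 0 := by
        change dirDeriv X (fun _ : M => (0 : ℝ)) x = 0
        rw [dirDeriv, mfderiv_const]; rfl
      rw [this]
      simp⟩
  ext u v
  have h1 := h (tExt x u) (fun i => tExt x (v i)) (tExt_smooth x u) (fun i => tExt_smooth x (v i))
  simp only [tExt_self] at h1
  have : dirDeriv (tExt x u) (fun y => (0 : DiffForm n M k) y (fun i => tExt x (v i) y)) x = 0 := by
    change dirDeriv _ (fun _ : M => (0 : ℝ)) x = 0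
    rw [dirDeriv, mfderiv_const]; rfl
  rw [this] at h1
  refine h1.trans ?_
  simp

theorem codiff_zero {k : ℕ} (hg : IsMetricAt g x) :
    codiff g (0 : DiffForm n M (k + 1)) x = 0 := by
  have h := Classical.epsilon_spec (p := fun α : TangentSpace (𝓡 n) x [⋀^Fin k]→L[ℝ] ℝ =>
    ∀ e, IsOrthonormalAt g x e → ∀ v : Fin k → TangentSpace (𝓡 n) x,
      α v = -∑ i, nablaForm g (0 : DiffForm n M (k + 1)) x (e i) (Matrix.vecCons (e i) v))
    ⟨0, fun e _ v => by simp [nablaForm_zero]⟩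
  obtain ⟨e, he⟩ := hg.exists_orthonormal
  ext v
  refine (h e he v).trans ?_
  simp [nablaForm_zero]

/-- Skew bilinear maps are `2`-forms. -/
theorem exists_twoForm {x : M} (B : TangentSpace (𝓡 n) x →L[ℝ] TangentSpace (𝓡 n) x →L[ℝ] ℝ)
    (hB : ∀ u v, B u v = - B v u) :
    ∃ b : TangentSpace (𝓡 n) x [⋀^Fin 2]→L[ℝ] ℝ, ∀ u v, b ![u, v] = B u v := by
  let f : MultilinearMap ℝ (fun _ : Fin 2 => TangentSpace (𝓡 n) x) ℝ :=
    { toFun := fun v => B (v 0) (v 1)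
      map_update_add' := by
        intro _ v i a b
        fin_cases i <;> simp [Function.update]
      map_update_smul' := by
        intro _ v i a b
        fin_cases i <;> simp [Function.update] }
  have hself : ∀ u, B u u = 0 := fun u => by linarith [hB u u]
  refine ⟨mkForm f fun v i j hv hij => ?_, fun u v => rfl⟩
  change B (v 0) (v 1) = 0
  have : v 0 = v 1 := by
    fin_cases i <;> fin_cases j <;> first | exact absurd rfl hij | exact hv | exact hv.symm
  rw [this, hself]

end Orthonormal

/-! ### Time derivatives of forms -/

section TimeForms

variable {n : ℕ} {M : Type*} [TopologicalSpace M] [T2Space M] [ChartedSpace (Model n) M]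
  [IsManifold (𝓡 n) ∞ M] {k : ℕ} {S : Set ℝ} {t₀ : ℝ}

/-- The exterior derivative commutes with time derivatives. -/
theorem hasDerivWithinAt_extD {b : ℝ → DiffForm n M k} {b' : DiffForm n M k} (ht : t₀ ∈ S)
    (hS : UniqueDiffOn ℝ S) (hcl : t₀ ∈ closure (interior S)) (hb : ∀ t ∈ S, IsSmoothForm (b t))
    (hj : ∀ (Y : Fin k → VectorField n M), (∀ i, IsSmoothField (Y i)) → ∀ x,
      ContMDiffWithinAt (𝓘(ℝ, ℝ).prod (𝓡 n)) 𝓘(ℝ, ℝ) ∞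
        (fun p : ℝ × M => b p.1 p.2 (fun i => Y i p.2)) (S ×ˢ univ) (t₀, x))
    (hd : ∀ x v, HasDerivWithinAt (fun t => b t x v) (b' x v) S t₀) :
    IsSmoothForm b' ∧ ∀ x v, HasDerivWithinAt (fun t => extD (b t) x v) (extD b' x v) S t₀ := by
  have hder : ∀ Y : Fin k → VectorField n M, (fun y => derivWithin
      (fun t => b t y (fun i => Y i y)) S t₀) = fun y => b' y (fun i => Y i y) := fun Y =>
    funext fun y => (hd y _).derivWithin (hS t₀ ht)
  have hb' : IsSmoothForm b' := by
    intro Y hY x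
    have := contMDiffAt_derivWithin ht hS (hj Y hY x)
    rwa [hder Y] at this
  refine ⟨hb', fun x v => ?_⟩
  rw [extD_tExt hb']
  have h1 : HasDerivWithinAt (fun t => ∑ i : Fin (k + 1), (-1 : ℝ) ^ (i : ℕ) *
      dirDeriv (tExt x (v i)) (fun y => b t y (fun j => tExt x (v (i.succAbove j)) y)) x)
      (∑ i : Fin (k + 1), (-1 : ℝ) ^ (i : ℕ) *
      dirDeriv (tExt x (v i)) (fun y => b' y (fun j => tExt x (v (i.succAbove j)) y)) x) S t₀ := by
    refine HasDerivWithinAt.fun_sum fun i _ => HasDerivWithinAt.const_mul _ ?_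
    have h2 := hasDerivWithinAt_mfderiv ht hS hcl (hj (fun j => tExt x (v (i.succAbove j)))
      (fun j => tExt_smooth x _) x) (tExt x (v i) x)
    have h3 := hder (fun j => tExt x (v (i.succAbove j)))
    exact HasDerivWithinAt.congr_deriv h2
      (congrArg (fun f : M → ℝ => (mfderiv (𝓡 n) 𝓘(ℝ, ℝ) f x (tExt x (v i) x) : ℝ)) h3)
  refine h1.congr_of_eventuallyEq_of_mem ?_ ht
  filter_upwards [self_mem_nhdsWithin] with t htS
  exact extD_tExt (hb t htS) x v

end TimeForms

/-! ### The time interval [0, T) -/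

section TimeInterval

variable {T : EReal}

theorem zero_mem_timeInterval (hT : 0 < T) : (0 : ℝ) ∈ timeInterval T := ⟨le_rfl, hT⟩

theorem exists_Ico_subset (hT : 0 < T) : ∃ ε : ℝ, 0 < ε ∧ Ico 0 ε ⊆ timeInterval T := by
  obtain ⟨ε, h0, h1⟩ := EReal.lt_iff_exists_real_btwn.1 hT
  exact ⟨ε, by exact_mod_cast h0, fun t ht => ⟨ht.1, lt_trans (by exact_mod_cast ht.2) h1⟩⟩

theorem convex_timeInterval : Convex ℝ (timeInterval T) := by
  refine Set.OrdConnected.convex ⟨fun a ha b hb c hc => ⟨ha.1.trans hc.1, ?_⟩⟩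
  exact lt_of_le_of_lt (by exact_mod_cast hc.2) hb.2

theorem zero_mem_closure_timeInterval (hT : 0 < T) :
    (0 : ℝ) ∈ closure (interior (timeInterval T)) := by
  obtain ⟨ε, hε, h⟩ := exists_Ico_subset hT
  have h1 : Ioo 0 ε ⊆ interior (timeInterval T) :=
    interior_maximal (Ioo_subset_Ico_self.trans h) isOpen_Ioo
  refine closure_mono h1 ?_
  rw [closure_Ioo hε.ne]
  exact ⟨le_rfl, hε.le⟩

theorem uniqueDiffOn_timeInterval (hT : 0 < T) : UniqueDiffOn ℝ (timeInterval T) := by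
  refine uniqueDiffOn_convex convex_timeInterval ?_
  have := zero_mem_closure_timeInterval hT
  exact closure_nonempty_iff.1 ⟨0, this⟩

end TimeInterval

/-! ### Exterior derivatives of forms depending on time -/

section Forms

variable {n : ℕ} {M : Type*} [TopologicalSpace M] [T2Space M] [ChartedSpace (Model n) M]
  [IsManifold (𝓡 n) ∞ M] {k : ℕ} {S : Set ℝ} {t₀ : ℝ}

theorem extD_neg {θ : DiffForm n M k} (hθ : IsSmoothForm θ) (x : M)
    (v : Fin (k + 1) → TangentSpace (𝓡 n) x) :
    extD (fun y => -θ y) x v = - extD θ x v := by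
  have hn : IsSmoothForm (fun y => -θ y) := fun Y hY => (hθ Y hY).neg
  rw [extD_tExt hn, extD_tExt hθ, ← Finset.sum_neg_distrib]
  refine Finset.sum_congr rfl fun i _ => ?_
  simp only [ContinuousAlternatingMap.neg_apply]
  rw [dirDeriv_neg]
  ring

theorem contMDiffWithinAt_extD_twoForm {b : ℝ → DiffForm n M 2} {x : M} (ht : t₀ ∈ S)
    (hS : UniqueDiffOn ℝ S) (hb : ∀ t ∈ S, IsSmoothForm (b t))
    (hj : ∀ Y Z : VectorField n M, IsSmoothField Y → IsSmoothField Z →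
      ContMDiffWithinAt (𝓘(ℝ, ℝ).prod (𝓡 n)) 𝓘(ℝ, ℝ) ∞
        (fun p : ℝ × M => twoFormMap (b p.1) p.2 (Y p.2) (Z p.2)) (S ×ˢ univ) (t₀, x))
    {Y : Fin 3 → VectorField n M} (hY : ∀ i, IsSmoothField (Y i)) :
    ContMDiffWithinAt (𝓘(ℝ, ℝ).prod (𝓡 n)) 𝓘(ℝ, ℝ) ∞
      (fun p : ℝ × M => extD (b p.1) p.2 (fun i => Y i p.2)) (S ×ˢ univ) (t₀, x) := by
  have hY' : ∀ i, ContMDiffWithinAt (𝓘(ℝ, ℝ).prod (𝓡 n)) ((𝓡 n).prod 𝓘(ℝ, Model n)) ∞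
      (fun p : ℝ × M => TotalSpace.mk' (Model n) (E := fun x : M => TangentSpace (𝓡 n) x) p.2
        (Y i p.2)) (S ×ˢ univ) (t₀, x) := fun i =>
    (ContMDiffAt.comp (t₀, x) (hY i x) contMDiffAt_snd).contMDiffWithinAt
  have hd : ∀ i j k, ContMDiffWithinAt (𝓘(ℝ, ℝ).prod (𝓡 n)) 𝓘(ℝ, ℝ) ∞
      (fun p : ℝ × M => dirDeriv (Y i) (fun y => twoFormMap (b p.1) y (Y j y) (Y k y)) p.2)
      (S ×ˢ univ) (t₀, x) := fun i j k =>
    contMDiffWithinAt_mfderiv ht hS (hj (Y j) (Y k) (hY j) (hY k)) (hY' i)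
  have hl : ∀ i j k, ContMDiffWithinAt (𝓘(ℝ, ℝ).prod (𝓡 n)) 𝓘(ℝ, ℝ) ∞
      (fun p : ℝ × M => twoFormMap (b p.1) p.2 (lieBr (Y i) (Y j) p.2) (Y k p.2))
      (S ×ˢ univ) (t₀, x) := fun i j k => hj _ _ ((hY i).lieBr (hY j)) (hY k)
  have h := ((((hd 0 1 2).sub (hd 1 0 2)).add (hd 2 0 1)).sub (hl 0 1 2)).add (hl 0 2 1)
    |>.sub (hl 1 2 0)
  refine h.congr_of_eventuallyEq_of_mem ?_ (mk_mem_prod ht (mem_univ _))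
  filter_upwards [self_mem_nhdsWithin] with p hp
  have e : (fun i => Y i p.2) = ![Y 0 p.2, Y 1 p.2, Y 2 p.2] := by funext i; fin_cases i <;> rfl
  rw [e, extD_twoForm (hb p.1 hp.1) (hY 0) (hY 1) (hY 2)]
  rfl

end Forms

section Solitons

variable {n : ℕ} {M : Type*} [TopologicalSpace M] [T2Space M] [ChartedSpace (Model n) M]
  [IsManifold (𝓡 n) ∞ M]
  {F : Type*} [NormedAddCommGroup F] [NormedSpace ℝ F] [FiniteDimensional ℝ F]
  {V : M → Type*} [TopologicalSpace (TotalSpace F V)]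
  [∀ x, AddCommGroup (V x)] [∀ x, Module ℝ (V x)] [∀ x, TopologicalSpace (V x)]
  [∀ x, IsTopologicalAddGroup (V x)] [∀ x, ContinuousSMul ℝ (V x)]
  [FiberBundle F V] [VectorBundle ℝ F V] [ContMDiffVectorBundle ∞ F V (𝓡 n)]
  {C : CourantData n V}

/-! ### The generalized Ricci curvature on eigenbundles -/

namespace CourantData

namespace IsGenMetric

variable {x : M} {G : Π x, V x →L[ℝ] V x}

theorem isMetricAt (hG : C.IsGenMetric F G) (hC : C.IsExact F) (x : M) :
    IsMetricAt (C.metricOf G) x :=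
  ⟨metricOf_symm hC, fun _ hu => hG.metricOf_pos hC hu⟩

theorem ofSplit_eq (u : TangentSpace (𝓡 n) x) (ξ : TangentSpace (𝓡 n) x →L[ℝ] ℝ) :
    C.ofSplit G x u ξ = C.splitting G x u + C.coanchor x ((1 / 2 : ℝ) • ξ) := by
  rw [ofSplit, map_smul]

theorem sigmaPlus_eq_ofSplit (u : TangentSpace (𝓡 n) x) :
    C.sigmaPlus G x u = C.ofSplit G x u (C.metricOf G x u) := by
  rw [ofSplit_eq, splitting_apply, add_assoc, ← map_add, ← add_smul]
  norm_num

theorem sigmaMinus_eq_ofSplit (u : TangentSpace (𝓡 n) x) :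
    sigmaMinus C G x u = C.ofSplit G x u (-C.metricOf G x u) := by
  rw [ofSplit_eq, splitting_apply, add_assoc, ← map_add, smul_neg, ← neg_smul, ← add_smul,
    sigmaMinus, sub_eq_add_neg, ← map_neg]
  norm_num

theorem anchor_ofSplit (hG : C.IsGenMetric F G) (hC : C.IsExact F) (u : TangentSpace (𝓡 n) x)
    (ξ : TangentSpace (𝓡 n) x →L[ℝ] ℝ) : C.anchor x (C.ofSplit G x u ξ) = u := by
  rw [ofSplit_eq, map_add, hG.anchor_splitting hC, hC.anchor_coanchor, add_zero]

theorem cotangentPart_ofSplit (hG : C.IsGenMetric F G) (hC : C.IsExact F)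
    (u : TangentSpace (𝓡 n) x) (ξ : TangentSpace (𝓡 n) x →L[ℝ] ℝ) :
    C.cotangentPart G x (C.ofSplit G x u ξ) = ξ := by
  ext v
  change (2 : ℝ) * C.pairing x (C.ofSplit G x u ξ) (C.splitting G x v) = ξ v
  rw [ofSplit_eq, map_add, _root_.add_apply, hG.pairing_splitting hC, hC.pairing_coanchor,
    hG.anchor_splitting hC]
  simp

theorem genRicci_ofSplit (hG : C.IsGenMetric F G) (hC : C.IsExact F) (u : TangentSpace (𝓡 n) x)
    (ξ : TangentSpace (𝓡 n) x →L[ℝ] ℝ) : C.genRicci G x (C.ofSplit G x u ξ) =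
    C.ofSplit G x (sharp (C.metricOf G) x (ricciB (C.metricOf G) (C.torsionOf G) x u) +
      (1 / 2 : ℝ) • sharp (C.metricOf G) x (twoFormMap (codiff (C.metricOf G) (C.torsionOf G)) x
        (sharp (C.metricOf G) x ξ)))
      (-((1 / 2 : ℝ) • twoFormMap (codiff (C.metricOf G) (C.torsionOf G)) x u) -
        ricciB (C.metricOf G) (C.torsionOf G) x (sharp (C.metricOf G) x ξ)) := by
  rw [genRicci]
  simp only [hG.anchor_ofSplit hC, hG.cotangentPart_ofSplit hC]

/-- Rc(G) interchanges the two eigenbundles of G: on the graphs of g and -g in the preferred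
splitting, the matrix becomes Ric^B ± ½ d*H. The time derivatives of the flow are read off in this
form. -/
theorem genRicci_sigmaPlus (hG : C.IsGenMetric F G) (hC : C.IsExact F)
    (u : TangentSpace (𝓡 n) x) : C.genRicci G x (C.sigmaPlus G x u) =
      sigmaMinus C G x (sharp (C.metricOf G) x (ricciB (C.metricOf G) (C.torsionOf G) x u +
        (1 / 2 : ℝ) • twoFormMap (codiff (C.metricOf G) (C.torsionOf G)) x u)) := by
  have hm := hG.isMetricAt hC x
  rw [sigmaPlus_eq_ofSplit, hG.genRicci_ofSplit hC, sigmaMinus_eq_ofSplit, hm.sharp_apply,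
    hm.apply_sharp, map_add, map_smul]
  congr 1
  abel

theorem genRicci_sigmaMinus (hG : C.IsGenMetric F G) (hC : C.IsExact F)
    (u : TangentSpace (𝓡 n) x) : C.genRicci G x (sigmaMinus C G x u) =
      C.sigmaPlus G x (sharp (C.metricOf G) x (ricciB (C.metricOf G) (C.torsionOf G) x u -
        (1 / 2 : ℝ) • twoFormMap (codiff (C.metricOf G) (C.torsionOf G)) x u)) := by
  have hm := hG.isMetricAt hC x
  rw [sigmaMinus_eq_ofSplit, hG.genRicci_ofSplit hC, sigmaPlus_eq_ofSplit, map_neg, hm.sharp_apply,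
    hm.apply_sharp, map_sub, map_smul]
  simp only [map_neg, smul_neg, sub_neg_eq_add]
  congr 1
  · abel

theorem pairing_sigmaMinus (hG : C.IsGenMetric F G) (hC : C.IsExact F)
    (u v : TangentSpace (𝓡 n) x) :
    C.pairing x (sigmaMinus C G x u) (sigmaMinus C G x v) = - C.metricOf G x u v := by
  simp only [sigmaMinus, map_sub, _root_.sub_apply, hC.pairing_coanchor, hC.pairing_coanchor_right,
    hG.anchor_sigmaPlus hC, hC.anchor_coanchor, map_zero]
  rw [metricOf_symm hC v u, ← metricOf_apply]
  ring

end IsGenMetric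

/-! ### The evolution of the metric and of the torsion -/

variable {T : EReal} {G : ℝ → Π x, V x →L[ℝ] V x}

namespace IsGRF

theorem hasDerivWithinAt_clm (h : C.IsGRF F T G) {t : ℝ} (ht : t ∈ timeInterval T) {x : M}
    (ℓ : V x →L[ℝ] ℝ) (e : V x) : HasDerivWithinAt (fun s => ℓ (G s x e))
      (ℓ (G t x ((-2 : ℝ) • C.genRicci (G t) x e))) (timeInterval T) t :=
  GenRicci.hasDerivWithinAt_clm ℓ (h.flow t ht x e)

/-- The symmetry is extracted from the flow, without the Bianchi identity. Differentiate ⟨G(t) σ₋u,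
σ₊v⟩ = ⟨G(t) σ₊v, σ₋u⟩ at t = 0, with σ± those of G(0); the skew terms d*H match and Ric^B(u,v) =
Ric^B(v,u) remains. -/
theorem ricciB_symm (h : C.IsGRF F T G) (hT : 0 < T) (hC : C.IsExact F) {x : M}
    (u v : TangentSpace (𝓡 n) x) :
    ricciB (C.metricOf (G 0)) (C.torsionOf (G 0)) x u v =
      ricciB (C.metricOf (G 0)) (C.torsionOf (G 0)) x v u := by
  have h0 := zero_mem_timeInterval hT
  have hG := h.genMetric 0 h0
  have hm := hG.isMetricAt hC x
  have h1 := h.hasDerivWithinAt_clm h0 (C.pairing x (C.sigmaPlus (G 0) x v))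
    (IsGenMetric.sigmaMinus C (G 0) x u)
  have h2 := h.hasDerivWithinAt_clm h0 (C.pairing x (IsGenMetric.sigmaMinus C (G 0) x u))
    (C.sigmaPlus (G 0) x v)
  have h3 := (uniqueDiffOn_timeInterval hT 0 h0).eq_deriv _ h1
    (h2.congr_of_mem (fun s hs => by
      rw [hC.symm x _ (G s x _), (h.genMetric s hs).symm, hC.symm]) h0)
  rw [hG.genRicci_sigmaMinus hC, hG.genRicci_sigmaPlus hC, map_smul, map_smul, map_smul, map_smul,
    hG.apply_sigmaPlus hC, hG.apply_sigmaMinus hC, ← IsGenMetric.metricOf_apply, map_neg,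
    hG.pairing_sigmaMinus hC, hm.symm v, hm.symm u, hm.apply_sharp, hm.apply_sharp] at h3
  simp only [_root_.add_apply, _root_.sub_apply, _root_.smul_apply, smul_eq_mul] at h3
  have h4 := twoFormMap_skew (codiff (C.metricOf (G 0)) (C.torsionOf (G 0))) u v
  linarith

theorem smooth_sigmaPlus (h : C.IsGRF F T G) (hC : C.IsExact F) {t : ℝ} (ht : t ∈ timeInterval T)
    (x : M) {Y : VectorField n M} (hY : IsSmoothField Y) :
    ContMDiffWithinAt (𝓘(ℝ, ℝ).prod (𝓡 n)) ((𝓡 n).prod 𝓘(ℝ, F)) ∞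
      (fun p : ℝ × M => TotalSpace.mk' F p.2 (C.sigmaPlus (G p.1) p.2 (Y p.2)))
      (timeInterval T ×ˢ univ) (t, x) :=
  IsGenMetric.smooth_sigmaPlus_comp hC (f := Prod.snd) (G := fun p : ℝ × M => G p.1)
    (mk_mem_prod ht (mem_univ _)) (fun p hp => h.genMetric p.1 hp.1)
    (fun a ha => h.smooth a ha (t, x) (mk_mem_prod ht (mem_univ _)))
    (ContMDiffAt.comp (t, x) (hY x) contMDiffAt_snd).contMDiffWithinAt

theorem smooth_pairing_sigmaPlus (h : C.IsGRF F T G) (hC : C.IsExact F) {t : ℝ}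
    (ht : t ∈ timeInterval T) (x : M) {Y : VectorField n M} (hY : IsSmoothField Y) {a : Π x, V x}
    (ha : IsSmoothSection (n := n) F a) :
    ContMDiffWithinAt (𝓘(ℝ, ℝ).prod (𝓡 n)) 𝓘(ℝ, ℝ) ∞
      (fun p : ℝ × M => C.pairing p.2 (C.sigmaPlus (G p.1) p.2 (Y p.2)) (a p.2))
      (timeInterval T ×ˢ univ) (t, x) :=
  hC.smooth_pairing_comp (f := Prod.snd) (mk_mem_prod ht (mem_univ _)) (h.smooth_sigmaPlus hC ht x hY)
    (ContMDiffAt.comp (t, x) (ha x) contMDiffAt_snd).contMDiffWithinAt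

/-- With e = σ₋^0 v, self-adjointness and G(t) σ₊^t = σ₊^t give ⟨σ₊^t u, (G(t) - G(0)) e⟩ = 2 ⟨σ₊^t
u, e⟩. Hence the function is g₀(u,v) plus half of the left side, whose derivative at 0 is given by
the flow equation. -/
theorem hasDerivWithinAt_pairing_sigmaPlus (h : C.IsGRF F T G) (hT : 0 < T) (hC : C.IsExact F)
    {x : M} (u v : TangentSpace (𝓡 n) x) :
    HasDerivWithinAt (fun t => C.pairing x (C.sigmaPlus (G t) x u) (C.sigmaPlus (G 0) x v))
      (-ricciB (C.metricOf (G 0)) (C.torsionOf (G 0)) x u v - (1 / 2) *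
        twoFormMap (codiff (C.metricOf (G 0)) (C.torsionOf (G 0))) x u v) (timeInterval T) 0 := by
  have := finiteDimensional_fibre F V x
  have := t2Space_fibre F V x
  have h0 := zero_mem_timeInterval hT
  have hG := h.genMetric 0 h0
  have hm := hG.isMetricAt hC x
  set e := IsGenMetric.sigmaMinus C (G 0) x v with he
  let b := Module.finBasis ℝ (V x)
  let ℓ : ∀ i, V x →L[ℝ] ℝ := fun i => LinearMap.toContinuousLinearMap (b.coord i)
  -- Expansion in a basis of the fibre replaces products of vector-valued functions by products of
  -- real ones.
  have hexp : ∀ a w : V x, C.pairing x a w = ∑ i, ℓ i w * C.pairing x a (b i) := by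
    intro a w
    conv_lhs => rw [← b.sum_repr w]
    rw [map_sum]
    exact Finset.sum_congr rfl fun i _ => by rw [map_smul]; rfl
  have hdiff : ∀ i, DifferentiableWithinAt ℝ (fun t => C.pairing x (C.sigmaPlus (G t) x u) (b i))
      (timeInterval T) 0 := by
    intro i
    have := differentiableWithinAt_time h0 (h.smooth_pairing_sigmaPlus hC h0 x (tExt_smooth x u)
      (ext_smooth (n := n) (F := F) x (b i)))
    simpa using this
  -- The factor from G(t) - G(0) vanishes at t = 0, so the derivative of σ₊^t u does not enter the
  -- result; only its existence is used.
  have h1 : HasDerivWithinAt (fun t => ∑ i, (ℓ i (G t x e) - ℓ i (G 0 x e)) *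
      C.pairing x (C.sigmaPlus (G t) x u) (b i))
      (∑ i, (ℓ i (G 0 x ((-2 : ℝ) • C.genRicci (G 0) x e)) *
        C.pairing x (C.sigmaPlus (G 0) x u) (b i))) (timeInterval T) 0 := by
    refine HasDerivWithinAt.fun_sum fun i _ => ?_
    refine (((h.hasDerivWithinAt_clm h0 (ℓ i) e).sub_const _).mul
      (hdiff i).hasDerivWithinAt).congr_deriv ?_
    rw [sub_self, zero_mul, add_zero]
  rw [← hexp] at h1
  have h2 := (h1.const_mul (1 / 2 : ℝ)).const_add (C.metricOf (G 0) x u v)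
  have hval : (1 / 2 : ℝ) * C.pairing x (C.sigmaPlus (G 0) x u)
      (G 0 x ((-2 : ℝ) • C.genRicci (G 0) x e)) =
      -ricciB (C.metricOf (G 0)) (C.torsionOf (G 0)) x u v - (1 / 2) *
        twoFormMap (codiff (C.metricOf (G 0)) (C.torsionOf (G 0))) x u v := by
    rw [he, hG.genRicci_sigmaMinus hC, map_smul, map_smul, hG.apply_sigmaPlus hC,
      ← IsGenMetric.metricOf_apply, hm.symm u, hm.apply_sharp]
    simp only [_root_.sub_apply, _root_.smul_apply, smul_eq_mul]
    rw [h.ricciB_symm hT hC v u, twoFormMap_skew _ v u]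
    ring
  refine (h2.congr_deriv hval).congr_of_mem (fun t ht => ?_) h0
  have hGt := h.genMetric t ht
  simp only [sub_mul, Finset.sum_sub_distrib, ← hexp]
  rw [hC.symm x _ (G t x e), hGt.symm, hGt.apply_sigmaPlus hC, he, hG.apply_sigmaMinus hC,
    IsGenMetric.sigmaMinus]
  simp only [map_neg, map_sub, hC.pairing_coanchor_right, hGt.anchor_sigmaPlus hC]
  rw [hm.symm v u]
  ring

/-- The first variation of the metric and of the torsion along the generalized Ricci flow. -/
theorem variation (h : C.IsGRF F T G) (hT : 0 < T) (hC : C.IsExact F) :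
    ((∀ x (u v : TangentSpace (𝓡 n) x), HasDerivWithinAt (fun t => C.metricOf (G t) x u v)
      (-2 * ricciB (C.metricOf (G 0)) (C.torsionOf (G 0)) x u v) (timeInterval T) 0) ∧
    ∀ x (v : Fin 3 → TangentSpace (𝓡 n) x), HasDerivWithinAt (fun t => C.torsionOf (G t) x v)
      (hodgeLaplacian (C.metricOf (G 0)) (C.torsionOf (G 0)) x v) (timeInterval T) 0) ∧
    ∀ x (Y : Fin 3 → VectorField n M), (∀ i, IsSmoothField (Y i)) →
      ContMDiffWithinAt (𝓘(ℝ, ℝ).prod (𝓡 n)) 𝓘(ℝ, ℝ) ∞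
        (fun p : ℝ × M => C.torsionOf (G p.1) p.2 (fun i => Y i p.2))
        (timeInterval T ×ˢ univ) (0, x) := by
  have h0 := zero_mem_timeInterval hT
  have hG := h.genMetric 0 h0
  have hU := uniqueDiffOn_timeInterval hT
  have hq := fun (x : M) (u v : TangentSpace (𝓡 n) x) =>
    h.hasDerivWithinAt_pairing_sigmaPlus hT hC u v
  -- The skew part of the pairing of the two lifts. By `exists_shift` its exterior derivative is the
  -- change of the torsion, and its initial derivative is -d*H because Ric^B is symmetric.
  let B : ℝ → Tensor2 n M := fun t x =>
    ContinuousLinearMap.precomp ℝ (C.sigmaPlus (G 0) x) ∘L C.pairing x ∘L C.sigmaPlus (G t) x -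
    ContinuousLinearMap.precomp ℝ (C.sigmaPlus (G t) x) ∘L C.pairing x ∘L C.sigmaPlus (G 0) x
  have hBa : ∀ t x (u v : TangentSpace (𝓡 n) x), B t x u v =
      C.pairing x (C.sigmaPlus (G t) x u) (C.sigmaPlus (G 0) x v) -
      C.pairing x (C.sigmaPlus (G t) x v) (C.sigmaPlus (G 0) x u) := fun t x u v => by
    rw [hC.symm x (C.sigmaPlus (G t) x v)]; rfl
  choose b hb using fun t x => exists_twoForm (B t x) (fun u v => by rw [hBa, hBa]; ring)
  have hbB : ∀ t x u v, twoFormMap (b t) x u v = B t x u v := fun t x u v => by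
    rw [twoFormMap_apply, hb]
  have hbv : ∀ t x (v : Fin 2 → TangentSpace (𝓡 n) x), b t x v = B t x (v 0) (v 1) := by
    intro t x v
    rw [← hb]
    congr 1
    funext i; fin_cases i <;> rfl
  have hBs : ∀ t ∈ timeInterval T, ∀ x, ∀ Y Z : VectorField n M, IsSmoothField Y →
      IsSmoothField Z → ContMDiffWithinAt (𝓘(ℝ, ℝ).prod (𝓡 n)) 𝓘(ℝ, ℝ) ∞
        (fun p : ℝ × M => B p.1 p.2 (Y p.2) (Z p.2)) (timeInterval T ×ˢ univ) (t, x) := by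
    intro t ht x Y Z hY hZ
    simp only [hBa]
    exact (h.smooth_pairing_sigmaPlus hC ht x hY (hG.smooth_sigmaPlus hC hZ)).sub
      (h.smooth_pairing_sigmaPlus hC ht x hZ (hG.smooth_sigmaPlus hC hY))
  have hbs : ∀ t ∈ timeInterval T, IsSmoothForm (b t) := by
    intro t ht Y hY x
    simp only [hbv]
    have h1 := ContMDiffWithinAt.comp (t := timeInterval T ×ˢ univ) (f := fun y : M => (t, y))
      (s := univ) x
      (hBs t ht x (Y 0) (Y 1) (hY 0) (hY 1))
      (contMDiffAt_const.prodMk contMDiffAt_id).contMDiffWithinAt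
      (fun y _ => mk_mem_prod ht (mem_univ _))
    exact contMDiffWithinAt_univ.1 h1
  have hH : ∀ t ∈ timeInterval T, ∀ x, C.torsionOf (G t) x = C.torsionOf (G 0) x + extD (b t) x :=
    fun t ht => (hG.exists_shift (h.genMetric t ht) hC).2 (b t) (hbs t ht)
      (fun x u v => by rw [hbB, hBa])
  obtain ⟨hb', hbd⟩ := hasDerivWithinAt_extD (k := 2) (b := b)
    (b' := fun x => -codiff (C.metricOf (G 0)) (C.torsionOf (G 0)) x) h0 hU
    (zero_mem_closure_timeInterval hT) hbs
    (fun Y hY x => by simp only [hbv]; exact hBs 0 h0 x _ _ (hY 0) (hY 1))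
    (fun x v => by
      simp only [hbv, hBa]
      refine ((hq x (v 0) (v 1)).sub (hq x (v 1) (v 0))).congr_deriv ?_
      have e : v = ![v 0, v 1] := by funext i; fin_cases i <;> rfl
      rw [h.ricciB_symm hT hC (v 1) (v 0), twoFormMap_skew _ (v 1) (v 0),
        ContinuousAlternatingMap.neg_apply]
      conv_rhs => rw [e]
      rw [twoFormMap_apply]
      ring)
  have hcs : IsSmoothForm (codiff (C.metricOf (G 0)) (C.torsionOf (G 0))) := by
    intro Y hY
    have := (hb' Y hY).neg
    refine this.congr fun x => ?_
    simp
  refine ⟨⟨fun x u v => ?_, fun x v => ?_⟩, fun x Y hY => ?_⟩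
  · have h1 := ((hq x u v).add (hq x v u)).sub_const (C.metricOf (G 0) x u v)
    refine (h1.congr_deriv ?_).congr_of_mem (fun t ht => ?_) h0
    · rw [h.ricciB_symm hT hC v u, twoFormMap_skew _ v u]; ring
    · exact (hG.exists_shift (h.genMetric t ht) hC).1 x u v
  · have h1 := (hbd x v).const_add (C.torsionOf (G 0) x v)
    refine (h1.congr_deriv ?_).congr_of_mem (fun t ht => ?_) h0
    -- The derivative of H is -d d*H. The missing term d*dH of the Hodge Laplacian vanishes because
    -- H is closed.
    · have hz : extD (C.torsionOf (G 0)) = 0 := funext fun y => hG.extD_torsionOf hC y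
      rw [extD_neg hcs, hodgeLaplacian, hz, codiff_zero (hG.isMetricAt hC x), add_zero]
      rfl
    · rw [hH t ht]; rfl
  · have h1 := contMDiffWithinAt_extD_twoForm (x := x) h0 hU hbs (fun Y Z hY hZ => by
      simp only [hbB]; exact hBs 0 h0 x Y Z hY hZ) hY
    have h2 : ContMDiffWithinAt (𝓘(ℝ, ℝ).prod (𝓡 n)) 𝓘(ℝ, ℝ) ∞
        (fun p : ℝ × M => C.torsionOf (G 0) p.2 (fun i => Y i p.2))
        (timeInterval T ×ˢ univ) (0, x) :=
      (ContMDiffAt.comp ((0 : ℝ), x) (hG.smooth_torsionOf hC Y hY x)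
        contMDiffAt_snd).contMDiffWithinAt
    refine (h2.add h1).congr_of_eventuallyEq_of_mem ?_ (mk_mem_prod h0 (mem_univ _))
    filter_upwards [self_mem_nhdsWithin] with p hp
    rw [hH p.1 hp.1]; rfl

end IsGRF

end CourantData

end Solitons

/-! ### From solitons to the static equations -/

section StaticSolitons

variable {n : ℕ} {M : Type*} [TopologicalSpace M] [T2Space M] [ChartedSpace (Model n) M]
  [IsManifold (𝓡 n) ∞ M]
  {F : Type*} [NormedAddCommGroup F] [NormedSpace ℝ F] [FiniteDimensional ℝ F]
  {V : M → Type*} [TopologicalSpace (TotalSpace F V)]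
  [∀ x, AddCommGroup (V x)] [∀ x, Module ℝ (V x)] [∀ x, TopologicalSpace (V x)]
  [∀ x, IsTopologicalAddGroup (V x)] [∀ x, ContinuousSMul ℝ (V x)]
  [FiberBundle F V] [VectorBundle ℝ F V] [ContMDiffVectorBundle ∞ F V (𝓡 n)]
  {C : CourantData n V} {T : EReal} {G : ℝ → Π x, V x →L[ℝ] V x}
  {c : ℝ → ℝ} {Φ : ℝ → BundleAut n F V}

theorem apply_mfderiv_of_eq_id {W : Type*} {k : ℕ} {ψ : M → M} (hψ : ψ = id)
    (θ : Π x : M, (Fin k → TangentSpace (𝓡 n) x) → W) (x : M)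
    (v : Fin k → TangentSpace (𝓡 n) x) :
    θ (ψ x) (fun i => mfderiv (𝓡 n) (𝓡 n) ψ x (v i)) = θ x v := by
  subst hψ
  rw [mfderiv_id]
  rfl

theorem mfderiv_diffeo_comp {f h : M ≃ₘ^∞⟮𝓡 n, 𝓡 n⟯ M} (x : M) (v : TangentSpace (𝓡 n) x) :
    mfderiv (𝓡 n) (𝓡 n) (fun y => f (h y)) x v =
      mfderiv (𝓡 n) (𝓡 n) f (h x) (mfderiv (𝓡 n) (𝓡 n) h x v) := by
  have h1 : mfderiv (𝓡 n) (𝓡 n) (fun y => f (h y)) x =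
      (mfderiv (𝓡 n) (𝓡 n) f (h x)).comp (mfderiv (𝓡 n) (𝓡 n) h x) :=
    mfderiv_comp x (f.contMDiff.mdifferentiableAt (by simp))
      (h.contMDiff.mdifferentiableAt (by simp))
  exact congrArg (fun L => (L v : Model n)) h1

/-- Generalized Ricci solitons satisfy the static soliton equations. -/
theorem CourantData.IsExact.isStaticSoliton (hC : C.IsExact F) (h : IsSoliton C T G c Φ) :
    ∃ X : VectorField n M, IsSmoothField X ∧
      IsStaticSoliton (C.metricOf (G 0)) (C.torsionOf (G 0))
        (-(1 / 2) * derivWithin c (timeInterval T) 0) X := by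
  have hT := h.pos_time
  have h0 := zero_mem_timeInterval hT
  have hU := uniqueDiffOn_timeInterval hT
  have hG := h.grf.genMetric 0 h0
  -- The isometry at time 0 need not be the identity. Composing with the inverse of its base map
  -- gives a family starting at the identity.
  let φ : ℝ → M → M := fun t x => (Φ t).base ((Φ 0).base.symm x)
  have hid : φ 0 = id := funext fun x => (Φ 0).base.apply_symm_apply x
  have hφ : ∀ x, ContMDiffWithinAt (𝓘(ℝ, ℝ).prod (𝓡 n)) (𝓡 n) ∞ (fun p : ℝ × M => φ p.1 p.2)
      (timeInterval T ×ˢ univ) (0, x) := by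
    intro x
    -- Smoothness is assumed for the bundle maps; restricting them to the zero section gives
    -- smoothness of the base maps.
    have h1 : ContMDiff (𝓘(ℝ, ℝ).prod (𝓡 n)) (𝓘(ℝ, ℝ).prod ((𝓡 n).prod 𝓘(ℝ, F))) ∞
        (fun p : ℝ × M => (p.1, TotalSpace.mk' F ((Φ 0).base.symm p.2)
          (0 : V ((Φ 0).base.symm p.2)))) :=
      contMDiff_fst.prodMk ((isSmoothSection_zero (n := n) (F := F) (V := V)).comp
        ((Φ 0).base.symm.contMDiff.comp contMDiff_snd))
    have h2 := ContMDiffWithinAt.comp (t := timeInterval T ×ˢ univ) ((0 : ℝ), x)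
      (h.family_smooth _ (mk_mem_prod h0 (mem_univ _))) h1.contMDiffAt.contMDiffWithinAt
      (s := timeInterval T ×ˢ univ) (fun p hp => mk_mem_prod hp.1 (mem_univ _))
    exact contMDiffWithinAt_base h2
  obtain ⟨X, hX, hv⟩ := exists_velocity h0 hU (zero_mem_closure_timeInterval hT) hφ
    (fun x => congrFun hid x)
  obtain ⟨⟨hg', hH'⟩, hHs⟩ := h.grf.variation hT hC
  have hc' : HasDerivWithinAt c (derivWithin c (timeInterval T) 0) (timeInterval T) 0 :=
    (h.c_smooth.differentiableOn (by simp) 0 h0).hasDerivWithinAt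
  have hgφ : ∀ t ∈ timeInterval T, ∀ x (u v : TangentSpace (𝓡 n) x),
      C.metricOf (G t) (φ t x) (mfderiv (𝓡 n) (𝓡 n) (φ t) x u) (mfderiv (𝓡 n) (𝓡 n) (φ t) x v) =
        c t * C.metricOf (G 0) ((Φ 0).base.symm x) (mfderiv (𝓡 n) (𝓡 n) (Φ 0).base.symm x u)
          (mfderiv (𝓡 n) (𝓡 n) (Φ 0).base.symm x v) := by
    intro t ht x u v
    rw [← (h.isometry t ht).metricOf hC hG (h.grf.genMetric t ht)]
    congr 1
    · exact congrArg _ (mfderiv_diffeo_comp x u)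
    · exact mfderiv_diffeo_comp x v
  have hHφ : ∀ t ∈ timeInterval T, ∀ x (v : Fin 3 → TangentSpace (𝓡 n) x),
      C.torsionOf (G t) (φ t x) (fun i => mfderiv (𝓡 n) (𝓡 n) (φ t) x (v i)) =
        c t * C.torsionOf (G 0) ((Φ 0).base.symm x)
          (fun i => mfderiv (𝓡 n) (𝓡 n) (Φ 0).base.symm x (v i)) := by
    intro t ht x v
    rw [← (h.isometry t ht).torsionOf hC hG (h.grf.genMetric t ht)]
    congr 1
    exact funext fun i => mfderiv_diffeo_comp x (v i)
  have hg : ∀ t ∈ timeInterval T, ∀ x (u v : TangentSpace (𝓡 n) x),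
      C.metricOf (G t) (φ t x) (mfderiv (𝓡 n) (𝓡 n) (φ t) x u) (mfderiv (𝓡 n) (𝓡 n) (φ t) x v) =
        c t * C.metricOf (G 0) x u v := by
    intro t ht x u v
    -- At t = 0, where c = 1 and φ is the identity, the relation says that the inverse of the
    -- initial base map preserves g₀. It therefore drops out of the relation at time t.
    have h1 := hgφ 0 h0 x u v
    rw [h.c_zero, one_mul] at h1
    rw [hgφ t ht, ← h1]
    congr 1
    exact apply_mfderiv_of_eq_id hid (fun x w => C.metricOf (G 0) x (w 0) (w 1)) x ![u, v]
  have hH : ∀ t ∈ timeInterval T, ∀ x (v : Fin 3 → TangentSpace (𝓡 n) x),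
      C.torsionOf (G t) (φ t x) (fun i => mfderiv (𝓡 n) (𝓡 n) (φ t) x (v i)) =
        c t * C.torsionOf (G 0) x v := by
    intro t ht x v
    have h1 := hHφ 0 h0 x v
    rw [h.c_zero, one_mul] at h1
    rw [hHφ t ht, ← h1]
    congr 1
    exact apply_mfderiv_of_eq_id hid (fun x w => C.torsionOf (G 0) x w) x v
  refine ⟨X, hX, fun x => ?_, fun x => ?_⟩
  · ext u v
    have h1 := hv.hasDerivWithinAt_pullback_tensor2 hX (x := x) (θ := fun t => C.metricOf (G t))
      (hG.smooth_metricOf hC) (fun Y Z hY hZ => hC.smooth_pairing_comp (mk_mem_prod h0 (mem_univ _))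
        (h.grf.smooth_sigmaPlus hC h0 x hY) (h.grf.smooth_sigmaPlus hC h0 x hZ))
      (θ' := fun u v => -2 * ricciB (C.metricOf (G 0)) (C.torsionOf (G 0)) x u v)
      (fun u v => hg' x u v) u v
    -- Two expressions for the initial derivative of φ_t^* g_t: -2 Ric^B + L_X g₀ from the flow, and
    -- c'(0) g₀ from the soliton condition.
    have h2 := (hU 0 h0).eq_deriv _ (h1.congr_of_mem (fun t ht => (hg t ht x u v).symm) h0)
      (hc'.mul_const (C.metricOf (G 0) x u v))
    simp only [_root_.add_apply, _root_.smul_apply, smul_eq_mul]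
    linarith
  · ext v
    have h1 := hv.hasDerivWithinAt_pullback_form hX (x := x) (θ := fun t => C.torsionOf (G t))
      (hG.smooth_torsionOf hC) (fun Y hY => hHs x Y hY)
      (θ' := fun v => hodgeLaplacian (C.metricOf (G 0)) (C.torsionOf (G 0)) x v)
      (fun v => hH' x v) v
    have h2 := (hU 0 h0).eq_deriv _ (h1.congr_of_mem (fun t ht => (hH t ht x v).symm) h0)
      (hc'.mul_const (C.torsionOf (G 0) x v))
    change _ = (_ : ℝ) • C.torsionOf (G 0) x v - lieForm X (C.torsionOf (G 0)) x v
    rw [smul_eq_mul]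
    linarith

end StaticSolitons

/-! ### The Levi-Civita connection and its curvature -/

section Riemannian

variable {n : ℕ} {M : Type*} [TopologicalSpace M] [T2Space M] [ChartedSpace (Model n) M]
  [IsManifold (𝓡 n) ∞ M] {g : Tensor2 n M} {X Y Z W X' Y' : VectorField n M} {x : M} {k : ℕ}

/-- Smooth Riemannian metrics, as tensors. -/
structure IsRiemannian (g : Tensor2 n M) : Prop where
  metricAt : ∀ x, IsMetricAt g x
  smooth : IsSmoothTensor2 g

/-- Fields along a map are smooth if their products with smooth fields are. -/
theorem contMDiffWithinAt_of_tensor2 {EN : Type*} [NormedAddCommGroup EN] [NormedSpace ℝ EN]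
    {HN : Type*} [TopologicalSpace HN] {J : ModelWithCorners ℝ EN HN} {N : Type*}
    [TopologicalSpace N] [ChartedSpace HN N] {f : N → M}
    {A : Π p, TangentSpace (𝓡 n) (f p) →L[ℝ] TangentSpace (𝓡 n) (f p) →L[ℝ] ℝ}
    {w : Π p, TangentSpace (𝓡 n) (f p)} {S : Set N} {p₀ : N} (hp : p₀ ∈ S)
    (hf : ContMDiffWithinAt J (𝓡 n) ∞ f S p₀)
    (hA : ∀ Y Z : VectorField n M, IsSmoothField Y → IsSmoothField Z →
      ContMDiffWithinAt J 𝓘(ℝ, ℝ) ∞ (fun p => A p (Y (f p)) (Z (f p))) S p₀)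
    (hbij : Function.Bijective (A p₀))
    (hw : ∀ Z : VectorField n M, IsSmoothField Z →
      ContMDiffWithinAt J 𝓘(ℝ, ℝ) ∞ (fun p => A p (w p) (Z (f p))) S p₀) :
    ContMDiffWithinAt J ((𝓡 n).prod 𝓘(ℝ, Model n)) ∞ (fun p => TotalSpace.mk' (Model n)
      (E := fun x : M => TangentSpace (𝓡 n) x) (f p) (w p)) S p₀ :=
  contMDiffWithinAt_of_map_section (n := n) (F := Model n) (F₂ := Model n →L[ℝ] ℝ)
    (V := fun x : M => TangentSpace (𝓡 n) x) (V₂ := fun x : M => TangentSpace (𝓡 n) x →L[ℝ] ℝ)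
    (h := f) (A := fun p => (A p).toLinearMap) hp hf
    (fun s hs => contMDiffWithinAt_covector hp hf (fun Z hZ => hA s Z hs hZ)) hbij
    (contMDiffWithinAt_covector hp hf hw)

theorem IsSmoothField.of_tensor2 (hg : IsSmoothTensor2 g) (hbij : ∀ x, Function.Bijective (g x))
    (h : ∀ Z, IsSmoothField Z → IsSmoothFn n M (fun x => g x (W x) (Z x))) : IsSmoothField W :=
  fun x => contMDiffWithinAt_univ.1 (contMDiffWithinAt_of_tensor2 (f := id) (A := g)
    (mem_univ x) contMDiff_id.contMDiffAt.contMDiffWithinAt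
    (fun _ _ hY hZ => (hg _ _ hY hZ x).contMDiffWithinAt) (hbij x)
    (fun _ hZ => (h _ hZ x).contMDiffWithinAt))

namespace IsRiemannian

theorem symm' (hg : IsRiemannian g) (x : M) (u v : TangentSpace (𝓡 n) x) : g x u v = g x v u :=
  (hg.metricAt x).symm u v

theorem ext (hg : IsRiemannian g) {u v : TangentSpace (𝓡 n) x}
    (h : ∀ Z, IsSmoothField Z → g x u (Z x) = g x v (Z x)) : u = v := by
  refine (hg.metricAt x).bijective.1 ?_
  ext w
  have := h _ (tExt_smooth x w)
  rwa [tExt_self] at this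

theorem koszul_tensorial (hg : IsRiemannian g) (hX : IsSmoothField X) (hY : IsSmoothField Y) :
    IsTensorial (fun Z => koszul g X Y Z x) x := by
  have hs := hg.smooth
  refine ⟨fun a b ha hb => ?_, fun f a hf ha => ?_⟩
  · simp only [koszul, Pi.add_apply, map_add]
    rw [dirDeriv_add (hs _ _ hY ha) (hs _ _ hY hb), dirDeriv_add (hs _ _ hX ha) (hs _ _ hX hb),
      lieBr_add_right ha hb, lieBr_add_right ha hb, dirDeriv_add_field]
    simp only [map_add, _root_.add_apply]; ring
  · simp only [koszul, Pi.smul_apply', map_smul, smul_eq_mul]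
    rw [dirDeriv_mul hf (hs _ _ hY ha), dirDeriv_mul hf (hs _ _ hX ha),
      lieBr_smul_right hf ha, lieBr_smul_right hf ha, dirDeriv_smul_field]
    simp only [map_add, map_smul, _root_.add_apply, _root_.smul_apply, smul_eq_mul]
    rw [hg.symm' x (a x) (Y x), hg.symm' x (a x) (X x)]; ring

theorem koszul_add_left (hg : IsRiemannian g) (hX : IsSmoothField X) (hX' : IsSmoothField X')
    (hY : IsSmoothField Y) (hZ : IsSmoothField Z) :
    koszul g (X + X') Y Z x = koszul g X Y Z x + koszul g X' Y Z x := by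
  have hs := hg.smooth
  simp only [koszul, Pi.add_apply, map_add, _root_.add_apply]
  rw [dirDeriv_add (hs _ _ hX hZ) (hs _ _ hX' hZ), dirDeriv_add (hs _ _ hX hY) (hs _ _ hX' hY),
    lieBr_add_left hX hX', lieBr_add_left hX hX', dirDeriv_add_field]
  simp only [map_add, _root_.add_apply]; ring

theorem koszul_smul_left (hg : IsRiemannian g) {f : M → ℝ} (hf : IsSmoothFn n M f)
    (hX : IsSmoothField X) (hY : IsSmoothField Y) (hZ : IsSmoothField Z) :
    koszul g (f • X) Y Z x = f x * koszul g X Y Z x := by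
  have hs := hg.smooth
  simp only [koszul, Pi.smul_apply', map_smul, smul_eq_mul, _root_.smul_apply]
  rw [dirDeriv_mul hf (hs _ _ hX hZ), dirDeriv_mul hf (hs _ _ hX hY),
    lieBr_smul_left hf hX, lieBr_smul_left hf hX, dirDeriv_smul_field]
  simp only [map_sub, map_smul, _root_.sub_apply, _root_.smul_apply, smul_eq_mul]
  ring

theorem koszul_add_right (hg : IsRiemannian g) (hX : IsSmoothField X) (hY : IsSmoothField Y)
    (hY' : IsSmoothField Y') (hZ : IsSmoothField Z) :
    koszul g X (Y + Y') Z x = koszul g X Y Z x + koszul g X Y' Z x := by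
  have hs := hg.smooth
  simp only [koszul, Pi.add_apply, map_add, _root_.add_apply]
  rw [dirDeriv_add (hs _ _ hY hZ) (hs _ _ hY' hZ), dirDeriv_add (hs _ _ hX hY) (hs _ _ hX hY'),
    lieBr_add_right hY hY', lieBr_add_left hY hY', dirDeriv_add_field]
  simp only [map_add, _root_.add_apply]; ring

theorem koszul_smul_right (hg : IsRiemannian g) {f : M → ℝ} (hf : IsSmoothFn n M f)
    (hX : IsSmoothField X) (hY : IsSmoothField Y) (hZ : IsSmoothField Z) :
    koszul g X (f • Y) Z x = f x * koszul g X Y Z x + dirDeriv X f x * g x (Y x) (Z x) := by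
  have hs := hg.smooth
  simp only [koszul, Pi.smul_apply', map_smul, smul_eq_mul, _root_.smul_apply]
  rw [dirDeriv_mul hf (hs _ _ hY hZ), dirDeriv_mul hf (hs _ _ hX hY),
    lieBr_smul_right hf hY, lieBr_smul_left hf hY, dirDeriv_smul_field]
  simp only [map_add, map_sub, map_smul, _root_.add_apply, _root_.sub_apply, _root_.smul_apply,
    smul_eq_mul]
  rw [hg.symm' x (Y x) (X x)]; ring

/-- The Koszul expression is tensorial in Z, hence a covector, and the metric turns it into a
vector. -/
theorem nabla_spec (hg : IsRiemannian g) (hX : IsSmoothField X) (hY : IsSmoothField Y)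
    (hZ : IsSmoothField Z) : g x (nabla g X Y x) (Z x) = koszul g X Y Z x := by
  obtain ⟨L, hL⟩ := exists_covector (hg.koszul_tensorial (x := x) hX hY)
  exact Classical.epsilon_spec (p := fun w : TangentSpace (𝓡 n) x =>
    ∀ Z : VectorField n M, IsSmoothField Z → g x w (Z x) = koszul g X Y Z x)
    ⟨sharp g x L, fun Z hZ => by rw [(hg.metricAt x).apply_sharp, hL Z hZ]⟩ Z hZ

theorem nabla_eq (hg : IsRiemannian g) (hX : IsSmoothField X) (hY : IsSmoothField Y)
    {w : TangentSpace (𝓡 n) x} (h : ∀ Z, IsSmoothField Z → g x w (Z x) = koszul g X Y Z x) :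
    nabla g X Y x = w :=
  hg.ext fun Z hZ => by rw [hg.nabla_spec hX hY hZ, h Z hZ]

theorem smooth_koszul (hg : IsRiemannian g) (hX : IsSmoothField X) (hY : IsSmoothField Y)
    (hZ : IsSmoothField Z) : IsSmoothFn n M (koszul g X Y Z) := by
  have hs := hg.smooth
  exact contMDiff_const.mul ((((((IsSmoothFn.dirDeriv hX (hs _ _ hY hZ)).add
    (IsSmoothFn.dirDeriv hY (hs _ _ hX hZ))).sub (IsSmoothFn.dirDeriv hZ (hs _ _ hX hY))).add
    (hs _ _ (hX.lieBr hY) hZ)).sub (hs _ _ (hX.lieBr hZ) hY)).sub (hs _ _ (hY.lieBr hZ) hX))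

theorem smooth_nabla (hg : IsRiemannian g) (hX : IsSmoothField X) (hY : IsSmoothField Y) :
    IsSmoothField (nabla g X Y) :=
  .of_tensor2 hg.smooth (fun x => (hg.metricAt x).bijective) fun _ hZ =>
    (hg.smooth_koszul hX hY hZ).congr fun _ => hg.nabla_spec hX hY hZ

theorem nabla_add_left (hg : IsRiemannian g) (hX : IsSmoothField X) (hX' : IsSmoothField X')
    (hY : IsSmoothField Y) : nabla g (X + X') Y x = nabla g X Y x + nabla g X' Y x :=
  hg.nabla_eq (hX.add hX') hY fun Z hZ => by
    rw [map_add, _root_.add_apply, hg.nabla_spec hX hY hZ, hg.nabla_spec hX' hY hZ,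
      hg.koszul_add_left hX hX' hY hZ]

theorem nabla_smul_left (hg : IsRiemannian g) {f : M → ℝ} (hf : IsSmoothFn n M f)
    (hX : IsSmoothField X) (hY : IsSmoothField Y) :
    nabla g (f • X) Y x = f x • nabla g X Y x :=
  hg.nabla_eq (hX.smul hf) hY fun Z hZ => by
    rw [map_smul, _root_.smul_apply, hg.nabla_spec hX hY hZ, hg.koszul_smul_left hf hX hY hZ,
      smul_eq_mul]

theorem nabla_add_right (hg : IsRiemannian g) (hX : IsSmoothField X) (hY : IsSmoothField Y)
    (hY' : IsSmoothField Y') : nabla g X (Y + Y') x = nabla g X Y x + nabla g X Y' x :=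
  hg.nabla_eq hX (hY.add hY') fun Z hZ => by
    rw [map_add, _root_.add_apply, hg.nabla_spec hX hY hZ, hg.nabla_spec hX hY' hZ,
      hg.koszul_add_right hX hY hY' hZ]

theorem nabla_smul_right (hg : IsRiemannian g) {f : M → ℝ} (hf : IsSmoothFn n M f)
    (hX : IsSmoothField X) (hY : IsSmoothField Y) :
    nabla g X (f • Y) x = f x • nabla g X Y x + dirDeriv X f x • Y x :=
  hg.nabla_eq hX (hY.smul hf) fun Z hZ => by
    rw [map_add, map_smul, map_smul, _root_.add_apply, _root_.smul_apply, _root_.smul_apply,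
      hg.nabla_spec hX hY hZ, hg.koszul_smul_right hf hX hY hZ, smul_eq_mul, smul_eq_mul]

theorem nabla_congr_left (hg : IsRiemannian g) (hX : IsSmoothField X) (hX' : IsSmoothField X')
    (hY : IsSmoothField Y) (h : X x = X' x) : nabla g X Y x = nabla g X' Y x :=
  IsTensorialAt.congr (Λ := fun X => nabla g X Y x) (x := x)
    ⟨fun _ _ ha hb => hg.nabla_add_left ha hb hY, fun _ _ hf ha => hg.nabla_smul_left hf ha hY⟩
    hX hX' h

variable (g) in
/-- The right-hand side in the definition of the curvature tensor. -/
def riem (X Y Z : VectorField n M) (x : M) : TangentSpace (𝓡 n) x :=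
  nabla g X (nabla g Y Z) x - nabla g Y (nabla g X Z) x - nabla g (lieBr X Y) Z x

theorem riem_swap (hg : IsRiemannian g) (hX : IsSmoothField X) (hY : IsSmoothField Y)
    (hZ : IsSmoothField Z) : riem g X Y Z x = - riem g Y X Z x := by
  have h1 : nabla g (lieBr X Y) Z x = - nabla g (lieBr Y X) Z x := by
    have h2 := hg.nabla_congr_left (hX.lieBr hY) (IsSmoothField.smul (f := fun _ => (-1 : ℝ))
      contMDiff_const (hY.lieBr hX)) hZ (x := x) (by rw [lieBr_swap]; simp)
    rw [h2, hg.nabla_smul_left contMDiff_const (hY.lieBr hX) hZ, neg_one_smul]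
  rw [riem, riem, h1]
  abel

theorem riem_tensorial₁ (hg : IsRiemannian g) (hY : IsSmoothField Y) (hZ : IsSmoothField Z) :
    IsTensorial (fun X => riem g X Y Z x) x := by
  have hn := hg.smooth_nabla hY hZ
  refine ⟨fun a b (ha : IsSmoothField a) (hb : IsSmoothField b) => ?_,
    fun f a hf (ha : IsSmoothField a) => ?_⟩
  · have h1 : nabla g (a + b) Z = nabla g a Z + nabla g b Z :=
      funext fun y => hg.nabla_add_left ha hb hZ
    have h2 := hg.nabla_congr_left (x := x) ((ha.add hb).lieBr hY)
      ((ha.lieBr hY).add (hb.lieBr hY)) hZ (lieBr_add_left ha hb)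
    simp only [riem]
    rw [h1, h2, hg.nabla_add_left ha hb hn,
      hg.nabla_add_right hY (hg.smooth_nabla ha hZ) (hg.smooth_nabla hb hZ),
      hg.nabla_add_left (ha.lieBr hY) (hb.lieBr hY) hZ]
    abel
  · have h1 : nabla g (f • a) Z = f • nabla g a Z :=
      funext fun y => hg.nabla_smul_left hf ha hZ
    have hYf := (IsSmoothFn.dirDeriv hY hf)
    have hs : IsSmoothField ((fun y => (-1 : ℝ) * dirDeriv Y f y) • a) :=
      ha.smul (contMDiff_const.mul hYf)
    have h2 := hg.nabla_congr_left (x := x) ((ha.smul hf).lieBr hY)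
      (((ha.lieBr hY).smul hf).add hs) hZ (by
        rw [lieBr_smul_left hf ha]
        simp [sub_eq_add_neg])
    simp only [riem]
    rw [h1, h2, hg.nabla_smul_left hf ha hn, hg.nabla_smul_right hf hY (hg.smooth_nabla ha hZ),
      hg.nabla_add_left ((ha.lieBr hY).smul hf) hs hZ, hg.nabla_smul_left hf (ha.lieBr hY) hZ,
      hg.nabla_smul_left (f := fun y => (-1 : ℝ) * dirDeriv Y f y) (contMDiff_const.mul hYf) ha hZ]
    module

/-- Obtained from the first slot by skew-symmetry in X and Y. -/
theorem riem_tensorial₂ (hg : IsRiemannian g) (hX : IsSmoothField X) (hZ : IsSmoothField Z) :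
    IsTensorial (fun Y => riem g X Y Z x) x := by
  have h := hg.riem_tensorial₁ (x := x) hX hZ
  refine ⟨fun a b ha hb => ?_, fun f a hf ha => ?_⟩
  · have := h.add a b ha hb
    simp only [hg.riem_swap hX (IsSmoothField.add ha hb) hZ, hg.riem_swap hX ha hZ,
      hg.riem_swap hX hb hZ, this]
    abel
  · have := h.smul f a hf ha
    simp only [hg.riem_swap hX (IsSmoothField.smul hf ha) hZ, hg.riem_swap hX ha hZ, this]
    rw [smul_neg]

/-- The second derivatives of f produced by the two orders of differentiation cancel against the
derivative of f along [X, Y], because the bracket is the commutator of derivations. -/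
theorem riem_tensorial₃ (hg : IsRiemannian g) (hX : IsSmoothField X) (hY : IsSmoothField Y) :
    IsTensorial (fun Z => riem g X Y Z x) x := by
  have hL := hX.lieBr hY
  refine ⟨fun a b ha hb => ?_, fun f a hf ha => ?_⟩
  · have h1 : ∀ W, IsSmoothField W → nabla g W (a + b) = nabla g W a + nabla g W b :=
      fun W hW => funext fun y => hg.nabla_add_right hW ha hb
    simp only [riem]
    rw [h1 X hX, h1 Y hY, h1 _ hL,
      hg.nabla_add_right hX (hg.smooth_nabla hY ha) (hg.smooth_nabla hY hb),
      hg.nabla_add_right hY (hg.smooth_nabla hX ha) (hg.smooth_nabla hX hb), Pi.add_apply]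
    abel
  · have h1 : ∀ W, IsSmoothField W → nabla g W (f • a) = f • nabla g W a + dirDeriv W f • a :=
      fun W hW => funext fun y => hg.nabla_smul_right hf hW ha
    have hd : ∀ {W}, IsSmoothField W → IsSmoothFn n M (dirDeriv W f) :=
      fun hW => IsSmoothFn.dirDeriv hW hf
    have hna : ∀ {W}, IsSmoothField W → IsSmoothField (nabla g W a) :=
      fun hW => hg.smooth_nabla hW ha
    simp only [riem]
    rw [h1 X hX, h1 Y hY, h1 _ hL, hg.nabla_add_right hX ((hna hY).smul hf)
        (IsSmoothField.smul (hd hY) ha),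
      hg.nabla_add_right hY ((hna hX).smul hf) (IsSmoothField.smul (hd hX) ha),
      hg.nabla_smul_right hf hX (hna hY), hg.nabla_smul_right hf hY (hna hX),
      hg.nabla_smul_right (hd hY) hX ha, hg.nabla_smul_right (hd hX) hY ha, Pi.add_apply,
      Pi.smul_apply', Pi.smul_apply', dirDeriv_lieBr hX hY hf]
    module

theorem curvature_spec (hg : IsRiemannian g) (hX : IsSmoothField X) (hY : IsSmoothField Y)
    (hZ : IsSmoothField Z) : curvature g x (X x) (Y x) (Z x) = riem g X Y Z x := by
  refine Classical.epsilon_spec (p := fun R : TangentSpace (𝓡 n) x →ₗ[ℝ]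
    TangentSpace (𝓡 n) x →ₗ[ℝ] TangentSpace (𝓡 n) x →ₗ[ℝ] TangentSpace (𝓡 n) x =>
    ∀ X Y Z : VectorField n M, IsSmoothField X → IsSmoothField Y → IsSmoothField Z →
      R (X x) (Y x) (Z x) = riem g X Y Z x) ?_ X Y Z hX hY hZ
  -- For smooth X and Y this is Z ↦ R(X,Y)Z as a linear map, with a default value 0 otherwise. The
  -- trilinear map is then a bilinear map with values in linear maps.
  have h3 : ∀ X Y : VectorField n M, ∃ L : TangentSpace (𝓡 n) x →ₗ[ℝ] TangentSpace (𝓡 n) x,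
      IsSmoothField X → IsSmoothField Y → ∀ Z, IsSmoothField Z → L (Z x) = riem g X Y Z x := by
    intro X Y
    by_cases h : IsSmoothField X ∧ IsSmoothField Y
    · obtain ⟨L, hL⟩ := exists_linear (hg.riem_tensorial₃ (x := x) h.1 h.2)
      exact ⟨L, fun _ _ => hL⟩
    · exact ⟨0, fun h1 h2 => absurd ⟨h1, h2⟩ h⟩
  choose Λ hΛ using h3
  have hu : ∀ X Y : VectorField n M, IsSmoothField X → IsSmoothField Y → ∀ u,
      Λ X Y u = riem g X Y (tExt x u) x := fun X Y hX hY u => by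
    rw [← hΛ X Y hX hY _ (tExt_smooth x u), tExt_self]
  obtain ⟨B, hB⟩ := exists_bilin_linear (Λ := Λ) (x := x)
    (fun Y hY => ⟨fun a b ha hb => by
        ext u
        rw [LinearMap.add_apply, hu _ _ (IsSmoothField.add ha hb) hY, hu _ _ ha hY, hu _ _ hb hY]
        exact (hg.riem_tensorial₁ hY (tExt_smooth x u)).add a b ha hb,
      fun f a hf ha => by
        ext u
        rw [LinearMap.smul_apply, hu _ _ (IsSmoothField.smul hf ha) hY, hu _ _ ha hY]
        exact (hg.riem_tensorial₁ hY (tExt_smooth x u)).smul f a hf ha⟩)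
    (fun X hX => ⟨fun a b ha hb => by
        ext u
        rw [LinearMap.add_apply, hu _ _ hX (IsSmoothField.add ha hb), hu _ _ hX ha, hu _ _ hX hb]
        exact (hg.riem_tensorial₂ hX (tExt_smooth x u)).add a b ha hb,
      fun f a hf ha => by
        ext u
        rw [LinearMap.smul_apply, hu _ _ hX (IsSmoothField.smul hf ha), hu _ _ hX ha]
        exact (hg.riem_tensorial₂ hX (tExt_smooth x u)).smul f a hf ha⟩)
  exact ⟨B, fun X Y Z hX hY hZ => by rw [hB X Y hX hY, hΛ X Y hX hY Z hZ]⟩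

end IsRiemannian

end Riemannian

/-! ### Traces: Ricci curvature, codifferential -/

section Traces

variable {n : ℕ} {M : Type*} [TopologicalSpace M] [T2Space M] [ChartedSpace (Model n) M]
  [IsManifold (𝓡 n) ∞ M] {g : Tensor2 n M} {X Y Z : VectorField n M} {x : M} {k : ℕ}
  {e : Fin n → TangentSpace (𝓡 n) x}

theorem form₃_eq_curryLeft (H : TangentSpace (𝓡 n) x [⋀^Fin 3]→L[ℝ] ℝ)
    (u a c : TangentSpace (𝓡 n) x) : H ![u, a, c] =
      (((H.toAlternatingMap.curryLeft u).curryLeft a).curryLeft c) ![] := rfl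

/-- A trace may be computed in any frame paired with the metric duals of its coframe. Smooth
coordinate frames can thus replace orthonormal bases chosen point by point. -/
theorem isOrthonormalAt_trace (he : IsOrthonormalAt g x e) {ι : Type*} [Fintype ι] {E : ι → TangentSpace (𝓡 n) x} {ε : ι → TangentSpace (𝓡 n) x →L[ℝ] ℝ}
    {E' : ι → TangentSpace (𝓡 n) x} (hE : ∀ v, v = ∑ i, ε i v • E i) (hE' : ∀ i, g x (E' i) = ε i)
    (β : TangentSpace (𝓡 n) x →ₗ[ℝ] TangentSpace (𝓡 n) x →ₗ[ℝ] ℝ) :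
    ∑ a, β (e a) (e a) = ∑ i, β (E i) (E' i) := by
  have h1 : ∀ i, β (E i) (E' i) = ∑ a, ε i (e a) * β (E i) (e a) := fun i => by
    conv_lhs => rw [he.expand (E' i)]
    simp only [map_sum, map_smul, hE', smul_eq_mul]
  have h2 : ∀ a, β (e a) (e a) = ∑ i, ε i (e a) * β (E i) (e a) := fun a => by
    conv_lhs => rw [hE (e a)]
    have h3 : ∀ w, β (∑ i, ε i (e a) • E i) w = ∑ i, ε i (e a) * β (E i) w := fun w => by
      simp only [map_sum, map_smul, LinearMap.sum_apply, LinearMap.smul_apply, smul_eq_mul]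
    rw [h3]
    simp_rw [← hE (e a)]
  simp_rw [h1, h2]
  exact Finset.sum_comm

namespace IsMetricAt

theorem ricci_spec (hg : IsMetricAt g x) (he : IsOrthonormalAt g x e)
    (u v : TangentSpace (𝓡 n) x) :
    ricci g x u v = ∑ i, g x (curvature g x (e i) u v) (e i) := by
  refine Classical.epsilon_spec (p := fun B : TangentSpace (𝓡 n) x →L[ℝ]
    TangentSpace (𝓡 n) x →L[ℝ] ℝ => ∀ e, IsOrthonormalAt g x e → ∀ u v,
      B u v = ∑ i, g x (curvature g x (e i) u v) (e i))
    ⟨LinearMap.toContinuousBilinearMap (LinearMap.mk₂ ℝ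
      (fun u v => ∑ i, g x (curvature g x (e i) u v) (e i)) ?_ ?_ ?_ ?_), ?_⟩ e he u v
  · intro u u' v; simp [Finset.sum_add_distrib]
  · intro r u v; simp [Finset.mul_sum]
  · intro u v v'; simp [Finset.sum_add_distrib]
  · intro r u v; simp [Finset.mul_sum]
  · intro e' he' u v
    let β : TangentSpace (𝓡 n) x →ₗ[ℝ] TangentSpace (𝓡 n) x →ₗ[ℝ] ℝ :=
      LinearMap.mk₂ ℝ (fun a b => g x (curvature g x a u v) b) (by simp) (by simp) (by simp)
        (by simp)
    exact (he.sum_eq he' hg.symm β).symm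

theorem formSq_spec (hg : IsMetricAt g x) (H : DiffForm n M 3) (he : IsOrthonormalAt g x e)
    (u v : TangentSpace (𝓡 n) x) :
    formSq g H x u v = ∑ i, ∑ j, H x ![u, e i, e j] * H x ![v, e i, e j] := by
  have hlin := form₃_eq_curryLeft (H x)
  refine Classical.epsilon_spec (p := fun B : TangentSpace (𝓡 n) x →L[ℝ]
    TangentSpace (𝓡 n) x →L[ℝ] ℝ => ∀ e, IsOrthonormalAt g x e → ∀ u v,
      B u v = ∑ i, ∑ j, H x ![u, e i, e j] * H x ![v, e i, e j])
    ⟨LinearMap.toContinuousBilinearMap (LinearMap.mk₂ ℝ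
      (fun u v => ∑ i, ∑ j, H x ![u, e i, e j] * H x ![v, e i, e j]) ?_ ?_ ?_ ?_), ?_⟩ e he u v
  · intro u u' v
    simp only [hlin, map_add, AlternatingMap.curryLeft_add, LinearMap.add_apply,
      AlternatingMap.add_apply, add_mul, Finset.sum_add_distrib]
  · intro r u v
    simp only [hlin, map_smul, AlternatingMap.curryLeft_smul, LinearMap.smul_apply,
      AlternatingMap.smul_apply, smul_mul_assoc, Finset.smul_sum]
  · intro u v v'
    simp only [hlin, map_add, AlternatingMap.curryLeft_add, LinearMap.add_apply,
      AlternatingMap.add_apply, mul_add, Finset.sum_add_distrib]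
  · intro r u v
    simp only [hlin, map_smul, AlternatingMap.curryLeft_smul, LinearMap.smul_apply,
      AlternatingMap.smul_apply, mul_smul_comm, Finset.smul_sum]
  · intro e' he' u v
    change ∑ i, ∑ j, H x ![u, e i, e j] * H x ![v, e i, e j] = _
    let β (a : TangentSpace (𝓡 n) x) :
        TangentSpace (𝓡 n) x →ₗ[ℝ] TangentSpace (𝓡 n) x →ₗ[ℝ] ℝ :=
      LinearMap.mk₂ ℝ (fun b c => H x ![u, a, b] * H x ![v, a, c])
        (by intros; simp only [hlin, map_add, AlternatingMap.add_apply, add_mul])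
        (by intros; simp only [hlin, map_smul, AlternatingMap.smul_apply, smul_mul_assoc])
        (by intros; simp only [hlin, map_add, AlternatingMap.add_apply, mul_add])
        (by intros; simp only [hlin, map_smul, AlternatingMap.smul_apply, mul_smul_comm])
    let γ (a : TangentSpace (𝓡 n) x) :
        TangentSpace (𝓡 n) x →ₗ[ℝ] TangentSpace (𝓡 n) x →ₗ[ℝ] ℝ :=
      LinearMap.mk₂ ℝ (fun b c => H x ![u, b, a] * H x ![v, c, a])
        (by intros; simp only [hlin, map_add, LinearMap.add_apply, AlternatingMap.curryLeft_add,
              AlternatingMap.add_apply, add_mul])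
        (by intros; simp only [hlin, map_smul, LinearMap.smul_apply, AlternatingMap.curryLeft_smul,
              AlternatingMap.smul_apply, smul_mul_assoc])
        (by intros; simp only [hlin, map_add, LinearMap.add_apply, AlternatingMap.curryLeft_add,
              AlternatingMap.add_apply, mul_add])
        (by intros; simp only [hlin, map_smul, LinearMap.smul_apply, AlternatingMap.curryLeft_smul,
              AlternatingMap.smul_apply, mul_smul_comm])
    have h1 := fun a => he.sum_eq he' hg.symm (β a)
    have h2 := fun a => he.sum_eq he' hg.symm (γ a)
    simp only [β, γ, LinearMap.mk₂_apply] at h1 h2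
    -- The change of orthonormal basis is performed in one index at a time, the other being held
    -- fixed.
    simp_rw [h1]
    rw [Finset.sum_comm]
    conv_rhs => rw [Finset.sum_comm]
    simp_rw [h2]

/-- The metric contraction of the codifferential does not depend on the orthonormal basis. -/
theorem codiff_spec (hg : IsMetricAt g x) {θ : DiffForm n M (k + 1)} (he : IsOrthonormalAt g x e)
    (v : Fin k → TangentSpace (𝓡 n) x) :
    codiff g θ x v = -∑ i, nablaForm g θ x (e i) (Matrix.vecCons (e i) v) := by
  let A : TangentSpace (𝓡 n) x [⋀^Fin k]→ₗ[ℝ] ℝ :=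
    -∑ i, (nablaForm g θ x (e i)).toAlternatingMap.curryLeft (e i)
  have hA : ∀ v, A v = -∑ i, nablaForm g θ x (e i) (Matrix.vecCons (e i) v) := fun v => by
    let ev : (TangentSpace (𝓡 n) x [⋀^Fin k]→ₗ[ℝ] ℝ) →+ ℝ :=
      { toFun := fun f => f v, map_zero' := rfl, map_add' := fun _ _ => rfl }
    change -ev (∑ i, (nablaForm g θ x (e i)).toAlternatingMap.curryLeft (e i)) = _
    rw [map_sum]
    rfl
  refine Classical.epsilon_spec (p := fun α : TangentSpace (𝓡 n) x [⋀^Fin k]→L[ℝ] ℝ =>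
    ∀ e, IsOrthonormalAt g x e → ∀ v : Fin k → TangentSpace (𝓡 n) x,
      α v = -∑ i, nablaForm g θ x (e i) (Matrix.vecCons (e i) v))
    ⟨mkForm A.toMultilinearMap fun v i j hij hne => A.map_eq_zero_of_eq v hij hne, ?_⟩ e he v
  intro e' he' v
  refine (hA v).trans ?_
  let β : TangentSpace (𝓡 n) x →ₗ[ℝ] TangentSpace (𝓡 n) x →ₗ[ℝ] ℝ :=
    LinearMap.mk₂ ℝ (fun a b => nablaForm g θ x a (Matrix.vecCons b v)) (by simp) (by simp)
      (fun a b c => (nablaForm g θ x a).vecCons_add v b c)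
      (fun r a b => (nablaForm g θ x a).vecCons_smul v r b)
  rw [neg_inj]
  exact (he.sum_eq he' hg.symm β).symm

end IsMetricAt

namespace IsRiemannian

theorem nablaForm_spec (hg : IsRiemannian g) {θ : DiffForm n M k} (hθ : IsSmoothForm θ)
    (hX : IsSmoothField X) {Y : Fin k → VectorField n M} (hY : ∀ i, IsSmoothField (Y i)) :
    nablaForm g θ x (X x) (fun i => Y i x) = dirDeriv X (fun y => θ y (fun i => Y i y)) x
      - ∑ i, θ x (Function.update (fun j => Y j x) i (nabla g X (Y i) x)) := by
  refine Classical.epsilon_spec (p := fun D : TangentSpace (𝓡 n) x →ₗ[ℝ]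
      TangentSpace (𝓡 n) x [⋀^Fin k]→L[ℝ] ℝ =>
    ∀ (X : VectorField n M) (Y : Fin k → VectorField n M), IsSmoothField X →
      (∀ i, IsSmoothField (Y i)) →
      D (X x) (fun i => Y i x) = dirDeriv X (fun y => θ y (fun i => Y i y)) x
        - ∑ i, θ x (Function.update (fun j => Y j x) i (nabla g X (Y i) x))) ?_ X Y hX hY
  have h1 : ∀ X : VectorField n M, ∃ α : TangentSpace (𝓡 n) x [⋀^Fin k]→L[ℝ] ℝ,
      IsSmoothField X → ∀ Y : Fin k → VectorField n M, (∀ i, IsSmoothField (Y i)) →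
      α (fun i => Y i x) = dirDeriv X (fun y => θ y (fun i => Y i y)) x
        - ∑ i, θ x (Function.update (fun j => Y j x) i (nabla g X (Y i) x)) := by
    intro X
    by_cases hX : IsSmoothField X
    · obtain ⟨α, hα⟩ := exists_form_derivation (X := X) (x := x) (D := nabla g X) hθ
        (fun a b ha hb => hg.nabla_add_right hX ha hb)
        (fun f a hf ha => hg.nabla_smul_right hf hX ha)
      exact ⟨α, fun _ => hα⟩
    · exact ⟨0, fun h => absurd h hX⟩
  choose Λ hΛ using h1
  obtain ⟨D, hD⟩ := exists_linear (Λ := Λ) (x := x)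
    ⟨fun a b ha hb => form_ext fun Y hY => by
      rw [ContinuousAlternatingMap.add_apply, hΛ _ (IsSmoothField.add ha hb) Y hY, hΛ a ha Y hY,
        hΛ b hb Y hY, dirDeriv_add_field]
      simp only [hg.nabla_add_left ha hb (hY _), ContinuousAlternatingMap.map_update_add,
        Finset.sum_add_distrib]
      ring,
    fun f a hf ha => form_ext fun Y hY => by
      rw [ContinuousAlternatingMap.smul_apply, hΛ _ (IsSmoothField.smul hf ha) Y hY, hΛ a ha Y hY,
        dirDeriv_smul_field]
      simp only [hg.nabla_smul_left hf ha (hY _), ContinuousAlternatingMap.map_update_smul,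
        smul_eq_mul, ← Finset.mul_sum]
      ring⟩
  exact ⟨D, fun X Y hX hY => by rw [hD X hX, hΛ X hX Y hY]⟩

theorem smooth_nablaForm (hg : IsRiemannian g) {θ : DiffForm n M k} (hθ : IsSmoothForm θ)
    (hX : IsSmoothField X) {Y : Fin k → VectorField n M} (hY : ∀ i, IsSmoothField (Y i)) :
    IsSmoothFn n M (fun x => nablaForm g θ x (X x) (fun i => Y i x)) := by
  have h1 : IsSmoothFn n M (fun x => dirDeriv X (fun y => θ y (fun i => Y i y)) x
      - ∑ i, θ x (Function.update (fun j => Y j x) i (nabla g X (Y i) x))) := by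
    refine (IsSmoothFn.dirDeriv hX (hθ Y hY)).sub (contMDiff_finsetSum fun i _ => ?_)
    refine (hθ _ (smooth_update hY i (hg.smooth_nabla hX (hY i)))).congr fun y => ?_
    rw [apply_update_eval]
  exact h1.congr fun y => hg.nablaForm_spec hθ hX hY

/-- Near x the codifferential is written as a trace over the coordinate frame and the vectors
g⁻¹ε_i. These are smooth by inversion of g, so no smooth orthonormal frame is needed. -/
theorem smooth_codiff (hg : IsRiemannian g) {θ : DiffForm n M (k + 1)} (hθ : IsSmoothForm θ) :
    IsSmoothForm (codiff g θ) := by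
  intro Y hY x
  let b := Module.finBasis ℝ (Model n)
  let E : ∀ i : Fin (Module.finrank ℝ (Model n)), VectorField n M := fun i =>
    frame n (Model n) (V := fun x : M => TangentSpace (𝓡 n) x) x (b i)
  let ε : Fin (Module.finrank ℝ (Model n)) → ∀ y : M, TangentSpace (𝓡 n) y →L[ℝ] ℝ :=
    fun i y => LinearMap.toContinuousLinearMap
      { toFun := fun v => b.coord i (crd (Model n) x v)
        map_add' := fun v w => by rw [crd_add, map_add]
        map_smul' := fun r v => by rw [crd_smul, map_smul]; rfl }
  have hEs : ∀ i, IsSmoothField (E i) := fun i => frame_smooth x (b i)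
  have hε : ∀ i (Z : VectorField n M), IsSmoothField Z →
      ContMDiffWithinAt (𝓡 n) 𝓘(ℝ, ℝ) ∞ (fun y => ε i y (Z y)) univ x := by
    intro i Z hZ
    have h1 := ((contMDiffWithinAt_totalSpace_iff_crd (n := n) (F := Model n) (f := _root_.id)
      (V := fun x : M => TangentSpace (𝓡 n) x) (v := Z) (mem_univ x)).1
      (hZ x).contMDiffWithinAt).2
    exact (LinearMap.toContinuousLinearMap (b.coord i)).contMDiff.contMDiffAt.comp_contMDiffWithinAt
      x h1
  have hE : ∀ᶠ y in 𝓝 x, ∀ v : TangentSpace (𝓡 n) y, v = ∑ i, ε i y v • E i y := by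
    filter_upwards [frame_crd (n := n) (F := Model n) (V := fun x : M => TangentSpace (𝓡 n) x) x]
      with y hy v
    let L : Model n →ₗ[ℝ] TangentSpace (𝓡 n) y :=
      { toFun := fun w => frame n (Model n) (V := fun x : M => TangentSpace (𝓡 n) x) x w y
        map_add' := fun v w => by rw [frame_add]; rfl
        map_smul' := fun r v => by rw [frame_smul]; rfl }
    have h1 : L (crd (Model n) x v) = v := hy v
    conv_lhs => rw [← h1, ← b.sum_repr (crd (Model n) x v), map_sum]
    exact Finset.sum_congr rfl fun i _ => by rw [map_smul]; rfl
  have key : ContMDiffWithinAt (𝓡 n) 𝓘(ℝ, ℝ) ∞ (fun y => -∑ i, nablaForm g θ y (E i y)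
      (Matrix.vecCons (sharp g y (ε i y)) fun j => Y j y)) univ x := by
    refine (contMDiffWithinAt_finsetSum fun i _ => ?_).neg
    have hv : ContMDiffWithinAt (𝓡 n) ((𝓡 n).prod 𝓘(ℝ, Model n)) ∞ (fun y =>
        TotalSpace.mk' (Model n) (E := fun x : M => TangentSpace (𝓡 n) x) y
          (sharp g y (ε i y))) univ x := by
      refine contMDiffWithinAt_of_tensor2 (f := id) (A := g) (mem_univ x)
        contMDiff_id.contMDiffAt.contMDiffWithinAt
        (fun _ _ hY hZ => (hg.smooth _ _ hY hZ x).contMDiffWithinAt) (hg.metricAt x).bijective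
        (fun Z hZ => ?_)
      simp only [id, (hg.metricAt _).apply_sharp]
      exact hε i Z hZ
    refine contMDiffWithinAt_apply_section (n := n) (F := Model n) (f := _root_.id)
      (V := fun x : M => TangentSpace (𝓡 n) x) (W := ℝ)
      (A := fun y =>
        { toFun := fun w => nablaForm g θ y (E i y) (Matrix.vecCons w fun j => Y j y)
          map_add' := fun v w => (nablaForm g θ y (E i y)).vecCons_add _ v w
          map_smul' := fun r v => (nablaForm g θ y (E i y)).vecCons_smul _ r v })
      (mem_univ x) (fun s hs => ?_) hv
    have h1 := hg.smooth_nablaForm (θ := θ) hθ (hEs i) (Y := Matrix.vecCons s Y)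
      (fun j => by refine Fin.cases ?_ (fun j => ?_) j; exacts [hs, hY j])
    refine (h1.congr fun y => ?_) x |>.contMDiffWithinAt
    change nablaForm g θ y (E i y) _ = _
    congr 1
    funext j
    refine Fin.cases ?_ (fun j => ?_) j <;> rfl
  rw [← contMDiffWithinAt_univ]
  refine key.congr_of_eventuallyEq_of_mem ?_ (mem_univ x)
  rw [nhdsWithin_univ]
  filter_upwards [hE] with y hy
  have hm := hg.metricAt y
  obtain ⟨e, he⟩ := hm.exists_orthonormal
  rw [hm.codiff_spec he, neg_inj]
  let β : TangentSpace (𝓡 n) y →ₗ[ℝ] TangentSpace (𝓡 n) y →ₗ[ℝ] ℝ :=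
    LinearMap.mk₂ ℝ (fun a b => nablaForm g θ y a (Matrix.vecCons b fun j => Y j y)) (by simp)
      (by simp) (fun a b c => (nablaForm g θ y a).vecCons_add _ b c)
      (fun r a b => (nablaForm g θ y a).vecCons_smul _ r b)
  exact isOrthonormalAt_trace he hy (fun i => hm.apply_sharp (ε i y)) β

end IsRiemannian

end Traces

/-! ### Naturality under diffeomorphisms -/

section Naturality

variable {n : ℕ} {M : Type*} [TopologicalSpace M] [T2Space M] [ChartedSpace (Model n) M]
  [IsManifold (𝓡 n) ∞ M] {f : M ≃ₘ^∞⟮𝓡 n, 𝓡 n⟯ M} {g g' : Tensor2 n M} {c : ℝ}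
  {X Y Z X' Y' Z' : VectorField n M} {x : M} {k : ℕ}

/-- The differential of a diffeomorphism. -/
abbrev tangentEquiv (f : M ≃ₘ^∞⟮𝓡 n, 𝓡 n⟯ M) (x : M) :
    TangentSpace (𝓡 n) x ≃L[ℝ] TangentSpace (𝓡 n) (f x) :=
  f.mfderivToContinuousLinearEquiv (by simp) x

/-- `f`-related vector fields. -/
def IsRelated (f : M ≃ₘ^∞⟮𝓡 n, 𝓡 n⟯ M) (Y Y' : VectorField n M) : Prop :=
  ∀ x, tangentEquiv f x (Y x) = Y' (f x)

theorem contMDiff_tangentEquiv (f : M ≃ₘ^∞⟮𝓡 n, 𝓡 n⟯ M) (hY : IsSmoothField Y) :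
    ContMDiff (𝓡 n) ((𝓡 n).prod 𝓘(ℝ, Model n)) ∞ (fun x => TotalSpace.mk' (Model n)
      (E := fun x : M => TangentSpace (𝓡 n) x) (f x) (tangentEquiv f x (Y x))) :=
  (f.contMDiff.contMDiff_tangentMap (by exact_mod_cast le_top)).comp hY

theorem exists_pull (f : M ≃ₘ^∞⟮𝓡 n, 𝓡 n⟯ M) (hY' : IsSmoothField Y') :
    ∃ Y, IsSmoothField Y ∧ IsRelated f Y Y' := by
  refine ⟨fun x => (tangentEquiv f x).symm (Y' (f x)), fun x => contMDiffWithinAt_univ.1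
    (contMDiffWithinAt_of_map_section (n := n) (F := Model n) (F₂ := Model n) (f := _root_.id)
      (h := f) (V := fun x : M => TangentSpace (𝓡 n) x) (V₂ := fun x : M => TangentSpace (𝓡 n) x)
      (A := fun x => (tangentEquiv f x).toLinearEquiv.toLinearMap) (mem_univ x)
      contMDiff_id.contMDiffAt.contMDiffWithinAt
      (fun s hs => (contMDiff_tangentEquiv f hs x).contMDiffWithinAt)
      (tangentEquiv f x).bijective ?_), fun x => (tangentEquiv f x).apply_symm_apply _⟩
  refine ((ContMDiff.comp hY' f.contMDiff).congr fun y => ?_) x |>.contMDiffWithinAt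
  exact congrArg (TotalSpace.mk' (Model n) (f y)) ((tangentEquiv f y).apply_symm_apply _)

theorem exists_push (f : M ≃ₘ^∞⟮𝓡 n, 𝓡 n⟯ M) (hY : IsSmoothField Y) :
    ∃ Y', IsSmoothField Y' ∧ IsRelated f Y Y' := by
  refine ⟨fun y => f.apply_symm_apply y ▸ tangentEquiv f (f.symm y) (Y (f.symm y)), ?_,
    fun x => (cast_apply f.injective (fun x => tangentEquiv f x (Y x)) _).symm⟩
  refine ((contMDiff_tangentEquiv f hY).comp f.symm.contMDiff).congr fun y => mk'_cast _ _

theorem exists_pull_eq (f : M ≃ₘ^∞⟮𝓡 n, 𝓡 n⟯ M) (x : M) (u : TangentSpace (𝓡 n) x) :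
    ∃ Y Y', IsSmoothField Y ∧ IsSmoothField Y' ∧ IsRelated f Y Y' ∧ Y x = u :=
  (exists_push f (tExt_smooth x u)).elim fun Y' h => ⟨_, Y', tExt_smooth x u, h.1, h.2, tExt_self x u⟩

theorem IsRelated.dirDeriv (h : IsRelated f Y Y') {φ : M → ℝ} (hφ : IsSmoothFn n M φ) :
    dirDeriv Y' φ (f x) = dirDeriv Y (fun y => φ (f y)) x := by
  have h1 : mfderiv (𝓡 n) 𝓘(ℝ, ℝ) (fun y => φ (f y)) x =
      (mfderiv (𝓡 n) 𝓘(ℝ, ℝ) φ (f x)).comp (mfderiv (𝓡 n) (𝓡 n) f x) :=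
    mfderiv_comp x (hφ.mdiff _) (f.contMDiff.mdifferentiableAt (by simp))
  have h2 := congrArg (fun L => (L (Y x) : ℝ)) h1
  refine Eq.trans ?_ h2.symm
  exact congrArg (fun w => (mfderiv (𝓡 n) 𝓘(ℝ, ℝ) φ (f x) w : ℝ)) (h x).symm

theorem IsSmoothFn.comp_diffeo {φ : M → ℝ} (hφ : IsSmoothFn n M φ) :
    IsSmoothFn n M (fun y => φ (f y)) := hφ.comp f.contMDiff

/-- The image of [Y, Z] and the field [Y', Z'] act in the same way on functions, by the commutator
formula on both sides. -/
theorem IsRelated.lieBr (hY : IsRelated f Y Y') (hZ : IsRelated f Z Z') (sY : IsSmoothField Y)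
    (sZ : IsSmoothField Z) (sY' : IsSmoothField Y') (sZ' : IsSmoothField Z') :
    IsRelated f (lieBr Y Z) (lieBr Y' Z') := by
  intro x
  refine tangent_ext fun φ hφ => ?_
  have hφf : IsSmoothFn n M (fun y => φ (f y)) := hφ.comp_diffeo
  obtain ⟨W', sW', hW⟩ := exists_push f (sY.lieBr sZ)
  have h1 := hW.dirDeriv hφ (x := x)
  have h2 : ∀ {A A' : VectorField n M}, IsRelated f A A' →
      (fun y => GenRicci.dirDeriv A' φ (f y)) = GenRicci.dirDeriv A (fun y => φ (f y)) :=
    fun h => funext fun y => h.dirDeriv hφ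
  rw [dirDeriv_lieBr sY sZ hφf, ← h2 hZ, ← h2 hY, ← hY.dirDeriv (IsSmoothFn.dirDeriv sZ' hφ),
    ← hZ.dirDeriv (IsSmoothFn.dirDeriv sY' hφ), ← dirDeriv_lieBr sY' sZ' hφ] at h1
  rw [hW x]
  exact h1

theorem isMetricAt_of_scaled (hg : IsRiemannian g') (hc : 0 < c)
    (h : ∀ x u v, g x u v = c * g' (f x) (tangentEquiv f x u) (tangentEquiv f x v)) (x : M) :
    IsMetricAt g x :=
  ⟨fun u v => by rw [h, h, hg.symm'], fun u hu => by
    rw [h]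
    exact mul_pos hc ((hg.metricAt _).pos _ (by simpa using hu))⟩

theorem isRiemannian_of_scaled (hg : IsRiemannian g') (hc : 0 < c)
    (h : ∀ x u v, g x u v = c * g' (f x) (tangentEquiv f x u) (tangentEquiv f x v)) :
    IsRiemannian g := by
  refine ⟨isMetricAt_of_scaled hg hc h, fun Y Z hY hZ => ?_⟩
  obtain ⟨Y', sY', rY⟩ := exists_push f hY
  obtain ⟨Z', sZ', rZ⟩ := exists_push f hZ
  refine ContMDiff.congr ((contMDiff_const (c := c)).mul
    (IsSmoothFn.comp_diffeo (f := f) (hg.smooth _ _ sY' sZ'))) fun y => ?_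
  rw [h, rY, rZ]
  rfl

variable (hg' : IsRiemannian g') (hc : 0 < c)
  (h : ∀ x u v, g x u v = c * g' (f x) (tangentEquiv f x u) (tangentEquiv f x v))

include hg' hc h

theorem koszul_natural (hX : IsRelated f X X') (hY : IsRelated f Y Y') (hZ : IsRelated f Z Z')
    (sX : IsSmoothField X) (sY : IsSmoothField Y) (sZ : IsSmoothField Z)
    (sX' : IsSmoothField X') (sY' : IsSmoothField Y') (sZ' : IsSmoothField Z') :
    koszul g X Y Z x = c * koszul g' X' Y' Z' (f x) := by
  have h1 : ∀ {A B W A' B' W' : VectorField n M}, IsRelated f A A' → IsRelated f B B' →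
      IsRelated f W W' → IsSmoothField A' → IsSmoothField B' →
      dirDeriv W (fun y => g y (A y) (B y)) x = c * dirDeriv W' (fun y => g' y (A' y) (B' y)) (f x) := by
    intro A B W A' B' W' rA rB rW sA' sB'
    rw [rW.dirDeriv (hg'.smooth _ _ sA' sB'), ← dirDeriv_const_mul _
      (hg'.smooth _ _ sA' sB').comp_diffeo]
    congr 1
    funext y
    rw [h, rA, rB]
  rw [koszul, koszul, h1 hY hZ hX sY' sZ', h1 hX hZ hY sX' sZ', h1 hX hY hZ sX' sY', h, h, h,
    hX.lieBr hY sX sY sX' sY', hX.lieBr hZ sX sZ sX' sZ', hY.lieBr hZ sY sZ sY' sZ', hX, hY, hZ]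
  ring

/-- Here g = c f^*g'. The factor c appears on both sides of the Koszul formula and cancels, so a
constant scaling does not affect the connection, nor therefore the curvature. -/
theorem nabla_natural (hX : IsRelated f X X') (hY : IsRelated f Y Y')
    (sX : IsSmoothField X) (sY : IsSmoothField Y) (sX' : IsSmoothField X') (sY' : IsSmoothField Y') :
    IsRelated f (nabla g X Y) (nabla g' X' Y') := by
  intro x
  refine hg'.ext fun Z' sZ' => ?_
  obtain ⟨Z, sZ, hZ⟩ := exists_pull f sZ'
  have h1 := (isRiemannian_of_scaled hg' hc h).nabla_spec sX sY sZ (x := x)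
  rw [koszul_natural hg' hc h hX hY hZ sX sY sZ sX' sY' sZ', h, hZ] at h1
  rw [hg'.nabla_spec sX' sY' sZ']
  exact mul_left_cancel₀ hc.ne' h1

theorem curvature_natural (u v w : TangentSpace (𝓡 n) x) :
    tangentEquiv f x (curvature g x u v w) =
      curvature g' (f x) (tangentEquiv f x u) (tangentEquiv f x v) (tangentEquiv f x w) := by
  have hg := isRiemannian_of_scaled hg' hc h
  obtain ⟨X, X', sX, sX', hX, rfl⟩ := exists_pull_eq f x u
  obtain ⟨Y, Y', sY, sY', hY, rfl⟩ := exists_pull_eq f x v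
  obtain ⟨Z, Z', sZ, sZ', hZ, rfl⟩ := exists_pull_eq f x w
  have n1 := nabla_natural hg' hc h hX hZ sX sZ sX' sZ'
  have n2 := nabla_natural hg' hc h hY hZ sY sZ sY' sZ'
  rw [hg.curvature_spec sX sY sZ, hX, hY, hZ, hg'.curvature_spec sX' sY' sZ',
    IsRiemannian.riem, IsRiemannian.riem, map_sub, map_sub,
    nabla_natural hg' hc h hX n2 sX (hg.smooth_nabla sY sZ) sX' (hg'.smooth_nabla sY' sZ'),
    nabla_natural hg' hc h hY n1 sY (hg.smooth_nabla sX sZ) sY' (hg'.smooth_nabla sX' sZ'),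
    nabla_natural hg' hc h (hX.lieBr hY sX sY sX' sY') hZ (sX.lieBr sY) sZ (sX'.lieBr sY') sZ']

/-- Since g = c f^*g', pushed-forward g-unit vectors have g'-length 1/√c, and the factor √c
normalizes them. -/
theorem isOrthonormalAt_push {e : Fin n → TangentSpace (𝓡 n) x} (he : IsOrthonormalAt g x e) :
    IsOrthonormalAt g' (f x) (fun i => Real.sqrt c • tangentEquiv f x (e i)) := by
  intro i j
  have h1 := he i j
  rw [h] at h1
  rw [← h1]
  simp only [map_smul, _root_.smul_apply, smul_eq_mul]
  rw [← mul_assoc, Real.mul_self_sqrt hc.le]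

theorem ricci_natural (u v : TangentSpace (𝓡 n) x) :
    ricci g x u v = ricci g' (f x) (tangentEquiv f x u) (tangentEquiv f x v) := by
  have hg := isMetricAt_of_scaled hg' hc h x
  obtain ⟨e, he⟩ := hg.exists_orthonormal
  rw [hg.ricci_spec he, (hg'.metricAt _).ricci_spec (isOrthonormalAt_push hg' hc h he)]
  refine Finset.sum_congr rfl fun i _ => ?_
  rw [h, curvature_natural hg' hc h]
  simp only [map_smul, LinearMap.smul_apply, _root_.smul_apply, smul_eq_mul]
  rw [← mul_assoc, Real.mul_self_sqrt hc.le]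

variable {H H' : DiffForm n M 3}

/-- The two contractions each contribute c⁻¹, and the two copies of H contribute c². Scaling g and H
together therefore leaves H² unchanged, as it does the Ricci tensor. -/
theorem formSq_natural
    (hH : ∀ x v, H x v = c * H' (f x) (fun i => tangentEquiv f x (v i)))
    (u v : TangentSpace (𝓡 n) x) :
    formSq g H x u v = formSq g' H' (f x) (tangentEquiv f x u) (tangentEquiv f x v) := by
  have hg := isMetricAt_of_scaled hg' hc h x
  obtain ⟨e, he⟩ := hg.exists_orthonormal
  rw [hg.formSq_spec H he, (hg'.metricAt _).formSq_spec H' (isOrthonormalAt_push hg' hc h he)]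
  refine Finset.sum_congr rfl fun i _ => Finset.sum_congr rfl fun j _ => ?_
  have h1 : ∀ w, H x ![w, e i, e j] = H' (f x) ![tangentEquiv f x w,
      Real.sqrt c • tangentEquiv f x (e i), Real.sqrt c • tangentEquiv f x (e j)] := by
    intro w
    have h2 : (fun l => tangentEquiv f x (![w, e i, e j] l)) =
        ![tangentEquiv f x w, tangentEquiv f x (e i), tangentEquiv f x (e j)] := by
      funext l; fin_cases l <;> rfl
    rw [hH, h2, form₃_eq_curryLeft, form₃_eq_curryLeft]
    simp only [map_smul, AlternatingMap.curryLeft_smul, LinearMap.smul_apply,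
      AlternatingMap.smul_apply, smul_eq_mul]
    rw [← mul_assoc, Real.mul_self_sqrt hc.le]
  rw [h1, h1]

theorem ricciB_natural
    (hH : ∀ x v, H x v = c * H' (f x) (fun i => tangentEquiv f x (v i)))
    (u v : TangentSpace (𝓡 n) x) :
    ricciB g H x u v = ricciB g' H' (f x) (tangentEquiv f x u) (tangentEquiv f x v) := by
  simp only [ricciB, _root_.sub_apply, _root_.smul_apply]
  rw [ricci_natural hg' hc h, formSq_natural hg' hc h hH]

theorem nablaForm_natural {θ θ' : DiffForm n M k} (hθ' : IsSmoothForm θ') (hθs : IsSmoothForm θ)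
    (hθ : ∀ x v, θ x v = c * θ' (f x) (fun i => tangentEquiv f x (v i)))
    (u : TangentSpace (𝓡 n) x) (v : Fin k → TangentSpace (𝓡 n) x) :
    nablaForm g θ x u v =
      c * nablaForm g' θ' (f x) (tangentEquiv f x u) (fun i => tangentEquiv f x (v i)) := by
  have hg := isRiemannian_of_scaled hg' hc h
  obtain ⟨X, X', sX, sX', hX, rfl⟩ := exists_pull_eq f x u
  choose Y Y' sY sY' hY eY using fun i => exists_pull_eq f x (v i)
  obtain rfl : (fun i => Y i x) = v := funext eY
  rw [hg.nablaForm_spec hθs sX sY, hX]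
  simp only [hY _ x]
  rw [hg'.nablaForm_spec hθ' sX' sY', hX.dirDeriv (hθ' Y' sY'), mul_sub, ← dirDeriv_const_mul _
    (IsSmoothFn.comp_diffeo (f := f) (hθ' Y' sY')), Finset.mul_sum]
  congr 1
  · congr 1
    funext y
    rw [hθ]
    simp only [hY _ y]
  · refine Finset.sum_congr rfl fun i _ => ?_
    rw [hθ]
    congr 2
    funext j
    rw [← nabla_natural hg' hc h hX (hY i) sX (sY i) sX' (sY' i)]
    rcases eq_or_ne j i with rfl | hj
    · rw [Function.update_self, Function.update_self]
    · rw [Function.update_of_ne hj, Function.update_of_ne hj, hY]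

/-- The factor c of the form is cancelled by the factor c⁻¹ from the trace over an orthonormal
basis. -/
theorem codiff_natural {θ θ' : DiffForm n M (k + 1)} (hθ' : IsSmoothForm θ') (hθs : IsSmoothForm θ)
    (hθ : ∀ x v, θ x v = c * θ' (f x) (fun i => tangentEquiv f x (v i)))
    (v : Fin k → TangentSpace (𝓡 n) x) :
    codiff g θ x v = codiff g' θ' (f x) (fun i => tangentEquiv f x (v i)) := by
  have hg := isMetricAt_of_scaled hg' hc h x
  obtain ⟨e, he⟩ := hg.exists_orthonormal
  rw [hg.codiff_spec he, (hg'.metricAt _).codiff_spec (isOrthonormalAt_push hg' hc h he), neg_inj]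
  refine Finset.sum_congr rfl fun i _ => ?_
  rw [nablaForm_natural hg' hc h hθ' hθs hθ, map_smul, ContinuousAlternatingMap.smul_apply,
    ContinuousAlternatingMap.vecCons_smul, smul_smul, Real.mul_self_sqrt hc.le, smul_eq_mul]
  congr 2
  funext j
  refine Fin.cases ?_ (fun j => ?_) j <;> rfl

omit hg' hc h

theorem isSmoothForm_pull {θ θ' : DiffForm n M k} (hθ' : IsSmoothForm θ')
    (hθ : ∀ x v, θ x v = c * θ' (f x) (fun i => tangentEquiv f x (v i))) : IsSmoothForm θ := by
  intro Y hY
  choose Y' sY' rY using fun i => exists_push f (hY i)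
  refine ContMDiff.congr ((contMDiff_const (c := c)).mul
    (IsSmoothFn.comp_diffeo (f := f) (hθ' _ sY'))) fun y => ?_
  rw [hθ]
  simp only [rY _ y]
  rfl

theorem extD_twoForm_natural {b b' : DiffForm n M 2} (hb' : IsSmoothForm b')
    (hb : ∀ x v, b x v = c * b' (f x) (fun i => tangentEquiv f x (v i)))
    (v : Fin 3 → TangentSpace (𝓡 n) x) :
    extD b x v = c * extD b' (f x) (fun i => tangentEquiv f x (v i)) := by
  have hbs := isSmoothForm_pull hb' hb
  choose Y Y' sY sY' hY eY using fun i => exists_pull_eq f x (v i)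
  have e1 : v = ![Y 0 x, Y 1 x, Y 2 x] := by
    funext i; fin_cases i <;> exact (eY _).symm
  have e2 : (fun i => tangentEquiv f x (v i)) = ![Y' 0 (f x), Y' 1 (f x), Y' 2 (f x)] := by
    funext i
    rw [← eY, hY]
    fin_cases i <;> rfl
  have h0 : ∀ x (u v : TangentSpace (𝓡 n) x), twoFormMap b x u v =
      c * twoFormMap b' (f x) (tangentEquiv f x u) (tangentEquiv f x v) := by
    intro x u v
    rw [twoFormMap_apply, twoFormMap_apply, hb]
    congr 2
    funext i; fin_cases i <;> rfl
  have h1 : ∀ i j l : Fin 3, dirDeriv (Y i) (fun y => twoFormMap b y (Y j y) (Y l y)) x =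
      c * dirDeriv (Y' i) (fun y => twoFormMap b' y (Y' j y) (Y' l y)) (f x) := by
    intro i j l
    rw [(hY i).dirDeriv (hb'.twoFormMap _ _ (sY' j) (sY' l)), ← dirDeriv_const_mul _
      (hb'.twoFormMap _ _ (sY' j) (sY' l)).comp_diffeo]
    congr 1
    funext y
    rw [h0, hY, hY]
  have h2 := fun i j => (hY i).lieBr (hY j) (sY i) (sY j) (sY' i) (sY' j) x
  rw [e2, extD_twoForm hb' (sY' 0) (sY' 1) (sY' 2), e1, extD_twoForm hbs (sY 0) (sY 1) (sY 2)]
  simp only [h1]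
  simp only [h0, h2, hY _ x]
  ring

end Naturality

/-! ### Primitives of families of forms, differentials of families of maps -/

section Primitives

variable {n : ℕ} {M : Type*} [TopologicalSpace M] [T2Space M] [ChartedSpace (Model n) M]
  [IsManifold (𝓡 n) ∞ M] {k : ℕ} {x : M}

/-- Integrals over `[0, s]` of functions depending smoothly on parameters. -/
theorem contDiff_integral_zero {E : Type} [NormedAddCommGroup E] [NormedSpace ℝ E]
    [FiniteDimensional ℝ E] {f : ℝ × E → ℝ} (hf : ContDiff ℝ ∞ f) :
    ContDiff ℝ ∞ (fun p : ℝ × E => ∫ r in (0 : ℝ)..p.1, f (r, p.2)) := by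
  -- Rescaling the variable gives p₁ ∫₀¹ f(r p₁, p₂) dr. The curve r ↦ (r p₁, p₂) depends linearly
  -- on p, so smoothness follows from that of composition with f on spaces of curves.
  let γ : ℝ × E →L[ℝ] C(TimeBox, ℝ × E) := LinearMap.toContinuousLinearMap
    { toFun := fun p => ⟨fun r => (r.1 * p.1, p.2), by fun_prop⟩
      map_add' := fun p q => by ext r <;> simp [mul_add]
      map_smul' := fun a p => by ext r <;> simp [mul_left_comm] }
  let f' : C(ℝ × E, ℝ) := ⟨f, hf.continuous⟩
  have h1 : ContDiff ℝ ∞ (fun p : ℝ × E => f'.comp (γ p)) :=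
    (contDiff_comp_continuousMap f' hf).comp γ.contDiff
  let one : TimeBox := ⟨1, by constructor <;> norm_num⟩
  have h2 : ContDiff ℝ ∞ (fun p : ℝ × E => p.1 * primitiveBox ℝ (f'.comp (γ p)) one) :=
    contDiff_fst.mul (((ContinuousMap.evalCLM ℝ one).comp (primitiveBox ℝ)).contDiff.comp h1)
  have h3 : (fun p : ℝ × E => ∫ r in (0 : ℝ)..p.1, f (r, p.2)) =
      fun p => p.1 * primitiveBox ℝ (f'.comp (γ p)) one := by
    funext p
    have h3 := intervalIntegral.mul_integral_comp_mul_right (a := 0) (b := 1) p.1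
      (f := fun r => f (r, p.2))
    rw [zero_mul, one_mul] at h3
    rw [← h3, primitiveBox_apply]
    congr 1
    refine intervalIntegral.integral_congr fun r hr => ?_
    rw [uIcc_of_le zero_le_one] at hr
    rw [extendBox_of_mem _ ⟨by linarith [hr.1], by linarith [hr.2]⟩]
    rfl
  rwa [h3]

theorem contMDiff_integral_zero {f : ℝ × M → ℝ}
    (hf : ContMDiff (𝓘(ℝ, ℝ).prod (𝓡 n)) 𝓘(ℝ, ℝ) ∞ f) :
    ContMDiff (𝓘(ℝ, ℝ).prod (𝓡 n)) 𝓘(ℝ, ℝ) ∞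
      (fun p : ℝ × M => ∫ r in (0 : ℝ)..p.1, f (r, p.2)) := by
  rintro ⟨s₀, x₀⟩
  set φ := extChartAt (𝓡 n) x₀
  have hU : IsOpen φ.target := isOpen_extChartAt_target x₀
  obtain ⟨ε, hε, hs⟩ := Metric.nhds_basis_closedBall.mem_iff.1
    (hU.mem_nhds (mem_extChartAt_target (I := 𝓡 n) x₀))
  let χ : ContDiffBump (φ x₀) := ⟨ε / 2, ε, by positivity, by linarith⟩
  -- A cutoff in space only. It extends the chart expression to all of ℝ × ℝⁿ and leaves the whole
  -- time integral unchanged for points near x₀.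
  let u : ℝ × Model n → ℝ := fun q => χ q.2 * f (q.1, φ.symm q.2)
  have hu : ContDiff ℝ ∞ u := by
    rw [contDiff_iff_contDiffAt]
    rintro ⟨r, z⟩
    by_cases hz : z ∈ tsupport χ
    · rw [χ.tsupport_eq] at hz
      have h2 : ContMDiffAt 𝓘(ℝ, Model n) (𝓡 n) ∞ φ.symm z :=
        (contMDiffOn_extChartAt_symm (I := 𝓡 n) (n := ∞) x₀).contMDiffAt (hU.mem_nhds (hs hz))
      have h3 : ContMDiffAt (𝓘(ℝ, ℝ).prod 𝓘(ℝ, Model n)) 𝓘(ℝ, ℝ) ∞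
          (fun q : ℝ × Model n => f (q.1, φ.symm q.2)) (r, z) :=
        hf.contMDiffAt.comp (r, z) (contMDiffAt_fst.prodMk (h2.comp (r, z) contMDiffAt_snd))
      have h4 := contMDiffWithinAt_prod_iff.1 (h3.contMDiffWithinAt (s := univ))
      exact (χ.contDiffAt.comp (r, z) contDiffAt_snd).mul (contDiffWithinAt_univ.1 h4)
    · refine (contDiffAt_const (c := (0 : ℝ))).congr_of_eventuallyEq ?_
      have h1 := (continuous_snd.tendsto (r, z)).eventually (notMem_tsupport_iff_eventuallyEq.1 hz)
      filter_upwards [h1] with q hq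
      change χ q.2 * _ = 0
      rw [hq]
      exact zero_mul _
  have h1 : ContMDiffAt (𝓘(ℝ, ℝ).prod (𝓡 n)) 𝓘(ℝ, ℝ) ∞
      (fun p : ℝ × M => ∫ r in (0 : ℝ)..p.1, u (r, φ p.2)) (s₀, x₀) := by
    have h2 : ContMDiffAt (𝓘(ℝ, ℝ).prod (𝓡 n)) 𝓘(ℝ, ℝ × Model n) ∞
        (fun p : ℝ × M => (p.1, φ p.2)) (s₀, x₀) :=
      contMDiffAt_fst.prodMk_space ((contMDiffAt_extChartAt (I := 𝓡 n) (x := x₀)).comp (s₀, x₀)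
        contMDiffAt_snd)
    exact (contDiff_integral_zero hu).contMDiff.contMDiffAt.comp (s₀, x₀) h2
  refine h1.congr_of_eventuallyEq ?_
  have h2 : ∀ᶠ y in 𝓝 x₀, y ∈ φ.source ∧ χ (φ y) = 1 := by
    filter_upwards [extChartAt_source_mem_nhds (I := 𝓡 n) x₀,
      (continuousAt_extChartAt (I := 𝓡 n) x₀).eventually χ.eventuallyEq_one] with y hy hy'
    exact ⟨hy, hy'⟩
  filter_upwards [(continuous_snd.tendsto (s₀, x₀)).eventually h2] with p hp
  refine intervalIntegral.integral_congr fun r _ => ?_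
  change f (r, p.2) = χ (φ p.2) * f (r, φ.symm (φ p.2))
  rw [hp.2, φ.left_inv hp.1, one_mul]

theorem continuous_time {f : ℝ × M → ℝ} (hf : ContMDiff (𝓘(ℝ, ℝ).prod (𝓡 n)) 𝓘(ℝ, ℝ) ∞ f)
    (x : M) : Continuous fun r => f (r, x) := hf.continuous.comp (by fun_prop)

/-- Families of forms have primitives. -/
theorem exists_primitive_form {β : ℝ → DiffForm n M k}
    (hβ : ∀ Y : Fin k → VectorField n M, (∀ i, IsSmoothField (Y i)) →
      ContMDiff (𝓘(ℝ, ℝ).prod (𝓡 n)) 𝓘(ℝ, ℝ) ∞ (fun p : ℝ × M => β p.1 p.2 (fun i => Y i p.2))) :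
    ∃ B : ℝ → DiffForm n M k, B 0 = 0 ∧
      (∀ Y : Fin k → VectorField n M, (∀ i, IsSmoothField (Y i)) →
        ContMDiff (𝓘(ℝ, ℝ).prod (𝓡 n)) 𝓘(ℝ, ℝ) ∞
          (fun p : ℝ × M => B p.1 p.2 (fun i => Y i p.2))) ∧
      ∀ s x v, HasDerivAt (fun s => B s x v) (β s x v) s := by
  have hc : ∀ x (v : Fin k → TangentSpace (𝓡 n) x), Continuous fun r => β r x v := by
    intro x v
    have := continuous_time (hβ (fun i => tExt x (v i)) (fun i => tExt_smooth x _)) x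
    simpa using this
  have hi : ∀ x (v : Fin k → TangentSpace (𝓡 n) x) (a b : ℝ),
      IntervalIntegrable (fun r => β r x v) MeasureTheory.volume a b :=
    fun x v a b => (hc x v).intervalIntegrable a b
  let f : ℝ → ∀ x : M, MultilinearMap ℝ (fun _ : Fin k => TangentSpace (𝓡 n) x) ℝ := fun s x =>
    { toFun := fun v => ∫ r in (0 : ℝ)..s, β r x v
      map_update_add' := fun v i a b => by
        simp only [ContinuousAlternatingMap.map_update_add]
        exact intervalIntegral.integral_add (hi _ _ _ _) (hi _ _ _ _)
      map_update_smul' := fun v i r a => by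
        simp only [ContinuousAlternatingMap.map_update_smul]
        exact intervalIntegral.integral_smul r _ }
  refine ⟨fun s x => mkForm (f s x) fun v i j hij hne => ?_, ?_, fun Y hY => ?_, fun s x v => ?_⟩
  · change ∫ r in (0 : ℝ)..s, β r x v = 0
    simp only [(β _ x).map_eq_zero_of_eq v hij hne, intervalIntegral.integral_zero]
  · funext x
    ext v
    exact intervalIntegral.integral_same
  · exact contMDiff_integral_zero (hβ Y hY)
  · exact intervalIntegral.integral_hasDerivAt_right (hi _ _ _ _)
      ((hc x v).stronglyMeasurableAtFilter _ _) (hc x v).continuousAt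

/-- The differentials of a smooth family of maps. -/
theorem contMDiff_mfderiv_family {φ : ℝ → M → M}
    (hφ : ContMDiff (𝓘(ℝ, ℝ).prod (𝓡 n)) (𝓡 n) ∞ (fun p : ℝ × M => φ p.1 p.2))
    {Y : VectorField n M} (hY : IsSmoothField Y) :
    ContMDiff (𝓘(ℝ, ℝ).prod (𝓡 n)) ((𝓡 n).prod 𝓘(ℝ, Model n)) ∞ (fun p : ℝ × M =>
      TotalSpace.mk' (Model n) (E := fun x : M => TangentSpace (𝓡 n) x) (φ p.1 p.2)
        (mfderiv (𝓡 n) (𝓡 n) (φ p.1) p.2 (Y p.2))) := by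
  rintro ⟨t, x⟩
  rw [← contMDiffWithinAt_univ]
  refine (contMDiffWithinAt_totalSpace_iff_crd (n := n) (F := Model n)
    (f := fun p : ℝ × M => φ p.1 p.2) (V := fun x : M => TangentSpace (𝓡 n) x)
    (v := fun p => mfderiv (𝓡 n) (𝓡 n) (φ p.1) p.2 (Y p.2)) (mem_univ (t, x))).2
    ⟨(hφ (t, x)).contMDiffWithinAt, ?_⟩
  let x₁ := φ t x
  have h1 : ContMDiffAt (𝓘(ℝ, ℝ).prod (𝓡 n)) 𝓘(ℝ, Model n) ∞
      (fun p : ℝ × M => extChartAt (𝓡 n) x₁ (φ p.1 p.2)) (t, x) :=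
    ContMDiffAt.comp (t, x) (contMDiffAt_extChartAt (I := 𝓡 n) (x := x₁)) (hφ (t, x))
  have h2 := contMDiffWithinAt_mfderiv (mem_univ t) uniqueDiffOn_univ
    (x₀ := x) (Y := fun p => Y p.2) (S := univ) h1.contMDiffWithinAt
    (ContMDiffAt.comp (t, x) (hY x) contMDiffAt_snd).contMDiffWithinAt
  rw [univ_prod_univ] at h2
  refine h2.congr_of_eventuallyEq_of_mem ?_ (mem_univ _)
  rw [nhdsWithin_univ]
  have h3 : ∀ᶠ p in 𝓝 (t, x), φ p.1 p.2 ∈ (extChartAt (𝓡 n) x₁).source :=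
    hφ.continuous.continuousAt.eventually (extChartAt_source_mem_nhds (I := 𝓡 n) x₁)
  filter_upwards [h3] with p hp
  rw [crd_tangent hp]
  have hφp : ContMDiff (𝓡 n) (𝓡 n) ∞ (φ p.1) :=
    hφ.comp (contMDiff_const.prodMk contMDiff_id)
  have h4 : mfderiv (𝓡 n) 𝓘(ℝ, Model n) (fun y => extChartAt (𝓡 n) x₁ (φ p.1 y)) p.2 =
      (mfderiv (𝓡 n) 𝓘(ℝ, Model n) (extChartAt (𝓡 n) x₁) (φ p.1 p.2)).comp
        (mfderiv (𝓡 n) (𝓡 n) (φ p.1) p.2) :=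
    mfderiv_comp p.2 (mdifferentiableAt_extChartAt (by rwa [extChartAt_source] at hp))
      (hφp.mdifferentiableAt (by simp))
  exact (congrArg (fun L => (L (Y p.2) : Model n)) h4).symm

variable {EN : Type*} [NormedAddCommGroup EN] [NormedSpace ℝ EN] {HN : Type*} [TopologicalSpace HN]
  {J : ModelWithCorners ℝ EN HN} {N : Type*} [TopologicalSpace N] [ChartedSpace HN N]

theorem contMDiffWithinAt_tensor2_apply {f : N → M}
    {A : Π p, TangentSpace (𝓡 n) (f p) →L[ℝ] TangentSpace (𝓡 n) (f p) →L[ℝ] ℝ}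
    {v w : Π p, TangentSpace (𝓡 n) (f p)} {S : Set N} {p₀ : N} (hp : p₀ ∈ S)
    (hA : ∀ Y Z : VectorField n M, IsSmoothField Y → IsSmoothField Z →
      ContMDiffWithinAt J 𝓘(ℝ, ℝ) ∞ (fun p => A p (Y (f p)) (Z (f p))) S p₀)
    (hv : ContMDiffWithinAt J ((𝓡 n).prod 𝓘(ℝ, Model n)) ∞ (fun p => TotalSpace.mk' (Model n)
      (E := fun x : M => TangentSpace (𝓡 n) x) (f p) (v p)) S p₀)
    (hw : ContMDiffWithinAt J ((𝓡 n).prod 𝓘(ℝ, Model n)) ∞ (fun p => TotalSpace.mk' (Model n)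
      (E := fun x : M => TangentSpace (𝓡 n) x) (f p) (w p)) S p₀) :
    ContMDiffWithinAt J 𝓘(ℝ, ℝ) ∞ (fun p => A p (v p) (w p)) S p₀ :=
  contMDiffWithinAt_apply_section (n := n) (F := Model n)
    (V := fun x : M => TangentSpace (𝓡 n) x) (A := fun p => (A p (v p)).toLinearMap) hp
    (fun Z hZ => contMDiffWithinAt_apply_section (n := n) (F := Model n)
      (V := fun x : M => TangentSpace (𝓡 n) x) (W := ℝ)
      (A := fun p =>
        { toFun := fun u => A p u (Z (f p))
          map_add' := fun a b => by rw [map_add]; rfl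
          map_smul' := fun r a => by rw [map_smul]; rfl }) hp (fun Y hY => hA Y Z hY hZ) hv) hw

end Primitives

/-! ### The generalized metrics `G(g,b)` on `TM ⊕ T*M` -/

section Twisted

variable {n : ℕ} {M : Type*} [TopologicalSpace M] [T2Space M] [ChartedSpace (Model n) M]
  [IsManifold (𝓡 n) ∞ M] {H₀ : DiffForm n M 3} {g : Tensor2 n M} {b : DiffForm n M 2} {x : M}
  {EN : Type*} [NormedAddCommGroup EN] [NormedSpace ℝ EN] {HN : Type*} [TopologicalSpace HN]
  {J : ModelWithCorners ℝ EN HN} {N : Type*} [TopologicalSpace N] [ChartedSpace HN N]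

theorem crd_genTangent (x₀ : M) : ∀ᶠ y in 𝓝 x₀, ∀ a : GenTangent n M y,
    crd (GenModel n) x₀ a = (crd (Model n) (V := fun x : M => TangentSpace (𝓡 n) x) x₀ a.1,
      crd (Model n →L[ℝ] ℝ) (V := fun x : M => TangentSpace (𝓡 n) x →L[ℝ] ℝ) x₀ a.2) := by
  filter_upwards [baseSet_eventually (F := Model n) (V := fun x : M => TangentSpace (𝓡 n) x) x₀,
    baseSet_eventually (F := Model n →L[ℝ] ℝ) (V := fun x : M => TangentSpace (𝓡 n) x →L[ℝ] ℝ) x₀,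
    baseSet_eventually (F := GenModel n) (V := GenTangent n M) x₀] with y h1 h2 h3 a
  rw [crd, crd, crd, Bundle.Trivialization.continuousLinearMapAt_apply,
    Bundle.Trivialization.continuousLinearMapAt_apply,
    Bundle.Trivialization.continuousLinearMapAt_apply,
    Bundle.Trivialization.linearMapAt_apply, if_pos h3, Bundle.Trivialization.linearMapAt_apply,
    if_pos h1, Bundle.Trivialization.linearMapAt_apply, if_pos h2]
  rfl

theorem contMDiffWithinAt_genTangent_iff {f : N → M} {a : Π p, GenTangent n M (f p)} {S : Set N}
    {p₀ : N} (hp : p₀ ∈ S) (hf : ContMDiffWithinAt J (𝓡 n) ∞ f S p₀) :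
    ContMDiffWithinAt J ((𝓡 n).prod 𝓘(ℝ, GenModel n)) ∞
      (fun p => TotalSpace.mk' (GenModel n) (E := GenTangent n M) (f p) (a p)) S p₀ ↔
    ContMDiffWithinAt J ((𝓡 n).prod 𝓘(ℝ, Model n)) ∞ (fun p => TotalSpace.mk' (Model n)
      (E := fun x : M => TangentSpace (𝓡 n) x) (f p) (a p).1) S p₀ ∧
    ContMDiffWithinAt J ((𝓡 n).prod 𝓘(ℝ, Model n →L[ℝ] ℝ)) ∞ (fun p => TotalSpace.mk'
      (Model n →L[ℝ] ℝ) (E := fun x : M => TangentSpace (𝓡 n) x →L[ℝ] ℝ) (f p) (a p).2) S p₀ := by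
  have h1 := hf.continuousWithinAt.eventually (crd_genTangent (n := n) (f p₀))
  rw [contMDiffWithinAt_totalSpace_iff_crd (n := n) (F := GenModel n) (V := GenTangent n M) hp,
    contMDiffWithinAt_totalSpace_iff_crd (n := n) (F := Model n)
      (V := fun x : M => TangentSpace (𝓡 n) x) hp,
    contMDiffWithinAt_totalSpace_iff_crd (n := n) (F := Model n →L[ℝ] ℝ)
      (V := fun x : M => TangentSpace (𝓡 n) x →L[ℝ] ℝ) hp]
  have h2 : (fun p => crd (GenModel n) (f p₀) (a p)) =ᶠ[𝓝[S] p₀] fun p =>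
      (crd (Model n) (V := fun x : M => TangentSpace (𝓡 n) x) (f p₀) (a p).1,
        crd (Model n →L[ℝ] ℝ) (V := fun x : M => TangentSpace (𝓡 n) x →L[ℝ] ℝ) (f p₀) (a p).2) :=
    h1.mono fun p hp => hp (a p)
  rw [Filter.EventuallyEq.contMDiffWithinAt_iff h2 (h2.self_of_nhdsWithin hp), contMDiffWithinAt_prod_module_iff]
  simp only [Function.comp_def]
  tauto

theorem isSmoothField_fst {a : Π x, GenTangent n M x} (ha : IsSmoothSection (n := n) (GenModel n) a) :
    IsSmoothField (fun x => (a x).1) := fun x => contMDiffWithinAt_univ.1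
  ((contMDiffWithinAt_genTangent_iff (f := id) (mem_univ x)
    contMDiff_id.contMDiffAt.contMDiffWithinAt).1 (ha x).contMDiffWithinAt).1

theorem isSmoothCovector_snd {a : Π x, GenTangent n M x}
    (ha : IsSmoothSection (n := n) (GenModel n) a) : IsSmoothCovector (fun x => (a x).2) :=
  isSmoothField_covector_apply fun x => contMDiffWithinAt_univ.1
  ((contMDiffWithinAt_genTangent_iff (f := id) (mem_univ x)
    contMDiff_id.contMDiffAt.contMDiffWithinAt).1 (ha x).contMDiffWithinAt).2

theorem contMDiffWithinAt_genTangent {f : N → M} {v : Π p, TangentSpace (𝓡 n) (f p)}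
    {ξ : Π p, TangentSpace (𝓡 n) (f p) →L[ℝ] ℝ} {S : Set N} {p₀ : N} (hp : p₀ ∈ S)
    (hv : ContMDiffWithinAt J ((𝓡 n).prod 𝓘(ℝ, Model n)) ∞ (fun p => TotalSpace.mk' (Model n)
      (E := fun x : M => TangentSpace (𝓡 n) x) (f p) (v p)) S p₀)
    (hξ : ∀ Z : VectorField n M, IsSmoothField Z →
      ContMDiffWithinAt J 𝓘(ℝ, ℝ) ∞ (fun p => ξ p (Z (f p))) S p₀) :
    ContMDiffWithinAt J ((𝓡 n).prod 𝓘(ℝ, GenModel n)) ∞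
      (fun p => TotalSpace.mk' (GenModel n) (E := GenTangent n M) (f p) (v p, ξ p)) S p₀ :=
  (contMDiffWithinAt_genTangent_iff hp (contMDiffWithinAt_base hv)).2
    ⟨hv, contMDiffWithinAt_covector hp (contMDiffWithinAt_base hv) hξ⟩

/-- `G(g,b)` depends smoothly on parameters. -/
theorem contMDiffWithinAt_genMetric {f : N → M} {g : N → Tensor2 n M} {b : N → DiffForm n M 2}
    {S : Set N} {p₀ : N} (hp : p₀ ∈ S) (hf : ContMDiffWithinAt J (𝓡 n) ∞ f S p₀)
    (hg : ∀ Y Z : VectorField n M, IsSmoothField Y → IsSmoothField Z →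
      ContMDiffWithinAt J 𝓘(ℝ, ℝ) ∞ (fun p => g p (f p) (Y (f p)) (Z (f p))) S p₀)
    (hb : ∀ Y Z : VectorField n M, IsSmoothField Y → IsSmoothField Z →
      ContMDiffWithinAt J 𝓘(ℝ, ℝ) ∞ (fun p => twoFormMap (b p) (f p) (Y (f p)) (Z (f p))) S p₀)
    (hm : ∀ p, IsMetricAt (g p) (f p)) {a : Π x, GenTangent n M x}
    (ha : IsSmoothSection (n := n) (GenModel n) a) :
    ContMDiffWithinAt J ((𝓡 n).prod 𝓘(ℝ, GenModel n)) ∞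
      (fun p => TotalSpace.mk' (GenModel n) (E := GenTangent n M) (f p)
        (genMetric (g p) (b p) (f p) (a (f p)))) S p₀ := by
  have h1 := isSmoothField_fst ha
  have h2 := isSmoothCovector_snd ha
  have hw : ContMDiffWithinAt J ((𝓡 n).prod 𝓘(ℝ, Model n)) ∞ (fun p => TotalSpace.mk' (Model n)
      (E := fun x : M => TangentSpace (𝓡 n) x) (f p)
      (sharp (g p) (f p) ((a (f p)).2 - twoFormMap (b p) (f p) (a (f p)).1))) S p₀ := by
    refine contMDiffWithinAt_of_tensor2 (A := fun p => g p (f p)) hp hf hg (hm p₀).bijective ?_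
    intro Z hZ
    simp only [(hm _).apply_sharp]
    exact ((h2 Z hZ).contMDiffAt.comp_contMDiffWithinAt p₀ hf).sub (hb _ _ h1 hZ)
  exact contMDiffWithinAt_genTangent hp hw fun Z hZ => (hg _ _ h1 hZ).add
    (contMDiffWithinAt_tensor2_apply (A := fun p => twoFormMap (b p) (f p)) hp hb hw
      ((hZ.contMDiffAt).comp_contMDiffWithinAt p₀ hf))

theorem twisted_pairing (a e : GenTangent n M x) :
    (twisted H₀).pairing x a e = (1 / 2 : ℝ) * (a.2 e.1 + e.2 a.1) := rfl

theorem genMetric_apply (a : GenTangent n M x) : genMetric g b x a =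
    (sharp g x (a.2 - twoFormMap b x a.1),
      g x a.1 + twoFormMap b x (sharp g x (a.2 - twoFormMap b x a.1))) := rfl

/-- In this form the symmetry and the positivity of ⟨G·,·⟩ are visible: it is half the sum of two
copies of g, in the vector part and in the b-shifted covector part. -/
theorem pairing_genMetric (hm : IsMetricAt g x) (a e : GenTangent n M x) :
    (twisted H₀).pairing x (genMetric g b x a) e = (1 / 2 : ℝ) * (g x a.1 e.1 +
      g x (sharp g x (a.2 - twoFormMap b x a.1)) (sharp g x (e.2 - twoFormMap b x e.1))) := by
  rw [twisted_pairing, genMetric_apply]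
  have h1 : e.2 = g x (sharp g x (e.2 - twoFormMap b x e.1)) + twoFormMap b x e.1 := by
    rw [hm.apply_sharp]; abel
  have h2 := congrArg (fun L => L (sharp g x (a.2 - twoFormMap b x a.1))) h1
  simp only [_root_.add_apply] at h2 ⊢
  rw [h2, hm.symm (sharp g x (e.2 - twoFormMap b x e.1)), twoFormMap_skew b e.1]
  ring

theorem isGenMetric_genMetric (hg : IsRiemannian g) (hb : IsSmoothForm b) :
    (twisted H₀).IsGenMetric (GenModel n) (genMetric g b) where
  smooth a ha x := contMDiffWithinAt_univ.1 (contMDiffWithinAt_genMetric (f := id)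
    (g := fun _ => g) (b := fun _ => b) (mem_univ x) contMDiff_id.contMDiffAt.contMDiffWithinAt
    (fun _ _ hY hZ => (hg.smooth _ _ hY hZ x).contMDiffWithinAt)
    (fun _ _ hY hZ => (hb.twoFormMap _ _ hY hZ x).contMDiffWithinAt) (fun p => hg.metricAt p) ha)
  orthogonal x a e := by
    have hm := hg.metricAt x
    rw [twisted_pairing, twisted_pairing, genMetric_apply, genMetric_apply]
    simp only [_root_.add_apply]
    rw [hm.symm a.1, hm.symm e.1, hm.apply_sharp, hm.apply_sharp]
    simp only [_root_.sub_apply]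
    rw [twoFormMap_skew b e.1 a.1, twoFormMap_skew b (sharp g x (e.2 - _))]
    ring
  symm x a e := by
    have hm := hg.metricAt x
    rw [pairing_genMetric hm, pairing_genMetric hm, hm.symm e.1, hm.symm (sharp g x (e.2 - _))]
  pos x a ha := by
    have hm := hg.metricAt x
    rw [pairing_genMetric hm]
    have hnn : ∀ u, 0 ≤ g x u u := fun u => by
      rcases eq_or_ne u 0 with rfl | h
      · simp
      · exact (hm.pos u h).le
    by_cases h1 : a.1 = 0
    · have h2 : sharp g x (a.2 - twoFormMap b x a.1) ≠ 0 := by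
        intro h2
        apply ha
        have h3 := hm.apply_sharp (a.2 - twoFormMap b x a.1)
        rw [h2, map_zero, h1, map_zero, sub_zero] at h3
        exact Prod.ext h1 h3.symm
      have := hm.pos _ h2
      have := hnn a.1
      positivity
    · have := hm.pos _ h1
      have := hnn (sharp g x (a.2 - twoFormMap b x a.1))
      positivity

/-- Only nondegeneracy of the pairing enters. The objects attached to the structure on TM ⊕ T*M can
thus be computed directly, without verifying the axioms of an exact Courant algebroid. -/
theorem CourantData.coanchor_eq {F : Type*} [NormedAddCommGroup F] [NormedSpace ℝ F]
    [FiniteDimensional ℝ F] {V : M → Type*} [TopologicalSpace (TotalSpace F V)]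
    [∀ x, AddCommGroup (V x)] [∀ x, Module ℝ (V x)] [∀ x, TopologicalSpace (V x)]
    [∀ x, IsTopologicalAddGroup (V x)] [∀ x, ContinuousSMul ℝ (V x)]
    [FiberBundle F V] [VectorBundle ℝ F V] {C : CourantData n V}
    (hC : ∀ a, (∀ e, C.pairing x a e = 0) → a = 0)
    {α : TangentSpace (𝓡 n) x →L[ℝ] ℝ} {a : V x}
    (h : ∀ e, C.pairing x a e = α (C.anchor x e)) : C.coanchor x α = a := by
  have := finiteDimensional_fibre F V x
  have := t2Space_fibre F V x
  have := finiteDimensional_clm_dual (E := V x)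
  have h1 : ContinuousLinearMap.precomp ℝ (C.anchor x) α = C.pairing x a :=
    ContinuousLinearMap.ext fun e => (h e).symm
  change (C.pairing x).inverse (ContinuousLinearMap.precomp ℝ (C.anchor x) α) = a
  rw [h1]
  exact (inverse_spec _ (bijective_of_nondegenerate _ hC)).2 a

/-- The factor 2 compensates the ½ in the pairing. -/
theorem twisted_coanchor (α : TangentSpace (𝓡 n) x →L[ℝ] ℝ) :
    (twisted H₀).coanchor x α = (0, (2 : ℝ) • α) := by
  refine CourantData.coanchor_eq (F := GenModel n) (V := GenTangent n M) (fun a ha => Prod.ext ?_ ?_) fun e => ?_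
  · refine SeparatingDual.eq_zero_of_forall_dual_eq_zero (R := ℝ) (V := Model n) fun ℓ => ?_
    have h1 := ha (0, ℓ)
    rw [twisted_pairing] at h1
    simp only [map_zero, zero_add] at h1
    exact (mul_eq_zero.1 h1).resolve_left (by norm_num)
  · ext v
    have h1 := ha (v, 0)
    rw [twisted_pairing] at h1
    simp only [_root_.zero_apply, add_zero] at h1
    exact (mul_eq_zero.1 h1).resolve_left (by norm_num)
  · change (1 / 2 : ℝ) * ((2 : ℝ) * α e.1 + e.2 0) = α e.1
    rw [map_zero]
    ring

/-- The 1-eigenbundle of G(g, b) is the graph of g + b. Its skew part b is then the preferred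
splitting, which accounts for the torsion H₀ + db below. -/
theorem sigmaPlus_genMetric (hm : IsMetricAt g x) (u : TangentSpace (𝓡 n) x) :
    (twisted H₀).sigmaPlus (genMetric g b) x u = (u, g x u + twoFormMap b x u) := by
  have h1 := Classical.epsilon_spec (p := fun s : TangentSpace (𝓡 n) x →L[ℝ] GenTangent n M x =>
    ∀ u, (twisted H₀).anchor x (s u) = u ∧ genMetric g b x (s u) = s u)
    ⟨(ContinuousLinearMap.id ℝ _).prod (g x + twoFormMap b x), fun u => ⟨rfl, by
      have h2 : sharp g x (g x u + twoFormMap b x u - twoFormMap b x u) = u := by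
        rw [add_sub_cancel_right, hm.sharp_apply]
      rw [genMetric_apply]
      refine Prod.ext h2 ?_
      exact congrArg (fun w => g x u + twoFormMap b x w) h2⟩⟩ u
  obtain ⟨h2, h3⟩ := h1
  change (twisted H₀).anchor x ((twisted H₀).sigmaPlus (genMetric g b) x u) = u at h2
  change genMetric g b x ((twisted H₀).sigmaPlus (genMetric g b) x u) = _ at h3
  set s := (twisted H₀).sigmaPlus (genMetric g b) x u
  have h4 : s.1 = u := h2
  have h3' : genMetric g b x s = s := h3
  have h5 := congrArg Prod.fst h3'
  rw [genMetric_apply] at h5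
  have h6 := congrArg (g x) h5
  simp only [hm.apply_sharp, h4] at h6
  refine Prod.ext h4 ?_
  change s.2 = g x u + twoFormMap b x u
  rw [← h6, sub_add_cancel]

theorem metricOf_genMetric (hg : ∀ x, IsMetricAt g x) :
    (twisted H₀).metricOf (genMetric g b) = g := by
  funext x
  ext u v
  rw [CourantData.IsGenMetric.metricOf_apply, sigmaPlus_genMetric (hg x),
    sigmaPlus_genMetric (hg x), twisted_pairing]
  simp only [_root_.add_apply]
  rw [(hg x).symm v u, twoFormMap_skew b v u]
  ring

theorem splitting_genMetric (hg : ∀ x, IsMetricAt g x) (u : TangentSpace (𝓡 n) x) :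
    (twisted H₀).splitting (genMetric g b) x u = (u, twoFormMap b x u) := by
  change (twisted H₀).sigmaPlus (genMetric g b) x u - (1 / 2 : ℝ) • ((twisted H₀).coanchor x
    ((twisted H₀).metricOf (genMetric g b) x u)) = _
  rw [sigmaPlus_genMetric (hg x), metricOf_genMetric hg, twisted_coanchor]
  refine Prod.ext ?_ ?_
  · change u - (1 / 2 : ℝ) • (0 : TangentSpace (𝓡 n) x) = u
    simp
  · change g x u + twoFormMap b x u - (1 / 2 : ℝ) • (2 : ℝ) • g x u = twoFormMap b x u
    module

theorem twisted_bracket_snd {a e : Π x, GenTangent n M x} (he : IsSmoothCovector fun x => (e x).2)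
    (ha : IsSmoothCovector fun x => (a x).2)
    (h2 : IsSmoothField fun x => (e x).1) {Z : VectorField n M} (hZ : IsSmoothField Z) :
    ((twisted H₀).bracket a e x).2 (Z x) =
      dirDeriv (fun y => (a y).1) (fun y => (e y).2 (Z y)) x
      - (e x).2 (lieBr (fun y => (a y).1) Z x)
      - (dirDeriv (fun y => (e y).1) (fun y => (a y).2 (Z y)) x
        - dirDeriv Z (fun y => (a y).2 (e y).1) x - (a x).2 (lieBr (fun y => (e y).1) Z x))
      + H₀ x ![(a x).1, (e x).1, Z x] := by
  change lieCovector (fun y => (a y).1) (fun y => (e y).2) x (Z x)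
    - twoFormMap (extD (oneForm fun y => (a y).2)) x (e x).1 (Z x)
    + H₀ x (Function.update ![(a x).1, (e x).1, 0] 2 (Z x)) = _
  have h3 : Function.update ![(a x).1, (e x).1, 0] 2 (Z x) = ![(a x).1, (e x).1, Z x] := by
    funext i; fin_cases i <;> rfl
  rw [h3, lieCovector_spec he hZ, twoFormMap_apply, extD_oneForm ha h2 hZ]

theorem torsionOf_genMetric (hg : ∀ x, IsMetricAt g x) (hb : IsSmoothForm b) :
    (twisted H₀).torsionOf (genMetric g b) = fun x => H₀ x + extD b x := by
  funext x
  have hbs := hb.twoFormMap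
  have key : ∀ X Y Z : VectorField n M, IsSmoothField X → IsSmoothField Y → IsSmoothField Z →
      (H₀ x + extD b x) ![X x, Y x, Z x] = 2 * (twisted H₀).pairing x
        ((twisted H₀).bracket (fun y => (twisted H₀).splitting (genMetric g b) y (X y))
          (fun y => (twisted H₀).splitting (genMetric g b) y (Y y)) x)
        ((twisted H₀).splitting (genMetric g b) x (Z x)) := by
    intro X Y Z hX hY hZ
    simp only [splitting_genMetric hg]
    rw [twisted_pairing, twisted_bracket_snd (a := fun y => (X y, twoFormMap b y (X y)))
      (e := fun y => (Y y, twoFormMap b y (Y y))) (fun W hW => hbs _ _ hY hW)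
      (fun W hW => hbs _ _ hX hW) hY hZ, ContinuousAlternatingMap.add_apply,
      extD_twoForm hb hX hY hZ]
    change _ = 2 * ((1 / 2 : ℝ) * (_ + twoFormMap b x (Z x) (lieBr X Y x)))
    rw [twoFormMap_skew b (Z x), twoFormMap_skew b (Y x) (lieBr X Z x),
      twoFormMap_skew b (X x) (lieBr Y Z x)]
    ring
  have h1 := Classical.epsilon_spec (p := fun H : TangentSpace (𝓡 n) x [⋀^Fin 3]→L[ℝ] ℝ =>
    ∀ X Y Z : VectorField n M, IsSmoothField X → IsSmoothField Y → IsSmoothField Z →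
      H ![X x, Y x, Z x] = 2 * (twisted H₀).pairing x
        ((twisted H₀).bracket (fun y => (twisted H₀).splitting (genMetric g b) y (X y))
          (fun y => (twisted H₀).splitting (genMetric g b) y (Y y)) x)
        ((twisted H₀).splitting (genMetric g b) x (Z x))) ⟨_, key⟩
  refine form_ext fun Y hY => ?_
  have h2 : (fun i => Y i x) = ![Y 0 x, Y 1 x, Y 2 x] := by funext i; fin_cases i <;> rfl
  rw [h2, key _ _ _ (hY 0) (hY 1) (hY 2)]
  exact h1 _ _ _ (hY 0) (hY 1) (hY 2)

/-- The action of `G(g,b)` on the generalized Ricci curvature. -/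
theorem genMetric_genRicci (hg : ∀ x, IsMetricAt g x) (hb : IsSmoothForm b) (a : GenTangent n M x)
    {H : DiffForm n M 3} (hH : (fun x => H₀ x + extD b x) = H)
    {w : TangentSpace (𝓡 n) x} (hw : g x w = a.2 - twoFormMap b x a.1) :
    genMetric g b x ((twisted H₀).genRicci (genMetric g b) x a) =
      (sharp g x (-((1 / 2 : ℝ) • twoFormMap (codiff g H) x a.1) - ricciB g H x w),
        ricciB g H x a.1 + (1 / 2 : ℝ) • twoFormMap (codiff g H) x w +
        twoFormMap b x (sharp g x (-((1 / 2 : ℝ) • twoFormMap (codiff g H) x a.1)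
          - ricciB g H x w))) := by
  have hc : (twisted H₀).cotangentPart (genMetric g b) x a = a.2 - twoFormMap b x a.1 := by
    ext v
    change (2 : ℝ) * (twisted H₀).pairing x a ((twisted H₀).splitting (genMetric g b) x v) = _
    rw [splitting_genMetric hg, twisted_pairing]
    simp only [_root_.sub_apply]
    rw [twoFormMap_skew b v]
    ring
  have hs : sharp g x (a.2 - twoFormMap b x a.1) = w := by rw [← hw, (hg x).sharp_apply]
  have ho : ∀ (u : TangentSpace (𝓡 n) x) (ξ : TangentSpace (𝓡 n) x →L[ℝ] ℝ),
      (twisted H₀).ofSplit (genMetric g b) x u ξ = (u, twoFormMap b x u + ξ) := by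
    intro u ξ
    rw [CourantData.ofSplit, splitting_genMetric hg, twisted_coanchor]
    refine Prod.ext ?_ ?_
    · change u + (1 / 2 : ℝ) • (0 : TangentSpace (𝓡 n) x) = u
      simp
    · change twoFormMap b x u + (1 / 2 : ℝ) • (2 : ℝ) • ξ = _
      module
  rw [CourantData.genRicci]
  simp only [metricOf_genMetric hg, torsionOf_genMetric hg hb, hH, hc, hs, ho]
  rw [genMetric_apply]
  simp only [add_sub_cancel_left, map_add, map_smul, (hg x).apply_sharp]
  rfl

end Twisted

/-! ### Time derivatives of `G(g,b)` -/

section Calculus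

variable {E W : Type*} [NormedAddCommGroup E] [NormedSpace ℝ E] [FiniteDimensional ℝ E]
  [NormedAddCommGroup W] [NormedSpace ℝ W] {S : Set ℝ} {t : ℝ}

theorem hasDerivWithinAt_clm_of_apply {A : ℝ → E →L[ℝ] W} {A' : E →L[ℝ] W}
    (h : ∀ v, HasDerivWithinAt (fun s => A s v) (A' v) S t) : HasDerivWithinAt A A' S t := by
  let β := Module.finBasis ℝ E
  have key : ∀ B : E →L[ℝ] W, B = ∑ i, ContinuousLinearMap.smulRightL ℝ E W
      (LinearMap.toContinuousLinearMap (β.coord i)) (B (β i)) := by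
    intro B
    ext v
    conv_lhs => rw [← β.sum_repr v, map_sum]
    rw [_root_.sum_apply]
    exact Finset.sum_congr rfl fun i _ => map_smul _ _ _
  rw [key A']
  have h1 : A = fun s => ∑ i, ContinuousLinearMap.smulRightL ℝ E W
      (LinearMap.toContinuousLinearMap (β.coord i)) (A s (β i)) := funext fun s => key (A s)
  rw [h1]
  exact HasDerivWithinAt.fun_sum fun i _ => (ContinuousLinearMap.smulRightL ℝ E W
    (LinearMap.toContinuousLinearMap (β.coord i))).hasFDerivAt.comp_hasDerivWithinAt t (h (β i))

/-- Differentiability comes from smoothness of inversion. The value is identified by differentiating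
g_s (g_s⁻¹ η_s) = η_s, so w' only has to solve the linearized equation. -/
theorem hasDerivWithinAt_inverse_apply {g : ℝ → E →L[ℝ] W} {g' : E →L[ℝ] W}
    {η : ℝ → W} {η' : W} {w' : E} [FiniteDimensional ℝ W]
    (hU : UniqueDiffWithinAt ℝ S t) (hg : HasDerivWithinAt g g' S t)
    (hη : HasDerivWithinAt η η' S t) (hbij : ∀ s, Function.Bijective (g s))
    (h : g' ((g t).inverse (η t)) + g t w' = η') :
    HasDerivWithinAt (fun s => (g s).inverse (η s)) w' S t := by
  have : CompleteSpace E := FiniteDimensional.complete ℝ E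
  let e : E ≃L[ℝ] W :=
    (LinearEquiv.ofBijective (g t : E →ₗ[ℝ] W) (hbij t)).toContinuousLinearEquiv
  have he : (e : E →L[ℝ] W) = g t := rfl
  have h1 : DifferentiableAt ℝ (ContinuousLinearMap.inverse : (E →L[ℝ] W) → W →L[ℝ] E) (g t) :=
    he ▸ (contDiffAt_map_inverse (n := 1) e).differentiableAt (by simp)
  have h2 := (h1.comp_differentiableWithinAt t hg.differentiableWithinAt).hasDerivWithinAt
  have h3 := h2.clm_apply hη
  have h4 := hg.clm_apply h3
  have h5 : (fun s => g s ((g s).inverse (η s))) = η :=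
    funext fun s => (inverse_spec (g s) (hbij s)).1 _
  have h6 := hU.eq_deriv _ (h5 ▸ h4) hη
  have h7 := (hbij t).1 (add_left_cancel (h6.trans h.symm))
  exact h7 ▸ h3

/-- For w_s = g_s⁻¹(ξ - b_s u) the linearized equation reads -2 R w + g w' = D u, that is w' = -2 z.
The rest is the product rule on a fixed normed space, applied later with ℝⁿ in the role of the
tangent space. -/
theorem hasDerivWithinAt_genMetric_model {g b : ℝ → E →L[ℝ] E →L[ℝ] ℝ}
    {R D : E →L[ℝ] E →L[ℝ] ℝ} (hU : UniqueDiffWithinAt ℝ S t)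
    (hbij : ∀ s, Function.Bijective (g s))
    (hg : ∀ u v, HasDerivWithinAt (fun s => g s u v) (-2 * R u v) S t)
    (hb : ∀ u v, HasDerivWithinAt (fun s => b s u v) (-D u v) S t) {u w z : E} {ξ : E →L[ℝ] ℝ}
    (hw : (g t).inverse (ξ - b t u) = w) (hz : g t z = -((1 / 2 : ℝ) • D u) - R w) :
    HasDerivWithinAt (fun s => ((g s).inverse (ξ - b s u),
      g s u + b s ((g s).inverse (ξ - b s u))))
      ((-2 : ℝ) • (z, R u + (1 / 2 : ℝ) • D w + b t z)) S t := by
  have : FiniteDimensional ℝ (E →L[ℝ] ℝ) := finiteDimensional_clm_dual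
  have hg1 : HasDerivWithinAt g ((-2 : ℝ) • R) S t :=
    hasDerivWithinAt_clm_of_apply fun u => hasDerivWithinAt_clm_of_apply fun v => hg u v
  have hb1 : HasDerivWithinAt b (-D) S t :=
    hasDerivWithinAt_clm_of_apply fun u => hasDerivWithinAt_clm_of_apply fun v => hb u v
  have hη : HasDerivWithinAt (fun s => ξ - b s u) (D u) S t := by
    refine ((hasDerivWithinAt_const t S ξ).sub
      (hb1.clm_apply (hasDerivWithinAt_const t S u))).congr_deriv ?_
    simp
  have hw1 : HasDerivWithinAt (fun s => (g s).inverse (ξ - b s u)) ((-2 : ℝ) • z) S t := by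
    refine hasDerivWithinAt_inverse_apply hU hg1 hη hbij ?_
    rw [hw, _root_.smul_apply, map_smul, hz]
    module
  refine hw1.prodMk (((hg1.clm_apply (hasDerivWithinAt_const t S u)).add
    (hb1.clm_apply hw1)).congr_deriv ?_)
  rw [hw, _root_.smul_apply, _root_.neg_apply, map_zero, map_smul]
  module

end Calculus

section Twisted

variable {n : ℕ} {M : Type*} [TopologicalSpace M] [T2Space M] [ChartedSpace (Model n) M]
  [IsManifold (𝓡 n) ∞ M] {H₀ H : DiffForm n M 3} {g : ℝ → Tensor2 n M} {b : ℝ → DiffForm n M 2}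
  {x : M} {S : Set ℝ} {t : ℝ}

/-- The variation of `G(g,b)` when `∂g/∂t = -2 Ric^B`, `∂b/∂t = -d*H`. -/
theorem hasDerivWithinAt_genMetric (hU : UniqueDiffWithinAt ℝ S t)
    (hm : ∀ s y, IsMetricAt (g s) y) (hbs : IsSmoothForm (b t))
    (hH : (fun x => H₀ x + extD (b t) x) = H)
    (hg : ∀ u v, HasDerivWithinAt (fun s => g s x u v) (-2 * ricciB (g t) H x u v) S t)
    (hb : ∀ v, HasDerivWithinAt (fun s => b s x v) (-codiff (g t) H x v) S t)
    (a : GenTangent n M x) : HasDerivWithinAt (fun s => genMetric (g s) (b s) x a)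
      (genMetric (g t) (b t) x ((-2 : ℝ) • (twisted H₀).genRicci (genMetric (g t) (b t)) x a))
      S t := by
  have hb1 : ∀ u v, HasDerivWithinAt (fun s => twoFormMap (b s) x u v)
      (-twoFormMap (codiff (g t) H) x u v) S t := fun u v => by
    simp only [twoFormMap_apply]
    exact hb _
  have key := hasDerivWithinAt_genMetric_model (E := Model n) (g := fun s => g s x)
    (b := fun s => twoFormMap (b s) x) (R := ricciB (g t) H x)
    (D := twoFormMap (codiff (g t) H) x) (u := a.1) (ξ := a.2) hU (fun s => (hm s x).bijective)
    hg hb1 rfl ((hm t x).apply_sharp _)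
  rw [ContinuousLinearMap.map_smul,
    genMetric_genRicci (hm t) hbs a hH ((hm t x).apply_sharp _)]
  exact key

end Twisted

/-! ### Scaled pullbacks along a flow -/

section FlowFamilies

variable {n : ℕ} {M : Type*} [TopologicalSpace M] [T2Space M] [ChartedSpace (Model n) M]
  [IsManifold (𝓡 n) ∞ M] {X Y Z : VectorField n M} {x : M} {k : ℕ}

theorem dirDeriv_const_smul_field (r : ℝ) (f : M → ℝ) :
    dirDeriv (r • X) f x = r * dirDeriv X f x := by
  rw [dirDeriv_apply, dirDeriv_apply, Pi.smul_apply, map_smul, smul_eq_mul]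

theorem lieBr_const_smul_left (r : ℝ) (hX : IsSmoothField X) :
    lieBr (r • X) Y x = r • lieBr X Y x := VectorField.mlieBracket_const_smul_left (hX.mdiff x)

theorem lieForm_neg {α : DiffForm n M k} (hα : IsSmoothForm α) (hX : IsSmoothField X) :
    lieForm ((-1 : ℝ) • X) α x = -lieForm X α x := by
  refine form_ext fun Y hY => ?_
  rw [lieForm_spec hα hY, ContinuousAlternatingMap.neg_apply, lieForm_spec hα hY,
    dirDeriv_const_smul_field]
  simp only [lieBr_const_smul_left (-1) hX, ContinuousAlternatingMap.map_update_smul,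
    smul_eq_mul, ← Finset.mul_sum]
  ring

theorem lieTensor2_neg {g : Tensor2 n M} (hg : IsSmoothTensor2 g) (hX : IsSmoothField X)
    (u v : TangentSpace (𝓡 n) x) :
    lieTensor2 ((-1 : ℝ) • X) g x u v = -lieTensor2 X g x u v := by
  obtain ⟨Y, hY, rfl⟩ : ∃ Y : VectorField n M, IsSmoothField Y ∧ Y x = u :=
    ⟨tExt x u, tExt_smooth x u, tExt_self x u⟩
  obtain ⟨Z, hZ, rfl⟩ : ∃ Z : VectorField n M, IsSmoothField Z ∧ Z x = v :=
    ⟨tExt x v, tExt_smooth x v, tExt_self x v⟩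
  rw [lieTensor2_spec hg hY hZ, lieTensor2_spec hg hY hZ, dirDeriv_const_smul_field,
    lieBr_const_smul_left (-1) hX, lieBr_const_smul_left (-1) hX, map_smul, map_smul,
    _root_.smul_apply, smul_eq_mul, smul_eq_mul]
  ring

theorem apply_mfderiv_comp {W : Type*} {χ φ ψ : M → M} (hχ : ∀ y, χ y = φ (ψ y))
    (hφ : ContMDiff (𝓡 n) (𝓡 n) ∞ φ) (hψ : ContMDiff (𝓡 n) (𝓡 n) ∞ ψ)
    (α : Π x : M, (Fin k → TangentSpace (𝓡 n) x) → W) (x : M)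
    (v : Fin k → TangentSpace (𝓡 n) x) :
    α (χ x) (fun i => mfderiv (𝓡 n) (𝓡 n) χ x (v i)) =
      α (φ (ψ x)) (fun i => mfderiv (𝓡 n) (𝓡 n) φ (ψ x) (mfderiv (𝓡 n) (𝓡 n) ψ x (v i))) := by
  obtain rfl : χ = fun y => φ (ψ y) := funext hχ
  have h1 : mfderiv (𝓡 n) (𝓡 n) (fun y => φ (ψ y)) x =
      (mfderiv (𝓡 n) (𝓡 n) φ (ψ x)).comp (mfderiv (𝓡 n) (𝓡 n) ψ x) :=
    mfderiv_comp x (hφ.mdifferentiableAt (by simp)) (hψ.mdifferentiableAt (by simp))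
  exact congrArg (α (φ (ψ x))) (funext fun i => congrArg (fun L => (L (v i) : Model n)) h1)

/-- `e^{-2λs} θ_{-s}^* α`. -/
def flowForm (θ : ℝ → M → M) (lam : ℝ) (α : DiffForm n M k) (s : ℝ) : DiffForm n M k := fun x =>
  Real.exp (-2 * lam * s) •
    (α (θ (-s) x)).compContinuousLinearMap (mfderiv (𝓡 n) (𝓡 n) (θ (-s)) x)

/-- `e^{-2λs} θ_{-s}^* g`. -/
def flowTensor (θ : ℝ → M → M) (lam : ℝ) (g : Tensor2 n M) (s : ℝ) : Tensor2 n M := fun x =>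
  Real.exp (-2 * lam * s) • (ContinuousLinearMap.precomp ℝ (mfderiv (𝓡 n) (𝓡 n) (θ (-s)) x) ∘L
    g (θ (-s) x) ∘L mfderiv (𝓡 n) (𝓡 n) (θ (-s)) x)

namespace IsFlow

variable {θ : ℝ → M → M} {lam : ℝ} {g : Tensor2 n M}

theorem flowForm_apply (h : IsFlow X θ) (hX : IsSmoothField X) (α : DiffForm n M k) (s : ℝ) (x : M)
    (v : Fin k → TangentSpace (𝓡 n) x) : flowForm θ lam α s x v = Real.exp (-2 * lam * s) *
      α (h.diffeo hX (-s) x) (fun i => tangentEquiv (h.diffeo hX (-s)) x (v i)) := rfl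

theorem flowTensor_apply (h : IsFlow X θ) (hX : IsSmoothField X) (s : ℝ) (x : M)
    (u v : TangentSpace (𝓡 n) x) : flowTensor θ lam g s x u v = Real.exp (-2 * lam * s) *
      g (h.diffeo hX (-s) x) (tangentEquiv (h.diffeo hX (-s)) x u)
        (tangentEquiv (h.diffeo hX (-s)) x v) := rfl

theorem flowForm_zero (h : IsFlow X θ) (α : DiffForm n M k) : flowForm θ lam α 0 = α := by
  funext x
  ext v
  change Real.exp (-2 * lam * 0) * α (θ (-0) x) (fun i => mfderiv (𝓡 n) (𝓡 n) (θ (-0)) x (v i)) = _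
  rw [mul_zero, Real.exp_zero, one_mul]
  exact apply_mfderiv_of_eq_id (funext fun y => by rw [neg_zero]; exact h.zero y)
    (fun x w => α x w) x v

theorem flowTensor_zero (h : IsFlow X θ) : flowTensor θ lam g 0 = g := by
  funext x
  ext u v
  change Real.exp (-2 * lam * 0) * g (θ (-0) x) (mfderiv (𝓡 n) (𝓡 n) (θ (-0)) x u)
    (mfderiv (𝓡 n) (𝓡 n) (θ (-0)) x v) = _
  rw [mul_zero, Real.exp_zero, one_mul]
  exact apply_mfderiv_of_eq_id (funext fun y => by rw [neg_zero]; exact h.zero y)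
    (fun x w => g x (w 0) (w 1)) x ![u, v]

theorem smooth_neg (h : IsFlow X θ) (hX : IsSmoothField X) :
    ContMDiff (𝓘(ℝ, ℝ).prod (𝓡 n)) (𝓡 n) ∞ (fun p : ℝ × M => θ (-p.1) p.2) :=
  (h.smooth hX).comp ((contMDiff_fst (I := 𝓘(ℝ, ℝ)) (J := 𝓡 n)).neg.prodMk contMDiff_snd)

theorem smooth_exp (r : ℝ) : ContMDiff (𝓘(ℝ, ℝ).prod (𝓡 n)) 𝓘(ℝ, ℝ) ∞
    (fun p : ℝ × M => Real.exp (r * p.1)) :=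
  (Real.contDiff_exp.comp (contDiff_const.mul contDiff_id)).contMDiff.comp
    (contMDiff_fst (I := 𝓘(ℝ, ℝ)) (J := 𝓡 n))

theorem contMDiff_flowTensor (h : IsFlow X θ) (hX : IsSmoothField X) (hg : IsSmoothTensor2 g)
    (hY : IsSmoothField Y) (hZ : IsSmoothField Z) :
    ContMDiff (𝓘(ℝ, ℝ).prod (𝓡 n)) 𝓘(ℝ, ℝ) ∞
      (fun p : ℝ × M => flowTensor θ lam g p.1 p.2 (Y p.2) (Z p.2)) := by
  refine (smooth_exp (-2 * lam)).mul fun p => contMDiffWithinAt_univ.1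
    (contMDiffWithinAt_tensor2_apply (f := fun p : ℝ × M => θ (-p.1) p.2)
      (A := fun p => g (θ (-p.1) p.2)) (mem_univ p) (fun V W hV hW => ?_)
      (contMDiff_mfderiv_family (φ := fun t => θ (-t)) (h.smooth_neg hX) hY p).contMDiffWithinAt
      (contMDiff_mfderiv_family (φ := fun t => θ (-t)) (h.smooth_neg hX) hZ p).contMDiffWithinAt)
  exact ((hg V W hV hW).comp (h.smooth_neg hX) p).contMDiffWithinAt

theorem contMDiff_flowForm (h : IsFlow X θ) (hX : IsSmoothField X) {α : DiffForm n M 2}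
    (hα : IsSmoothForm α) {Y : Fin 2 → VectorField n M} (hY : ∀ i, IsSmoothField (Y i)) :
    ContMDiff (𝓘(ℝ, ℝ).prod (𝓡 n)) 𝓘(ℝ, ℝ) ∞
      (fun p : ℝ × M => flowForm θ lam α p.1 p.2 (fun i => Y i p.2)) := by
  refine (h.contMDiff_flowTensor hX (lam := lam) hα.twoFormMap (hY 0) (hY 1)).congr fun p => ?_
  change Real.exp _ * α _ _ = Real.exp _ * twoFormMap α _ _ _
  rw [twoFormMap_apply]
  congr 2
  ext1 i; fin_cases i <;> rfl

/-- By the group law θ_{-s} = θ_{-(s-t)} ∘ θ_{-t}, so the derivative at s = t is that of pullbacks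
by a family starting at the identity with velocity -X, taken at the point θ_{-t} x. -/
theorem hasDerivAt_flowForm (h : IsFlow X θ) (hX : IsSmoothField X) {α : DiffForm n M k}
    (hα : IsSmoothForm α) (t : ℝ) (x : M) (v : Fin k → TangentSpace (𝓡 n) x) :
    HasDerivAt (fun s => flowForm θ lam α s x v)
      (-2 * lam * flowForm θ lam α t x v - flowForm θ lam (lieForm X α) t x v) t := by
  have h1 := (h.isVelocity hX t (-1)).hasDerivWithinAt_pullback_form (hX.const_smul (-1))
    (x := θ (-t) x) (θ := fun _ => α) hα
    (fun Y hY => ((hα Y hY).comp (contMDiff_snd (I := 𝓘(ℝ, ℝ)) (J := 𝓡 n)) _).contMDiffWithinAt)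
    (θ' := fun _ => 0) (fun v => hasDerivWithinAt_const t _ _)
    (fun i => mfderiv (𝓡 n) (𝓡 n) (θ (-t)) x (v i))
  rw [hasDerivWithinAt_univ, lieForm_neg hα hX, zero_add] at h1
  have h2 : (fun s => α (θ (-s) x) (fun i => mfderiv (𝓡 n) (𝓡 n) (θ (-s)) x (v i))) = fun s =>
      α (θ (-1 * (s - t)) (θ (-t) x)) (fun i => mfderiv (𝓡 n) (𝓡 n) (θ (-1 * (s - t))) (θ (-t) x)
        (mfderiv (𝓡 n) (𝓡 n) (θ (-t)) x (v i))) := by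
    funext s
    refine apply_mfderiv_comp (fun y => ?_) (h.smooth_apply hX _) (h.smooth_apply hX _)
      (fun x w => α x w) x v
    rw [← h.add]
    congr 1
    ring
  have h3 : HasDerivAt (fun s => Real.exp (-2 * lam * s)) (Real.exp (-2 * lam * t) * (-2 * lam)) t :=
    ((hasDerivAt_id t).const_mul (-2 * lam)).exp.congr_deriv (by simp)
  refine (h3.mul (h2 ▸ h1)).congr_deriv ?_
  change Real.exp (-2 * lam * t) * (-2 * lam) * α (θ (-t) x) (fun i => mfderiv (𝓡 n) (𝓡 n)
    (θ (-t)) x (v i)) + Real.exp (-2 * lam * t) * -lieForm X α (θ (-t) x) (fun i =>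
    mfderiv (𝓡 n) (𝓡 n) (θ (-t)) x (v i)) = -2 * lam * (Real.exp (-2 * lam * t) * α (θ (-t) x)
    (fun i => mfderiv (𝓡 n) (𝓡 n) (θ (-t)) x (v i))) - Real.exp (-2 * lam * t) *
    lieForm X α (θ (-t) x) (fun i => mfderiv (𝓡 n) (𝓡 n) (θ (-t)) x (v i))
  ring

theorem hasDerivAt_flowTensor (h : IsFlow X θ) (hX : IsSmoothField X) (hg : IsSmoothTensor2 g)
    (t : ℝ) (x : M) (u v : TangentSpace (𝓡 n) x) :
    HasDerivAt (fun s => flowTensor θ lam g s x u v)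
      (-2 * lam * flowTensor θ lam g t x u v - flowTensor θ lam (lieTensor2 X g) t x u v) t := by
  have h1 := (h.isVelocity hX t (-1)).hasDerivWithinAt_pullback_tensor2 (hX.const_smul (-1))
    (x := θ (-t) x) (θ := fun _ => g) hg
    (fun Y Z hY hZ => ((hg Y Z hY hZ).comp
      (contMDiff_snd (I := 𝓘(ℝ, ℝ)) (J := 𝓡 n)) _).contMDiffWithinAt)
    (θ' := fun _ _ => 0) (fun u v => hasDerivWithinAt_const t _ _)
    (mfderiv (𝓡 n) (𝓡 n) (θ (-t)) x u) (mfderiv (𝓡 n) (𝓡 n) (θ (-t)) x v)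
  rw [hasDerivWithinAt_univ, lieTensor2_neg hg hX, zero_add] at h1
  have h2 : (fun s => g (θ (-s) x) (mfderiv (𝓡 n) (𝓡 n) (θ (-s)) x u)
      (mfderiv (𝓡 n) (𝓡 n) (θ (-s)) x v)) = fun s => g (θ (-1 * (s - t)) (θ (-t) x))
      (mfderiv (𝓡 n) (𝓡 n) (θ (-1 * (s - t))) (θ (-t) x) (mfderiv (𝓡 n) (𝓡 n) (θ (-t)) x u))
      (mfderiv (𝓡 n) (𝓡 n) (θ (-1 * (s - t))) (θ (-t) x) (mfderiv (𝓡 n) (𝓡 n) (θ (-t)) x v)) := by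
    funext s
    refine apply_mfderiv_comp (fun y => ?_) (h.smooth_apply hX _) (h.smooth_apply hX _)
      (fun x w => g x (w 0) (w 1)) x ![u, v]
    rw [← h.add]
    congr 1
    ring
  have h3 : HasDerivAt (fun s => Real.exp (-2 * lam * s)) (Real.exp (-2 * lam * t) * (-2 * lam)) t :=
    ((hasDerivAt_id t).const_mul (-2 * lam)).exp.congr_deriv (by simp)
  refine (h3.mul (h2 ▸ h1)).congr_deriv ?_
  change Real.exp (-2 * lam * t) * (-2 * lam) * g (θ (-t) x) (mfderiv (𝓡 n) (𝓡 n) (θ (-t)) x u)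
    (mfderiv (𝓡 n) (𝓡 n) (θ (-t)) x v) + Real.exp (-2 * lam * t) * -lieTensor2 X g (θ (-t) x)
    (mfderiv (𝓡 n) (𝓡 n) (θ (-t)) x u) (mfderiv (𝓡 n) (𝓡 n) (θ (-t)) x v) =
    -2 * lam * (Real.exp (-2 * lam * t) * g (θ (-t) x) (mfderiv (𝓡 n) (𝓡 n) (θ (-t)) x u)
    (mfderiv (𝓡 n) (𝓡 n) (θ (-t)) x v)) - Real.exp (-2 * lam * t) * lieTensor2 X g (θ (-t) x)
    (mfderiv (𝓡 n) (𝓡 n) (θ (-t)) x u) (mfderiv (𝓡 n) (𝓡 n) (θ (-t)) x v)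
  ring

theorem isRiemannian_flowTensor (h : IsFlow X θ) (hX : IsSmoothField X) (hg : IsRiemannian g)
    (s : ℝ) : IsRiemannian (flowTensor θ lam g s) :=
  isRiemannian_of_scaled (f := h.diffeo hX (-s)) hg (Real.exp_pos _) (h.flowTensor_apply hX s)

theorem isSmoothForm_flowForm (h : IsFlow X θ) (hX : IsSmoothField X) {α : DiffForm n M k}
    (hα : IsSmoothForm α) (s : ℝ) : IsSmoothForm (flowForm θ lam α s) :=
  isSmoothForm_pull (f := h.diffeo hX (-s)) hα (h.flowForm_apply hX α s)

variable {H : DiffForm n M 3}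

/-- The static equation rewrites -2λ g - L_X g as -2 Ric^B. Since Ric^B is invariant under
simultaneous scaling, one factor e^{-2λt} is left over, and the time change absorbs it later. -/
theorem hasDerivAt_metric (h : IsFlow X θ) (hX : IsSmoothField X) (hg : IsRiemannian g)
    (hs : IsStaticSoliton g H lam X) (t : ℝ) (x : M) (u v : TangentSpace (𝓡 n) x) :
    HasDerivAt (fun s => flowTensor θ lam g s x u v) (Real.exp (-2 * lam * t) *
      (-2 * ricciB (flowTensor θ lam g t) (flowForm θ lam H t) x u v)) t := by
  refine (h.hasDerivAt_flowTensor hX hg.smooth t x u v).congr_deriv ?_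
  rw [ricciB_natural (f := h.diffeo hX (-t)) hg (Real.exp_pos _) (h.flowTensor_apply hX t)
    (h.flowForm_apply hX H t), hs.1, h.flowTensor_apply hX, h.flowTensor_apply hX]
  simp only [_root_.add_apply, _root_.smul_apply, smul_eq_mul]
  ring

/-- The `2`-forms completing the scaled pullbacks of a static soliton to a family of generalized
metrics. -/
theorem exists_twoForms (h : IsFlow X θ) (hX : IsSmoothField X) (hg : IsRiemannian g)
    (hH : IsSmoothForm H) (hdH : ∀ x, extD H x = 0) (hs : IsStaticSoliton g H lam X) :
    ∃ B : ℝ → DiffForm n M 2, B 0 = 0 ∧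
      (∀ Y : Fin 2 → VectorField n M, (∀ i, IsSmoothField (Y i)) →
        ContMDiff (𝓘(ℝ, ℝ).prod (𝓡 n)) 𝓘(ℝ, ℝ) ∞ (fun p : ℝ × M => B p.1 p.2 (fun i => Y i p.2))) ∧
      (∀ t x v, HasDerivAt (fun s => B s x v) (Real.exp (-2 * lam * t) *
        -codiff (flowTensor θ lam g t) (flowForm θ lam H t) x v) t) ∧
      ∀ t, (fun x => H x + extD (B t) x) = flowForm θ lam H t := by
  set D := codiff g H
  have hD : IsSmoothForm D := hg.smooth_codiff hH
  -- B integrates the pulled-back codifferential. The codifferential of the scaled pair carries no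
  -- factor of its own, so the factor e^{-2λs} inside `flowForm` is the one in the statement.
  obtain ⟨B, hB0, hBs, hBd⟩ := exists_primitive_form (β := fun s x => -flowForm θ lam D s x)
    (fun Y hY => (h.contMDiff_flowForm hX (lam := lam) hD hY).neg)
  have hBt : ∀ t, IsSmoothForm (B t) := fun t Y hY =>
    (hBs Y hY).comp (contMDiff_const.prodMk contMDiff_id)
  refine ⟨B, hB0, hBs, fun t x v => (hBd t x v).congr_deriv ?_, fun t => ?_⟩
  · rw [codiff_natural (f := h.diffeo hX (-t)) hg (Real.exp_pos _) (h.flowTensor_apply hX t) hH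
      (h.isSmoothForm_flowForm hX hH t) (h.flowForm_apply hX H t),
      ContinuousAlternatingMap.neg_apply, h.flowForm_apply hX]
    ring
  · funext x
    ext v
    -- The second static equation with dH = 0, solved for L_X H.
    have hdD : ∀ y w, lieForm X H y w = -2 * lam * H y w + extD D y w := by
      intro y w
      have h1 := congrArg (fun L => L w) (hs.2 y)
      have h2 : codiff g (extD H) y = 0 := by
        rw [show extD H = 0 from funext hdH]
        exact codiff_zero (hg.metricAt y)
      change -(extD D y w + codiff g (extD H) y w) = -2 * lam * H y w - lieForm X H y w at h1
      rw [h2] at h1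
      change -(extD D y w + 0) = _ at h1
      linarith
    -- The difference H + dB(s) - Ĥ(s), with Ĥ(s) = e^{-2λs} θ_{-s}^* H, has zero derivative by
    -- `hdD` and naturality of d, and it vanishes at s = 0.
    have hdB : ∀ s, HasDerivAt (fun s => H x v + extD (B s) x v - flowForm θ lam H s x v) 0 s := by
      intro s
      have h1 := (hasDerivWithinAt_extD (mem_univ s) uniqueDiffOn_univ (by simp)
        (fun t _ => hBt t) (fun Y hY y => ((hBs Y hY) _).contMDiffWithinAt)
        (fun y w => (hBd s y w).hasDerivWithinAt)).2 x v
      rw [hasDerivWithinAt_univ] at h1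
      refine ((h1.const_add (H x v)).sub (h.hasDerivAt_flowForm hX hH s x v)).congr_deriv ?_
      rw [extD_neg (h.isSmoothForm_flowForm hX hD s), extD_twoForm_natural
        (f := h.diffeo hX (-s)) (c := Real.exp (-2 * lam * s)) hD (h.flowForm_apply hX D s),
        h.flowForm_apply hX, h.flowForm_apply hX, hdD]
      ring
    have h1 := is_const_of_deriv_eq_zero (fun s => (hdB s).differentiableAt)
      (fun s => (hdB s).deriv) t 0
    have h2 : extD (0 : DiffForm n M 2) x v = 0 := by
      have := extD_neg (θ := (0 : DiffForm n M 2)) (fun Y _ => contMDiff_const) x v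
      rw [show (fun y => -(0 : DiffForm n M 2) y) = 0 from funext fun y => neg_zero] at this
      linarith
    rw [h.flowForm_zero, hB0, h2] at h1
    rw [ContinuousAlternatingMap.add_apply]
    linarith

end IsFlow

end FlowFamilies

/-! ### Isometries of `(TM ⊕ T*M)_H` -/

section Isometries

variable {n : ℕ} {M : Type*} [TopologicalSpace M] [T2Space M] [ChartedSpace (Model n) M]
  [IsManifold (𝓡 n) ∞ M] {f : M ≃ₘ^∞⟮𝓡 n, 𝓡 n⟯ M} {c : ℝ} {B : DiffForm n M 2} {x : M}

/-- `X + ξ ↦ f_* X + c f_* ξ + B (f_* X)`. -/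
def courantMap (f : M ≃ₘ^∞⟮𝓡 n, 𝓡 n⟯ M) (c : ℝ) (B : DiffForm n M 2) (x : M) :
    GenTangent n M x →L[ℝ] GenTangent n M (f x) :=
  ((tangentEquiv f x : TangentSpace (𝓡 n) x →L[ℝ] TangentSpace (𝓡 n) (f x)) ∘L
    ContinuousLinearMap.fst ℝ _ _).prod
  (c • ContinuousLinearMap.precomp ℝ
      ((tangentEquiv f x).symm : TangentSpace (𝓡 n) (f x) →L[ℝ] TangentSpace (𝓡 n) x) ∘L
      ContinuousLinearMap.snd ℝ _ _ +
    twoFormMap B (f x) ∘L (tangentEquiv f x : TangentSpace (𝓡 n) x →L[ℝ]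
      TangentSpace (𝓡 n) (f x)) ∘L ContinuousLinearMap.fst ℝ _ _)

theorem courantMap_fst (a : GenTangent n M x) : (courantMap f c B x a).1 = tangentEquiv f x a.1 :=
  rfl

theorem courantMap_snd (a : GenTangent n M x) (v : TangentSpace (𝓡 n) (f x)) :
    (courantMap f c B x a).2 v =
      c * a.2 ((tangentEquiv f x).symm v) + twoFormMap B (f x) (tangentEquiv f x a.1) v := rfl

/-- The inverse of `courantMap`. -/
def courantMapInv (f : M ≃ₘ^∞⟮𝓡 n, 𝓡 n⟯ M) (c : ℝ) (B : DiffForm n M 2) (x : M) :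
    GenTangent n M (f x) →L[ℝ] GenTangent n M x :=
  (((tangentEquiv f x).symm : TangentSpace (𝓡 n) (f x) →L[ℝ] TangentSpace (𝓡 n) x) ∘L
    ContinuousLinearMap.fst ℝ _ _).prod
  (c⁻¹ • ContinuousLinearMap.precomp ℝ
      (tangentEquiv f x : TangentSpace (𝓡 n) x →L[ℝ] TangentSpace (𝓡 n) (f x)) ∘L
      (ContinuousLinearMap.snd ℝ _ _ - twoFormMap B (f x) ∘L ContinuousLinearMap.fst ℝ _ _))

/-- `courantMap` as an isomorphism. -/
def courantEquiv (f : M ≃ₘ^∞⟮𝓡 n, 𝓡 n⟯ M) (hc : c ≠ 0) (B : DiffForm n M 2) (x : M) :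
    GenTangent n M x ≃L[ℝ] GenTangent n M (f x) :=
  ContinuousLinearEquiv.equivOfInverse (courantMap f c B x) (courantMapInv f c B x)
    (fun a => Prod.ext ((tangentEquiv f x).symm_apply_apply a.1) (by
      ext v
      change c⁻¹ * ((courantMap f c B x a).2 (tangentEquiv f x v)
        - twoFormMap B (f x) (tangentEquiv f x a.1) (tangentEquiv f x v)) = a.2 v
      rw [courantMap_snd, ContinuousLinearEquiv.symm_apply_apply, add_sub_cancel_right,
        inv_mul_cancel_left₀ hc]))
    (fun a => Prod.ext ((tangentEquiv f x).apply_symm_apply a.1) (by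
      ext v
      rw [courantMap_snd]
      change c * (c⁻¹ * (a.2 (tangentEquiv f x ((tangentEquiv f x).symm v)) - twoFormMap B (f x) a.1
          (tangentEquiv f x ((tangentEquiv f x).symm v))))
        + twoFormMap B (f x) (tangentEquiv f x ((tangentEquiv f x).symm a.1)) v = a.2 v
      rw [ContinuousLinearEquiv.apply_symm_apply, ContinuousLinearEquiv.apply_symm_apply,
        mul_inv_cancel_left₀ hc, sub_add_cancel]))

variable {H : DiffForm n M 3} {g g' : Tensor2 n M}

/-- The vector parts agree by naturality of the Lie bracket. In the covector parts, tested on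
related fields, the Lie derivative terms scale by c, and the terms with B assemble into dB by the
invariant formula. What remains is f^*(H + dB) = c H. -/
theorem courantMap_bracket (hB : IsSmoothForm B)
    (hH : ∀ x v, H (f x) (fun i => tangentEquiv f x (v i)) +
      extD B (f x) (fun i => tangentEquiv f x (v i)) = c * H x v)
    {a b a' b' : Π x, GenTangent n M x} (ha : IsSmoothSection (n := n) (GenModel n) a)
    (hb : IsSmoothSection (n := n) (GenModel n) b) (ha' : ∀ x, a' (f x) = courantMap f c B x (a x))
    (hb' : ∀ x, b' (f x) = courantMap f c B x (b x)) (x : M) :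
    (twisted H).bracket a' b' (f x) = courantMap f c B x ((twisted H).bracket a b x) := by
  have sX := isSmoothField_fst ha
  have sY := isSmoothField_fst hb
  have sξ := isSmoothCovector_snd ha
  have sη := isSmoothCovector_snd hb
  have hBs := hB.twoFormMap
  -- The sections a' and b' are not assumed smooth. Their smoothness, for vector parts here and
  -- covector parts in `cov`, is forced by relatedness to smooth sections.
  have rel : ∀ e e' : Π x, GenTangent n M x, IsSmoothSection (n := n) (GenModel n) e →
      (∀ x, e' (f x) = courantMap f c B x (e x)) →
      IsRelated f (fun x => (e x).1) (fun x => (e' x).1) ∧ IsSmoothField (fun x => (e' x).1) := by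
    intro e e' he h
    have h1 : IsRelated f (fun x => (e x).1) (fun x => (e' x).1) := fun x => by
      change tangentEquiv f x (e x).1 = (e' (f x)).1
      rw [h, courantMap_fst]
    obtain ⟨W, hW, hW'⟩ := exists_push f (isSmoothField_fst he)
    have h2 : (fun x => (e' x).1) = W := funext fun y => by
      obtain ⟨x, rfl⟩ := f.surjective y
      exact (h1 x).symm.trans (hW' x)
    exact ⟨h1, h2 ▸ hW⟩
  obtain ⟨rX, sX'⟩ := rel a a' ha ha'
  obtain ⟨rY, sY'⟩ := rel b b' hb hb'
  have val : ∀ (e e' : Π x, GenTangent n M x), (∀ x, e' (f x) = courantMap f c B x (e x)) →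
      ∀ {Z Z' : VectorField n M}, IsRelated f Z Z' → ∀ x, (e' (f x)).2 (Z' (f x)) =
        c * (e x).2 (Z x) + twoFormMap B (f x) (e' (f x)).1 (Z' (f x)) := by
    intro e e' h Z Z' hZ x
    rw [h, courantMap_snd, courantMap_fst, ← hZ x, ContinuousLinearEquiv.symm_apply_apply]
  have cov : ∀ e e' : Π x, GenTangent n M x, IsSmoothSection (n := n) (GenModel n) e →
      (∀ x, e' (f x) = courantMap f c B x (e x)) → IsSmoothCovector (fun x => (e' x).2) := by
    intro e e' he h Z' hZ'
    obtain ⟨Z, hZ, rZ⟩ := exists_pull f hZ'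
    have h1 : IsSmoothFn n M fun y => c * (e (f.symm y)).2 (Z (f.symm y)) :=
      contMDiff_const.mul (IsSmoothFn.comp_diffeo (f := f.symm) (isSmoothCovector_snd he Z hZ))
    refine (h1.add (hBs _ _ (rel e e' he h).2 hZ')).congr fun y => ?_
    obtain ⟨x, hx⟩ : ∃ x, f x = y := f.surjective y
    subst hx
    change _ = c * (e (f.symm (f x))).2 (Z (f.symm (f x))) + _
    rw [f.symm_apply_apply]
    exact val e e' h rZ x
  have sξ' := cov a a' ha ha'
  have sη' := cov b b' hb hb'
  refine Prod.ext (rX.lieBr rY sX sY sX' sY' x).symm ?_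
  ext v
  obtain ⟨Z, Z', sZ, sZ', rZ, hv⟩ := exists_pull_eq f x ((tangentEquiv f x).symm v)
  have hv' : v = Z' (f x) := by rw [← rZ x, hv, ContinuousLinearEquiv.apply_symm_apply]
  rw [hv', twisted_bracket_snd sη' sξ' sY' sZ', courantMap_snd, ← rZ x,
    ContinuousLinearEquiv.symm_apply_apply, twisted_bracket_snd sη sξ sY sZ]
  have d1 : ∀ {e e' : Π x, GenTangent n M x} {U U' W W' : VectorField n M},
      IsSmoothSection (n := n) (GenModel n) e → (∀ x, e' (f x) = courantMap f c B x (e x)) →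
      IsRelated f U U' → IsRelated f W W' → IsSmoothField W → IsSmoothField W' →
      dirDeriv U' (fun y => (e' y).2 (W' y)) (f x) = c * dirDeriv U (fun y => (e y).2 (W y)) x
        + dirDeriv U' (fun y => twoFormMap B y (e' y).1 (W' y)) (f x) := by
    intro e e' U U' W W' he h rU rW sW sW'
    have s1 := isSmoothCovector_snd he W sW
    have s2 := hBs _ _ (rel e e' he h).2 sW'
    have s3 : IsSmoothFn n M (fun y => c * (e y).2 (W y)) := contMDiff_const.mul s1
    rw [rU.dirDeriv (cov e e' he h W' sW'), rU.dirDeriv s2, ← dirDeriv_const_mul c s1]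
    refine Eq.trans ?_ (dirDeriv_add s3 (IsSmoothFn.comp_diffeo (f := f) s2))
    exact congrArg (fun φ => dirDeriv U φ x) (funext fun y => val e e' h rW y)
  rw [rZ x, d1 hb hb' rX rZ sZ sZ', d1 ha ha' rY rZ sZ sZ', d1 ha ha' rZ rY sY sY',
    val b b' hb' (rX.lieBr rZ sX sZ sX' sZ'), val a a' ha' (rY.lieBr rZ sY sZ sY' sZ')]
  have h1 := hH x ![(a x).1, (b x).1, Z x]
  have h2 : (fun i => tangentEquiv f x (![(a x).1, (b x).1, Z x] i)) =
      ![(a' (f x)).1, (b' (f x)).1, Z' (f x)] := by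
    funext i
    fin_cases i
    · exact rX x
    · exact rY x
    · exact rZ x
  rw [h2, extD_twoForm hB (X := fun y => (a' y).1) (Y := fun y => (b' y).1) sX' sY' sZ'] at h1
  have h3 : twoFormMap B (f x) (tangentEquiv f x ((twisted H).bracket a b x).1) (Z' (f x)) =
      twoFormMap B (f x) (lieBr (fun y => (a' y).1) (fun y => (b' y).1) (f x)) (Z' (f x)) :=
    congrArg (fun w => twoFormMap B (f x) w (Z' (f x))) (rX.lieBr rY sX sY sX' sY' x)
  rw [h3]
  rw [twoFormMap_skew B _ (b' (f x)).1, twoFormMap_skew B _ (a' (f x)).1] at h1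
  linarith


theorem twoFormMap_zero (x : M) : twoFormMap (0 : DiffForm n M 2) x = 0 := by
  ext u v
  rw [twoFormMap_apply]
  rfl

theorem courantMap_genMetric (hm : ∀ x, IsMetricAt g x) (hm' : ∀ x, IsMetricAt g' x)
    (hg : ∀ x u v, g' (f x) (tangentEquiv f x u) (tangentEquiv f x v) = c * g x u v)
    (a : GenTangent n M x) : courantMap f c B x (genMetric g 0 x a) =
      genMetric g' B (f x) (courantMap f c B x a) := by
  set w := sharp g x (a.2 - twoFormMap 0 x a.1)
  have hw : g x w = a.2 := by
    rw [(hm x).apply_sharp, twoFormMap_zero, _root_.zero_apply, sub_zero]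
  have h1 : sharp g' (f x) ((courantMap f c B x a).2 -
      twoFormMap B (f x) (courantMap f c B x a).1) = tangentEquiv f x w := by
    rw [← (hm' (f x)).sharp_apply (tangentEquiv f x w)]
    congr 1
    ext v
    rw [_root_.sub_apply, courantMap_snd, courantMap_fst, add_sub_cancel_right, ← hw, ← hg,
      ContinuousLinearEquiv.apply_symm_apply]
  rw [genMetric_apply (g := g'), h1]
  refine Prod.ext rfl ?_
  ext v
  rw [courantMap_snd]
  change c * (g x a.1 ((tangentEquiv f x).symm v) + twoFormMap 0 x w ((tangentEquiv f x).symm v))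
    + twoFormMap B (f x) (tangentEquiv f x w) v =
    g' (f x) (tangentEquiv f x a.1) v + twoFormMap B (f x) (tangentEquiv f x w) v
  rw [twoFormMap_zero, _root_.zero_apply, _root_.zero_apply, add_zero, ← hg,
    ContinuousLinearEquiv.apply_symm_apply]

theorem isIsometry_courantEquiv (hc : c ≠ 0) (hB : IsSmoothForm B)
    (hm : ∀ x, IsMetricAt g x) (hm' : ∀ x, IsMetricAt g' x)
    (hg : ∀ x u v, g' (f x) (tangentEquiv f x u) (tangentEquiv f x v) = c * g x u v)
    (hH : ∀ x v, H (f x) (fun i => tangentEquiv f x (v i)) +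
      extD B (f x) (fun i => tangentEquiv f x (v i)) = c * H x v)
    (hs : ContMDiff ((𝓡 n).prod 𝓘(ℝ, GenModel n)) ((𝓡 n).prod 𝓘(ℝ, GenModel n)) ∞
      (fun p : TotalSpace (GenModel n) (GenTangent n M) =>
        TotalSpace.mk' (GenModel n) (f p.1) (courantEquiv f hc B p.1 p.2))) :
    IsIsometry ((twisted H).scale c) (genMetric g 0) (twisted H) (genMetric g' B)
      ⟨f, courantEquiv f hc B, hs⟩ where
  pairing x a b := by
    change (twisted H).pairing (f x) (courantMap f c B x a) (courantMap f c B x b) =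
      c * (twisted H).pairing x a b
    rw [twisted_pairing, twisted_pairing, courantMap_snd, courantMap_snd, courantMap_fst,
      courantMap_fst, ContinuousLinearEquiv.symm_apply_apply,
      ContinuousLinearEquiv.symm_apply_apply, twoFormMap_skew B (tangentEquiv f x b.1)]
    ring
  bracket a b a' b' ha hb ha' hb' x := courantMap_bracket hB hH ha hb ha' hb' x
  metric x a := courantMap_genMetric hm hm' hg a

end Isometries

/-! ### Families of isometries -/

section IsometryFamilies

variable {n : ℕ} {M : Type*} [TopologicalSpace M] [T2Space M] [ChartedSpace (Model n) M]
  [IsManifold (𝓡 n) ∞ M] {X : VectorField n M} {x : M} {k : ℕ} {θ : ℝ → M → M} {lam : ℝ}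
  {g : Tensor2 n M}

namespace IsFlow

theorem flowForm_push (h : IsFlow X θ) (hX : IsSmoothField X) (α : DiffForm n M k) (s : ℝ) (x : M)
    (v : Fin k → TangentSpace (𝓡 n) x) : flowForm θ lam α s (h.diffeo hX s x)
      (fun i => tangentEquiv (h.diffeo hX s) x (v i)) = Real.exp (-2 * lam * s) * α x v := by
  have h1 := apply_mfderiv_comp (χ := id) (fun y => (h.neg_comp s y).symm)
    (h.smooth_apply hX (-s)) (h.smooth_apply hX s) (fun x w => α x w) x v
  have h2 := apply_mfderiv_of_eq_id rfl (fun x w => α x w) x v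
  exact congrArg (fun r => Real.exp (-2 * lam * s) * r) (h1.symm.trans h2)

theorem flowTensor_push (h : IsFlow X θ) (hX : IsSmoothField X) (s : ℝ) (x : M)
    (u v : TangentSpace (𝓡 n) x) : flowTensor θ lam g s (h.diffeo hX s x)
      (tangentEquiv (h.diffeo hX s) x u) (tangentEquiv (h.diffeo hX s) x v) =
      Real.exp (-2 * lam * s) * g x u v := by
  have h1 := apply_mfderiv_comp (χ := id) (fun y => (h.neg_comp s y).symm)
    (h.smooth_apply hX (-s)) (h.smooth_apply hX s) (fun x w => g x (w 0) (w 1)) x ![u, v]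
  have h2 := apply_mfderiv_of_eq_id rfl (fun x w => g x (w 0) (w 1)) x ![u, v]
  exact congrArg (fun r => Real.exp (-2 * lam * s) * r) (h1.symm.trans h2)

variable {B : ℝ → DiffForm n M 2}

theorem contMDiff_courantMap_section (h : IsFlow X θ) (hX : IsSmoothField X)
    (hB : ∀ Y : Fin 2 → VectorField n M, (∀ i, IsSmoothField (Y i)) →
      ContMDiff (𝓘(ℝ, ℝ).prod (𝓡 n)) 𝓘(ℝ, ℝ) ∞ (fun p : ℝ × M => B p.1 p.2 (fun i => Y i p.2)))
    {a : Π x, GenTangent n M x} (ha : IsSmoothSection (n := n) (GenModel n) a) :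
    ContMDiff (𝓘(ℝ, ℝ).prod (𝓡 n)) ((𝓡 n).prod 𝓘(ℝ, GenModel n)) ∞ (fun p : ℝ × M =>
      TotalSpace.mk' (GenModel n) (E := GenTangent n M) (h.diffeo hX p.1 p.2)
        (courantMap (h.diffeo hX p.1) (Real.exp (-2 * lam * p.1)) (B p.1) p.2 (a p.2))) := by
  intro p
  have hθ := h.smooth hX
  have he : ∀ {Y : VectorField n M}, IsSmoothField Y → ContMDiffWithinAt (𝓘(ℝ, ℝ).prod (𝓡 n))
      ((𝓡 n).prod 𝓘(ℝ, Model n)) ∞ (fun p : ℝ × M => TotalSpace.mk' (Model n)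
        (E := fun x : M => TangentSpace (𝓡 n) x) (h.diffeo hX p.1 p.2)
        (tangentEquiv (h.diffeo hX p.1) p.2 (Y p.2))) univ p := fun hY =>
    (contMDiff_mfderiv_family hθ hY p).contMDiffWithinAt
  have h1 := isSmoothField_fst ha
  have h2 := isSmoothCovector_snd ha
  refine contMDiffWithinAt_univ.1 (contMDiffWithinAt_genTangent
    (f := fun p : ℝ × M => h.diffeo hX p.1 p.2)
    (v := fun p => tangentEquiv (h.diffeo hX p.1) p.2 (a p.2).1)
    (ξ := fun p => (courantMap (h.diffeo hX p.1) (Real.exp (-2 * lam * p.1)) (B p.1) p.2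
      (a p.2)).2) (mem_univ p) (he h1) fun Z hZ => ?_)
  have hZθ : ContMDiffWithinAt (𝓘(ℝ, ℝ).prod (𝓡 n)) ((𝓡 n).prod 𝓘(ℝ, Model n)) ∞
      (fun p : ℝ × M => TotalSpace.mk' (Model n) (E := fun x : M => TangentSpace (𝓡 n) x)
        (h.diffeo hX p.1 p.2) (Z (h.diffeo hX p.1 p.2))) univ p :=
    (ContMDiff.comp hZ hθ p).contMDiffWithinAt
  -- The covector part involves the inverse differential of the flow. Its smooth dependence on (t,
  -- x) is obtained from that of the differential by the criterion for invertible families.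
  have hW := contMDiffWithinAt_of_map_section (n := n) (F := Model n) (F₂ := Model n)
    (V := fun x : M => TangentSpace (𝓡 n) x) (V₂ := fun x : M => TangentSpace (𝓡 n) x)
    (f := fun p : ℝ × M => p.2) (h := fun p : ℝ × M => h.diffeo hX p.1 p.2)
    (A := fun p => (tangentEquiv (h.diffeo hX p.1) p.2).toLinearEquiv.toLinearMap)
    (v := fun p => (tangentEquiv (h.diffeo hX p.1) p.2).symm (Z (h.diffeo hX p.1 p.2)))
    (mem_univ p) (contMDiff_snd (I := 𝓘(ℝ, ℝ)) (J := 𝓡 n) p).contMDiffWithinAt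
    (fun s hs => he hs) (tangentEquiv (h.diffeo hX p.1) p.2).bijective
    (hZθ.congr (fun q _ => by simp) (by simp))
  have h3 := contMDiffWithinAt_covector_apply (n := n) (F := Model n)
    (V := fun x : M => TangentSpace (𝓡 n) x) (f := fun p : ℝ × M => p.2)
    (A := fun p => (a p.2).2) (contMDiffWithinAt_covector (n := n) (F := Model n)
    (V := fun x : M => TangentSpace (𝓡 n) x) (mem_univ p)
      (contMDiff_snd (I := 𝓘(ℝ, ℝ)) (J := 𝓡 n) p).contMDiffWithinAt
      (fun Y hY => ((h2 Y hY).comp (contMDiff_snd (I := 𝓘(ℝ, ℝ)) (J := 𝓡 n)) p).contMDiffWithinAt))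
    hW
  have h4 := contMDiffWithinAt_tensor2_apply (f := fun p : ℝ × M => h.diffeo hX p.1 p.2)
    (A := fun p => twoFormMap (B p.1) (h.diffeo hX p.1 p.2)) (mem_univ p)
    (fun Y Y' hY hY' => by
      have h5 := ((hB ![Y, Y'] (by intro i; fin_cases i <;> assumption)).comp
        ((contMDiff_fst (I := 𝓘(ℝ, ℝ)) (J := 𝓡 n)).prodMk hθ) p).contMDiffWithinAt (s := univ)
      refine h5.congr (fun q _ => ?_) ?_ <;>
      · rw [twoFormMap_apply]
        change B _ _ _ = B _ _ _
        congr 1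
        ext1 i; fin_cases i <;> rfl)
    (he h1) hZθ
  exact (((smooth_exp (n := n) (M := M) (-2 * lam)) p).contMDiffWithinAt.mul h3).add h4

theorem contMDiff_courantMap (h : IsFlow X θ) (hX : IsSmoothField X)
    (hB : ∀ Y : Fin 2 → VectorField n M, (∀ i, IsSmoothField (Y i)) →
      ContMDiff (𝓘(ℝ, ℝ).prod (𝓡 n)) 𝓘(ℝ, ℝ) ∞ (fun p : ℝ × M => B p.1 p.2 (fun i => Y i p.2))) :
    ContMDiff (𝓘(ℝ, ℝ).prod ((𝓡 n).prod 𝓘(ℝ, GenModel n))) ((𝓡 n).prod 𝓘(ℝ, GenModel n)) ∞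
      (fun p : ℝ × TotalSpace (GenModel n) (GenTangent n M) =>
        TotalSpace.mk' (GenModel n) (E := GenTangent n M) (h.diffeo hX p.1 p.2.1)
          (courantMap (h.diffeo hX p.1) (Real.exp (-2 * lam * p.1)) (B p.1) p.2.1 p.2.2)) := by
  intro p
  have h1 : ContMDiff (𝓘(ℝ, ℝ).prod ((𝓡 n).prod 𝓘(ℝ, GenModel n))) (𝓘(ℝ, ℝ).prod (𝓡 n)) ∞
      (fun p : ℝ × TotalSpace (GenModel n) (GenTangent n M) => (p.1, p.2.1)) :=
    contMDiff_fst.prodMk ((contMDiff_proj (GenTangent n M)).comp contMDiff_snd)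
  exact contMDiffWithinAt_univ.1 (contMDiffWithinAt_map_section (n := n) (F := GenModel n)
    (F₂ := GenModel n) (V := GenTangent n M) (V₂ := GenTangent n M)
    (f := fun p : ℝ × TotalSpace (GenModel n) (GenTangent n M) => p.2.1)
    (h := fun p => h.diffeo hX p.1 p.2.1)
    (A := fun p => (courantMap (h.diffeo hX p.1) (Real.exp (-2 * lam * p.1)) (B p.1)
      p.2.1).toLinearMap) (v := fun p => p.2.2) (mem_univ p)
    (fun s hs => (((h.contMDiff_courantMap_section hX hB hs).comp h1) p).contMDiffWithinAt)
    (contMDiff_snd p).contMDiffWithinAt)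

end IsFlow

/-! ### Smooth metrics -/

theorem isRiemannian_inner (g : SmoothMetric n M) : IsRiemannian g.inner where
  metricAt x := ⟨g.symm x, g.pos x⟩
  smooth _ _ hY hZ x := contMDiffWithinAt_univ.1 (contMDiffWithinAt_covector_apply (n := n)
    (F := Model n) (V := fun x : M => TangentSpace (𝓡 n) x) (f := id)
    ((g.contMDiff x).clm_bundle_apply (hY x)).contMDiffWithinAt (hZ x).contMDiffWithinAt)

theorem exists_pos_mul_le {E : Type*} [NormedAddCommGroup E] [NormedSpace ℝ E]
    [FiniteDimensional ℝ E] (A : E →L[ℝ] E →L[ℝ] ℝ) (hA : ∀ v, v ≠ 0 → 0 < A v v) :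
    ∃ m > 0, ∀ v, m * ‖v‖ ^ 2 ≤ A v v := by
  rcases (Metric.sphere (0 : E) 1).eq_empty_or_nonempty with h | h
  · refine ⟨1, one_pos, fun v => ?_⟩
    rcases eq_or_ne v 0 with rfl | hv
    · simp
    · have : ‖v‖⁻¹ • v ∈ Metric.sphere (0 : E) 1 := by simp [norm_smul, hv]
      rw [h] at this
      exact this.elim
  · obtain ⟨u, hu, hmin⟩ := (isCompact_sphere (0 : E) 1).exists_isMinOn h
      (f := fun v => A v v) (A.continuous.clm_apply continuous_id).continuousOn
    have hu0 : u ≠ 0 := by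
      rintro rfl
      simp at hu
    refine ⟨A u u, hA u hu0, fun v => ?_⟩
    rcases eq_or_ne v 0 with rfl | hv
    · simp
    · have h1 : ‖v‖⁻¹ • v ∈ Metric.sphere (0 : E) 1 := by simp [norm_smul, hv]
      have h2 : A u u ≤ A (‖v‖⁻¹ • v) (‖v‖⁻¹ • v) := hmin h1
      have h3 : 0 < ‖v‖ := norm_pos_iff.2 hv
      rw [map_smul, map_smul, _root_.smul_apply, smul_eq_mul, smul_eq_mul] at h2
      calc A u u * ‖v‖ ^ 2 ≤ ‖v‖⁻¹ * (‖v‖⁻¹ * A v v) * ‖v‖ ^ 2 := by gcongr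
        _ = A v v := by field_simp

/-- The bundled notion of Riemannian metric asks for bounded unit balls. In finite dimension this
follows from the minimum of the quadratic form on the unit sphere. -/
theorem isVonNBounded_model {E : Type*} [NormedAddCommGroup E] [NormedSpace ℝ E]
    [FiniteDimensional ℝ E] (A : E →L[ℝ] E →L[ℝ] ℝ) (hA : ∀ v, v ≠ 0 → 0 < A v v) :
    Bornology.IsVonNBounded ℝ {v : E | A v v < 1} := by
  obtain ⟨m, hm, h⟩ := exists_pos_mul_le A hA
  refine (NormedSpace.isVonNBounded_closedBall ℝ E (1 + m⁻¹)).subset fun v hv => ?_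
  have h1 : m * ‖v‖ ^ 2 < 1 := (h v).trans_lt hv
  have h2 : ‖v‖ ^ 2 < m⁻¹ := by
    rw [← one_div, lt_div_iff₀ hm]
    linarith
  rw [mem_closedBall_zero_iff]
  nlinarith [sq_nonneg (‖v‖ - 1)]

/-- Smooth Riemannian metrics from tensors. -/
def IsRiemannian.toSmoothMetric (hg : IsRiemannian g) : SmoothMetric n M where
  inner := g
  symm x := (hg.metricAt x).symm
  pos x := (hg.metricAt x).pos
  isVonNBounded x := isVonNBounded_model (E := Model n) (g x) (hg.metricAt x).pos
  contMDiff x := contMDiffWithinAt_univ.1 (contMDiffWithinAt_hom (n := n) (F := Model n)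
    (V := fun x : M => TangentSpace (𝓡 n) x) (F₂ := Model n →L[ℝ] ℝ)
    (V₂ := fun x : M => TangentSpace (𝓡 n) x →L[ℝ] ℝ) (f := id) (mem_univ x)
    contMDiff_id.contMDiffAt.contMDiffWithinAt fun Y hY =>
    contMDiffWithinAt_covector (n := n) (F := Model n) (V := fun x : M => TangentSpace (𝓡 n) x)
      (mem_univ x) contMDiff_id.contMDiffAt.contMDiffWithinAt
      fun Z hZ => (hg.smooth Y Z hY hZ x).contMDiffWithinAt)

end IsometryFamilies

/-! ### Time change -/

/-- The equation τ' = e^{2λτ} with τ(0) = 0 is solved by -log(1 - 2λt)/(2λ), or by t when λ = 0. The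
bound t < 1/(2|λ| + 1) keeps 1 - 2λt positive. -/
theorem exists_timeChange (lam : ℝ) : ∃ T : EReal, 0 < T ∧ ∃ τ : ℝ → ℝ, τ 0 = 0 ∧
    ContDiffOn ℝ ∞ τ (timeInterval T) ∧
    ∀ t, t ∈ timeInterval T → HasDerivWithinAt τ (Real.exp (2 * lam * τ t)) (timeInterval T) t := by
  rcases eq_or_ne lam 0 with rfl | hlam
  · exact ⟨⊤, EReal.zero_lt_top, id, rfl, contDiffOn_id, fun t _ => by
      simpa using hasDerivWithinAt_id t _⟩
  have h2 : 0 < 2 * |lam| + 1 := by positivity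
  refine ⟨((1 / (2 * |lam| + 1) : ℝ) : EReal), by exact_mod_cast one_div_pos.2 h2,
    fun t => -Real.log (1 - 2 * lam * t) / (2 * lam), by simp, ?_, ?_⟩
  all_goals
    have hpos : ∀ t ∈ timeInterval ((1 / (2 * |lam| + 1) : ℝ) : EReal), 0 < 1 - 2 * lam * t := by
      rintro t ⟨h0, h1⟩
      have h3 : t < 1 / (2 * |lam| + 1) := by exact_mod_cast h1
      rw [lt_div_iff₀ h2] at h3
      nlinarith [le_abs_self lam, mul_le_mul_of_nonneg_right (le_abs_self lam) h0]
  · exact (((contDiffOn_const.sub (contDiffOn_const.mul contDiffOn_id)).log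
      fun t ht => (hpos t ht).ne').neg).div_const _
  · intro t ht
    have hu := hpos t ht
    have h3 : HasDerivAt (fun t => 1 - 2 * lam * t) (-(2 * lam)) t := by
      simpa using ((hasDerivAt_id t).const_mul (2 * lam)).const_sub 1
    refine (((h3.log hu.ne').neg.div_const (2 * lam)).congr_deriv ?_).hasDerivWithinAt
    rw [mul_div_cancel₀ _ (by simpa using hlam : 2 * lam ≠ 0), Real.exp_neg, Real.exp_log hu]
    field_simp

/-! ### Solitons from static solitons -/

section Solitons

variable {n : ℕ} {M : Type*} [TopologicalSpace M] [T2Space M] [ChartedSpace (Model n) M]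
  [IsManifold (𝓡 n) ∞ M] {X : VectorField n M} {g₀ : Tensor2 n M} {H₀ : DiffForm n M 3}
  {lam : ℝ}

/-- Static solitons with complete vector field give rise to generalized Ricci solitons. -/
theorem IsStaticSoliton.exists_isSoliton (hs : IsStaticSoliton g₀ H₀ lam X)
    (hg : IsRiemannian g₀) (hH : IsSmoothForm H₀) (hdH : ∀ x, extD H₀ x = 0)
    (hX : IsSmoothField X) (hXc : IsCompleteField X) :
    ∃ (T : EReal) (g : ℝ → SmoothMetric n M) (b : ℝ → DiffForm n M 2) (c : ℝ → ℝ)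
      (Φ : ℝ → BundleAut n (GenModel n) (GenTangent n M)),
      (∀ t ∈ timeInterval T, IsSmoothForm (b t)) ∧
      IsSoliton (twisted H₀) T (fun t => genMetric (g t).inner (b t)) c Φ ∧
      lam = -(1 / 2) * derivWithin c (timeInterval T) 0 ∧
      genMetric (g 0).inner (b 0) = genMetric g₀ 0 := by
  obtain ⟨θ, h⟩ := exists_isFlow hX hXc
  obtain ⟨B, hB0, hB, hBd, hBH⟩ := h.exists_twoForms hX hg hH hdH hs
  obtain ⟨T, hT, τ, hτ0, hτs, hτd⟩ := exists_timeChange lam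
  have h0 := zero_mem_timeInterval hT
  have hU := uniqueDiffOn_timeInterval hT
  have hBs : ∀ s, IsSmoothForm (B s) := fun s Y hY =>
    (hB Y hY).comp (contMDiff_const.prodMk contMDiff_id)
  have hgs : ∀ s, IsRiemannian (flowTensor θ lam g₀ s) := fun s => h.isRiemannian_flowTensor hX hg s
  have hG0 : genMetric (flowTensor θ lam g₀ (τ 0)) (B (τ 0)) = genMetric g₀ 0 := by
    rw [hτ0, h.flowTensor_zero, hB0]
  -- The scaling c = e^{-2λτ} has constant derivative -2λ, by cancellation of the exponentials; this
  -- identifies λ with -c'(0)/2.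
  have hcd : ∀ t ∈ timeInterval T, HasDerivWithinAt (fun t => Real.exp (-2 * lam * τ t))
      (-2 * lam) (timeInterval T) t := by
    intro t ht
    refine ((hτd t ht).const_mul (-2 * lam)).exp.congr_deriv ?_
    rw [mul_left_comm, ← Real.exp_add]
    ring_nf
    simp
  have hsmooth : ∀ s, ContMDiff ((𝓡 n).prod 𝓘(ℝ, GenModel n)) ((𝓡 n).prod 𝓘(ℝ, GenModel n)) ∞
      (fun p : TotalSpace (GenModel n) (GenTangent n M) => TotalSpace.mk' (GenModel n)
        (h.diffeo hX s p.1) (courantEquiv (h.diffeo hX s) (Real.exp_ne_zero (-2 * lam * s)) (B s)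
          p.1 p.2)) := fun s =>
    (h.contMDiff_courantMap hX (lam := lam) hB).comp (contMDiff_const.prodMk contMDiff_id)
  have hτM : ∀ {E' : Type} [NormedAddCommGroup E'] [NormedSpace ℝ E'] {H' : Type}
      [TopologicalSpace H'] {J : ModelWithCorners ℝ E' H'} {N : Type _} [TopologicalSpace N]
      [ChartedSpace H' N], ContMDiffOn (𝓘(ℝ, ℝ).prod J) (𝓘(ℝ, ℝ).prod J) ∞
        (fun p : ℝ × N => (τ p.1, p.2)) (timeInterval T ×ˢ univ) := fun {_ _ _ _ _ _ _ _ _} =>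
    (hτs.contMDiffOn.comp contMDiff_fst.contMDiffOn fun _ hp => hp.1).prodMk
      contMDiff_snd.contMDiffOn
  refine ⟨T, fun t => (hgs (τ t)).toSmoothMetric, fun t => B (τ t),
    fun t => Real.exp (-2 * lam * τ t), fun t => ⟨h.diffeo hX (τ t), courantEquiv
      (h.diffeo hX (τ t)) (Real.exp_ne_zero (-2 * lam * τ t)) (B (τ t)), hsmooth (τ t)⟩,
    fun t _ => hBs (τ t), ⟨hT, ⟨fun t _ => isGenMetric_genMetric (hgs (τ t)) (hBs (τ t)), ?_, ?_⟩,
      ?_, fun t _ => Real.exp_pos _, by simp [hτ0], ?_, ?_⟩, ?_, hG0⟩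
  · intro a ha p hp
    refine contMDiffWithinAt_genMetric (f := fun p : ℝ × M => p.2)
      (g := fun p => flowTensor θ lam g₀ (τ p.1)) (b := fun p => B (τ p.1)) hp
      (contMDiff_snd p).contMDiffWithinAt (fun Y Z hY hZ => ?_) (fun Y Z hY hZ => ?_)
      (fun p => (hgs (τ p.1)).metricAt p.2) ha
    · exact ((h.contMDiff_flowTensor hX hg.smooth hY hZ).comp_contMDiffOn hτM) p hp
    · have h5 := ((hB ![Y, Z] (by intro i; fin_cases i <;> assumption)).comp_contMDiffOn hτM) p hp
      refine h5.congr (fun q _ => ?_) ?_ <;>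
      · rw [twoFormMap_apply]
        change B _ _ _ = B _ _ _
        congr 1
        ext1 i; fin_cases i <;> rfl
  · intro t ht x a
    -- By the chain rule τ' cancels the factor left over in the s-derivatives of the metric and of
    -- B, which gives the unscaled equations ∂g/∂t = -2 Ric^B and ∂b/∂t = -d*H.
    have hone : Real.exp (-2 * lam * τ t) * Real.exp (2 * lam * τ t) = 1 := by
      rw [← Real.exp_add]
      ring_nf
      simp
    refine hasDerivWithinAt_genMetric (H := flowForm θ lam H₀ (τ t)) (hU t ht)
      (g := fun t => flowTensor θ lam g₀ (τ t)) (b := fun t => B (τ t))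
      (fun s y => (hgs (τ s)).metricAt y) (hBs (τ t)) (hBH (τ t)) (fun u v => ?_) (fun v => ?_) a
    · refine ((h.hasDerivAt_metric hX hg hs (τ t) x u v).comp_hasDerivWithinAt t
        (hτd t ht)).congr_deriv ?_
      rw [mul_right_comm, hone, one_mul]
    · refine ((hBd (τ t) x v).comp_hasDerivWithinAt t (hτd t ht)).congr_deriv ?_
      rw [mul_right_comm, hone, one_mul]
  · exact (contDiffOn_const.mul hτs).exp
  · exact (h.contMDiff_courantMap hX (lam := lam) hB).comp_contMDiffOn hτM
  · intro t ht
    change IsIsometry _ (genMetric (flowTensor θ lam g₀ (τ 0)) (B (τ 0))) _ _ _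
    rw [hG0]
    -- The condition f^*(H₀ + dB) = c H₀ holds because H₀ + dB is e^{-2λτ} θ_{-τ}^* H₀ and f = θ_τ
    -- undoes the pullback.
    exact isIsometry_courantEquiv _ (hBs (τ t)) hg.metricAt (hgs (τ t)).metricAt
      (h.flowTensor_push hX (τ t)) (fun x v => (congrArg (fun H : DiffForm n M 3 =>
        H (h.diffeo hX (τ t) x) (fun i => tangentEquiv (h.diffeo hX (τ t)) x (v i)))
        (hBH (τ t))).trans (h.flowForm_push hX H₀ (τ t) x v)) _
  · rw [(hcd 0 h0).derivWithin (hU 0 h0)]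
    ring

end Solitons

end GenRicci

end

theorem mainTheorem9 {n : ℕ} {M : Type*} [TopologicalSpace M] [T2Space M]
    [SigmaCompactSpace M] [ChartedSpace (EuclideanSpace ℝ (Fin n)) M] [IsManifold (𝓡 n) ∞ M] :
    -- every soliton on an exact Courant algebroid satisfies the static equations
    (∀ (F : Type*) [NormedAddCommGroup F] [NormedSpace ℝ F] [FiniteDimensional ℝ F]
      (V : M → Type*) [TopologicalSpace (Bundle.TotalSpace F V)]
      [∀ x, AddCommGroup (V x)] [∀ x, Module ℝ (V x)] [∀ x, TopologicalSpace (V x)]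
      [∀ x, IsTopologicalAddGroup (V x)] [∀ x, ContinuousSMul ℝ (V x)]
      [FiberBundle F V] [VectorBundle ℝ F V] [ContMDiffVectorBundle ∞ F V (𝓡 n)]
      (C : CourantData n V) (T : EReal) (G : ℝ → Π x, V x →L[ℝ] V x)
      (c : ℝ → ℝ) (Φ : ℝ → BundleAut n F V),
      C.IsExact F → IsSoliton C T G c Φ →
      ∃ X : VectorField n M, IsSmoothField X ∧
        IsStaticSoliton (C.metricOf (G 0)) (C.torsionOf (G 0))
          (-(1 / 2) * derivWithin c (timeInterval T) 0) X) ∧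
    -- conversely, the static equations (with `X` complete) give rise to a soliton
    (∀ (g₀ : SmoothMetric n M) (H₀ : DiffForm n M 3) (lam : ℝ) (X : VectorField n M),
      IsSmoothForm H₀ → (∀ x, extD H₀ x = 0) → IsSmoothField X → IsCompleteField X →
      IsStaticSoliton g₀.inner H₀ lam X →
      ∃ (T : EReal) (g : ℝ → SmoothMetric n M) (b : ℝ → DiffForm n M 2) (c : ℝ → ℝ)
        (Φ : ℝ → BundleAut n (GenModel n) (GenTangent n M)),
        (∀ t ∈ timeInterval T, IsSmoothForm (b t)) ∧
        IsSoliton (twisted H₀) T (fun t => genMetric (g t).inner (b t)) c Φ ∧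
        lam = -(1 / 2) * derivWithin c (timeInterval T) 0 ∧
        genMetric (g 0).inner (b 0) = genMetric g₀.inner 0) := by
  refine ⟨fun F _ _ _ V _ _ _ _ _ _ _ _ _ C T G c Φ hC h => hC.isStaticSoliton h,
    fun g₀ H₀ lam X hH hdH hX hXc hs => ?_⟩
  exact hs.exists_isSoliton (isRiemannian_inner g₀) hH hdH hX hXc
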